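/- **Setting.** Let $M$ be a compact smooth $d$-manifold with boundary $\Sigma=\partial M$, let $\boldsymbol c=[g]=\{\Omega^2 g: 0<\Omega\in C^\infty(M)\}$ be a conformal class of smooth Riemannian metrics on $M$, and let $\mathcal V M$ be a smooth real vector bundle of finite rank over $M$, with restriction $\mathcal V\Sigma$ to $\Sigma$. For a vector bundle $B$, a section of $B[w]$ (a section of conformal weight $w$) is an equivalence class $[g;s]=[\Omega^2g;\Omega^w s]$ with $g\in\boldsymbol c$ and $s$ a smooth section of $B$; along $\Sigma$ weights are understood with respect to the conformal class induced by $\boldsymbol c$. Let $\sigma\ge 0$ be a defining density for $\Sigma$: a section of weight $1$ with $\sigma^{-1}(0)=\Sigma$ and $\nabla\sigma\ne0$ at every point of $\Sigma$. (Thus $(M,\boldsymbol c,\sigma)$ is a conformally compact structure.) Let $\hat n=d\sigma/|d\sigma|_g$ along $\Sigma$ be the unit conormal, which has weight $1$. One-forms on $\Sigma$ are regarded as sections of $T^*M|_\Sigma$ through the orthogonal projection $TM|_\Sigma\to T\Sigma$. For a connection $\nabla^A$ on $\mathcal VM$ with curvature $F^A_{ab}=[\nabla^A_a,\nabla^A_b]$,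 the conformally compact Yang–Mills current $j[A]$, a section of $T^*M\otimes\operatorname{End}\mathcal VM[-1]$, is given for $g\in\boldsymbol c$ by $$j_b[A]=\sigma\,\nabla^aF^A_{ab}-(d-4)\,n^aF^A_{ab},\qquad n=d\sigma,$$ where $\nabla$ is the Levi-Civita connection of $g$ coupled to $\nabla^A$ and indices are raised with $g$. One writes $j[A]=\mathcal O(\sigma^\infty)$ if for every integer $\ell\ge0$ there is a smooth section $k_\ell$ of $T^*M\otimes\operatorname{End}\mathcal VM[-1-\ell]$ with $j[A]=\sigma^\ell k_\ell$. **Theorem.** Let $d\ge5$. Let $\bar\nabla^{\bar A}$ be a smooth connection on $\mathcal V\Sigma$, and let $E\in\Gamma(T^*\Sigma\otimes\operatorname{End}\mathcal V\Sigma[3-d])$ satisfy the Gauss law $$\bar\nabla^{\bar A}_aE^a=0,$$ where $\bar\nabla^{\bar A}$ is coupled to the Levi-Civita connection of a metric in the induced conformal class on $\Sigma$. Let $\nabla^{A_0}$ be a smooth connection on $\mathcal VM$ such that $\nabla^{A_0}_v=\bar\nabla^{\bar A}_v$ along $\Sigma$ for all $v$ tangent to $\Sigma$, and $$F^{A_0}=\sigma^{d-4}G$$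 for some $G\in\Gamma(\wedge^2T^*M\otimes\operatorname{End}\mathcal VM[4-d])$ with $$G_{ab}|_\Sigma=\hat n_aE_b-\hat n_bE_a.$$ Then there exists $a\in\Gamma(T^*M\otimes\operatorname{End}\mathcal VM[2-d])$ such that the connection $\nabla^A=\nabla^{A_0}+\sigma^{d-2}a$ satisfies $$j[A]=\mathcal O(\sigma^\infty).$$ -/

import Mathlib

set_option maxSynthPendingDepth 3

open Bundle Manifold
open scoped ContDiff

noncomputable section

namespace ElectricYM

section Pullback

/-! ### The fibres of a pullback bundle -/

variable {B B' : Type*} {V : B → Type*} (f : B' → B)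

instance pullbackAddCommGroup [∀ x, AddCommGroup (V x)] (x : B') : AddCommGroup ((f *ᵖ V) x) :=
  { instAddCommMonoidPullback V f x, (inferInstanceAs <| AddCommGroup (V (f x)) :
    AddCommGroup ((f *ᵖ V) x)) with }

instance pullbackIsTopologicalAddGroup [∀ x, AddCommGroup (V x)] [∀ x, TopologicalSpace (V x)]
    [h : ∀ x, IsTopologicalAddGroup (V x)] (x : B') : IsTopologicalAddGroup ((f *ᵖ V) x) :=
  h (f x)

instance pullbackContinuousSMul [∀ x, AddCommGroup (V x)] [∀ x, Module ℝ (V x)]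
    [∀ x, TopologicalSpace (V x)] [h : ∀ x, ContinuousSMul ℝ (V x)] (x : B') :
    ContinuousSMul ℝ ((f *ᵖ V) x) :=
  h (f x)

end Pullback

section Geometry

variable {E : Type*} [NormedAddCommGroup E] [NormedSpace ℝ E]
  {H : Type*} [TopologicalSpace H] (I : ModelWithCorners ℝ E H)
  (M : Type*) [TopologicalSpace M] [ChartedSpace H M] [IsManifold I ∞ M]

/-! ### Conformal classes and conformal densities -/

/-- Smooth Riemannian metrics on `M` (smooth up to the boundary, if `M` has one). -/
abbrev Metric : Type _ := ContMDiffRiemannianMetric I ∞ E (fun x : M ↦ TangentSpace I x)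

variable {I M}

/-- `g' = Ω² g`. -/
def IsRescaling (Ω : M → ℝ) (g g' : Metric I M) : Prop :=
  ∀ (x : M) (u v : TangentSpace I x), g'.inner x u v = Ω x ^ 2 * g.inner x u v

/-- `c` is a conformal class `[g] = {Ω² g : 0 < Ω ∈ C^∞(M)}`. -/
def IsConformalClass (c : Set (Metric I M)) : Prop :=
  ∃ g : Metric I M, c = {g' | ∃ Ω : M → ℝ,
    ContMDiff I 𝓘(ℝ, ℝ) ∞ Ω ∧ (∀ x, 0 < Ω x) ∧ IsRescaling Ω g g'}

/-- A smooth conformal density `[g; f] = [Ω² g; Ω^w f]` of weight `w`: a smooth function `f` for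
each `g ∈ c`, subject to this transformation rule. -/
structure Density (c : Set (Metric I M)) (w : ℤ) where
  /-- The function which represents the density in the scale `g ∈ c`. -/
  rep : c → M → ℝ
  contMDiff (g : c) : ContMDiff I 𝓘(ℝ, ℝ) ∞ (rep g)
  rescale (g g' : c) (Ω : M → ℝ) (hΩ : ∀ x, 0 < Ω x) (h : IsRescaling Ω g.1 g'.1) (x : M) :
    rep g' x = Ω x ^ w * rep g x

/-- `σ` is a defining density for `∂M`: a non-negative density of weight one whose zero locus
is `∂M` and whose derivative vanishes nowhere on `∂M`. Along the zero locus of `σ` the derivative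
`∇σ` in a scale `g` is the differential of the function that represents `σ` in this scale. -/
structure IsDefiningDensity {c : Set (Metric I M)} (σ : Density c 1) : Prop where
  nonneg (g : c) (x : M) : 0 ≤ σ.rep g x
  zero_iff (g : c) (x : M) : σ.rep g x = 0 ↔ x ∈ I.boundary M
  deriv_ne_zero (g : c) (x : M) (hx : x ∈ I.boundary M) : mvfderiv I (σ.rep g) x ≠ 0

section Endomorphism

variable (F : Type*) [NormedAddCommGroup F] [NormedSpace ℝ F]
  (V : M → Type*) [TopologicalSpace (TotalSpace F V)]
  [∀ x, AddCommGroup (V x)] [∀ x, Module ℝ (V x)] [∀ x, TopologicalSpace (V x)]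
  [∀ x, IsTopologicalAddGroup (V x)] [∀ x, ContinuousSMul ℝ (V x)]
  [FiberBundle F V] [VectorBundle ℝ F V]

/-- Smooth sections of `T*M ⊗ End V [w]`. The value of such a one-form `a` on the vector `u`, as an
endomorphism applied to `s ∈ V x`, is written `a x s u`: this is the order of arguments which
Mathlib uses for covariant derivatives and for their differences. -/
structure EndOneForm (c : Set (Metric I M)) (w : ℤ) where
  /-- The one-form which represents the section in the scale `g ∈ c`. -/
  rep : c → ∀ x : M, V x →L[ℝ] TangentSpace I x →L[ℝ] V x
  contMDiff (g : c) : ContMDiff I (I.prod 𝓘(ℝ, F →L[ℝ] E →L[ℝ] F)) ∞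
    (fun x ↦ TotalSpace.mk' (F →L[ℝ] E →L[ℝ] F)
      (E := fun x : M ↦ V x →L[ℝ] TangentSpace I x →L[ℝ] V x) x (rep g x))
  rescale (g g' : c) (Ω : M → ℝ) (hΩ : ∀ x, 0 < Ω x) (h : IsRescaling Ω g.1 g'.1) (x : M) :
    rep g' x = Ω x ^ w • rep g x

/-- Smooth sections of `Λ²T*M ⊗ End V [w]`, with the order of arguments `G x s u v`. -/
structure EndTwoForm (c : Set (Metric I M)) (w : ℤ) where
  /-- The two-form which represents the section in the scale `g ∈ c`. -/
  rep : c → ∀ x : M, V x →L[ℝ] TangentSpace I x →L[ℝ] TangentSpace I x →L[ℝ] V x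
  contMDiff (g : c) : ContMDiff I (I.prod 𝓘(ℝ, F →L[ℝ] E →L[ℝ] E →L[ℝ] F)) ∞
    (fun x ↦ TotalSpace.mk' (F →L[ℝ] E →L[ℝ] E →L[ℝ] F)
      (E := fun x : M ↦ V x →L[ℝ] TangentSpace I x →L[ℝ] TangentSpace I x →L[ℝ] V x) x (rep g x))
  antisymm (g : c) (x : M) (s : V x) (u v : TangentSpace I x) :
    rep g x s u v = - rep g x s v u
  rescale (g g' : c) (Ω : M → ℝ) (hΩ : ∀ x, 0 < Ω x) (h : IsRescaling Ω g.1 g'.1) (x : M) :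
    rep g' x = Ω x ^ w • rep g x

end Endomorphism

/-! ### Riemannian geometry in a scale -/

section Riemannian

variable [FiniteDimensional ℝ E]

/-- The inverse of the Gram matrix of `g` in a basis of `T_xM`, that is `g^{ij}`. (The tangent
space `T_xM` is a copy of the model space `E`, and the basis is a fixed basis of `E`; nothing below
depends on it.) -/
def inverseGram (g : Metric I M) (x : M) :
    Matrix (Fin (Module.finrank ℝ E)) (Fin (Module.finrank ℝ E)) ℝ :=
  (Matrix.of fun i j ↦ g.inner x (Module.finBasis ℝ E i : TangentSpace I x)
    (Module.finBasis ℝ E j : TangentSpace I x))⁻¹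

/-- The contraction `g^{ab} T_{ab}` of a bilinear `T`. -/
def metricTrace {W : Type*} [AddCommGroup W] [Module ℝ W] (g : Metric I M) (x : M)
    (T : TangentSpace I x → TangentSpace I x → W) : W :=
  ∑ i, ∑ j, inverseGram g x i j • T (Module.finBasis ℝ E i : E) (Module.finBasis ℝ E j : E)

/-- The vector `g^{ab} α_a` with the index of the linear form `α` raised. -/
def sharp (g : Metric I M) (x : M) (α : TangentSpace I x → ℝ) : TangentSpace I x :=
  metricTrace g x fun u v ↦ α u • v

/-- The right hand side of the Koszul formula, which is `2 g(∇_X Y, Z)`. -/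
def koszul (g : Metric I M) (X Y Z : ∀ x : M, TangentSpace I x) (x : M) : ℝ :=
  mvfderiv I (fun y ↦ g.inner y (Y y) (Z y)) x (X x)
    + mvfderiv I (fun y ↦ g.inner y (X y) (Z y)) x (Y x)
    - mvfderiv I (fun y ↦ g.inner y (X y) (Y y)) x (Z x)
    + g.inner x (VectorField.mlieBracket I X Y x) (Z x)
    - g.inner x (VectorField.mlieBracket I X Z x) (Y x)
    - g.inner x (VectorField.mlieBracket I Y Z x) (X x)

/-- The Levi-Civita derivative `∇_u Y ∈ T_xM` of a vector field `Y` along `u ∈ T_xM`, given by the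
Koszul formula, in which `u` and the test vector are extended to smooth vector fields near `x`. -/
def leviCivita (g : Metric I M) (Y : ∀ x : M, TangentSpace I x) (x : M) (u : TangentSpace I x) :
    TangentSpace I x :=
  sharp g x fun z ↦ (1 / 2 : ℝ) * koszul g (FiberBundle.extend E u) Y (FiberBundle.extend E z) x

/-- `|α|²_g = g^{ab} α_a α_b` for the linear form `α`. -/
def conormSq (g : Metric I M) (x : M) (α : TangentSpace I x → ℝ) : ℝ :=
  metricTrace g x fun u v ↦ α u * α v

/-- The unit conormal `n̂ = dσ / |dσ|_g` in the scale `g`. It is meant at points of `∂M`. -/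
def unitConormal {c : Set (Metric I M)} (σ : Density c 1) (g : c) (x : M)
    (u : TangentSpace I x) : ℝ :=
  mvfderiv I (σ.rep g) x u / √(conormSq g.1 x (mvfderiv I (σ.rep g) x))

/-- The tangential projection `u^a - n̂^a n̂_b u^b`. -/
def tangential {c : Set (Metric I M)} (σ : Density c 1) (g : c) (x : M)
    (u : TangentSpace I x) : TangentSpace I x :=
  u - unitConormal σ g x u • sharp g.1 x (unitConormal σ g x)

end Riemannian

/-! ### Connections -/

section Connection

variable [FiniteDimensional ℝ E]
  {F : Type*} [NormedAddCommGroup F] [NormedSpace ℝ F]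
  {V : M → Type*} [TopologicalSpace (TotalSpace F V)]
  [∀ x, AddCommGroup (V x)] [∀ x, Module ℝ (V x)] [∀ x, TopologicalSpace (V x)]
  [∀ x, IsTopologicalAddGroup (V x)] [∀ x, ContinuousSMul ℝ (V x)]
  [FiberBundle F V]

/-- The curvature `F(u, v) s = ∇_u ∇_v s - ∇_v ∇_u s - ∇_{[u, v]} s` of a connection, evaluated at
`x` by extending `u`, `v`, `s` to smooth vector fields and a smooth section near `x`. -/
def curvature (A : CovariantDerivative I F V) (x : M) (s : V x) (u v : TangentSpace I x) : V x :=
  let X : ∀ y : M, TangentSpace I y := FiberBundle.extend E u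
  let Y : ∀ y : M, TangentSpace I y := FiberBundle.extend E v
  let S : ∀ y : M, V y := FiberBundle.extend F s
  A (fun y ↦ A S y (Y y)) x u - A (fun y ↦ A S y (X y)) x v
    - A S x (VectorField.mlieBracket I X Y x)

/-- `(∇_u E)(v) s` for an `End V`-valued one-form `E`, where `∇` is the connection `A` coupled to
the Levi-Civita connection of `g`. -/
def covDerivOneForm (g : Metric I M) (A : CovariantDerivative I F V)
    (e : ∀ x : M, V x → TangentSpace I x → V x) (x : M) (s : V x) (u v : TangentSpace I x) : V x :=
  let Y : ∀ y : M, TangentSpace I y := FiberBundle.extend E v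
  let S : ∀ y : M, V y := FiberBundle.extend F s
  A (fun y ↦ e y (S y) (Y y)) x u - e x (A S x u) v - e x s (leviCivita g Y x u)

/-- `(∇_u Φ)(v, w) s` for an `End V`-valued two-form `Φ`, where `∇` is the connection `A` coupled to
the Levi-Civita connection of `g`. -/
def covDerivTwoForm (g : Metric I M) (A : CovariantDerivative I F V)
    (Φ : ∀ x : M, V x → TangentSpace I x → TangentSpace I x → V x) (x : M) (s : V x)
    (u v w : TangentSpace I x) : V x :=
  let Y : ∀ y : M, TangentSpace I y := FiberBundle.extend E v
  let Z : ∀ y : M, TangentSpace I y := FiberBundle.extend E w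
  let S : ∀ y : M, V y := FiberBundle.extend F s
  A (fun y ↦ Φ y (S y) (Y y) (Z y)) x u - Φ x (A S x u) v w
    - Φ x s (leviCivita g Y x u) w - Φ x s v (leviCivita g Z x u)

/-- The divergence `∇^a E_a` of an `End V`-valued one-form. -/
def divOneForm (g : Metric I M) (A : CovariantDerivative I F V)
    (e : ∀ x : M, V x → TangentSpace I x → V x) (x : M) (s : V x) : V x :=
  metricTrace g x fun u v ↦ covDerivOneForm g A e x s u v

/-- The conformally compact Yang–Mills current `j_b = σ ∇^a F_{ab} - (d - 4) n^a F_{ab}`, `n = dσ`,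
in the scale `g`, evaluated on the vector `w`. Here `d = dim M`. -/
def current {c : Set (Metric I M)} (σ : Density c 1) (A : CovariantDerivative I F V) (g : c)
    (x : M) (s : V x) (w : TangentSpace I x) : V x :=
  σ.rep g x • metricTrace g.1 x (fun u v ↦ covDerivTwoForm g.1 A (curvature A) x s u v w)
    - ((Module.finrank ℝ E : ℝ) - 4) •
      curvature A x s (sharp g.1 x (mvfderiv I (σ.rep g) x)) w

variable [VectorBundle ℝ F V]

/-- `j[A] = O(σ^ℓ)`: the current is `σ^ℓ` times a smooth section of `T*M ⊗ End V [-1 - ℓ]`. -/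
def CurrentVanishesToOrder {c : Set (Metric I M)} (σ : Density c 1) (A : CovariantDerivative I F V)
    (l : ℕ) : Prop :=
  ∃ k : EndOneForm F V c (-1 - l), ∀ (g : c) (x : M) (s : V x) (w : TangentSpace I x),
    current σ A g x s w = σ.rep g x ^ l • k.rep g x s w

end Connection

end Geometry

/-! ### The boundary -/

section Boundary

variable {E : Type*} [NormedAddCommGroup E] [NormedSpace ℝ E] [FiniteDimensional ℝ E]
  {H : Type*} [TopologicalSpace H] {I : ModelWithCorners ℝ E H}
  {M : Type*} [TopologicalSpace M] [ChartedSpace H M] [IsManifold I ∞ M]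
  {E' : Type*} [NormedAddCommGroup E'] [NormedSpace ℝ E']
  {H' : Type*} [TopologicalSpace H'] {J : ModelWithCorners ℝ E' H'}
  {S : Type*} [TopologicalSpace S] [ChartedSpace H' S]

/-- The smooth map `ι` identifies the manifold `S` with the boundary `∂M`: it is a smooth embedding
(an injective immersion which is a homeomorphism onto its image) with image `∂M`. -/
structure IsBoundaryInclusion (ι : C^∞⟮J, S; I, M⟯) : Prop where
  isEmbedding : Topology.IsEmbedding ι
  injective_mfderiv (x : S) : Function.Injective (mfderiv J I ι x)
  range_eq : Set.range ι = I.boundary M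

variable [IsManifold J ∞ S]

/-- `h = Ω² ι^*g`. -/
def IsInducedMetric (ι : C^∞⟮J, S; I, M⟯) (Ω : S → ℝ) (g : Metric I M) (h : Metric J S) : Prop :=
  ∀ (x : S) (u v : TangentSpace J x),
    h.inner x u v = Ω x ^ 2 * g.inner (ι x) (mfderiv J I ι x u) (mfderiv J I ι x v)

/-- The conformal class on `S = ∂M` induced by `c`: all metrics `Ω² ι^*g`, where `g ∈ c`
and `0 < Ω ∈ C^∞(S)`. -/
def inducedClass (ι : C^∞⟮J, S; I, M⟯) (c : Set (Metric I M)) : Set (Metric J S) :=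
  {h | ∃ g ∈ c, ∃ Ω : S → ℝ, ContMDiff J 𝓘(ℝ, ℝ) ∞ Ω ∧ (∀ x, 0 < Ω x) ∧ IsInducedMetric ι Ω g h}

variable {F : Type*} [NormedAddCommGroup F] [NormedSpace ℝ F]
  {V : M → Type*} [TopologicalSpace (TotalSpace F V)]
  [∀ x, AddCommGroup (V x)] [∀ x, Module ℝ (V x)] [∀ x, TopologicalSpace (V x)]
  [∀ x, IsTopologicalAddGroup (V x)] [∀ x, ContinuousSMul ℝ (V x)]
  [FiberBundle F V] [VectorBundle ℝ F V]

/-- `∇^A_v = ∇̄_v` along `S` for all `v` tangent to `S`, where `∇̄` is a connection on the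
restriction `V|_S = ι^*V`. -/
def InducesOnBoundary (ι : C^∞⟮J, S; I, M⟯) (A : CovariantDerivative I F V)
    (B : CovariantDerivative J F (ι *ᵖ V)) : Prop :=
  ∀ s : ∀ x : M, V x, ContMDiff I (I.prod 𝓘(ℝ, F)) ∞ (fun x ↦ TotalSpace.mk' F x (s x)) →
    ∀ (x : S) (v : TangentSpace J x),
      A s (ι x) (mfderiv J I ι x v) = B (fun y ↦ (s (ι y) : (ι *ᵖ V) y)) x v

/-- `F^A = σ^m G`. -/
def HasCurvature {c : Set (Metric I M)} (σ : Density c 1) (A : CovariantDerivative I F V) (m : ℕ)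
    {w : ℤ} (G : EndTwoForm F V c w) : Prop :=
  ∀ (g : c) (x : M) (s : V x) (u v : TangentSpace I x),
    curvature A x s u v = σ.rep g x ^ m • G.rep g x s u v

/-- `G|_S = n̂_a E_b - n̂_b E_a`. This is stated in every scale `g ∈ c`, where `E` is taken in the
scale `h = ι^*g`; the one-form `E` on `S` acts on vectors of `TM|_S` through the tangential
projection. -/
def HasElectricField {c : Set (Metric I M)} (σ : Density c 1) (ι : C^∞⟮J, S; I, M⟯) {w w' : ℤ}
    (G : EndTwoForm F V c w) (e : EndOneForm F (ι *ᵖ V) (inducedClass ι c) w') : Prop :=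
  ∀ (g : c) (h : inducedClass ι c), IsInducedMetric ι (fun _ ↦ 1) g.1 h.1 →
    ∀ (x : S) (s : V (ι x)) (u v : TangentSpace I (ι x)) (u' v' : TangentSpace J x),
      mfderiv J I ι x u' = tangential σ g (ι x) u → mfderiv J I ι x v' = tangential σ g (ι x) v →
      G.rep g (ι x) s u v = unitConormal σ g (ι x) u • (e.rep h x s v' : V (ι x))
        - unitConormal σ g (ι x) v • (e.rep h x s u' : V (ι x))

/-- The Gauss law `∇̄^a E_a = 0`, in every scale of the boundary. -/
def GaussLaw [FiniteDimensional ℝ E'] {W : S → Type*} [TopologicalSpace (TotalSpace F W)]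
    [∀ x, AddCommGroup (W x)] [∀ x, Module ℝ (W x)] [∀ x, TopologicalSpace (W x)]
    [∀ x, IsTopologicalAddGroup (W x)] [∀ x, ContinuousSMul ℝ (W x)]
    [FiberBundle F W] [VectorBundle ℝ F W] {c : Set (Metric J S)} {w : ℤ}
    (B : CovariantDerivative J F W) (e : EndOneForm F W c w) : Prop :=
  ∀ (h : c) (x : S) (s : W x), divOneForm h.1 B (fun y t v ↦ e.rep h y t v) x s = 0

end Boundary

end ElectricYM

end

set_option linter.unusedSectionVars false

noncomputable section

/-! ### Yang–Mills calculus over a ring with commuting derivations -/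

namespace ElectricYM

/-- Commuting derivations `d i` of a commutative algebra `R` of scalars and compatible derivations
`D i` of an `R`-algebra `𝓐` of endomorphisms. -/
structure Calculus (ι R 𝓐 : Type*) [CommRing R] [Algebra ℝ R] [Ring 𝓐] [Algebra R 𝓐] where
  /-- the derivations of the scalars -/
  d : ι → R →ₗ[ℝ] R
  /-- the derivations of the endomorphisms -/
  D : ι → 𝓐 →+ 𝓐
  d_mul (i : ι) (f g : R) : d i (f * g) = d i f * g + f * d i g
  D_mul (i : ι) (a b : 𝓐) : D i (a * b) = D i a * b + a * D i b
  D_smul (i : ι) (f : R) (a : 𝓐) : D i (f • a) = d i f • a + f • D i a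
  d_comm (i j : ι) (f : R) : d i (d j f) = d j (d i f)
  D_comm (i j : ι) (a : 𝓐) : D i (D j a) = D j (D i a)

namespace Calculus

variable {ι R 𝓐 : Type*} [CommRing R] [Algebra ℝ R] [Ring 𝓐] [Algebra R 𝓐]
  (C : Calculus ι R 𝓐)

lemma sum_sum_comm {κ κ' N : Type*} [Fintype κ] [Fintype κ'] [AddCommMonoid N]
    (f : κ → κ → κ' → κ' → N) :
    ∑ a, ∑ b, ∑ c, ∑ e, f a b c e = ∑ c, ∑ e, ∑ a, ∑ b, f a b c e := by
  conv_lhs => enter [2, a]; rw [Finset.sum_comm]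
  rw [Finset.sum_comm]
  refine Finset.sum_congr rfl fun c _ ↦ ?_
  conv_lhs => enter [2, a]; rw [Finset.sum_comm]
  rw [Finset.sum_comm]

lemma d_one (i : ι) : C.d i 1 = 0 := by
  have h := C.d_mul i 1 1
  simp only [mul_one, one_mul] at h
  exact left_eq_add.mp h

lemma d_natCast (i : ι) (k : ℕ) : C.d i (k : R) = 0 := by
  rw [← nsmul_one, map_nsmul, d_one, smul_zero]

lemma mul_d_pow (i : ι) (f : R) (k : ℕ) : f * C.d i (f ^ k) = k * f ^ k * C.d i f := by
  induction k with
  | zero => simp [d_one]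
  | succ k ih =>
    rw [pow_succ, d_mul, mul_add, ← mul_assoc, ih]
    push_cast
    ring

lemma d_pow_succ (i : ι) (f : R) (k : ℕ) : C.d i (f ^ (k + 1)) = (k + 1) * f ^ k * C.d i f := by
  rw [pow_succ', d_mul, mul_d_pow]
  ring

/-- The covariant derivative of an endomorphism in the direction `i`. -/
def cov (A : ι → 𝓐) (i : ι) (Φ : 𝓐) : 𝓐 := C.D i Φ + (A i * Φ - Φ * A i)

/-- The curvature of the connection `d + A`. -/
def curv (A : ι → 𝓐) (i j : ι) : 𝓐 := C.D i (A j) - C.D j (A i) + (A i * A j - A j * A i)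

section Cov

variable (A : ι → 𝓐)

lemma cov_add (i : ι) (Φ Ψ : 𝓐) : C.cov A i (Φ + Ψ) = C.cov A i Φ + C.cov A i Ψ := by
  simp only [cov, map_add]
  noncomm_ring

lemma cov_zero (i : ι) : C.cov A i 0 = 0 := by
  simp [cov]

lemma cov_neg (i : ι) (Φ : 𝓐) : C.cov A i (-Φ) = -C.cov A i Φ := by
  simp only [cov, map_neg]
  noncomm_ring

lemma cov_sub (i : ι) (Φ Ψ : 𝓐) : C.cov A i (Φ - Ψ) = C.cov A i Φ - C.cov A i Ψ := by
  rw [sub_eq_add_neg, cov_add, cov_neg, ← sub_eq_add_neg]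

lemma cov_sum {κ : Type*} (i : ι) (s : Finset κ) (Φ : κ → 𝓐) :
    C.cov A i (∑ k ∈ s, Φ k) = ∑ k ∈ s, C.cov A i (Φ k) := by
  induction s using Finset.cons_induction with
  | empty => simp [cov_zero]
  | cons k s hk ih => rw [Finset.sum_cons, Finset.sum_cons, cov_add, ih]

lemma cov_smul (i : ι) (f : R) (Φ : 𝓐) :
    C.cov A i (f • Φ) = C.d i f • Φ + f • C.cov A i Φ := by
  simp only [cov, D_smul, mul_smul_comm, smul_mul_assoc, smul_add, smul_sub]
  abel

lemma cov_cov_sub (i j : ι) (Φ : 𝓐) :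
    C.cov A i (C.cov A j Φ) - C.cov A j (C.cov A i Φ)
      = C.curv A i j * Φ - Φ * C.curv A i j := by
  simp only [cov, curv, map_add, map_sub, D_mul, C.D_comm i j Φ]
  noncomm_ring

lemma curv_antisymm (i j : ι) : C.curv A i j = -C.curv A j i := by
  simp only [curv]
  noncomm_ring

lemma cov_add_connection (f : R) (b : ι → 𝓐) (i : ι) (Φ : 𝓐) :
    C.cov (fun j ↦ A j + f • b j) i Φ = C.cov A i Φ + f • (b i * Φ - Φ * b i) := by
  simp only [cov, add_mul, mul_add, smul_mul_assoc, mul_smul_comm, smul_sub]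
  abel

lemma curv_add_connection (s : R) (k : ℕ) (b : ι → 𝓐) (i j : ι) :
    C.curv (fun l ↦ A l + s ^ (k + 1) • b l) i j = C.curv A i j
      + (((k + 1 : ℕ) : R) * s ^ k) • (C.d i s • b j - C.d j s • b i)
      + s ^ (k + 1) • (C.cov A i (b j) - C.cov A j (b i)
          + s ^ (k + 1) • (b i * b j - b j * b i)) := by
  simp only [curv, cov, map_add, D_smul, d_pow_succ, add_mul, mul_add, smul_mul_assoc,
    mul_smul_comm, smul_sub, smul_add, smul_smul, Nat.cast_add, Nat.cast_one]
  module

end Cov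

variable [Fintype ι]

/-- Both indices of a two-form raised with `h`. -/
def up (h : ι → ι → R) (Φ : ι → ι → 𝓐) (a b : ι) : 𝓐 :=
  ∑ c, ∑ e, (h a c * h b e) • Φ c e

/-- `½ h^{ef} ∂_a g_{ef}`, the logarithmic derivative of the volume density. -/
def logVol (g h : ι → ι → R) (a : ι) : R := (1 / 2 : ℝ) • ∑ e, ∑ f, h e f * C.d a (g e f)

/-- The divergence of a bivector density, contracted with the first index. -/
def div (A : ι → 𝓐) (γ : ι → R) (T : ι → 𝓐) : 𝓐 := ∑ a, (C.cov A a (T a) + γ a • T a)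

/-- The raised current `σ ∇_a F^{ab} - m σ_a F^{ab}`. -/
def current (A : ι → 𝓐) (γ : ι → R) (s : R) (m : ℕ) (T : ι → ι → 𝓐) (b : ι) : 𝓐 :=
  s • C.div A γ (fun a ↦ T a b) - (m : R) • ∑ a, C.d a s • T a b

section Up

variable {h : ι → ι → R}

lemma up_antisymm {Φ : ι → ι → 𝓐} (hΦ : ∀ i j, Φ i j = -Φ j i) (a b : ι) :
    up h Φ a b = -up h Φ b a := by
  unfold up
  rw [Finset.sum_comm, ← Finset.sum_neg_distrib]
  refine Finset.sum_congr rfl fun e _ ↦ ?_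
  rw [← Finset.sum_neg_distrib]
  refine Finset.sum_congr rfl fun c _ ↦ ?_
  rw [hΦ c e, smul_neg, mul_comm]

lemma up_add (Φ Ψ : ι → ι → 𝓐) (a b : ι) :
    up h (fun i j ↦ Φ i j + Ψ i j) a b = up h Φ a b + up h Ψ a b := by
  simp only [up, smul_add, Finset.sum_add_distrib]

lemma up_smul (f : R) (Φ : ι → ι → 𝓐) (a b : ι) :
    up h (fun i j ↦ f • Φ i j) a b = f • up h Φ a b := by
  simp only [up, Finset.smul_sum, smul_smul]
  refine Finset.sum_congr rfl fun c _ ↦ Finset.sum_congr rfl fun e _ ↦ ?_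
  rw [mul_comm]

end Up

section Div

variable (A : ι → 𝓐) (γ : ι → R)

lemma div_add (T U : ι → 𝓐) :
    C.div A γ (fun a ↦ T a + U a) = C.div A γ T + C.div A γ U := by
  simp only [div, cov_add, smul_add, ← Finset.sum_add_distrib]
  refine Finset.sum_congr rfl fun a _ ↦ ?_
  abel

lemma div_smul (f : R) (T : ι → 𝓐) :
    C.div A γ (fun a ↦ f • T a) = ∑ a, C.d a f • T a + f • C.div A γ T := by
  simp only [div, cov_smul, Finset.smul_sum, ← Finset.sum_add_distrib, smul_add]
  refine Finset.sum_congr rfl fun a _ ↦ ?_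
  rw [smul_comm f]
  abel

lemma div_sub (T U : ι → 𝓐) :
    C.div A γ (fun a ↦ T a - U a) = C.div A γ T - C.div A γ U := by
  simp only [div, cov_sub, smul_sub, ← Finset.sum_sub_distrib]
  refine Finset.sum_congr rfl fun a _ ↦ ?_
  abel

lemma div_add_connection (f : R) (b T : ι → 𝓐) :
    C.div (fun j ↦ A j + f • b j) γ T
      = C.div A γ T + f • ∑ a, (b a * T a - T a * b a) := by
  simp only [div, cov_add_connection, Finset.smul_sum, ← Finset.sum_add_distrib]
  refine Finset.sum_congr rfl fun a _ ↦ ?_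
  abel

lemma sum_commutator_up_eq_zero (h : ι → ι → R) (hs : ∀ i j, h i j = h j i)
    (Φ : ι → ι → 𝓐) (hΦ : ∀ i j, Φ i j = -Φ j i) :
    ∑ b, ∑ a, (Φ b a * up h Φ a b - up h Φ a b * Φ b a) = 0 := by
  have h1 : ∑ b, ∑ a, Φ b a * up h Φ a b
      = ∑ b, ∑ a, ∑ c, ∑ e, (h a c * h b e) • (Φ b a * Φ c e) := by
    simp only [up, Finset.mul_sum, mul_smul_comm]
  have h2 : ∑ b, ∑ a, up h Φ a b * Φ b a
      = ∑ b, ∑ a, ∑ c, ∑ e, (h a c * h b e) • (Φ c e * Φ b a) := by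
    simp only [up, Finset.sum_mul, smul_mul_assoc]
  simp only [Finset.sum_sub_distrib, h1, h2, sub_eq_zero]
  calc ∑ b, ∑ a, ∑ c, ∑ e, (h a c * h b e) • (Φ b a * Φ c e)
      = ∑ b, ∑ a, ∑ c, ∑ e, (h a c * h b e) • (Φ a b * Φ e c) := by
        refine Finset.sum_congr rfl fun b _ ↦ Finset.sum_congr rfl fun a _ ↦
          Finset.sum_congr rfl fun c _ ↦ Finset.sum_congr rfl fun e _ ↦ ?_
        rw [hΦ b a, hΦ c e, neg_mul_neg]
    _ = ∑ e, ∑ c, ∑ a, ∑ b, (h a c * h b e) • (Φ a b * Φ e c) := by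
        rw [Finset.sum_comm' (t' := Finset.univ) (s' := fun _ ↦ Finset.univ) (by simp)]
        conv_lhs => enter [2, a]; rw [Finset.sum_comm]
        conv_lhs => enter [2, a, 2, c]; rw [Finset.sum_comm]
        conv_lhs => enter [2, a]; rw [Finset.sum_comm]
        rw [Finset.sum_comm]
        conv_lhs => enter [2, e]; rw [Finset.sum_comm]
    _ = _ := by
        refine Finset.sum_congr rfl fun b _ ↦ Finset.sum_congr rfl fun a _ ↦
          Finset.sum_congr rfl fun c _ ↦ Finset.sum_congr rfl fun e _ ↦ ?_
        rw [hs c a, hs e b]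


lemma eq_zero_of_add_self (R : Type*) {𝓐 : Type*} [CommRing R] [Algebra ℝ R] [Ring 𝓐]
    [Algebra R 𝓐] {x : 𝓐} (hx : x + x = 0) : x = 0 := by
  have h : (algebraMap ℝ R (1 / 2)) • (x + x) = x := by
    rw [← two_smul R x, smul_smul, ← map_ofNat (algebraMap ℝ R) 2, ← map_mul]
    norm_num
  rw [← h, hx, smul_zero]

lemma sum_d_mul_antisymm_eq_zero (q : ι → ι → R) (hq : ∀ a b, q a b = q b a) (T : ι → ι → 𝓐)
    (hT : ∀ a b, T a b = -T b a) : ∑ b, ∑ a, q b a • T a b = 0 := by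
  apply eq_zero_of_add_self R
  conv_lhs => enter [2]; rw [Finset.sum_comm]
  rw [← Finset.sum_add_distrib]
  refine Finset.sum_eq_zero fun b _ ↦ ?_
  rw [← Finset.sum_add_distrib]
  refine Finset.sum_eq_zero fun a _ ↦ ?_
  rw [hT a b, hq b a, smul_neg, neg_add_cancel]

lemma div_div_eq_zero (A : ι → 𝓐) (γ : ι → R) (hγ : ∀ i j, C.d i (γ j) = C.d j (γ i))
    (h : ι → ι → R) (hs : ∀ i j, h i j = h j i) :
    C.div A γ (fun b ↦ C.div A γ fun a ↦ up h (C.curv A) a b) = 0 := by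
  set T := up h (C.curv A) with hTdef
  have hT : ∀ a b, T a b = -T b a := up_antisymm (C.curv_antisymm A)
  have key : ∑ b, ∑ a, C.cov A b (C.cov A a (T a b)) = 0 := by
    apply eq_zero_of_add_self R
    have h2 : ∑ b, ∑ a, C.cov A b (C.cov A a (T a b))
        = ∑ b, ∑ a, -C.cov A a (C.cov A b (T a b)) := by
      rw [Finset.sum_comm]
      refine Finset.sum_congr rfl fun b _ ↦ Finset.sum_congr rfl fun a _ ↦ ?_
      rw [hT b a, cov_neg, cov_neg]
    conv_lhs => enter [2]; rw [h2]
    rw [← sum_commutator_up_eq_zero h hs _ (C.curv_antisymm A), ← Finset.sum_add_distrib]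
    refine Finset.sum_congr rfl fun b _ ↦ ?_
    rw [← Finset.sum_add_distrib]
    refine Finset.sum_congr rfl fun a _ ↦ ?_
    rw [← sub_eq_add_neg, cov_cov_sub]
  have key2 : ∑ b, ∑ a, C.d b (γ a) • T a b = 0 := sum_d_mul_antisymm_eq_zero _ (fun _ _ ↦ hγ _ _) T hT
  have key3 : ∑ b, ∑ a, (γ b * γ a) • T a b = 0 :=
    sum_d_mul_antisymm_eq_zero _ (fun _ _ ↦ mul_comm _ _) T hT
  have key4 : ∑ b, ∑ a, (γ a • C.cov A b (T a b) + γ b • C.cov A a (T a b)) = 0 := by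
    simp only [Finset.sum_add_distrib]
    rw [Finset.sum_comm, ← Finset.sum_add_distrib]
    refine Finset.sum_eq_zero fun a _ ↦ ?_
    rw [← Finset.sum_add_distrib]
    refine Finset.sum_eq_zero fun b _ ↦ ?_
    rw [hT a b, cov_neg, smul_neg, neg_add_cancel]
  have expand : C.div A γ (fun b ↦ C.div A γ fun a ↦ T a b)
      = ∑ b, ∑ a, C.cov A b (C.cov A a (T a b)) + ∑ b, ∑ a, C.d b (γ a) • T a b
        + ∑ b, ∑ a, (γ b * γ a) • T a b
        + ∑ b, ∑ a, (γ a • C.cov A b (T a b) + γ b • C.cov A a (T a b)) := by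
    simp only [div, cov_sum, cov_add, cov_smul, Finset.smul_sum, smul_add, smul_smul,
      ← Finset.sum_add_distrib]
    refine Finset.sum_congr rfl fun b _ ↦ Finset.sum_congr rfl fun a _ ↦ ?_
    abel
  rw [expand, key, key2, key3, key4]
  simp

lemma smul_div_current (A : ι → 𝓐) (γ : ι → R) (hγ : ∀ i j, C.d i (γ j) = C.d j (γ i))
    (h : ι → ι → R) (hs : ∀ i j, h i j = h j i) (s : R) (m : ℕ) :
    s • C.div A γ (C.current A γ s m (up h (C.curv A)))
      = ((m + 1 : ℕ) : R) • ∑ b, C.d b s • C.current A γ s m (up h (C.curv A)) b := by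
  set T := up h (C.curv A) with hTdef
  have hT : ∀ a b, T a b = -T b a := up_antisymm (C.curv_antisymm A)
  set S := ∑ b, C.d b s • C.div A γ fun a ↦ T a b with hS
  have hTT : ∑ b, ∑ a, (C.d b s * C.d a s) • T a b = 0 :=
    sum_d_mul_antisymm_eq_zero _ (fun _ _ ↦ mul_comm _ _) T hT
  have h1 : ∑ b, C.d b s • C.current A γ s m T b = s • S := by
    have h0 : ∑ b, C.d b s • C.current A γ s m T b
        = s • S - (m : R) • ∑ b, ∑ a, (C.d b s * C.d a s) • T a b := by
      simp only [current, hS, Finset.smul_sum, smul_sub, smul_smul, ← Finset.sum_sub_distrib]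
      refine Finset.sum_congr rfl fun b _ ↦ ?_
      congr 1
      · rw [mul_comm]
      · refine Finset.sum_congr rfl fun a _ ↦ ?_
        congr 1
        ring
    rw [h0, hTT, smul_zero, sub_zero]
  have h2 : C.div A γ (C.current A γ s m T) = ((m + 1 : ℕ) : R) • S := by
    have h3 : ∑ b, ∑ a, C.d b (C.d a s) • T a b = 0 :=
      sum_d_mul_antisymm_eq_zero _ (fun _ _ ↦ C.d_comm _ _ _) T hT
    have h4 : C.div A γ (fun b ↦ ∑ a, C.d a s • T a b)
        = ∑ b, ∑ a, C.d b (C.d a s) • T a b - S := by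
      have hS' : S = -∑ b, ∑ a, (C.d a s • C.cov A b (T a b) + (γ b * C.d a s) • T a b) := by
        rw [hS, Finset.sum_comm, ← Finset.sum_neg_distrib]
        refine Finset.sum_congr rfl fun b _ ↦ ?_
        rw [div, Finset.smul_sum, ← Finset.sum_neg_distrib]
        refine Finset.sum_congr rfl fun a _ ↦ ?_
        rw [hT a b, cov_neg, smul_add, smul_neg, smul_neg, smul_neg, smul_smul,
          neg_add, mul_comm (γ a)]
      rw [hS', sub_neg_eq_add, ← Finset.sum_add_distrib]
      simp only [div, cov_sum, cov_smul, Finset.smul_sum, smul_smul, ← Finset.sum_add_distrib]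
      refine Finset.sum_congr rfl fun b _ ↦ Finset.sum_congr rfl fun a _ ↦ ?_
      abel
    have h5 : C.div A γ (fun b ↦ (m : R) • ∑ a, C.d a s • T a b) = -((m : R) • S) := by
      rw [div_smul, h4, h3, zero_sub, smul_neg]
      simp [d_natCast]
    have h6 : C.div A γ (fun b ↦ C.div A γ fun a ↦ T a b) = 0 := C.div_div_eq_zero A γ hγ h hs
    change C.div A γ (fun b ↦ s • C.div A γ (fun a ↦ T a b) - (m : R) • ∑ a, C.d a s • T a b) = _
    rw [div_sub, h5, div_smul, h6, smul_zero, add_zero, sub_neg_eq_add]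
    push_cast
    rw [add_smul, one_smul, add_comm]
  rw [h1, h2, smul_comm]

/-- The leading terms of `J = s ^ N K`. -/
lemma pow_smul_conservation (A : ι → 𝓐) (γ : ι → R) (s : R) (m N : ℕ) (J K : ι → 𝓐)
    (hJ : s • C.div A γ J = ((m + 1 : ℕ) : R) • ∑ b, C.d b s • J b)
    (hK : ∀ b, J b = s ^ N • K b) :
    s ^ N • (s • C.div A γ K + ((N : R) - ((m + 1 : ℕ) : R)) • ∑ b, C.d b s • K b) = 0 := by
  have h1 : J = fun b ↦ s ^ N • K b := funext hK
  rw [h1, div_smul, smul_add, Finset.smul_sum] at hJ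
  simp only [smul_smul, mul_d_pow] at hJ
  have h2 : ∑ b, ((N : R) * s ^ N * C.d b s) • K b
      = ((N : R) * s ^ N) • ∑ b, C.d b s • K b := by
    simp only [Finset.smul_sum, smul_smul]
  have h3 : ∑ b, (C.d b s * s ^ N) • K b = s ^ N • ∑ b, C.d b s • K b := by
    simp only [Finset.smul_sum, smul_smul]
    refine Finset.sum_congr rfl fun b _ ↦ by rw [mul_comm]
  rw [h2, h3] at hJ
  have h4 : (s * s ^ N) • C.div A γ K
      = ((m + 1 : ℕ) : R) • s ^ N • ∑ b, C.d b s • K b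
        - ((N : R) * s ^ N) • ∑ b, C.d b s • K b := eq_sub_of_add_eq' hJ
  rw [smul_add, smul_smul, mul_comm (s ^ N) s, h4]
  module

lemma current_smul_pow (A : ι → 𝓐) (γ : ι → R) (s : R) (m : ℕ) (T : ι → ι → 𝓐) (b : ι) :
    C.current A γ s m (fun a b ↦ s ^ m • T a b) b
      = s ^ (m + 1) • C.div A γ fun a ↦ T a b := by
  rw [current, div_smul, smul_add]
  simp only [Finset.smul_sum, smul_smul, mul_d_pow]
  rw [add_sub_right_comm, ← Finset.sum_sub_distrib, Finset.sum_eq_zero, zero_add, pow_succ']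
  intro a _
  rw [sub_eq_zero]
  congr 1
  ring

/-- The change of the current under `A ↦ A + s ^ (k + 1) b`. -/
lemma exists_current_add_connection (A : ι → 𝓐) (γ : ι → R) (h : ι → ι → R) (s : R) (m k : ℕ)
    (b : ι → 𝓐) : ∃ r : ι → 𝓐, ∀ i,
      C.current (fun j ↦ A j + s ^ (k + 1) • b j) γ s m
          (up h (C.curv fun j ↦ A j + s ^ (k + 1) • b j)) i
        = C.current A γ s m (up h (C.curv A)) i
          + (((k + 1 : ℕ) : R) * ((k : R) - m) * s ^ k) •
            ∑ a, C.d a s • up h (fun c e ↦ C.d c s • b e - C.d e s • b c) a i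
          + s ^ (k + 1) • r i := by
  set A' : ι → 𝓐 := fun j ↦ A j + s ^ (k + 1) • b j with hA'
  set N : ι → ι → 𝓐 := fun c e ↦ C.d c s • b e - C.d e s • b c with hN
  set W : ι → ι → 𝓐 := fun i j ↦ C.cov A i (b j) - C.cov A j (b i)
    + s ^ (k + 1) • (b i * b j - b j * b i) with hW
  have hup : up h (C.curv A') = fun a b ↦ up h (C.curv A) a b
      + (((k + 1 : ℕ) : R) * s ^ k) • up h N a b + s ^ (k + 1) • up h W a b := by
    have : C.curv A' = fun i j ↦ (C.curv A i j + (((k + 1 : ℕ) : R) * s ^ k) • N i j)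
        + s ^ (k + 1) • W i j := by
      funext i j
      rw [hA', curv_add_connection]
    funext a b
    rw [this, up_add, up_add, up_smul, up_smul]
  refine ⟨fun i ↦ s • ∑ a, (b a * up h (C.curv A') a i - up h (C.curv A') a i * b a)
    + ((k + 1 : ℕ) : R) • C.div A γ (fun a ↦ up h N a i)
    + (s • C.div A γ (fun a ↦ up h W a i) + (((k + 1 : ℕ) : R) - m) • ∑ a, C.d a s • up h W a i),
    fun i ↦ ?_⟩
  have e1 : C.div A' γ (fun a ↦ up h (C.curv A') a i)
      = C.div A γ (fun a ↦ up h (C.curv A') a i)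
        + s ^ (k + 1) • ∑ a, (b a * up h (C.curv A') a i - up h (C.curv A') a i * b a) :=
    C.div_add_connection A γ _ b _
  have e2 : C.div A γ (fun a ↦ up h (C.curv A') a i)
      = C.div A γ (fun a ↦ up h (C.curv A) a i)
        + (∑ a, (((k + 1 : ℕ) : R) * C.d a (s ^ k)) • up h N a i
          + (((k + 1 : ℕ) : R) * s ^ k) • C.div A γ fun a ↦ up h N a i)
        + (∑ a, C.d a (s ^ (k + 1)) • up h W a i
          + s ^ (k + 1) • C.div A γ fun a ↦ up h W a i) := by
    conv_lhs => rw [hup]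
    rw [C.div_add A γ (fun a ↦ _ + _), C.div_add, div_smul, div_smul]
    simp only [d_mul, d_natCast, zero_mul, zero_add]
  have e3 : ∑ a, C.d a s • up h (C.curv A') a i
      = ∑ a, C.d a s • up h (C.curv A) a i
        + (((k + 1 : ℕ) : R) * s ^ k) • ∑ a, C.d a s • up h N a i
        + s ^ (k + 1) • ∑ a, C.d a s • up h W a i := by
    rw [hup]
    simp only [Finset.smul_sum, ← Finset.sum_add_distrib, smul_add]
    refine Finset.sum_congr rfl fun a _ ↦ ?_
    module
  have e4 : s • ∑ a, (((k + 1 : ℕ) : R) * C.d a (s ^ k)) • up h N a i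
      = (((k + 1 : ℕ) : R) * k * s ^ k) • ∑ a, C.d a s • up h N a i := by
    simp only [Finset.smul_sum, smul_smul]
    refine Finset.sum_congr rfl fun a _ ↦ ?_
    rw [mul_left_comm, mul_d_pow]
    congr 1
    ring
  have e5 : s • ∑ a, C.d a (s ^ (k + 1)) • up h W a i
      = (((k + 1 : ℕ) : R) * s ^ (k + 1)) • ∑ a, C.d a s • up h W a i := by
    simp only [Finset.smul_sum, smul_smul]
    refine Finset.sum_congr rfl fun a _ ↦ ?_
    rw [mul_d_pow]
  rw [current, e1, e3, current]
  rw [e2]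
  simp only [smul_add]
  rw [e4, e5]
  module

section Conformal

variable (A : ι → 𝓐) (γ : ι → R) (h : ι → ι → R)

/-- The raised current has conformal weight `-3`: here `γ'` is the logarithmic volume derivative
of the rescaled metric, and `w * v = 1`. -/
lemma current_conformal (w v : R) (hv : w * v = 1) (m : ℕ) (γ' : ι → R)
    (hγ : ∀ a, γ' a = γ a + ((m + 4 : ℕ) : R) * v * C.d a w) (s : R) (T : ι → ι → 𝓐) (b : ι) :
    C.current A γ' (w * s) m (fun a b ↦ v ^ 4 • T a b) b = v ^ 3 • C.current A γ s m T b := by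
  have hdv : ∀ a, C.d a v = -(v ^ 2 * C.d a w) := by
    intro a
    have h1 : C.d a w * v + w * C.d a v = 0 := by rw [← d_mul, hv, d_one]
    linear_combination v * h1 - C.d a v * hv
  have hdv4 : ∀ a, C.d a (v ^ 4) = -(4 * v ^ 5 * C.d a w) := by
    intro a
    rw [C.d_pow_succ a v 3, hdv]
    push_cast
    ring
  rw [current, current]
  simp only [div, cov_smul, hγ, hdv4, d_mul, Finset.smul_sum, smul_sub, ← Finset.sum_sub_distrib]
  refine Finset.sum_congr rfl fun a _ ↦ ?_
  simp only [smul_add, smul_smul]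
  have h1 : (w * s) * (v ^ 4) = v ^ 3 * s := by linear_combination v ^ 3 * s * hv
  have e : ∀ x y : R, x = y → ∀ Φ : 𝓐, x • Φ = y • Φ := fun x y h Φ ↦ by rw [h]
  rw [h1]
  have h2 : w * s * -(4 * v ^ 5 * C.d a w) = -4 * v ^ 4 * s * C.d a w := by
    linear_combination -4 * v ^ 4 * s * C.d a w * hv
  have h3 : w * s * ((γ a + ((m + 4 : ℕ) : R) * v * C.d a w) * v ^ 4)
      = v ^ 3 * s * γ a + ((m + 4 : ℕ) : R) * v ^ 4 * s * C.d a w := by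
    linear_combination (v ^ 3 * s * γ a + ((m + 4 : ℕ) : R) * v ^ 4 * s * C.d a w) * hv
  have h4 : (m : R) * ((C.d a w * s + w * C.d a s) * v ^ 4)
      = m * v ^ 4 * s * C.d a w + m * v ^ 3 * C.d a s := by
    linear_combination m * v ^ 3 * C.d a s * hv
  rw [h2, h3, h4]
  push_cast
  module

end Conformal

section LogVol

variable {g h : ι → ι → R} [DecidableEq ι]

lemma d_inverse (hgh : ∀ i k, ∑ j, g i j * h j k = if i = k then 1 else 0)
    (hhg : ∀ i k, ∑ j, h i j * g j k = if i = k then 1 else 0) (u i k : ι) :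
    C.d u (h i k) = -∑ p, ∑ q, h i p * C.d u (g p q) * h q k := by
  have h1 : ∀ p, ∑ q, (C.d u (g p q) * h q k + g p q * C.d u (h q k)) = 0 := by
    intro p
    simp only [← d_mul, ← map_sum, hgh]
    split_ifs
    · exact C.d_one u
    · exact map_zero _
  have h2 : ∑ p, h i p * ∑ q, (C.d u (g p q) * h q k + g p q * C.d u (h q k)) = 0 := by
    simp [h1]
  simp only [Finset.mul_sum, mul_add, Finset.sum_add_distrib] at h2
  have h3 : ∑ p, ∑ q, h i p * (g p q * C.d u (h q k)) = C.d u (h i k) := by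
    rw [Finset.sum_comm]
    simp only [← mul_assoc, ← Finset.sum_mul, hhg]
    simp
  rw [h3] at h2
  rw [eq_neg_iff_add_eq_zero, add_comm, ← h2]
  simp only [mul_assoc]

lemma logVol_closed (hs : ∀ i j, h i j = h j i)
    (hgh : ∀ i k, ∑ j, g i j * h j k = if i = k then 1 else 0)
    (hhg : ∀ i k, ∑ j, h i j * g j k = if i = k then 1 else 0) (i j : ι) :
    C.d i (logVol C g h j) = C.d j (logVol C g h i) := by
  simp only [logVol, map_smul, map_sum, d_mul]
  congr 1
  simp only [Finset.sum_add_distrib, C.d_comm i j]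
  congr 1
  simp only [C.d_inverse hgh hhg, neg_mul, Finset.sum_mul, Finset.sum_neg_distrib]
  congr 1
  rw [sum_sum_comm]
  refine Finset.sum_congr rfl fun e _ ↦ Finset.sum_congr rfl fun f _ ↦
    Finset.sum_congr rfl fun p _ ↦ Finset.sum_congr rfl fun q _ ↦ ?_
  rw [hs p e, hs f q]
  ring


/-- The Christoffel symbols of the first kind. -/
def christoffel (g : ι → ι → R) (u v e : ι) : R :=
  (1 / 2 : ℝ) • (C.d u (g v e) + C.d v (g u e) - C.d e (g u v))

/-- `∇_u Φ_{vw}`, for the connection `A` coupled to the Levi-Civita connection. -/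
def covTwoForm (A : ι → 𝓐) (g h : ι → ι → R) (Φ : ι → ι → 𝓐) (u v w : ι) : 𝓐 :=
  C.cov A u (Φ v w) - ∑ k, (∑ e, h k e * C.christoffel g u v e) • Φ k w
    - ∑ k, (∑ e, h k e * C.christoffel g u w e) • Φ v k

/-- `∇_u e_v`, for the connection `A` coupled to the Levi-Civita connection. -/
def covOneForm (A : ι → 𝓐) (g h : ι → ι → R) (ε : ι → 𝓐) (u v : ι) : 𝓐 :=
  C.cov A u (ε v) - ∑ k, (∑ e, h k e * C.christoffel g u v e) • ε k

lemma half_add_half (x : R) : (1 / 2 : ℝ) • x + (1 / 2 : ℝ) • x = x := by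
  rw [← add_smul]; norm_num

/-- The contracted Christoffel symbols. -/
lemma sum_christoffel (hs : ∀ i j, h i j = h j i)
    (hgh : ∀ i k, ∑ j, g i j * h j k = if i = k then 1 else 0)
    (hhg : ∀ i k, ∑ j, h i j * g j k = if i = k then 1 else 0) (c : ι) :
    ∑ u, ∑ v, h u v * ∑ e, h c e * C.christoffel g u v e
      = -∑ u, (C.d u (h u c) + C.logVol g h u * h u c) := by
  have h1 : ∑ u, C.d u (h u c) = -∑ u, ∑ v, ∑ e, h u v * C.d u (g v e) * h e c := by
    simp only [C.d_inverse hgh hhg, Finset.sum_neg_distrib]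
  have h2 : ∑ u, C.logVol g h u * h u c
      = (1 / 2 : ℝ) • ∑ u, ∑ v, ∑ e, h u v * C.d e (g u v) * h e c := by
    simp only [logVol, smul_mul_assoc, ← Finset.smul_sum, Finset.sum_mul]
    congr 1
    rw [Finset.sum_comm]
    refine Finset.sum_congr rfl fun u _ ↦ ?_
    rw [Finset.sum_comm]
  have h3 : ∑ u, ∑ v, h u v * ∑ e, h c e * C.christoffel g u v e
      = (1 / 2 : ℝ) • (∑ u, ∑ v, ∑ e, h u v * C.d u (g v e) * h e c
        + ∑ u, ∑ v, ∑ e, h u v * C.d v (g u e) * h e c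
        - ∑ u, ∑ v, ∑ e, h u v * C.d e (g u v) * h e c) := by
    simp only [Finset.mul_sum, ← Finset.sum_add_distrib, ← Finset.sum_sub_distrib, christoffel,
      Finset.smul_sum]
    refine Finset.sum_congr rfl fun u _ ↦ Finset.sum_congr rfl fun v _ ↦
      Finset.sum_congr rfl fun e _ ↦ ?_
    rw [mul_smul_comm, mul_smul_comm, hs c e]
    congr 1
    ring
  have h4 : ∑ u, ∑ v, ∑ e, h u v * C.d v (g u e) * h e c
      = ∑ u, ∑ v, ∑ e, h u v * C.d u (g v e) * h e c := by
    rw [Finset.sum_comm]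
    refine Finset.sum_congr rfl fun u _ ↦ Finset.sum_congr rfl fun v _ ↦
      Finset.sum_congr rfl fun e _ ↦ ?_
    rw [hs u v]
  rw [h3, h4, Finset.sum_add_distrib, h1, h2, smul_sub, smul_add, half_add_half]
  ring

lemma sum_smul_smul_comm (q : ι → ι → R) (p : ι → ι → ι → R) (ε : ι → 𝓐) :
    ∑ u, ∑ v, ∑ k, q u v • p k u v • ε k = ∑ k, (∑ u, ∑ v, q u v * p k u v) • ε k := by
  simp only [Finset.sum_smul, mul_smul]
  conv_lhs => enter [2, u]; rw [Finset.sum_comm]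
  rw [Finset.sum_comm]

lemma div_sum (A : ι → 𝓐) (γ : ι → R) (T : ι → ι → 𝓐) :
    C.div A γ (fun a ↦ ∑ w, T w a) = ∑ w, C.div A γ (T w) := by
  simp only [div, cov_sum, Finset.smul_sum, ← Finset.sum_add_distrib]
  rw [Finset.sum_comm]

/-- The divergence of a one-form. -/
lemma sum_covOneForm (hs : ∀ i j, h i j = h j i)
    (hgh : ∀ i k, ∑ j, g i j * h j k = if i = k then 1 else 0)
    (hhg : ∀ i k, ∑ j, h i j * g j k = if i = k then 1 else 0) (A ε : ι → 𝓐) :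
    ∑ u, ∑ v, h u v • C.covOneForm A g h ε u v
      = C.div A (C.logVol g h) fun a ↦ ∑ c, h a c • ε c := by
  have h1 : ∑ u, ∑ v, ∑ k, h u v • (∑ e, h k e * C.christoffel g u v e) • ε k
      = -∑ k, ∑ u, (C.d u (h u k) + C.logVol g h u * h u k) • ε k := by
    rw [sum_smul_smul_comm h fun k u v ↦ ∑ e, h k e * C.christoffel g u v e]
    simp only [C.sum_christoffel hs hgh hhg, neg_smul, Finset.sum_neg_distrib, Finset.sum_smul]
  simp only [covOneForm, smul_sub, Finset.sum_sub_distrib, Finset.smul_sum]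
  rw [h1, sub_neg_eq_add]
  simp only [div, cov_sum, cov_smul, Finset.smul_sum, smul_smul]
  simp only [add_smul, Finset.sum_add_distrib]
  rw [Finset.sum_comm (f := fun k u ↦ C.d u (h u k) • ε k),
    Finset.sum_comm (f := fun k u ↦ (C.logVol g h u * h u k) • ε k)]
  abel

lemma sum_christoffel_antisymm (hs : ∀ i j, h i j = h j i) (gs : ∀ i j, g i j = g j i)
    (hgh : ∀ i k, ∑ j, g i j * h j k = if i = k then 1 else 0)
    (hhg : ∀ i k, ∑ j, h i j * g j k = if i = k then 1 else 0) (Φ : ι → ι → 𝓐)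
    (hΦ : ∀ i j, Φ i j = -Φ j i) (b : ι) :
    ∑ w, h w b • ∑ u, ∑ v, ∑ k, (h u v * ∑ e, h k e * C.christoffel g u w e) • Φ v k
      = -∑ a, ∑ w, ∑ c, (C.d a (h w b) * h a c) • Φ c w := by
  let X : ι → ι → R := fun v k ↦ ∑ u, ∑ w, ∑ e, h w b * h u v * h k e * C.d u (g w e)
  let Y : ι → ι → R := fun v k ↦ ∑ u, ∑ w, ∑ e, h w b * h u v * h k e * C.d w (g u e)
  let Z : ι → ι → R := fun v k ↦ ∑ u, ∑ w, ∑ e, h w b * h u v * h k e * C.d e (g u w)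
  have hY : ∀ v k, Y v k = Y k v := by
    intro v k
    simp only [Y]
    conv_rhs => rw [Finset.sum_comm]; enter [2, w]; rw [Finset.sum_comm]
    rw [Finset.sum_comm]
    refine Finset.sum_congr rfl fun w _ ↦ Finset.sum_congr rfl fun u _ ↦
      Finset.sum_congr rfl fun e _ ↦ ?_
    rw [hs u v, hs k e, gs u e]
    ring
  have hZ : ∀ v k, Z v k = X k v := by
    intro v k
    simp only [X, Z]
    conv_rhs => rw [Finset.sum_comm]; enter [2, w]; rw [Finset.sum_comm]
    rw [Finset.sum_comm]
    refine Finset.sum_congr rfl fun w _ ↦ Finset.sum_congr rfl fun u _ ↦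
      Finset.sum_congr rfl fun e _ ↦ ?_
    rw [hs u v, hs k e, gs u w]
    ring
  have hYΦ : ∑ v, ∑ k, Y v k • Φ v k = 0 := by
    rw [Finset.sum_comm]
    exact sum_d_mul_antisymm_eq_zero _ (fun a b ↦ hY b a) Φ hΦ
  have hZΦ : ∑ v, ∑ k, Z v k • Φ v k = -∑ v, ∑ k, X v k • Φ v k := by
    rw [Finset.sum_comm, ← Finset.sum_neg_distrib]
    refine Finset.sum_congr rfl fun v _ ↦ ?_
    rw [← Finset.sum_neg_distrib]
    refine Finset.sum_congr rfl fun k _ ↦ ?_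
    rw [hZ, hΦ, smul_neg]
  have hL : ∑ w, h w b • ∑ u, ∑ v, ∑ k, (h u v * ∑ e, h k e * C.christoffel g u w e) • Φ v k
      = ∑ v, ∑ k, ((1 / 2 : ℝ) • (X v k + Y v k - Z v k)) • Φ v k := by
    have h1 : ∀ v k, (1 / 2 : ℝ) • (X v k + Y v k - Z v k)
        = ∑ w, ∑ u, h w b * (h u v * ∑ e, h k e * C.christoffel g u w e) := by
      intro v k
      simp only [X, Y, Z, ← Finset.sum_add_distrib, ← Finset.sum_sub_distrib, Finset.smul_sum,
        Finset.mul_sum, christoffel, mul_smul_comm]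
      rw [Finset.sum_comm]
      refine Finset.sum_congr rfl fun w _ ↦ Finset.sum_congr rfl fun u _ ↦
        Finset.sum_congr rfl fun e _ ↦ ?_
      congr 1
      ring
    simp only [h1, Finset.sum_smul, Finset.smul_sum, smul_smul]
    conv_rhs => rw [sum_sum_comm]
  have hR : ∑ a, ∑ w, ∑ c, (C.d a (h w b) * h a c) • Φ c w = -∑ v, ∑ k, X v k • Φ v k := by
    simp only [C.d_inverse hgh hhg, X]
    conv_lhs => enter [2, a]; rw [Finset.sum_comm]
    rw [Finset.sum_comm, ← Finset.sum_neg_distrib]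
    refine Finset.sum_congr rfl fun v _ ↦ ?_
    rw [Finset.sum_comm, ← Finset.sum_neg_distrib]
    refine Finset.sum_congr rfl fun k _ ↦ ?_
    rw [← Finset.sum_smul, ← neg_smul]
    congr 1
    rw [← Finset.sum_neg_distrib]
    refine Finset.sum_congr rfl fun u _ ↦ ?_
    rw [neg_mul, Finset.sum_comm]
    simp only [Finset.sum_mul]
    congr 1
    refine Finset.sum_congr rfl fun w _ ↦ Finset.sum_congr rfl fun e _ ↦ ?_
    rw [gs e w]
    ring
  rw [hL, hR, neg_neg]
  simp only [smul_add, smul_sub, add_smul, sub_smul, Finset.sum_add_distrib,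
    Finset.sum_sub_distrib]
  have hsm : ∀ q : ι → ι → R, ∑ v, ∑ k, ((1 / 2 : ℝ) • q v k) • Φ v k
      = (algebraMap ℝ R (1 / 2)) • ∑ v, ∑ k, q v k • Φ v k := by
    intro q
    rw [Finset.smul_sum]
    refine Finset.sum_congr rfl fun v _ ↦ ?_
    rw [Finset.smul_sum]
    refine Finset.sum_congr rfl fun k _ ↦ ?_
    rw [smul_smul, Algebra.smul_def (1 / 2 : ℝ)]
  rw [hsm, hsm, hsm, hYΦ, hZΦ, smul_zero, add_zero, smul_neg, sub_neg_eq_add, ← add_smul,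
    ← map_add]
  norm_num

/-- The divergence of a two-form, with all indices raised. -/
lemma sum_covTwoForm (hs : ∀ i j, h i j = h j i) (gs : ∀ i j, g i j = g j i)
    (hgh : ∀ i k, ∑ j, g i j * h j k = if i = k then 1 else 0)
    (hhg : ∀ i k, ∑ j, h i j * g j k = if i = k then 1 else 0) (A : ι → 𝓐) (Φ : ι → ι → 𝓐)
    (hΦ : ∀ i j, Φ i j = -Φ j i) (b : ι) :
    ∑ w, h w b • ∑ u, ∑ v, h u v • C.covTwoForm A g h Φ u v w
      = C.div A (C.logVol g h) fun a ↦ up h Φ a b := by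
  have key : ∀ w, ∑ u, ∑ v, h u v • C.covTwoForm A g h Φ u v w
      = C.div A (C.logVol g h) (fun a ↦ ∑ c, h a c • Φ c w)
        - ∑ u, ∑ v, ∑ k, (h u v * ∑ e, h k e * C.christoffel g u w e) • Φ v k := by
    intro w
    rw [← C.sum_covOneForm hs hgh hhg A fun c ↦ Φ c w]
    simp only [covTwoForm, covOneForm, smul_sub, Finset.sum_sub_distrib, Finset.smul_sum, smul_smul]
  have h2 : (fun a ↦ up h Φ a b) = fun a ↦ ∑ w, h w b • ∑ c, h a c • Φ c w := by
    funext a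
    simp only [up, Finset.smul_sum, smul_smul]
    rw [Finset.sum_comm]
    refine Finset.sum_congr rfl fun w _ ↦ Finset.sum_congr rfl fun c _ ↦ ?_
    rw [hs b w, mul_comm]
  have h3 : C.div A (C.logVol g h) (fun a ↦ up h Φ a b)
      = ∑ w, h w b • C.div A (C.logVol g h) (fun a ↦ ∑ c, h a c • Φ c w)
        + ∑ a, ∑ w, ∑ c, (C.d a (h w b) * h a c) • Φ c w := by
    rw [h2, C.div_sum A _ fun w a ↦ h w b • ∑ c, h a c • Φ c w]
    have h4 : ∀ w, C.div A (C.logVol g h) (fun a ↦ h w b • ∑ c, h a c • Φ c w)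
        = ∑ a, ∑ c, (C.d a (h w b) * h a c) • Φ c w
          + h w b • C.div A (C.logVol g h) (fun a ↦ ∑ c, h a c • Φ c w) := by
      intro w
      rw [div_smul]
      simp only [Finset.smul_sum, smul_smul]
    simp only [h4, Finset.sum_add_distrib]
    rw [add_comm, Finset.sum_comm (f := fun a w ↦ ∑ c, (C.d a (h w b) * h a c) • Φ c w)]
  rw [h3]
  simp only [key, smul_sub, Finset.sum_sub_distrib]
  rw [C.sum_christoffel_antisymm hs gs hgh hhg Φ hΦ, sub_neg_eq_add]

/-- The raised current in terms of the Levi-Civita connection. -/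
lemma sum_current (hs : ∀ i j, h i j = h j i) (gs : ∀ i j, g i j = g j i)
    (hgh : ∀ i k, ∑ j, g i j * h j k = if i = k then 1 else 0)
    (hhg : ∀ i k, ∑ j, h i j * g j k = if i = k then 1 else 0) (A : ι → 𝓐) (s : R) (m : ℕ)
    (w : ι) :
    s • ∑ u, ∑ v, h u v • C.covTwoForm A g h (C.curv A) u v w
        - (m : R) • ∑ u, ∑ v, (h u v * C.d u s) • C.curv A v w
      = ∑ b, g w b • C.current A (C.logVol g h) s m (up h (C.curv A)) b := by
  have lower : ∀ q : ι → 𝓐, ∑ b, g w b • ∑ v, h v b • q v = q w := by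
    intro q
    have h1 : ∀ v, ∑ b, g w b * h v b = if w = v then 1 else 0 := fun v ↦ by
      rw [← hgh w v]
      exact Finset.sum_congr rfl fun b _ ↦ by rw [hs v b]
    simp only [Finset.smul_sum, smul_smul]
    rw [Finset.sum_comm]
    simp only [← Finset.sum_smul, h1]
    simp
  have h1 : ∀ b, C.current A (C.logVol g h) s m (up h (C.curv A)) b
      = ∑ v, h v b • (s • ∑ u, ∑ x, h u x • C.covTwoForm A g h (C.curv A) u x v
        - (m : R) • ∑ u, ∑ x, (h u x * C.d u s) • C.curv A x v) := by
    intro b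
    rw [current, ← C.sum_covTwoForm hs gs hgh hhg A _ (C.curv_antisymm A) b]
    simp only [smul_sub, Finset.sum_sub_distrib, smul_comm (h _ b) s, smul_comm (h _ b) (m : R),
      ← Finset.smul_sum]
    congr 2
    simp only [up, Finset.smul_sum, smul_smul]
    conv_lhs => enter [2, a]; rw [Finset.sum_comm]
    rw [Finset.sum_comm]
    refine Finset.sum_congr rfl fun v _ ↦ Finset.sum_congr rfl fun a _ ↦
      Finset.sum_congr rfl fun e _ ↦ ?_
    rw [hs b v]
    congr 1
    ring
  simp only [h1, lower]

lemma sum_d_up (s : R) (b : ι → 𝓐)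
    (hgh : ∀ i k, ∑ j, g i j * h j k = if i = k then 1 else 0) (w : ι) :
    ∑ i, g w i • ∑ a, C.d a s • up h (fun c e ↦ C.d c s • b e - C.d e s • b c) a i
      = (∑ u, ∑ v, h u v * (C.d u s * C.d v s)) • b w
        - C.d w s • ∑ u, ∑ v, (h u v * C.d u s) • b v := by
  have h1 : ∀ v, ∑ b, g w b * h b v = if w = v then 1 else 0 := fun v ↦ hgh w v
  have h2 : ∑ i, g w i • ∑ a, C.d a s • up h (fun c e ↦ C.d c s • b e - C.d e s • b c) a i
      = ∑ e, (∑ i, g w i * h i e) • ∑ a, ∑ c, (C.d a s * h a c) •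
          (C.d c s • b e - C.d e s • b c) := by
    simp only [up, Finset.smul_sum, Finset.sum_mul, Finset.sum_smul, smul_smul]
    conv_lhs => enter [2, i, 2, a]; rw [Finset.sum_comm]
    conv_lhs => enter [2, i]; rw [Finset.sum_comm]
    rw [Finset.sum_comm]
    refine Finset.sum_congr rfl fun e _ ↦ ?_
    conv_rhs => enter [2, a]; rw [Finset.sum_comm]
    conv_rhs => rw [Finset.sum_comm]
    refine Finset.sum_congr rfl fun i _ ↦ Finset.sum_congr rfl fun a _ ↦
      Finset.sum_congr rfl fun c _ ↦ ?_
    congr 1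
    ring
  rw [h2]
  simp only [h1, ite_smul, one_smul, zero_smul, Finset.sum_ite_eq, Finset.mem_univ, if_true]
  simp only [smul_sub, Finset.sum_sub_distrib, Finset.sum_smul, Finset.smul_sum, smul_smul]
  congr 1
  · refine Finset.sum_congr rfl fun a _ ↦ Finset.sum_congr rfl fun c _ ↦ ?_
    congr 1
    ring
  · refine Finset.sum_congr rfl fun a _ ↦ Finset.sum_congr rfl fun c _ ↦ ?_
    congr 1
    ring

section NormalComponent

/-- The gradient `ν^a = h^{ae} ∂_e s`. -/
def grad (h : ι → ι → R) (s : R) (a : ι) : R := ∑ e, h a e * C.d e s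

/-- `|ds|²`. -/
def gradSq (h : ι → ι → R) (s : R) : R := ∑ a, C.d a s * C.grad h s a

/-- The contraction `Φ_{bc} ν^c` with the gradient of `s`. -/
def contractGrad (h : ι → ι → R) (s : R) (Φ : ι → ι → 𝓐) (b : ι) : 𝓐 :=
  ∑ c, C.grad h s c • Φ b c

lemma sum_grad_contractGrad (s : R) (Φ : ι → ι → 𝓐) (hΦ : ∀ i j, Φ i j = -Φ j i) :
    ∑ b, C.grad h s b • C.contractGrad h s Φ b = 0 := by
  simp only [contractGrad, Finset.smul_sum, smul_smul]
  rw [Finset.sum_comm]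
  exact sum_d_mul_antisymm_eq_zero _ (fun _ _ ↦ mul_comm _ _) Φ hΦ

lemma sum_contractGrad_up (hs : ∀ i j, h i j = h j i) (s : R) (Φ : ι → ι → 𝓐) (a : ι) :
    ∑ c, h a c • C.contractGrad h s Φ c = ∑ b, C.d b s • up h Φ a b := by
  simp only [contractGrad, grad, up, Finset.smul_sum, Finset.sum_smul, smul_smul]
  conv_rhs => rw [Finset.sum_comm]
  refine Finset.sum_congr rfl fun c _ ↦ ?_
  conv_rhs => rw [Finset.sum_comm]
  refine Finset.sum_congr rfl fun e _ ↦ Finset.sum_congr rfl fun b _ ↦ ?_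
  rw [hs b e]
  congr 1
  ring

lemma sum_d_smul_div_up (hs : ∀ i j, h i j = h j i)
    (hgh : ∀ i k, ∑ j, g i j * h j k = if i = k then 1 else 0)
    (hhg : ∀ i k, ∑ j, h i j * g j k = if i = k then 1 else 0) (A : ι → 𝓐) (s : R)
    (Φ : ι → ι → 𝓐) (hΦ : ∀ i j, Φ i j = -Φ j i) :
    ∑ b, C.d b s • C.div A (C.logVol g h) (fun a ↦ up h Φ a b)
      = ∑ u, ∑ v, h u v • C.covOneForm A g h (C.contractGrad h s Φ) u v := by
  rw [C.sum_covOneForm hs hgh hhg]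
  have h1 : (fun a ↦ ∑ c, h a c • C.contractGrad h s Φ c)
      = fun a ↦ ∑ b, C.d b s • up h Φ a b := funext fun a ↦ C.sum_contractGrad_up hs s Φ a
  rw [h1, C.div_sum A _ fun b a ↦ C.d b s • up h Φ a b]
  simp only [div_smul, Finset.sum_add_distrib]
  rw [right_eq_add, Finset.sum_comm]
  exact Finset.sum_comm.trans (sum_d_mul_antisymm_eq_zero _ (fun _ _ ↦ C.d_comm _ _ _) _
    (up_antisymm hΦ))

lemma sum_grad_grad_covOneForm (hs : ∀ i j, h i j = h j i) (gs : ∀ i j, g i j = g j i)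
    (hgh : ∀ i k, ∑ j, g i j * h j k = if i = k then 1 else 0) (A : ι → 𝓐) (s : R)
    (ε : ι → 𝓐) (hε : ∑ b, C.grad h s b • ε b = 0) :
    ∑ u, ∑ v, (C.grad h s u * C.grad h s v) • C.covOneForm A g h ε u v
      = ∑ k, (-((1 / 2 : ℝ) • C.d k (C.gradSq h s))) • ∑ c, h k c • ε c := by
  set ν := C.grad h s with hν
  set εu : ι → 𝓐 := fun k ↦ ∑ c, h k c • ε c with hεu
  have lower : ∀ v, ε v = ∑ k, g v k • εu k := by
    intro v
    simp only [hεu, Finset.smul_sum, smul_smul]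
    rw [Finset.sum_comm]
    simp only [← Finset.sum_smul, hgh]
    simp
  have hn : ∀ k, C.d k s = ∑ v, g k v * ν v := by
    intro k
    simp only [hν, grad, Finset.mul_sum, ← mul_assoc]
    rw [Finset.sum_comm]
    simp only [← Finset.sum_mul, hgh]
    simp
  have hdν : ∀ u k, ∑ v, C.d u (ν v) * g v k = C.d u (C.d k s) - ∑ v, ν v * C.d u (g v k) := by
    intro u k
    rw [hn k, map_sum, eq_sub_iff_add_eq, ← Finset.sum_add_distrib]
    refine Finset.sum_congr rfl fun v _ ↦ ?_
    rw [d_mul, gs k v]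
    ring
  have h1 : ∀ u, ∑ v, ν v • C.cov A u (ε v)
      = -∑ k, (C.d u (C.d k s) - ∑ v, ν v * C.d u (g v k)) • εu k := by
    intro u
    have h2 : ∑ v, (C.d u (ν v) • ε v + ν v • C.cov A u (ε v)) = 0 := by
      simp only [← cov_smul, ← cov_sum, hε, cov_zero]
    rw [Finset.sum_add_distrib, add_comm] at h2
    rw [eq_neg_of_add_eq_zero_left h2]
    congr 1
    simp only [← hdν, Finset.sum_smul, mul_smul]
    rw [Finset.sum_comm]
    simp only [← Finset.smul_sum, ← lower]
  have h2 : ∀ u v, ∑ k, (∑ e, h k e * C.christoffel g u v e) • ε k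
      = ∑ e, C.christoffel g u v e • εu e := by
    intro u v
    simp only [hεu, Finset.sum_smul, Finset.smul_sum, smul_smul]
    rw [Finset.sum_comm]
    refine Finset.sum_congr rfl fun e _ ↦ Finset.sum_congr rfl fun k _ ↦ ?_
    rw [hs k e, mul_comm]
  have h3 : ∑ u, ∑ v, (ν u * ν v) • C.covOneForm A g h ε u v
      = ∑ k, (-∑ u, ν u * (C.d u (C.d k s) - ∑ v, ν v * C.d u (g v k))
        - ∑ u, ∑ v, ν u * ν v * C.christoffel g u v k) • εu k := by
    obtain ⟨q, hq⟩ : ∃ q : ι → ι → R,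
      q = fun u k ↦ C.d u (C.d k s) - ∑ v, ν v * C.d u (g v k) := ⟨_, rfl⟩
    have hq' : ∀ u k, C.d u (C.d k s) - ∑ v, ν v * C.d u (g v k) = q u k := fun u k ↦ by rw [hq]
    simp only [hq'] at h1 ⊢
    have h5 : ∑ u, ∑ v, (ν u * ν v) • C.covOneForm A g h ε u v
        = ∑ u, ν u • ∑ v, ν v • C.cov A u (ε v)
          - ∑ u, ∑ v, (ν u * ν v) • ∑ e, C.christoffel g u v e • εu e := by
      simp only [covOneForm, h2, smul_sub, Finset.sum_sub_distrib, Finset.smul_sum, smul_smul]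
    rw [h5]
    simp only [h1, sub_smul, neg_smul, smul_neg, Finset.sum_sub_distrib, Finset.sum_neg_distrib,
      Finset.sum_smul, Finset.smul_sum, smul_smul]
    congr 1
    · rw [Finset.sum_comm]
    · conv_lhs => enter [2, u]; rw [Finset.sum_comm]
      rw [Finset.sum_comm]
  have h4 : ∀ k, C.d k (C.gradSq h s)
      = 2 * ∑ u, ν u * C.d k (C.d u s) - ∑ u, ∑ v, ν u * ν v * C.d k (g u v) := by
    intro k
    have h5 : ∑ a, C.d a s * C.d k (ν a)
        = ∑ v, ν v * (C.d k (C.d v s) - ∑ a, ν a * C.d k (g a v)) := by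
      simp only [← hdν]
      conv_lhs => enter [2, a]; rw [hn a, Finset.sum_mul]
      rw [Finset.sum_comm]
      refine Finset.sum_congr rfl fun v _ ↦ ?_
      rw [Finset.mul_sum]
      refine Finset.sum_congr rfl fun a _ ↦ ?_
      ring
    have h6 : ∑ v, ∑ a, ν v * (ν a * C.d k (g a v)) = ∑ u, ∑ v, ν u * ν v * C.d k (g u v) := by
      rw [Finset.sum_comm]
      refine Finset.sum_congr rfl fun v _ ↦ Finset.sum_congr rfl fun a _ ↦ ?_
      ring
    rw [gradSq, map_sum]
    simp only [d_mul, Finset.sum_add_distrib, ← hν]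
    rw [h5]
    simp only [mul_sub, Finset.sum_sub_distrib, Finset.mul_sum, ← h6]
    rw [← add_sub_assoc, ← Finset.sum_add_distrib]
    congr 1
    refine Finset.sum_congr rfl fun v _ ↦ ?_
    ring
  rw [h3]
  refine Finset.sum_congr rfl fun k _ ↦ ?_
  congr 1
  have h5 : ∑ u, ∑ v, ν u * ν v * C.christoffel g u v k
      = (1 / 2 : ℝ) • (∑ u, ∑ v, ν u * ν v * C.d u (g v k) + ∑ u, ∑ v, ν u * ν v * C.d v (g u k)
        - ∑ u, ∑ v, ν u * ν v * C.d k (g u v)) := by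
    simp only [← Finset.sum_add_distrib, ← Finset.sum_sub_distrib, christoffel,
      Finset.smul_sum, mul_smul_comm]
    refine Finset.sum_congr rfl fun u _ ↦ Finset.sum_congr rfl fun v _ ↦ ?_
    congr 1
    ring
  have h6 : ∑ u, ∑ v, ν u * ν v * C.d v (g u k) = ∑ u, ∑ v, ν u * ν v * C.d u (g v k) := by
    rw [Finset.sum_comm]
    refine Finset.sum_congr rfl fun v _ ↦ Finset.sum_congr rfl fun a _ ↦ ?_
    ring
  have h7 : ∑ u, ν u * (C.d u (C.d k s) - ∑ v, ν v * C.d u (g v k))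
      = ∑ u, ν u * C.d k (C.d u s) - ∑ u, ∑ v, ν u * ν v * C.d u (g v k) := by
    simp only [mul_sub, Finset.sum_sub_distrib, Finset.mul_sum, mul_assoc, C.d_comm k]
  rw [h4, h5, h6, h7]
  simp only [Algebra.smul_def]
  have hc : algebraMap ℝ R (1 / 2) * 2 = 1 := by
    rw [← map_ofNat (algebraMap ℝ R) 2, ← map_mul]
    norm_num
  linear_combination (∑ u, ν u * C.d k (C.d u s) - ∑ u, ∑ v, ν u * ν v * C.d u (g v k)) * hc

end NormalComponent

end LogVol

end Div

end Calculus

end ElectricYM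

/-! ### Smooth functions on convex sets -/

namespace ElectricYM

open Filter Set MeasureTheory
open scoped Topology

section Parametric

variable {E W : Type*} [NormedAddCommGroup E] [NormedSpace ℝ E]
  [NormedAddCommGroup W] [NormedSpace ℝ W] {s : Set E}

/-- Differentiation under the integral on a convex set. -/
lemma hasFDerivWithinAt_integral_of_convex [CompleteSpace W] (hs : Convex ℝ s) {α : Type*}
    [MeasurableSpace α] {μ : Measure α}
    {f : α → E → W} {f' : α → E → E →L[ℝ] W} {u : α → ℝ} (hu : Integrable u μ)
    (hf : ∀ a, ∀ x ∈ s, HasFDerivWithinAt (f a) (f' a x) s x)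
    (hf' : ∀ a, ∀ x ∈ s, ‖f' a x‖ ≤ u a) (hint : ∀ x ∈ s, Integrable (f · x) μ)
    (hint' : ∀ x ∈ s, Integrable (f' · x) μ) {x : E} (hx : x ∈ s) :
    HasFDerivWithinAt (fun y ↦ ∫ a, f a y ∂μ) (∫ a, f' a x ∂μ) s x := by
  rw [hasFDerivWithinAt_iff_tendsto]
  have hA : ∀ y, Integrable (fun a ↦ f' a x (y - x)) μ := fun y ↦
    (ContinuousLinearMap.apply ℝ W (y - x)).integrable_comp (hint' x hx)
  have hD : ∀ y ∈ s, ∀ a, ‖f a y - f a x - f' a x (y - x)‖ ≤ 2 * u a * ‖y - x‖ := by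
    intro y hy a
    have h1 : ‖f a y - f a x‖ ≤ u a * ‖y - x‖ :=
      hs.norm_image_sub_le_of_norm_hasFDerivWithin_le (hf a) (hf' a) hx hy
    have h2 : ‖f' a x (y - x)‖ ≤ u a * ‖y - x‖ :=
      ((f' a x).le_opNorm _).trans (by gcongr; exact hf' a x hx)
    exact (norm_sub_le _ _).trans (by linarith)
  have hI : ∀ y ∈ s, Integrable (fun a ↦ f a y - f a x - f' a x (y - x)) μ := fun y hy ↦
    ((hint y hy).sub (hint x hx)).sub (hA y)
  have h0 : Tendsto (fun y ↦ ∫ a, ‖y - x‖⁻¹ * ‖f a y - f a x - f' a x (y - x)‖ ∂μ) (𝓝[s] x)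
      (𝓝 (∫ _, (0 : ℝ) ∂μ)) := by
    refine tendsto_integral_filter_of_dominated_convergence (fun a ↦ 2 * u a) ?_ ?_
      (hu.const_mul 2) ?_
    · filter_upwards [self_mem_nhdsWithin] with y hy
      exact ((hI y hy).norm.const_mul _).aestronglyMeasurable
    · filter_upwards [self_mem_nhdsWithin] with y hy
      refine Eventually.of_forall fun a ↦ ?_
      rw [Real.norm_of_nonneg (by positivity)]
      have hua : 0 ≤ u a := (norm_nonneg _).trans (hf' a x hx)
      rcases (norm_nonneg (y - x)).eq_or_lt with h | h
      · rw [← h]; simpa using hua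
      · rw [inv_mul_le_iff₀ h]; linarith [hD y hy a]
    · exact Eventually.of_forall fun a ↦ hasFDerivWithinAt_iff_tendsto.1 (hf a x hx)
  rw [integral_zero] at h0
  refine squeeze_zero_norm' ?_ h0
  filter_upwards [self_mem_nhdsWithin] with y hy
  have hB : ∫ a, f a y ∂μ - ∫ a, f a x ∂μ - (∫ a, f' a x ∂μ) (y - x)
      = ∫ a, (f a y - f a x - f' a x (y - x)) ∂μ := by
    have h1 : ∫ a, (f a y - f a x - f' a x (y - x)) ∂μ
        = ∫ a, (f a y - f a x) ∂μ - ∫ a, f' a x (y - x) ∂μ :=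
      integral_sub ((hint y hy).sub (hint x hx)) (hA y)
    rw [h1, integral_sub (hint y hy) (hint x hx),
      ContinuousLinearMap.integral_apply (hint' x hx)]
  rw [hB, Real.norm_of_nonneg (by positivity), integral_const_mul]
  gcongr
  exact norm_integral_le_integral_norm _

/-- Smoothness of integrals with a parameter in a convex set. -/
lemma contDiffOn_integral_of_convex [CompleteSpace W] (hs : Convex ℝ s) {α : Type*}
    [MeasurableSpace α] {μ : Measure α}
    {f : α → E → W} {p : α → E → FormalMultilinearSeries ℝ E W}
    (hf : ∀ a, HasFTaylorSeriesUpToOn ∞ (f a) (p a) s)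
    (hb : ∀ j : ℕ, ∃ u : α → ℝ, Integrable u μ ∧ ∀ a, ∀ x ∈ s, ‖p a x j‖ ≤ u a)
    (hm : ∀ j : ℕ, ∀ x ∈ s, AEStronglyMeasurable (fun a ↦ p a x j) μ) :
    ContDiffOn ℝ ∞ (fun x ↦ ∫ a, f a x ∂μ) s := by
  have hint : ∀ j : ℕ, ∀ x ∈ s, Integrable (fun a ↦ p a x j) μ := fun j x hx ↦ by
    obtain ⟨u, hu, hpu⟩ := hb j
    exact hu.mono' (hm j x hx) (Eventually.of_forall fun a ↦ hpu a x hx)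
  let q : E → FormalMultilinearSeries ℝ E W := fun x j ↦ ∫ a, p a x j ∂μ
  have hder : ∀ j : ℕ, ∀ x ∈ s, HasFDerivWithinAt (q · j) (q x j.succ).curryLeft s x := by
    intro j x hx
    obtain ⟨u, hu, hpu⟩ := hb (j + 1)
    have key := hasFDerivWithinAt_integral_of_convex (f := fun a y ↦ p a y j)
      (f' := fun a y ↦ (p a y j.succ).curryLeft) hs hu
      (fun a y hy ↦ (hf a).fderivWithin j (by exact_mod_cast WithTop.coe_lt_top j) y hy)
      (fun a y hy ↦ by simpa using hpu a y hy) (hint j)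
      (fun y hy ↦ (continuousMultilinearCurryLeftEquiv ℝ (fun _ : Fin (j + 1) ↦ E)
        W).toContinuousLinearEquiv.toContinuousLinearMap.integrable_comp (hint (j + 1) y hy)) hx
    have h2 := (continuousMultilinearCurryLeftEquiv ℝ (fun _ : Fin (j + 1) ↦ E)
        W).toContinuousLinearEquiv.integral_comp_comm (μ := μ) fun a ↦ p a x (j + 1)
    change HasFDerivWithinAt (q · j) ((continuousMultilinearCurryLeftEquiv ℝ
      (fun _ : Fin (j + 1) ↦ E) W).toContinuousLinearEquiv (∫ a, p a x (j + 1) ∂μ)) s x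
    rw [← h2]
    exact key
  refine HasFTaylorSeriesUpToOn.contDiffOn (f' := q) ⟨fun x hx ↦ ?_, fun j _ ↦ hder j,
    fun j _ x hx ↦ (hder j x hx).continuousWithinAt⟩
  have h1 : ∀ a, (continuousMultilinearCurryFin0 ℝ E W) (p a x 0) = f a x :=
    fun a ↦ (hf a).zero_eq x hx
  simp_rw [← h1]
  exact ((continuousMultilinearCurryFin0 ℝ E W).toContinuousLinearEquiv.integral_comp_comm
    fun a ↦ p a x 0).symm

/-- Smoothness of series on a convex set. -/
lemma contDiffOn_tsum_of_convex [CompleteSpace W] (hs : Convex ℝ s) (hs' : UniqueDiffOn ℝ s)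
    {f : ℕ → E → W} (hf : ∀ i, ContDiffOn ℝ ∞ (f i) s)
    (hb : ∀ j : ℕ, ∃ u : ℕ → ℝ, Summable u ∧
      ∀ i, ∀ x ∈ s, ‖iteratedFDerivWithin ℝ j (f i) s x‖ ≤ u i) :
    ContDiffOn ℝ ∞ (fun x ↦ ∑' i, f i x) s := by
  have hsum : ∀ {g : ℕ → ℝ}, (∀ i, 0 ≤ g i) → Summable g → Integrable g Measure.count :=
    fun h0 h ↦ integrable_count_iff.2 (by simpa [abs_of_nonneg (h0 _)] using h.norm)
  have hC := contDiffOn_integral_of_convex (μ := Measure.count) hs (f := f)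
    (p := fun i ↦ ftaylorSeriesWithin ℝ (f i) s) (fun i ↦ (hf i).ftaylorSeriesWithin hs')
    (fun j ↦ by
      obtain ⟨u, hu, h⟩ := hb j
      refine ⟨fun i ↦ |u i|, hsum (fun i ↦ abs_nonneg _) hu.abs,
        fun i x hx ↦ (h i x hx).trans (le_abs_self _)⟩)
    (fun j x hx ↦ continuous_of_discreteTopology.aestronglyMeasurable)
  refine hC.congr fun x hx ↦ ?_
  obtain ⟨u, hu, h⟩ := hb 0
  have hi : Integrable (fun i ↦ f i x) Measure.count := by
    refine integrable_count_iff.2 (hu.of_nonneg_of_le (fun _ ↦ norm_nonneg _) fun i ↦ ?_)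
    simpa using h i x hx
  rw [integral_countable hi]
  simp

end Parametric

section Borel

variable {E W : Type*} [NormedAddCommGroup E] [NormedSpace ℝ E]
  [NormedAddCommGroup W] [NormedSpace ℝ W] {s : Set E}

/-- A smooth cutoff on the real line which is `1` near `0`. -/
def cutoff : ContDiffBump (0 : ℝ) := ⟨1, 2, one_pos, one_lt_two⟩

lemma exists_iteratedFDerivWithin_bound (hs : IsCompact s) (hs' : UniqueDiffOn ℝ s) {f : E → W}
    (hf : ContDiffOn ℝ ∞ f s) (N : ℕ) :
    ∃ C : ℝ, 1 ≤ C ∧ ∀ j ≤ N, ∀ x ∈ s, ‖iteratedFDerivWithin ℝ j f s x‖ ≤ C := by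
  induction N with
  | zero =>
    obtain ⟨C, hC⟩ := hs.exists_bound_of_continuousOn
      (hf.continuousOn_iteratedFDerivWithin (m := 0) (by simp) hs')
    exact ⟨max C 1, le_max_right _ _, fun j hj x hx ↦ by
      obtain rfl : j = 0 := by omega
      exact (hC x hx).trans (le_max_left _ _)⟩
  | succ N ih =>
    obtain ⟨C, hC1, hC⟩ := ih
    obtain ⟨C', hC'⟩ := hs.exists_bound_of_continuousOn
      (hf.continuousOn_iteratedFDerivWithin (m := N + 1) (by exact_mod_cast le_top) hs')
    refine ⟨max C C', hC1.trans (le_max_left _ _), fun j hj x hx ↦ ?_⟩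
    rcases Nat.le_succ_iff.1 hj with h | rfl
    · exact (hC j h x hx).trans (le_max_left _ _)
    · exact (hC' x hx).trans (le_max_right _ _)

lemma contDiff_cutoff_mul_pow (k : ℕ) : ContDiff ℝ ∞ fun t : ℝ ↦ cutoff t * t ^ k :=
  cutoff.contDiff.mul (contDiff_id.pow k)

lemma exists_iteratedDeriv_cutoff_bound (k N : ℕ) :
    ∃ C : ℝ, 1 ≤ C ∧ ∀ j ≤ N, ∀ t, |iteratedDeriv j (fun t : ℝ ↦ cutoff t * t ^ k) t| ≤ C := by
  have h : ∀ j, ∃ C, ∀ t, |iteratedDeriv j (fun t : ℝ ↦ cutoff t * t ^ k) t| ≤ C := fun j ↦ by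
    have hc : HasCompactSupport (fun t : ℝ ↦ cutoff t * t ^ k) :=
      cutoff.hasCompactSupport.mul_right
    obtain ⟨C, hC⟩ := (hc.iteratedFDeriv (𝕜 := ℝ) j).exists_bound_of_continuous
      ((contDiff_cutoff_mul_pow k).continuous_iteratedFDeriv (m := j) (by exact_mod_cast le_top))
    exact ⟨C, fun t ↦ by
      rw [← Real.norm_eq_abs, ← norm_iteratedFDeriv_eq_norm_iteratedDeriv]; exact hC t⟩
  choose C hC using h
  refine ⟨1 + ∑ j ∈ Finset.range (N + 1), |C j|, le_add_of_nonneg_right (by positivity),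
    fun j hj t ↦ (hC j t).trans ((le_abs_self _).trans ?_)⟩
  have := Finset.single_le_sum (f := fun j ↦ |C j|) (fun _ _ ↦ abs_nonneg _)
    (Finset.mem_range_succ_iff.2 hj)
  linarith

lemma contDiffOn_cutoff_smul {σ : E → ℝ} (hσ : ContDiffOn ℝ ∞ σ s) {b : E → W}
    (hb : ContDiffOn ℝ ∞ b s) (ε : ℝ) (k : ℕ) :
    ContDiffOn ℝ ∞ (fun x ↦ (cutoff (σ x / ε) * σ x ^ k) • b x) s := by
  have h1 : ContDiffOn ℝ ∞ (fun x ↦ cutoff (σ x / ε)) s :=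
    cutoff.contDiff.comp_contDiffOn (hσ.div_const ε)
  exact (h1.mul (hσ.pow k)).smul hb

/-- The terms of a Borel sum are small. -/
lemma exists_cutoff_smul_bound (hs : IsCompact s) (hs' : UniqueDiffOn ℝ s) {σ : E → ℝ}
    (hσ : ContDiffOn ℝ ∞ σ s) {b : E → W} (hb : ContDiffOn ℝ ∞ b s) (k : ℕ) {η : ℝ}
    (hη : 0 < η) :
    ∃ δ > 0, ∀ ε, 0 < ε → ε ≤ δ → ∀ j < k, ∀ x ∈ s,
      ‖iteratedFDerivWithin ℝ j (fun x ↦ (cutoff (σ x / ε) * σ x ^ k) • b x) s x‖ ≤ η := by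
  obtain ⟨Cb, hCb1, hCb⟩ := exists_iteratedFDerivWithin_bound hs hs' hb k
  obtain ⟨D, hD1, hD⟩ := exists_iteratedFDerivWithin_bound hs hs' hσ k
  obtain ⟨C, hC1, hC⟩ := exists_iteratedDeriv_cutoff_bound k k
  set θ : ℝ → ℝ := fun t : ℝ ↦ cutoff t * t ^ k with hθ
  set L : ℝ := ∑ j ∈ Finset.range (k + 1), ∑ i ∈ Finset.range (j + 1),
    (j.choose i : ℝ) * ((i.factorial : ℝ) * C * D ^ i) * Cb with hL
  have hL0 : 0 ≤ L := by positivity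
  refine ⟨min 1 (η / (L + 1)), by positivity, fun ε hε hεδ j hj x hx ↦ ?_⟩
  have hε1 : ε ≤ 1 := hεδ.trans (min_le_left _ _)
  have hε2 : ε * (L + 1) ≤ η := by
    have := hεδ.trans (min_le_right _ _)
    rwa [le_div_iff₀ (by positivity)] at this
  have hg : ContDiff ℝ ∞ fun t : ℝ ↦ θ (ε⁻¹ * t) :=
    (contDiff_cutoff_mul_pow k).comp (contDiff_const.mul contDiff_id)
  set g : ℝ → ℝ := fun t ↦ ε ^ k * θ (ε⁻¹ * t) with hgdef
  have hg' : ContDiff ℝ ∞ g := contDiff_const.mul hg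
  have hgb : ∀ i ≤ j, ∀ t, ‖iteratedFDeriv ℝ i g t‖ ≤ ε * C := by
    intro i hi t
    rw [norm_iteratedFDeriv_eq_norm_iteratedDeriv]
    have h1 : iteratedDeriv i g t = ε ^ k * ((ε⁻¹) ^ i * iteratedDeriv i θ (ε⁻¹ * t)) := by
      rw [hgdef, iteratedDeriv_const_mul_field, iteratedDeriv_comp_const_mul
        ((contDiff_cutoff_mul_pow k).of_le (by exact_mod_cast le_top))]
    rw [h1, ← mul_assoc, norm_mul]
    refine mul_le_mul ?_ (hC i (by omega) _) (norm_nonneg _) hε.le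
    have h2 : ε ^ k * ε⁻¹ ^ i = ε ^ (k - i) := by
      rw [inv_pow, ← div_eq_mul_inv, pow_sub₀ _ hε.ne' (by omega), div_eq_mul_inv]
    rw [h2, Real.norm_of_nonneg (by positivity)]
    calc ε ^ (k - i) ≤ ε ^ 1 := pow_le_pow_of_le_one hε.le hε1 (by omega)
      _ = ε := pow_one _
  have hcomp : ∀ i ≤ j, ‖iteratedFDerivWithin ℝ i (g ∘ σ) s x‖ ≤
      i.factorial * (ε * C) * D ^ i := by
    intro i hi
    refine norm_iteratedFDerivWithin_comp_le (N := ∞) (t := univ) hg'.contDiffOn hσ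
      (by exact_mod_cast le_top) uniqueDiffOn_univ hs' (mapsTo_univ _ _) hx ?_ ?_
    · intro l hl
      rw [iteratedFDerivWithin_univ]
      exact hgb l (hl.trans hi) _
    · intro l hl hli
      exact (hD l (by omega) x hx).trans (le_self_pow₀ hD1 (by omega))
  have heq : (fun x ↦ (cutoff (σ x / ε) * σ x ^ k) • b x) = fun x ↦ (g ∘ σ) x • b x := by
    funext y
    congr 1
    simp only [hgdef, hθ, Function.comp, mul_pow, inv_pow]
    rw [div_eq_inv_mul]
    field_simp
  rw [heq]
  refine (norm_iteratedFDerivWithin_smul_le (N := ∞) (hg'.comp_contDiffOn hσ) hb hs' hx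
    (by exact_mod_cast le_top)).trans ?_
  calc ∑ i ∈ Finset.range (j + 1), (j.choose i : ℝ) * ‖iteratedFDerivWithin ℝ i (g ∘ σ) s x‖ *
        ‖iteratedFDerivWithin ℝ (j - i) b s x‖
      ≤ ∑ i ∈ Finset.range (j + 1), (j.choose i : ℝ) * (i.factorial * (ε * C) * D ^ i) * Cb := by
        refine Finset.sum_le_sum fun i hi ↦ ?_
        have hi' : i ≤ j := Finset.mem_range_succ_iff.1 hi
        gcongr
        · exact hcomp i hi'
        · exact hCb _ (by omega) x hx
    _ = ε * ∑ i ∈ Finset.range (j + 1), (j.choose i : ℝ) * (i.factorial * C * D ^ i) * Cb := by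
        rw [Finset.mul_sum]
        exact Finset.sum_congr rfl fun i _ ↦ by ring
    _ ≤ ε * L := by
        gcongr
        exact Finset.single_le_sum (f := fun j : ℕ ↦ ∑ i ∈ Finset.range (j + 1),
          (j.choose i : ℝ) * ((i.factorial : ℝ) * C * D ^ i) * Cb)
          (fun _ _ ↦ by positivity) (Finset.mem_range_succ_iff.2 hj.le)
    _ ≤ ε * (L + 1) := by gcongr; linarith
    _ ≤ η := hε2

/-- A scale `ε` is admissible for the `k`-th term of a Borel sum on `s`. -/
def IsBorelScale (s : Set E) (σ : E → ℝ) (b : E → W) (k : ℕ) (ε : ℝ) : Prop :=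
  ∀ M ≤ k, ∀ j < k - M, ∀ x ∈ s, ‖iteratedFDerivWithin ℝ j
    (fun x ↦ (cutoff (σ x / ε) * σ x ^ (k - M)) • b x) s x‖ ≤ (1 / 2) ^ k

lemma exists_isBorelScale (hs : IsCompact s) (hs' : UniqueDiffOn ℝ s) {σ : E → ℝ}
    (hσ : ContDiffOn ℝ ∞ σ s) {b : E → W} (hb : ContDiffOn ℝ ∞ b s) (k : ℕ) :
    ∃ δ > 0, ∀ ε, 0 < ε → ε ≤ δ → IsBorelScale s σ b k ε := by
  choose δ hδ h using fun M : ℕ ↦ exists_cutoff_smul_bound hs hs' hσ hb (k - M)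
    (η := (1 / 2) ^ k) (by positivity)
  refine ⟨(Finset.range (k + 1)).inf' (by simp) δ, ?_, fun ε hε hle M hM ↦ h M ε hε ?_⟩
  · rw [gt_iff_lt, Finset.lt_inf'_iff]
    exact fun M _ ↦ hδ M
  · exact hle.trans (Finset.inf'_le _ (Finset.mem_range_succ_iff.2 hM))

lemma contDiffOn_borel [CompleteSpace W] (hc : Convex ℝ s) (hs : IsCompact s)
    (hs' : UniqueDiffOn ℝ s) {σ : E → ℝ} (hσ : ContDiffOn ℝ ∞ σ s) {b : ℕ → E → W}
    (hb : ∀ k, ContDiffOn ℝ ∞ (b k) s) {ε : ℕ → ℝ} (hε : ∀ k, IsBorelScale s σ (b k) k (ε k))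
    (M : ℕ) :
    ContDiffOn ℝ ∞
      (fun x ↦ ∑' k, (cutoff (σ x / ε (k + M)) * σ x ^ k) • b (k + M) x) s := by
  refine contDiffOn_tsum_of_convex hc hs' (fun k ↦ contDiffOn_cutoff_smul hσ (hb _) _ _)
    fun j ↦ ?_
  choose C hC1 hC using fun k : ℕ ↦ exists_iteratedFDerivWithin_bound hs hs'
    (contDiffOn_cutoff_smul hσ (hb (k + M)) (ε (k + M)) k) j
  refine ⟨fun k ↦ if k ≤ j then C k else (1 / 2) ^ (k + M), ?_, fun k x hx ↦ ?_⟩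
  · rw [← summable_nat_add_iff (j + 1)]
    have : (fun k ↦ if k + (j + 1) ≤ j then C (k + (j + 1)) else
        ((1 : ℝ) / 2) ^ (k + (j + 1) + M)) = fun k ↦ (1 / 2) ^ k * (1 / 2) ^ (j + 1 + M) := by
      funext k
      rw [if_neg (by omega), ← pow_add, add_assoc]
    rw [this]
    exact (summable_geometric_of_lt_one (by norm_num) (by norm_num)).mul_right _
  · beta_reduce
    split_ifs with h
    · exact hC k j le_rfl x hx
    · have := hε (k + M) M (by omega) j (by omega) x hx
      simpa only [Nat.add_sub_cancel] using this

end Borel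

section Hadamard

variable {E W : Type*} [NormedAddCommGroup E] [NormedSpace ℝ E]
  [NormedAddCommGroup W] [NormedSpace ℝ W] {s : Set E}

/-- The linear map which scales the direction `e` by `t`, where `l e = 1`. -/
def scaling (l : E →L[ℝ] ℝ) (e : E) (t : ℝ) : E →L[ℝ] E :=
  ContinuousLinearMap.id ℝ E + (t - 1) • l.smulRight e

lemma scaling_apply (l : E →L[ℝ] ℝ) (e : E) (t : ℝ) (x : E) :
    scaling l e t x = x + ((t - 1) * l x) • e := by
  simp [scaling, smul_smul]

lemma continuous_scaling (l : E →L[ℝ] ℝ) (e : E) : Continuous (scaling l e) := by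
  unfold scaling
  fun_prop

lemma scaling_mem (hc : Convex ℝ s) {l : E →L[ℝ] ℝ} {e : E}
    (h0 : ∀ x ∈ s, scaling l e 0 x ∈ s) {t : ℝ} (ht : t ∈ Icc (0 : ℝ) 1) {x : E} (hx : x ∈ s) :
    scaling l e t x ∈ s := by
  have := hc (h0 x hx) hx (sub_nonneg.2 ht.2) ht.1 (by ring)
  convert this using 1
  simp only [scaling_apply]
  module

lemma contDiffOn_integral_scaling [CompleteSpace W] (hc : Convex ℝ s) (hs : IsCompact s)
    (hs' : UniqueDiffOn ℝ s) {l : E →L[ℝ] ℝ} {e : E} (h0 : ∀ x ∈ s, scaling l e 0 x ∈ s)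
    {f : E → W} (hf : ContDiffOn ℝ ∞ f s) :
    ContDiffOn ℝ ∞ (fun x ↦ ∫ t : Icc (0 : ℝ) 1, f (scaling l e t x)) s := by
  have hmaps : ∀ t : Icc (0 : ℝ) 1, MapsTo (scaling l e t) s s := fun t x hx ↦
    scaling_mem hc h0 t.2 hx
  refine contDiffOn_integral_of_convex hc (f := fun (t : Icc (0 : ℝ) 1) x ↦ f (scaling l e t x))
    (p := fun t x j ↦ (ftaylorSeriesWithin ℝ f s (scaling l e t x) j).compContinuousLinearMap
      fun _ ↦ scaling l e t)
    (fun t ↦ ((hf.ftaylorSeriesWithin hs').compContinuousLinearMap (scaling l e t)).mono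
      (hmaps t)) (fun j ↦ ?_) (fun j x hx ↦ ?_)
  · obtain ⟨C, hC1, hC⟩ := exists_iteratedFDerivWithin_bound hs hs' hf j
    obtain ⟨D, hD⟩ := (isCompact_Icc (a := (0 : ℝ)) (b := 1)).exists_bound_of_continuousOn
      (continuous_scaling l e).continuousOn
    refine ⟨fun _ ↦ C * |D| ^ j, integrable_const _, fun t x hx ↦ ?_⟩
    refine (ContinuousMultilinearMap.norm_compContinuousLinearMap_le _ _).trans ?_
    have h1 : ∏ _i : Fin j, ‖scaling l e t‖ ≤ |D| ^ j := by
      rw [Finset.prod_const, Finset.card_univ, Fintype.card_fin]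
      exact pow_le_pow_left₀ (norm_nonneg _) ((hD t t.2).trans (le_abs_self _)) j
    exact mul_le_mul (hC j le_rfl _ (hmaps t hx)) h1 (by positivity) (by linarith)
  · have h1 : Continuous fun t : Icc (0 : ℝ) 1 ↦ scaling l e t :=
      (continuous_scaling l e).comp continuous_subtype_val
    have h2 : Continuous fun t : Icc (0 : ℝ) 1 ↦ ftaylorSeriesWithin ℝ f s (scaling l e t x) j :=
      (hf.continuousOn_iteratedFDerivWithin (m := j) (by exact_mod_cast le_top)
        hs').comp_continuous (h1.clm_apply continuous_const) fun t ↦ hmaps t hx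
    have h3 : Continuous fun t : Icc (0 : ℝ) 1 ↦
        (ContinuousMultilinearMap.compContinuousLinearMapContinuousMultilinear ℝ
          (fun _ : Fin j ↦ E) (fun _ ↦ E) W) (fun _ ↦ scaling l e t) :=
      (ContinuousMultilinearMap.cont _).comp (continuous_pi fun _ ↦ h1)
    exact (h3.clm_apply h2).aestronglyMeasurable

/-- The Hadamard lemma. -/
lemma eq_smul_integral_scaling [CompleteSpace W] (hc : Convex ℝ s)
    (hs' : UniqueDiffOn ℝ s) {l : E →L[ℝ] ℝ} {e : E} (h0 : ∀ x ∈ s, scaling l e 0 x ∈ s)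
    {f : E → W} (hf : ContDiffOn ℝ ∞ f s) (hz : ∀ x ∈ s, f (scaling l e 0 x) = 0)
    {x : E} (hx : x ∈ s) :
    f x = l x • ∫ t : Icc (0 : ℝ) 1, fderivWithin ℝ f s (scaling l e t x) e := by
  have hmaps : ∀ t ∈ Icc (0 : ℝ) 1, scaling l e t x ∈ s := fun t ht ↦ scaling_mem hc h0 ht hx
  have hcont : Continuous fun t ↦ scaling l e t x :=
    (continuous_scaling l e).clm_apply continuous_const
  have hline : ∀ t, HasDerivAt (fun t ↦ scaling l e t x) (l x • e) t := fun t ↦ by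
    simp only [scaling_apply]
    have h1 : HasDerivAt (fun t : ℝ ↦ (t - 1) * l x) (l x) t := by
      simpa using ((hasDerivAt_id t).sub_const 1).mul_const (l x)
    exact (h1.smul_const e).const_add x
  have hder : ∀ t ∈ Icc (0 : ℝ) 1, HasDerivWithinAt (fun t ↦ f (scaling l e t x))
      (l x • fderivWithin ℝ f s (scaling l e t x) e) (Icc 0 1) t := by
    intro t ht
    have h1 : HasFDerivWithinAt f (fderivWithin ℝ f s (scaling l e t x)) s (scaling l e t x) :=
      ((hf.differentiableOn (by simp)) _ (hmaps t ht)).hasFDerivWithinAt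
    have := h1.comp_hasDerivWithinAt t (hline t).hasDerivWithinAt hmaps
    rw [map_smul] at this
    exact this
  have hcf : ContinuousOn (fun t ↦ fderivWithin ℝ f s (scaling l e t x) e) (Icc 0 1) :=
    (((hf.continuousOn_fderivWithin hs' (by simp)).comp hcont.continuousOn hmaps)).clm_apply
      continuousOn_const
  have key := intervalIntegral.integral_eq_sub_of_hasDerivAt_of_le (zero_le_one' ℝ)
    (fun t ht ↦ (hder t ht).continuousWithinAt)
    (fun t ht ↦ (hder t (Ioo_subset_Icc_self ht)).hasDerivAt (Icc_mem_nhds ht.1 ht.2))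
    ((continuousOn_const.smul hcf).intervalIntegrable_of_Icc zero_le_one)
  rw [hz x hx, sub_zero, intervalIntegral.integral_smul,
    intervalIntegral.integral_of_le zero_le_one, ← integral_Icc_eq_integral_Ioc,
    ← integral_subtype measurableSet_Icc] at key
  rw [key]
  simp [scaling_apply]

/-- Smooth functions that vanish where a defining function vanishes are divisible by it. -/
lemma exists_eq_smul_of_vanishing [CompleteSpace W] (hc : Convex ℝ s) (hs : IsCompact s)
    (hs' : UniqueDiffOn ℝ s) {l : E →L[ℝ] ℝ} {e : E} (he : l e = 1)
    (h0 : ∀ x ∈ s, scaling l e 0 x ∈ s)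
    {σ : E → ℝ} (hσ : ContDiffOn ℝ ∞ σ s) (hσl : ∀ x ∈ s, σ x = 0 ↔ l x = 0)
    (hdσ : ∀ x ∈ s, l x = 0 → fderivWithin ℝ σ s x e ≠ 0)
    {f : E → W} (hf : ContDiffOn ℝ ∞ f s) (hz : ∀ x ∈ s, σ x = 0 → f x = 0) :
    ∃ g : E → W, ContDiffOn ℝ ∞ g s ∧ ∀ x ∈ s, f x = σ x • g x := by
  have hl0 : ∀ x, l (scaling l e 0 x) = 0 := fun x ↦ by simp [scaling_apply, he]
  have hd : ∀ {W : Type _} [NormedAddCommGroup W] [NormedSpace ℝ W] {f : E → W},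
      ContDiffOn ℝ ∞ f s → ContDiffOn ℝ ∞ (fun x ↦ fderivWithin ℝ f s x e) s :=
    fun hf ↦ (hf.fderivWithin hs' (by simp)).clm_apply contDiffOn_const
  have hdσ' : ContDiffOn ℝ ∞ (fun x ↦ fderivWithin ℝ σ s x e) s :=
    (hσ.fderivWithin hs' (by simp)).clm_apply contDiffOn_const
  set u : E → ℝ := fun x ↦ ∫ t : Icc (0 : ℝ) 1, fderivWithin ℝ σ s (scaling l e t x) e
  set v : E → W := fun x ↦ ∫ t : Icc (0 : ℝ) 1, fderivWithin ℝ f s (scaling l e t x) e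
  have hu : ContDiffOn ℝ ∞ u s := contDiffOn_integral_scaling hc hs hs' h0 hdσ'
  have hv : ContDiffOn ℝ ∞ v s := contDiffOn_integral_scaling hc hs hs' h0 (hd hf)
  have hσu : ∀ x ∈ s, σ x = l x * u x := fun x hx ↦ eq_smul_integral_scaling hc hs' h0 hσ
    (fun x hx ↦ (hσl _ (h0 x hx)).2 (hl0 x)) hx
  have hfv : ∀ x ∈ s, f x = l x • v x := fun x hx ↦ eq_smul_integral_scaling hc hs' h0 hf
    (fun x hx ↦ hz _ (h0 x hx) ((hσl _ (h0 x hx)).2 (hl0 x))) hx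
  have hu0 : ∀ x ∈ s, u x ≠ 0 := by
    intro x hx hux
    by_cases hlx : l x = 0
    · refine hdσ x hx hlx ?_
      have : u x = fderivWithin ℝ σ s x e := by simp [u, scaling_apply, hlx]
      rw [← this, hux]
    · exact hlx ((hσl x hx).1 (by rw [hσu x hx, hux, mul_zero]))
  refine ⟨fun x ↦ (u x)⁻¹ • v x, (hu.inv hu0).smul hv, fun x hx ↦ ?_⟩
  rw [hfv x hx, hσu x hx, smul_smul, mul_assoc, mul_inv_cancel₀ (hu0 x hx), mul_one]

end Hadamard

end ElectricYM

/-! ### The Levi-Civita connection of a metric -/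

namespace ElectricYM

open Filter Set
open scoped Topology

variable {E : Type*} [NormedAddCommGroup E] [NormedSpace ℝ E]
  {H : Type*} [TopologicalSpace H] {I : ModelWithCorners ℝ E H}
  {M : Type*} [TopologicalSpace M] [ChartedSpace H M] [IsManifold I ∞ M]

section GramMatrix

variable {κ : Type*} [Fintype κ] [DecidableEq κ]

/-- The Gram matrix of a family of tangent vectors. -/
def gram (g : Metric I M) (x : M) (b : κ → TangentSpace I x) : Matrix κ κ ℝ :=
  Matrix.of fun i j ↦ g.inner x (b i) (b j)

lemma gram_apply (g : Metric I M) (x : M) (b : κ → TangentSpace I x) (i j : κ) :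
    gram g x b i j = g.inner x (b i) (b j) := rfl

lemma inner_eq_zero_of_forall (g : Metric I M) (x : M) {v : TangentSpace I x}
    (h : ∀ w, g.inner x v w = 0) : v = 0 := by
  by_contra hv
  exact (g.pos x v hv).ne' (h v)

lemma isUnit_gram_det (g : Metric I M) (x : M) {b : κ → TangentSpace I x}
    (hb : LinearIndependent ℝ b) : IsUnit (gram g x b).det := by
  rw [isUnit_iff_ne_zero]
  intro h0
  obtain ⟨v, hv, hv'⟩ := Matrix.exists_mulVec_eq_zero_iff.2 h0
  have hw : g.inner x (∑ i, v i • b i) (∑ i, v i • b i) = 0 := by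
    have : ∀ i, ∑ j, v j * g.inner x (b i) (b j) = 0 := fun i ↦ by
      have := congrFun hv' i
      simp only [Matrix.mulVec, dotProduct, gram_apply, Pi.zero_apply] at this
      rw [← this]
      exact Finset.sum_congr rfl fun j _ ↦ mul_comm _ _
    simp only [map_sum, map_smul, _root_.sum_apply, _root_.smul_apply,
      smul_eq_mul]
    refine Finset.sum_eq_zero fun i _ ↦ ?_
    have h2 := this i
    simp only [g.symm x (b i)] at h2
    rw [h2, mul_zero]
  have hw0 : ∑ i, v i • b i = 0 := by
    by_contra hne
    exact (g.pos x _ hne).ne' hw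
  exact hv (funext fun i ↦ Fintype.linearIndependent_iff.1 hb v hw0 i)

lemma gram_mul_inv (g : Metric I M) (x : M) {b : κ → TangentSpace I x}
    (hb : LinearIndependent ℝ b) (i k : κ) :
    ∑ j, g.inner x (b i) (b j) * (gram g x b)⁻¹ j k = if i = k then 1 else 0 := by
  have := congrFun (congrFun (Matrix.mul_nonsing_inv _ (isUnit_gram_det g x hb)) i) k
  rwa [Matrix.mul_apply, Matrix.one_apply] at this

lemma inv_mul_gram (g : Metric I M) (x : M) {b : κ → TangentSpace I x}
    (hb : LinearIndependent ℝ b) (i k : κ) :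
    ∑ j, (gram g x b)⁻¹ i j * g.inner x (b j) (b k) = if i = k then 1 else 0 := by
  have := congrFun (congrFun (Matrix.nonsing_inv_mul _ (isUnit_gram_det g x hb)) i) k
  rwa [Matrix.mul_apply, Matrix.one_apply] at this

lemma inv_gram_symm (g : Metric I M) (x : M) (b : κ → TangentSpace I x) (i j : κ) :
    (gram g x b)⁻¹ i j = (gram g x b)⁻¹ j i := by
  have h1 : (gram g x b).transpose = gram g x b := by
    ext i j
    exact g.symm x _ _
  have h2 := Matrix.transpose_nonsing_inv (gram g x b)
  rw [h1] at h2
  exact congrFun (congrFun h2 j) i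

/-- The components of a vector are determined by its inner products. -/
lemma sum_inv_gram_smul (g : Metric I M) (x : M) {b : κ → TangentSpace I x}
    (hb : LinearIndependent ℝ b) (hb' : Submodule.span ℝ (range b) = ⊤) (v : TangentSpace I x) :
    ∑ i, ∑ j, ((gram g x b)⁻¹ i j * g.inner x v (b i)) • b j = v := by
  rw [← sub_eq_zero]
  refine inner_eq_zero_of_forall g x fun w ↦ ?_
  have hw : w ∈ Submodule.span ℝ (range b) := hb' ▸ Submodule.mem_top
  induction hw using Submodule.span_induction with
  | zero => simp
  | add y z _ _ hy hz => rw [map_add, hy, hz, add_zero]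
  | smul c y _ hy => rw [map_smul, hy, smul_zero]
  | mem y hy =>
    obtain ⟨d, rfl⟩ := hy
    simp only [map_sub, map_sum, map_smul, _root_.sub_apply,
      _root_.sum_apply, _root_.smul_apply, smul_eq_mul]
    have : ∀ i, ∑ j, (gram g x b)⁻¹ i j * g.inner x v (b i) * g.inner x (b j) (b d)
        = if i = d then g.inner x v (b i) else 0 := fun i ↦ by
      have h1 := congrArg (· * g.inner x v (b i)) (inv_mul_gram g x hb i d)
      simp only [Finset.sum_mul, ite_mul, one_mul, zero_mul] at h1
      rw [← h1]
      exact Finset.sum_congr rfl fun j _ ↦ by ring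
    simp [this]

variable [FiniteDimensional ℝ E]

variable (I) in
/-- The basis of the tangent spaces that is used in the definition of contractions. -/
def tangentBasis (x : M) (i : Fin (Module.finrank ℝ E)) : TangentSpace I x :=
  (Module.finBasis ℝ E i : E)

lemma linearIndependent_tangentBasis (x : M) : LinearIndependent ℝ (tangentBasis I x) :=
  (Module.finBasis ℝ E).linearIndependent

lemma span_tangentBasis (x : M) : Submodule.span ℝ (range (tangentBasis I x)) = ⊤ :=
  (Module.finBasis ℝ E).span_eq

/-- The contraction with the inverse metric does not depend on the basis. -/
lemma metricTrace_eq_sum (g : Metric I M) (x : M) {b : κ → TangentSpace I x}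
    (hb : LinearIndependent ℝ b) (hb' : Submodule.span ℝ (range b) = ⊤)
    {W : Type*} [AddCommGroup W] [Module ℝ W]
    (T : TangentSpace I x →ₗ[ℝ] TangentSpace I x →ₗ[ℝ] W) :
    metricTrace g x (fun u v ↦ T u v) = ∑ i, ∑ j, (gram g x b)⁻¹ i j • T (b i) (b j) := by
  set f := tangentBasis I x
  have h1 : ∀ v, ∑ i, ∑ j, ((gram g x f)⁻¹ i j * g.inner x v (f i)) • f j = v :=
    sum_inv_gram_smul g x (linearIndependent_tangentBasis x) (span_tangentBasis x)
  have h2 : ∀ v, ∑ i, ∑ j, ((gram g x b)⁻¹ i j * g.inner x v (b i)) • b j = v :=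
    sum_inv_gram_smul g x hb hb'
  have h3 : metricTrace g x (fun u v ↦ T u v) = ∑ a, ∑ c, (gram g x f)⁻¹ a c • T (f a) (f c) := rfl
  rw [h3]
  calc ∑ a, ∑ c, (gram g x f)⁻¹ a c • T (f a) (f c)
      = ∑ a, ∑ c, (gram g x f)⁻¹ a c • ∑ i, ∑ j,
          ((gram g x b)⁻¹ i j * g.inner x (f a) (b i)) • T (b j) (f c) := by
        refine Finset.sum_congr rfl fun a _ ↦ Finset.sum_congr rfl fun c _ ↦ ?_
        conv_lhs => rw [← h2 (f a)]
        simp only [map_sum, map_smul, LinearMap.sum_apply, LinearMap.smul_apply]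
    _ = ∑ i, ∑ j, (gram g x b)⁻¹ i j • ∑ a, ∑ c,
          ((gram g x f)⁻¹ a c * g.inner x (b i) (f a)) • T (b j) (f c) := by
        simp only [Finset.smul_sum, smul_smul]
        rw [Calculus.sum_sum_comm]
        refine Finset.sum_congr rfl fun i _ ↦ Finset.sum_congr rfl fun j _ ↦
          Finset.sum_congr rfl fun a _ ↦ Finset.sum_congr rfl fun c _ ↦ ?_
        rw [g.symm x (b i) (f a)]
        congr 1
        ring
    _ = ∑ i, ∑ j, (gram g x b)⁻¹ i j • T (b j) (b i) := by
        refine Finset.sum_congr rfl fun i _ ↦ Finset.sum_congr rfl fun j _ ↦ ?_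
        conv_rhs => rw [← h1 (b i)]
        simp only [map_sum, map_smul]
    _ = _ := by
        rw [Finset.sum_comm]
        refine Finset.sum_congr rfl fun i _ ↦ Finset.sum_congr rfl fun j _ ↦ ?_
        rw [inv_gram_symm]

/-- Raising an index is inverse to lowering it. -/
lemma inner_sharp (g : Metric I M) (x : M) (α : TangentSpace I x →ₗ[ℝ] ℝ) (w : TangentSpace I x) :
    g.inner x (sharp g x α) w = α w := by
  set f := tangentBasis I x
  have h1 := sum_inv_gram_smul g x (linearIndependent_tangentBasis x) (span_tangentBasis x) w
  have h3 : sharp g x α = ∑ a, ∑ c, (gram g x f)⁻¹ a c • α (f a) • f c := rfl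
  rw [h3]
  conv_rhs => rw [← h1]
  simp only [map_sum, map_smul, _root_.sum_apply, _root_.smul_apply,
    smul_eq_mul]
  rw [Finset.sum_comm]
  refine Finset.sum_congr rfl fun i _ ↦ Finset.sum_congr rfl fun j _ ↦ ?_
  rw [inv_gram_symm, g.symm x w]
  ring

lemma eq_of_inner_eq (g : Metric I M) (x : M) {v v' : TangentSpace I x}
    (h : ∀ w, g.inner x v w = g.inner x v' w) : v = v' :=
  sub_eq_zero.1 (inner_eq_zero_of_forall g x fun w ↦ by simp [h])

end GramMatrix

section Koszul

variable {g : Metric I M} {x : M} {X X' Y Y' Z Z' : ∀ x : M, TangentSpace I x}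

lemma mdifferentiableAt_inner (g : Metric I M)
    (hY : MDiffAt (T% Y) x) (hZ : MDiffAt (T% Z) x) :
    MDiffAt (fun y ↦ g.inner y (Y y) (Z y)) x := by
  have : MDifferentiableAt I (I.prod 𝓘(ℝ)) (fun y ↦ TotalSpace.mk' ℝ (E := Bundle.Trivial M ℝ) y
      (g.inner y (Y y) (Z y))) x := by
    apply MDifferentiableAt.clm_bundle_apply₂ (F₁ := E) (F₂ := E)
    · exact (g.contMDiff x).mdifferentiableAt (by simp)
    · exact hY
    · exact hZ
  simp only [mdifferentiableAt_section] at this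
  exact this

lemma contMDiffAt_inner {k : ℕ∞} (g : Metric I M)
    (hY : CMDiffAt k (T% Y) x) (hZ : CMDiffAt k (T% Z) x) :
    CMDiffAt k (fun y ↦ g.inner y (Y y) (Z y)) x := by
  have : ContMDiffAt I (I.prod 𝓘(ℝ)) k (fun y ↦ TotalSpace.mk' ℝ (E := Bundle.Trivial M ℝ) y
      (g.inner y (Y y) (Z y))) x := by
    apply ContMDiffAt.clm_bundle_apply₂ (F₁ := E) (F₂ := E)
    · exact (g.contMDiff x).of_le (by exact_mod_cast le_top)
    · exact hY
    · exact hZ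
  simp only [contMDiffAt_section] at this
  exact this

lemma mvfderiv_inner_add_left (hY : MDiffAt (T% Y) x) (hY' : MDiffAt (T% Y') x)
    (hZ : MDiffAt (T% Z) x) (v : TangentSpace I x) :
    mvfderiv I (fun y ↦ g.inner y ((Y + Y') y) (Z y)) x v =
      mvfderiv I (fun y ↦ g.inner y (Y y) (Z y)) x v
        + mvfderiv I (fun y ↦ g.inner y (Y' y) (Z y)) x v := by
  have h : (fun y ↦ g.inner y ((Y + Y') y) (Z y))
      = (fun y ↦ g.inner y (Y y) (Z y)) + fun y ↦ g.inner y (Y' y) (Z y) := by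
    funext y
    simp
  rw [h, mvfderiv_add (mdifferentiableAt_inner g hY hZ) (mdifferentiableAt_inner g hY' hZ)]
  rfl

lemma mvfderiv_inner_smul_left {f : M → ℝ} (hf : MDiffAt f x) (hY : MDiffAt (T% Y) x)
    (hZ : MDiffAt (T% Z) x) (v : TangentSpace I x) :
    mvfderiv I (fun y ↦ g.inner y ((f • Y) y) (Z y)) x v =
      f x * mvfderiv I (fun y ↦ g.inner y (Y y) (Z y)) x v
        + mvfderiv I f x v * g.inner x (Y x) (Z x) := by
  have h : (fun y ↦ g.inner y ((f • Y) y) (Z y)) = f • fun y ↦ g.inner y (Y y) (Z y) := by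
    funext y
    simp
  rw [h, mvfderiv_smul hf (mdifferentiableAt_inner g hY hZ)]
  simp

lemma mvfderiv_inner_comm (v : TangentSpace I x) :
    mvfderiv I (fun y ↦ g.inner y (Y y) (Z y)) x v =
      mvfderiv I (fun y ↦ g.inner y (Z y) (Y y)) x v := by
  have : (fun y ↦ g.inner y (Y y) (Z y)) = fun y ↦ g.inner y (Z y) (Y y) :=
    funext fun y ↦ g.symm y _ _
  rw [this]

lemma mvfderiv_inner_add_right (hY : MDiffAt (T% Y) x) (hY' : MDiffAt (T% Y') x)
    (hZ : MDiffAt (T% Z) x) (v : TangentSpace I x) :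
    mvfderiv I (fun y ↦ g.inner y (Z y) ((Y + Y') y)) x v =
      mvfderiv I (fun y ↦ g.inner y (Z y) (Y y)) x v
        + mvfderiv I (fun y ↦ g.inner y (Z y) (Y' y)) x v := by
  rw [mvfderiv_inner_comm, mvfderiv_inner_add_left hY hY' hZ, mvfderiv_inner_comm (Y := Z),
    mvfderiv_inner_comm (Y := Z)]

lemma mvfderiv_inner_smul_right {f : M → ℝ} (hf : MDiffAt f x) (hY : MDiffAt (T% Y) x)
    (hZ : MDiffAt (T% Z) x) (v : TangentSpace I x) :
    mvfderiv I (fun y ↦ g.inner y (Z y) ((f • Y) y)) x v =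
      f x * mvfderiv I (fun y ↦ g.inner y (Z y) (Y y)) x v
        + mvfderiv I f x v * g.inner x (Z x) (Y x) := by
  rw [mvfderiv_inner_comm, mvfderiv_inner_smul_left hf hY hZ, mvfderiv_inner_comm (Y := Z),
    g.symm x (Z x)]

variable [CompleteSpace E]

lemma koszul_tensorialAt_left (g : Metric I M) (hY : MDiffAt (T% Y) x) (hZ : MDiffAt (T% Z) x) :
    TensorialAt I E (fun X ↦ koszul g X Y Z x) x where
  smul {f X} hf hX := by
    simp only [koszul, mvfderiv_inner_smul_left hf hX hZ, mvfderiv_inner_smul_left hf hX hY]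
    simp only [VectorField.mlieBracket_smul_left hf hX, Pi.smul_apply', map_smul, map_add, smul_eq_mul,
      _root_.add_apply, _root_.smul_apply, neg_smul, map_neg,
      _root_.neg_apply]
    ring
  add {X X'} hX hX' := by
    simp only [koszul, mvfderiv_inner_add_left hX hX' hZ, mvfderiv_inner_add_left hX hX' hY]
    simp only [VectorField.mlieBracket_add_left hX hX', Pi.add_apply, map_add,
      _root_.add_apply]
    ring

lemma koszul_tensorialAt_right (g : Metric I M) (hX : MDiffAt (T% X) x)
    (hY : MDiffAt (T% Y) x) :
    TensorialAt I E (fun Z ↦ koszul g X Y Z x) x where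
  smul {f Z} hf hZ := by
    simp only [koszul, mvfderiv_inner_smul_right hf hZ hX, mvfderiv_inner_smul_right hf hZ hY]
    simp only [VectorField.mlieBracket_smul_right hf hZ, Pi.smul_apply', map_smul, map_add, smul_eq_mul,
      _root_.add_apply, _root_.smul_apply]
    rw [g.symm x (Z x) (Y x), g.symm x (Z x) (X x)]
    ring
  add {Z Z'} hZ hZ' := by
    simp only [koszul, mvfderiv_inner_add_right hZ hZ' hX, mvfderiv_inner_add_right hZ hZ' hY]
    simp only [VectorField.mlieBracket_add_right hZ hZ', Pi.add_apply, map_add,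
      _root_.add_apply]
    ring

lemma koszul_smul_middle {f : M → ℝ} (hf : MDiffAt f x) (hX : MDiffAt (T% X) x)
    (hY : MDiffAt (T% Y) x) (hZ : MDiffAt (T% Z) x) :
    koszul g X (f • Y) Z x
      = f x * koszul g X Y Z x + 2 * mvfderiv I f x (X x) * g.inner x (Y x) (Z x) := by
  simp only [koszul, mvfderiv_inner_smul_left hf hY hZ, mvfderiv_inner_smul_right hf hY hX]
  simp only [VectorField.mlieBracket_smul_right hf hY, VectorField.mlieBracket_smul_left hf hY,
    Pi.smul_apply', map_smul, map_add, smul_eq_mul, neg_smul, map_neg,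
    _root_.add_apply, _root_.smul_apply, _root_.neg_apply]
  rw [g.symm x (Y x) (X x)]
  ring

lemma koszul_add_middle (hX : MDiffAt (T% X) x)
    (hY : MDiffAt (T% Y) x) (hY' : MDiffAt (T% Y') x) (hZ : MDiffAt (T% Z) x) :
    koszul g X (Y + Y') Z x = koszul g X Y Z x + koszul g X Y' Z x := by
  simp only [koszul, mvfderiv_inner_add_left hY hY' hZ, mvfderiv_inner_add_right hY hY' hX]
  simp only [VectorField.mlieBracket_add_right hY hY', VectorField.mlieBracket_add_left hY hY',
    Pi.add_apply, map_add, _root_.add_apply]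
  ring

end Koszul

section LeviCivita

variable [FiniteDimensional ℝ E] {g : Metric I M} {x : M}
  {X X' Y Y' Z Z' : ∀ x : M, TangentSpace I x}

instance : CompleteSpace E := FiniteDimensional.complete ℝ E

lemma inner_leviCivita (hX : MDiffAt (T% X) x) (hY : MDiffAt (T% Y) x) (hZ : MDiffAt (T% Z) x) :
    g.inner x (leviCivita g Y x (X x)) (Z x) = 1 / 2 * koszul g X Y Z x := by
  have hu : MDiffAt (T% (FiberBundle.extend E (X x) : ∀ y : M, TangentSpace I y)) x :=
    FiberBundle.mdifferentiableAt_extend ..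
  have hr := koszul_tensorialAt_right g hu hY
  let L : TangentSpace I x →ₗ[ℝ] ℝ := (1 / 2 : ℝ) • (TensorialAt.mkHom _ x hr).toLinearMap
  have h1 : leviCivita g Y x (X x) = sharp g x L := rfl
  rw [h1, inner_sharp]
  change (1 / 2 : ℝ) * TensorialAt.mkHom _ x hr (Z x) = _
  congr 1
  refine (TensorialAt.mkHom_apply hr hZ).trans ?_
  exact (koszul_tensorialAt_left g hY hZ).pointwise hu hX (by simp)

lemma leviCivita_eq_of_forall (hX : MDiffAt (T% X) x) (hY : MDiffAt (T% Y) x)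
    {v : TangentSpace I x}
    (h : ∀ Z : ∀ x : M, TangentSpace I x, MDiffAt (T% Z) x →
      g.inner x v (Z x) = 1 / 2 * koszul g X Y Z x) :
    leviCivita g Y x (X x) = v := by
  refine eq_of_inner_eq g x fun w ↦ ?_
  have hw : MDiffAt (T% (FiberBundle.extend E w : ∀ y : M, TangentSpace I y)) x :=
    FiberBundle.mdifferentiableAt_extend ..
  have h1 := inner_leviCivita (g := g) hX hY hw
  rw [← h _ hw] at h1
  simpa using h1

lemma leviCivita_add_left (hY : MDiffAt (T% Y) x) (u v : TangentSpace I x) :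
    leviCivita g Y x (u + v) = leviCivita g Y x u + leviCivita g Y x v := by
  have hu : MDiffAt (T% (FiberBundle.extend E u : ∀ y : M, TangentSpace I y)) x :=
    FiberBundle.mdifferentiableAt_extend ..
  have hv : MDiffAt (T% (FiberBundle.extend E v : ∀ y : M, TangentSpace I y)) x :=
    FiberBundle.mdifferentiableAt_extend ..
  have h := leviCivita_eq_of_forall (g := g) (v := leviCivita g Y x u + leviCivita g Y x v)
    (mdifferentiableAt_add_section hu hv) hY fun Z hZ ↦ by
      have h1 := inner_leviCivita (g := g) hu hY hZ
      have h2 := inner_leviCivita (g := g) hv hY hZ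
      rw [FiberBundle.extend_apply_self] at h1 h2
      rw [map_add, _root_.add_apply, h1, h2,
        (koszul_tensorialAt_left g hY hZ).add hu hv]
      ring
  simpa using h

lemma leviCivita_smul_left (hY : MDiffAt (T% Y) x) (c : ℝ) (u : TangentSpace I x) :
    leviCivita g Y x (c • u) = c • leviCivita g Y x u := by
  have hu : MDiffAt (T% (FiberBundle.extend E u : ∀ y : M, TangentSpace I y)) x :=
    FiberBundle.mdifferentiableAt_extend ..
  have hc : MDiffAt (fun _ : M ↦ c) x := mdifferentiableAt_const
  have h := leviCivita_eq_of_forall (g := g) (v := c • leviCivita g Y x u)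
    (hc.smul_section hu) hY fun Z hZ ↦ by
      have h1 := inner_leviCivita (g := g) hu hY hZ
      rw [FiberBundle.extend_apply_self] at h1
      rw [map_smul, _root_.smul_apply, h1,
        (koszul_tensorialAt_left g hY hZ).smul hc hu, smul_eq_mul, smul_eq_mul]
      ring
  simpa using h

lemma leviCivita_add (hY : MDiffAt (T% Y) x) (hY' : MDiffAt (T% Y') x) (u : TangentSpace I x) :
    leviCivita g (Y + Y') x u = leviCivita g Y x u + leviCivita g Y' x u := by
  have hu : MDiffAt (T% (FiberBundle.extend E u : ∀ y : M, TangentSpace I y)) x :=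
    FiberBundle.mdifferentiableAt_extend ..
  have h := leviCivita_eq_of_forall (g := g) (v := leviCivita g Y x u + leviCivita g Y' x u)
    hu (mdifferentiableAt_add_section hY hY') fun Z hZ ↦ by
      have h1 := inner_leviCivita (g := g) hu hY hZ
      have h2 := inner_leviCivita (g := g) hu hY' hZ
      rw [FiberBundle.extend_apply_self] at h1 h2
      rw [map_add, _root_.add_apply, h1, h2, koszul_add_middle hu hY hY' hZ]
      ring
  simpa using h

lemma leviCivita_smul {f : M → ℝ} (hf : MDiffAt f x) (hY : MDiffAt (T% Y) x)
    (u : TangentSpace I x) :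
    leviCivita g (f • Y) x u = f x • leviCivita g Y x u + mvfderiv I f x u • Y x := by
  have hu : MDiffAt (T% (FiberBundle.extend E u : ∀ y : M, TangentSpace I y)) x :=
    FiberBundle.mdifferentiableAt_extend ..
  have h := leviCivita_eq_of_forall (g := g)
    (v := f x • leviCivita g Y x u + mvfderiv I f x u • Y x)
    hu (hf.smul_section hY) fun Z hZ ↦ by
      have h1 := inner_leviCivita (g := g) hu hY hZ
      rw [FiberBundle.extend_apply_self] at h1
      rw [map_add, _root_.add_apply, map_smul, _root_.smul_apply, h1,
        map_smul, _root_.smul_apply, koszul_smul_middle hf hu hY hZ,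
        FiberBundle.extend_apply_self, smul_eq_mul, smul_eq_mul]
      ring
  simpa using h

end LeviCivita

end ElectricYM

/-! ### Connections in a trivialization -/

namespace ElectricYM

open Filter Set
open scoped Topology

variable {E : Type*} [NormedAddCommGroup E] [NormedSpace ℝ E] [FiniteDimensional ℝ E]
  {H : Type*} [TopologicalSpace H] {I : ModelWithCorners ℝ E H}
  {M : Type*} [TopologicalSpace M] [ChartedSpace H M] [IsManifold I ∞ M]
  {F : Type*} [NormedAddCommGroup F] [NormedSpace ℝ F] [FiniteDimensional ℝ F]

section Operators

variable {G : Type*} [NormedAddCommGroup G] [NormedSpace ℝ G] {x : M}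

/-- Smoothness of operator valued functions can be tested on vectors. -/
lemma contMDiffWithinAt_clm_of_apply {k : ℕ∞} {s : Set M} {φ : M → F →L[ℝ] G}
    (h : ∀ v, CMDiffAt[s] k (fun y ↦ φ y v) x) : CMDiffAt[s] k φ x := by
  let b := Module.finBasis ℝ F
  have h1 : φ = fun y ↦ ∑ i, (ContinuousLinearMap.smulRightL ℝ F G
      (LinearMap.toContinuousLinearMap (b.coord i))) (φ y (b i)) := by
    funext y
    ext v
    conv_lhs => rw [← b.sum_repr v, map_sum]
    simp [map_smul]
  rw [h1]
  refine ContMDiffWithinAt.sum fun i _ ↦ ?_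
  exact (ContinuousLinearMap.contMDiff _).contMDiffAt.comp_contMDiffWithinAt x (h (b i))

lemma contMDiffAt_clm_of_apply {k : ℕ∞} {φ : M → F →L[ℝ] G}
    (h : ∀ v, CMDiffAt k (fun y ↦ φ y v) x) : CMDiffAt k φ x := by
  simp only [← contMDiffWithinAt_univ] at h ⊢
  exact contMDiffWithinAt_clm_of_apply h

lemma mvfderiv_clm_apply {φ : M → F →L[ℝ] G} {f : M → F} (hφ : MDiffAt φ x) (hf : MDiffAt f x)
    (u : TangentSpace I x) :
    mvfderiv I (fun y ↦ φ y (f y)) x u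
      = mvfderiv I φ x u (f x) + φ x (mvfderiv I f x u) := by
  let φ' : E →L[ℝ] F →L[ℝ] G := mvfderiv I φ x
  let f' : E →L[ℝ] F := mvfderiv I f x
  have h1 : HasFDerivWithinAt (fun z ↦ φ ((extChartAt I x).symm z)) φ' (range I)
      (extChartAt I x x) := hφ.hasMFDerivAt.2
  have h2 : HasFDerivWithinAt (fun z ↦ f ((extChartAt I x).symm z)) f' (range I)
      (extChartAt I x x) := hf.hasMFDerivAt.2
  let D : E →L[ℝ] G := (φ x).comp f' + φ'.flip (f x)
  have h3 : HasMFDerivAt I 𝓘(ℝ, G) (fun y ↦ φ y (f y)) x D := by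
    refine ⟨hφ.continuousAt.clm_apply hf.continuousAt, ?_⟩
    have := h1.clm_apply h2
    rw [extChartAt_to_inv] at this
    exact this
  have h4 : mvfderiv I (fun y ↦ φ y (f y)) x u = D u := DFunLike.congr_fun h3.mfderiv u
  exact h4.trans (add_comm _ _)

lemma mdifferentiableAt_clm_apply {φ : M → F →L[ℝ] G} {f : M → F} (hφ : MDiffAt φ x)
    (hf : MDiffAt f x) : MDiffAt (fun y ↦ φ y (f y)) x := hφ.clm_apply hf

lemma mvfderiv_congr {f f' : M → G} (h : f =ᶠ[𝓝 x] f') : mvfderiv I f x = mvfderiv I f' x := by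
  unfold mvfderiv
  have := h.mfderiv_eq (I := I) (I' := 𝓘(ℝ, G))
  ext u
  simp [this]
  rfl

end Operators

variable {V : M → Type*} [TopologicalSpace (TotalSpace F V)]
  [∀ x, AddCommGroup (V x)] [∀ x, Module ℝ (V x)] [∀ x, TopologicalSpace (V x)]
  [∀ x, IsTopologicalAddGroup (V x)] [∀ x, ContinuousSMul ℝ (V x)]
  [FiberBundle F V] [VectorBundle ℝ F V] [ContMDiffVectorBundle ∞ F V I]

section Trivialization

variable (e : Trivialization F (TotalSpace.proj : TotalSpace F V → M)) [MemTrivializationAtlas e]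
  {x : M}

lemma contMDiffAt_iff_continuousLinearMapAt {k : ℕ∞} (hx : x ∈ e.baseSet) {S : ∀ y, V y} :
    CMDiffAt k (T% S) x ↔ CMDiffAt k (fun y ↦ e.continuousLinearMapAt ℝ y (S y)) x := by
  have : ContMDiffVectorBundle k F V I := ContMDiffVectorBundle.of_le (n := ∞) (by exact_mod_cast le_top)
  rw [e.contMDiffAt_section_iff hx]
  refine Filter.EventuallyEq.contMDiffAt_iff ?_
  filter_upwards [e.open_baseSet.mem_nhds hx] with y hy
  exact (Trivialization.continuousLinearMapAt_apply_of_mem ℝ e hy _).symm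

lemma mdifferentiableAt_iff_continuousLinearMapAt (hx : x ∈ e.baseSet) {S : ∀ y, V y} :
    MDiffAt (T% S) x ↔ MDiffAt (fun y ↦ e.continuousLinearMapAt ℝ y (S y)) x := by
  have : ContMDiffVectorBundle 1 F V I := ContMDiffVectorBundle.of_le (n := ∞) (by simp)
  rw [e.mdifferentiableAt_section_iff I _ hx]
  refine Filter.EventuallyEq.mdifferentiableAt_iff ?_
  filter_upwards [e.open_baseSet.mem_nhds hx] with y hy
  exact (Trivialization.continuousLinearMapAt_apply_of_mem ℝ e hy _).symm

lemma contMDiffOn_symmL_apply (v : F) :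
    CMDiff[e.baseSet] ∞ (T% (fun y ↦ e.symmL ℝ y v : ∀ y, V y)) := by
  rw [e.contMDiffOn_section_baseSet_iff]
  refine (contMDiffOn_const (c := v)).congr fun y hy ↦ ?_
  rw [← Trivialization.continuousLinearMapAt_apply_of_mem ℝ e hy, e.continuousLinearMapAt_symmL hy]

lemma mdifferentiableAt_symmL_apply (hx : x ∈ e.baseSet) (v : F) :
    MDiffAt (T% (fun y ↦ e.symmL ℝ y v : ∀ y, V y)) x :=
  ((contMDiffOn_symmL_apply (I := I) e v).contMDiffAt
    (e.open_baseSet.mem_nhds hx)).mdifferentiableAt (by simp)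

lemma eq_of_continuousLinearMapAt_eq (hx : x ∈ e.baseSet) {v w : V x}
    (h : e.continuousLinearMapAt ℝ x v = e.continuousLinearMapAt ℝ x w) : v = w := by
  rw [← e.symmL_continuousLinearMapAt (R := ℝ) hx v, h, e.symmL_continuousLinearMapAt hx]

lemma continuousLinearMapAt_eq_zero (hx : x ∉ e.baseSet) : e.continuousLinearMapAt ℝ x = 0 := by
  ext v
  change e.linearMapAt ℝ x v = 0
  rw [Trivialization.coe_linearMapAt]
  exact if_neg hx

lemma covariantDerivative_symmL_tensorialAt (A : CovariantDerivative I F V) (hx : x ∈ e.baseSet)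
    (u : TangentSpace I x) :
    TensorialAt I F (fun S ↦ e.continuousLinearMapAt ℝ x (A S x u)
      - mvfderiv I (fun y ↦ e.continuousLinearMapAt ℝ y (S y)) x u) x where
  smul {f S} hf hS := by
    have hS' := (mdifferentiableAt_iff_continuousLinearMapAt e hx).1 hS
    have h1 : (fun y ↦ e.continuousLinearMapAt ℝ y ((f • S) y))
        = f • fun y ↦ e.continuousLinearMapAt ℝ y (S y) := by
      funext y
      simp
    rw [A.isCovariantDerivativeOnUniv.leibniz hS hf, h1, mvfderiv_smul hf hS']
    simp [smul_sub]
  add {S S'} hS hS' := by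
    have h1 : (fun y ↦ e.continuousLinearMapAt ℝ y ((S + S') y))
        = (fun y ↦ e.continuousLinearMapAt ℝ y (S y))
          + fun y ↦ e.continuousLinearMapAt ℝ y (S' y) := by
      funext y
      simp
    rw [A.isCovariantDerivativeOnUniv.add hS hS', h1,
      mvfderiv_add ((mdifferentiableAt_iff_continuousLinearMapAt e hx).1 hS)
        ((mdifferentiableAt_iff_continuousLinearMapAt e hx).1 hS')]
    simp
    abel

/-- The connection form of `A` in the trivialization `e`. -/
def connectionForm (A : CovariantDerivative I F V) (x : M) (u : TangentSpace I x) : F →L[ℝ] F :=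
  LinearMap.toContinuousLinearMap
    { toFun := fun v ↦ e.continuousLinearMapAt ℝ x (A (fun y ↦ e.symmL ℝ y v) x u)
      map_add' := fun v w ↦ by
        by_cases hx : x ∈ e.baseSet
        · have : (fun y ↦ e.symmL ℝ y (v + w)) = (fun y ↦ e.symmL ℝ y v) + fun y ↦ e.symmL ℝ y w :=
            funext fun y ↦ map_add _ _ _
          rw [this, A.isCovariantDerivativeOnUniv.add (mdifferentiableAt_symmL_apply e hx v)
            (mdifferentiableAt_symmL_apply e hx w)]
          simp
        · simp [continuousLinearMapAt_eq_zero e hx]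
      map_smul' := fun c v ↦ by
        by_cases hx : x ∈ e.baseSet
        · have : (fun y ↦ e.symmL ℝ y (c • v)) = c • fun y ↦ e.symmL ℝ y v :=
            funext fun y ↦ map_smul _ _ _
          rw [this, A.isCovariantDerivativeOnUniv.smul_const c
            (mdifferentiableAt_symmL_apply e hx v)]
          simp
        · simp [continuousLinearMapAt_eq_zero e hx] }

lemma connectionForm_apply (A : CovariantDerivative I F V) (u : TangentSpace I x) (v : F) :
    connectionForm e A x u v = e.continuousLinearMapAt ℝ x (A (fun y ↦ e.symmL ℝ y v) x u) := rfl

/-- The covariant derivative in a trivialization. -/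
lemma continuousLinearMapAt_covariantDerivative (A : CovariantDerivative I F V)
    (hx : x ∈ e.baseSet) {S : ∀ y, V y} (hS : MDiffAt (T% S) x) (u : TangentSpace I x) :
    e.continuousLinearMapAt ℝ x (A S x u)
      = mvfderiv I (fun y ↦ e.continuousLinearMapAt ℝ y (S y)) x u
        + connectionForm e A x u (e.continuousLinearMapAt ℝ x (S x)) := by
  have : ContMDiffVectorBundle 1 F V I := ContMDiffVectorBundle.of_le (n := ∞) (by simp)
  have h1 := (covariantDerivative_symmL_tensorialAt e A hx u).pointwise hS
    (mdifferentiableAt_symmL_apply e hx (e.continuousLinearMapAt ℝ x (S x)))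
    (e.symmL_continuousLinearMapAt hx _).symm
  have h2 : mvfderiv I (fun y ↦ e.continuousLinearMapAt ℝ y
      (e.symmL ℝ y (e.continuousLinearMapAt ℝ x (S x)))) x = 0 := by
    rw [mvfderiv_congr (f' := fun _ ↦ e.continuousLinearMapAt ℝ x (S x)), mvfderiv_const]
    filter_upwards [e.open_baseSet.mem_nhds hx] with y hy
    exact e.continuousLinearMapAt_symmL hy _
  beta_reduce at h1
  rw [h2, ← connectionForm_apply, sub_eq_iff_eq_add] at h1
  rw [h1]
  simp [add_comm]

/-- The covariant derivative of a local smooth section is smooth. -/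
lemma contMDiffOn_covariantDerivative [T2Space M] {A : CovariantDerivative I F V}
    (hA : CovariantDerivative.ContMDiffCovariantDerivative A ∞) {S : ∀ y, V y} {U : Set M}
    (hU : IsOpen U) (hS : CMDiff[U] ∞ (T% S)) :
    ContMDiffOn I (I.prod 𝓘(ℝ, E →L[ℝ] F)) ∞ (fun y ↦ TotalSpace.mk' (E →L[ℝ] F)
      (E := fun y : M ↦ TangentSpace I y →L[ℝ] V y) y (A S y)) U := by
  intro x hx
  have : ContMDiffVectorBundle 1 F V I := ContMDiffVectorBundle.of_le (n := ∞) (by simp)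
  obtain ⟨χ, -, hχU⟩ := (SmoothBumpFunction.nhds_basis_tsupport (I := I) x).mem_iff.1
    (hU.mem_nhds hx)
  have hχS : ContMDiff I (I.prod 𝓘(ℝ, F)) ∞ (T% ((χ : M → ℝ) • S)) := by
    refine ContMDiffOn.smul_section_of_tsupport χ.contMDiff.contMDiffOn hU hχU hS
  have h1 := hA.contMDiff.contMDiff (σ := (χ : M → ℝ) • S) hχS.contMDiffOn
  have h2 := (h1.contMDiffAt univ_mem (x := x))
  refine (h2.congr_of_eventuallyEq ?_).contMDiffWithinAt
  filter_upwards [χ.eventuallyEq_one.eventuallyEq_nhds, hU.mem_nhds hx] with y hy hyU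
  have h3 : MDiffAt (T% S) y := ((hS y hyU).contMDiffAt (hU.mem_nhds hyU)).mdifferentiableAt
    (by simp)
  have h4 : A S y = A ((χ : M → ℝ) • S) y :=
    A.isCovariantDerivativeOnUniv.congr_of_eventuallyEq h3
      ((hχS y).mdifferentiableAt (by simp)) univ_mem (by
        filter_upwards [hy] with z hz
        simp [hz])
  rw [h4]

lemma contMDiffOn_covariantDerivative_apply [T2Space M] {A : CovariantDerivative I F V}
    (hA : CovariantDerivative.ContMDiffCovariantDerivative A ∞) {S : ∀ y, V y} {U : Set M}
    (hU : IsOpen U) (hS : CMDiff[U] ∞ (T% S)) {X : ∀ y : M, TangentSpace I y}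
    (hX : CMDiff[U] ∞ (T% X)) : CMDiff[U] ∞ (T% (fun y ↦ A S y (X y) : ∀ y, V y)) := by
  apply ContMDiffOn.clm_bundle_apply (F₁ := E) (contMDiffOn_covariantDerivative hA hU hS) hX

lemma contMDiffOn_connectionForm [T2Space M] {A : CovariantDerivative I F V}
    (hA : CovariantDerivative.ContMDiffCovariantDerivative A ∞) {U : Set M}
    (hU : IsOpen U) (hUe : U ⊆ e.baseSet) {X : ∀ y : M, TangentSpace I y}
    (hX : CMDiff[U] ∞ (T% X)) : CMDiff[U] ∞ (fun y ↦ connectionForm e A y (X y)) := by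
  intro x hx
  refine ContMDiffAt.contMDiffWithinAt (contMDiffAt_clm_of_apply fun v ↦ ?_)
  have := (contMDiffOn_covariantDerivative_apply hA hU
    ((contMDiffOn_symmL_apply (I := I) e v).mono hUe) hX).contMDiffAt (hU.mem_nhds hx)
  exact (contMDiffAt_iff_continuousLinearMapAt e (hUe hx)).1 this

end Trivialization

end ElectricYM

/-! ### Curvature and covariant derivatives in commuting frames -/

namespace ElectricYM

open Filter Set
open scoped Topology

variable {E : Type*} [NormedAddCommGroup E] [NormedSpace ℝ E] [FiniteDimensional ℝ E]
  {H : Type*} [TopologicalSpace H] {I : ModelWithCorners ℝ E H}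
  {M : Type*} [TopologicalSpace M] [ChartedSpace H M] [IsManifold I ∞ M]
  {F : Type*} [NormedAddCommGroup F] [NormedSpace ℝ F] [FiniteDimensional ℝ F]
  {κ : Type*} [Fintype κ] [DecidableEq κ]

variable (I) in
/-- A smooth frame of commuting vector fields on the open set `U`. -/
structure IsCommutingFrame (U : Set M) (X : κ → ∀ x : M, TangentSpace I x) : Prop where
  isOpen : IsOpen U
  contMDiffOn (i : κ) : CMDiff[U] ∞ (T% (X i))
  linearIndependent (x : M) (hx : x ∈ U) : LinearIndependent ℝ fun i ↦ X i x
  span (x : M) (hx : x ∈ U) : Submodule.span ℝ (range fun i ↦ X i x) = ⊤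
  bracket (x : M) (hx : x ∈ U) (i j : κ) : VectorField.mlieBracket I (X i) (X j) x = 0

section Smooth

variable {x : M} {k : ℕ∞} {A : M → Matrix κ κ ℝ}

lemma mdifferentiableAt_sum {G : Type*} [NormedAddCommGroup G] [NormedSpace ℝ G]
    {f : κ → M → G} (hf : ∀ i, MDiffAt (f i) x) : MDiffAt (fun y ↦ ∑ i, f i y) x := by
  classical
  induction (Finset.univ : Finset κ) using Finset.induction_on with
  | empty => simpa using mdifferentiableAt_const
  | insert i t hi ih =>
    simp only [Finset.sum_insert hi]
    exact (hf i).add ih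

lemma contMDiffAt_det (hA : ∀ i j, CMDiffAt k (fun y ↦ A y i j) x) :
    CMDiffAt k (fun y ↦ (A y).det) x := by
  simp only [Matrix.det_apply']
  refine ContMDiffAt.sum fun τ _ ↦ ContMDiffAt.mul contMDiffAt_const ?_
  exact ContMDiffAt.prod fun i _ ↦ hA _ _

lemma contMDiffAt_matrix_inv (hA : ∀ i j, CMDiffAt k (fun y ↦ A y i j) x)
    (h0 : IsUnit (A x).det) (i j : κ) : CMDiffAt k (fun y ↦ (A y)⁻¹ i j) x := by
  have h1 : (fun y ↦ (A y)⁻¹ i j) = fun y ↦ ((A y).det)⁻¹ * ((A y).updateRow j (Pi.single i 1)).det := by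
    funext y
    rw [Matrix.inv_def, Matrix.smul_apply, Matrix.adjugate_apply, Ring.inverse_eq_inv', smul_eq_mul]
  rw [h1]
  refine ((contMDiffAt_det hA).inv₀ h0.ne_zero).mul (contMDiffAt_det fun a b ↦ ?_)
  simp only [Matrix.updateRow_apply]
  split_ifs
  · exact contMDiffAt_const
  · exact hA a b

end Smooth

namespace IsCommutingFrame

variable {U : Set M} {X : κ → ∀ x : M, TangentSpace I x} {x : M}

lemma contMDiffAt (hX : IsCommutingFrame I U X) (hx : x ∈ U)
    (i : κ) : CMDiffAt ∞ (T% (X i)) x :=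
  (hX.contMDiffOn i).contMDiffAt (hX.isOpen.mem_nhds hx)

lemma mdifferentiableAt (hX : IsCommutingFrame I U X) (hx : x ∈ U)
    (i : κ) : MDiffAt (T% (X i)) x :=
  (hX.contMDiffAt hx i).mdifferentiableAt (by simp)

lemma contMDiffAt_gram (hX : IsCommutingFrame I U X) (hx : x ∈ U)
    (g : Metric I M) (i j : κ) :
    CMDiffAt ∞ (fun y ↦ g.inner y (X i y) (X j y)) x :=
  contMDiffAt_inner (k := ⊤) g (hX.contMDiffAt hx i) (hX.contMDiffAt hx j)

lemma contMDiffAt_inv_gram (hX : IsCommutingFrame I U X) (hx : x ∈ U)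
    (g : Metric I M) (i j : κ) :
    CMDiffAt ∞ (fun y ↦ (gram g y fun i ↦ X i y)⁻¹ i j) x :=
  contMDiffAt_matrix_inv (k := ⊤) (fun i j ↦ hX.contMDiffAt_gram hx g i j)
    (isUnit_gram_det g x (hX.linearIndependent x hx)) i j

/-- The Levi-Civita connection in a commuting frame. -/
lemma leviCivita_eq (hX : IsCommutingFrame I U X) (hx : x ∈ U)
    (g : Metric I M) (i j : κ) :
    leviCivita g (X j) x (X i x) = ∑ k, (∑ m, (gram g x fun i ↦ X i x)⁻¹ k m * ((1 / 2 : ℝ) *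
      (mvfderiv I (fun y ↦ g.inner y (X j y) (X m y)) x (X i x)
        + mvfderiv I (fun y ↦ g.inner y (X i y) (X m y)) x (X j x)
        - mvfderiv I (fun y ↦ g.inner y (X i y) (X j y)) x (X m x)))) • X k x := by
  rw [← sum_inv_gram_smul g x (hX.linearIndependent x hx) (hX.span x hx)
    (leviCivita g (X j) x (X i x)), Finset.sum_comm]
  refine Finset.sum_congr rfl fun k _ ↦ ?_
  rw [← Finset.sum_smul]
  congr 1
  refine Finset.sum_congr rfl fun m _ ↦ ?_
  rw [inner_leviCivita (hX.mdifferentiableAt hx i) (hX.mdifferentiableAt hx j)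
    (hX.mdifferentiableAt hx m), inv_gram_symm, koszul, hX.bracket x hx, hX.bracket x hx,
    hX.bracket x hx]
  simp

lemma sharp_eq (hX : IsCommutingFrame I U X) (hx : x ∈ U)
    (g : Metric I M) (α : TangentSpace I x →ₗ[ℝ] ℝ) :
    sharp g x α = ∑ j, (∑ i, (gram g x fun i ↦ X i x)⁻¹ j i * α (X i x)) • X j x := by
  have h := metricTrace_eq_sum g x (hX.linearIndependent x hx) (hX.span x hx)
    (LinearMap.mk₂ ℝ (fun u v ↦ α u • v) (by simp [add_smul]) (by simp [smul_smul]) (by simp)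
      (by intros; rw [smul_comm]))
  have h' : sharp g x α = metricTrace g x (fun u v ↦ α u • v) := rfl
  rw [h']
  refine h.trans ?_
  rw [Finset.sum_comm]
  refine Finset.sum_congr rfl fun j _ ↦ ?_
  rw [Finset.sum_smul]
  refine Finset.sum_congr rfl fun i _ ↦ ?_
  rw [LinearMap.mk₂_apply, smul_smul, inv_gram_symm]

/-- Differentiable vector fields have differentiable components. -/
lemma exists_components (hX : IsCommutingFrame I U X) (hx : x ∈ U)
    [Nonempty (Metric I M)] {Y : ∀ y : M, TangentSpace I y}
    (hY : MDiffAt (T% Y) x) :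
    ∃ c : κ → M → ℝ, (∀ i, MDiffAt (c i) x) ∧ ∀ y ∈ U, Y y = ∑ i, c i y • X i y := by
  obtain ⟨g⟩ := ‹Nonempty (Metric I M)›
  refine ⟨fun j y ↦ ∑ i, (gram g y fun i ↦ X i y)⁻¹ i j * g.inner y (Y y) (X i y),
    fun j ↦ ?_, fun y hy ↦ ?_⟩
  · have : ∀ i, MDiffAt (fun y ↦ (gram g y fun i ↦ X i y)⁻¹ i j * g.inner y (Y y) (X i y)) x :=
      fun i ↦ ((hX.contMDiffAt_inv_gram hx g i j).mdifferentiableAt (by simp)).mul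
        (mdifferentiableAt_inner g hY (hX.mdifferentiableAt hx i))
    exact mdifferentiableAt_sum this
  · conv_lhs => rw [← sum_inv_gram_smul g y (hX.linearIndependent y hy) (hX.span y hy) (Y y)]
    rw [Finset.sum_comm]
    exact Finset.sum_congr rfl fun j _ ↦ (Finset.sum_smul ..).symm

end IsCommutingFrame

variable {V : M → Type*} [TopologicalSpace (TotalSpace F V)]
  [∀ x, AddCommGroup (V x)] [∀ x, Module ℝ (V x)] [∀ x, TopologicalSpace (V x)]
  [∀ x, IsTopologicalAddGroup (V x)] [∀ x, ContinuousSMul ℝ (V x)]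
  [FiberBundle F V] [VectorBundle ℝ F V] [ContMDiffVectorBundle ∞ F V I]

section Curvature

variable {A : CovariantDerivative I F V} {S : ∀ y, V y} {x : M} {X Y : ∀ y : M, TangentSpace I y}

/-- The covariant derivative of `S` is differentiable at `x`. -/
def MDifferentiableCovAt (A : CovariantDerivative I F V) (S : ∀ y, V y) (x : M) : Prop :=
  MDifferentiableAt I (I.prod 𝓘(ℝ, E →L[ℝ] F)) (fun y ↦ TotalSpace.mk' (E →L[ℝ] F)
    (E := fun y : M ↦ TangentSpace I y →L[ℝ] V y) y (A S y)) x

lemma MDifferentiableCovAt.apply (hAS : MDifferentiableCovAt A S x) (hX : MDiffAt (T% X) x) :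
    MDiffAt (T% (fun y ↦ A S y (X y) : ∀ y, V y)) x := by
  have : ContMDiffVectorBundle 1 F V I := ContMDiffVectorBundle.of_le (n := ∞) (by simp)
  apply MDifferentiableAt.clm_bundle_apply (F₁ := E) hAS hX

lemma curvature_tensorialAt_left (hAS : MDifferentiableCovAt A S x) (Y : ∀ y : M, TangentSpace I y) :
    TensorialAt I E (fun X : ∀ y : M, TangentSpace I y ↦
      A (fun y ↦ A S y (Y y)) x (X x) - A (fun y ↦ A S y (X y)) x (Y x)
        - A S x (VectorField.mlieBracket I X Y x)) x where
  smul {f X} hf hX := by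
    have h1 : (fun y ↦ A S y ((f • X) y)) = f • fun y ↦ A S y (X y) := by
      funext y
      simp
    rw [h1, A.isCovariantDerivativeOnUniv.leibniz (hAS.apply hX) hf,
      VectorField.mlieBracket_smul_left hf hX]
    simp only [Pi.smul_apply', map_smul, map_add, neg_smul, map_neg, _root_.add_apply,
      _root_.smul_apply, ContinuousLinearMap.smulRight_apply]
    module
  add {X X'} hX hX' := by
    have h1 : (fun y ↦ A S y ((X + X') y)) = (fun y ↦ A S y (X y)) + fun y ↦ A S y (X' y) := by
      funext y
      simp
    rw [h1, A.isCovariantDerivativeOnUniv.add (hAS.apply hX) (hAS.apply hX'),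
      VectorField.mlieBracket_add_left hX hX']
    simp only [Pi.add_apply, map_add, _root_.add_apply]
    module

lemma curvature_tensorialAt_right (hAS : MDifferentiableCovAt A S x)
    (X : ∀ y : M, TangentSpace I y) :
    TensorialAt I E (fun Y : ∀ y : M, TangentSpace I y ↦
      A (fun y ↦ A S y (Y y)) x (X x) - A (fun y ↦ A S y (X y)) x (Y x)
        - A S x (VectorField.mlieBracket I X Y x)) x where
  smul {f Y} hf hY := by
    have h1 : (fun y ↦ A S y ((f • Y) y)) = f • fun y ↦ A S y (Y y) := by
      funext y
      simp
    rw [h1, A.isCovariantDerivativeOnUniv.leibniz (hAS.apply hY) hf,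
      VectorField.mlieBracket_smul_right hf hY]
    simp only [Pi.smul_apply', map_smul, map_add, _root_.add_apply,
      _root_.smul_apply, ContinuousLinearMap.smulRight_apply]
    module
  add {Y Y'} hY hY' := by
    have h1 : (fun y ↦ A S y ((Y + Y') y)) = (fun y ↦ A S y (Y y)) + fun y ↦ A S y (Y' y) := by
      funext y
      simp
    rw [h1, A.isCovariantDerivativeOnUniv.add (hAS.apply hY) (hAS.apply hY'),
      VectorField.mlieBracket_add_right hY hY']
    simp only [Pi.add_apply, map_add, _root_.add_apply]
    module

lemma mdifferentiableCovAt_extend [T2Space M]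
    (hA : CovariantDerivative.ContMDiffCovariantDerivative A ∞) (s : V x) :
    MDifferentiableCovAt A (FiberBundle.extend F s) x := by
  obtain ⟨N, hN, hS⟩ := FiberBundle.exists_contMDiffOn_extend (k := ∞) I F s
  obtain ⟨W, hWN, hW, hxW⟩ := mem_nhds_iff.1 hN
  exact ((contMDiffOn_covariantDerivative hA hW (hS.mono hWN)).contMDiffAt
    (hW.mem_nhds hxW)).mdifferentiableAt (by simp)

lemma curvature_eq [T2Space M] (hA : CovariantDerivative.ContMDiffCovariantDerivative A ∞)
    (s : V x) (hX : MDiffAt (T% X) x) (hY : MDiffAt (T% Y) x) :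
    curvature A x s (X x) (Y x) = A (fun y ↦ A (FiberBundle.extend F s) y (Y y)) x (X x)
      - A (fun y ↦ A (FiberBundle.extend F s) y (X y)) x (Y x)
      - A (FiberBundle.extend F s) x (VectorField.mlieBracket I X Y x) := by
  have hAS := mdifferentiableCovAt_extend hA s
  have h := TensorialAt.pointwise₂ (I := I) (F := E) (F' := E) (x := x)
    (Φ := fun X Y : ∀ y : M, TangentSpace I y ↦
      A (fun y ↦ A (FiberBundle.extend F s) y (Y y)) x (X x)
      - A (fun y ↦ A (FiberBundle.extend F s) y (X y)) x (Y x)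
      - A (FiberBundle.extend F s) x (VectorField.mlieBracket I X Y x))
    (fun Y _ ↦ curvature_tensorialAt_left hAS Y) (fun X _ ↦ curvature_tensorialAt_right hAS X)
    (FiberBundle.mdifferentiableAt_extend I E (X x)) hX
    (FiberBundle.mdifferentiableAt_extend I E (Y x)) hY (by simp) (by simp)
  beta_reduce at h
  rw [← h]
  simp only [FiberBundle.extend_apply_self]
  rfl

variable (I) in
/-- The derivations defined by the vector fields `X i` commute at `x`. -/
def DerivationsCommuteAt (G : Type*) [NormedAddCommGroup G] [NormedSpace ℝ G]
    (X : κ → ∀ x : M, TangentSpace I x) (x : M) : Prop :=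
  ∀ (f : M → G) (W : Set M), IsOpen W → x ∈ W → CMDiff[W] ∞ f → ∀ i j,
    mvfderiv I (fun y ↦ mvfderiv I f y (X j y)) x (X i x)
      = mvfderiv I (fun y ↦ mvfderiv I f y (X i y)) x (X j x)

variable (e : Trivialization F (TotalSpace.proj : TotalSpace F V → M)) [MemTrivializationAtlas e]

/-- The components of the curvature in a commuting frame. -/
def curvatureMatrix (A : CovariantDerivative I F V) (X : κ → ∀ x : M, TangentSpace I x) (i j : κ)
    (x : M) : F →L[ℝ] F :=
  mvfderiv I (fun y ↦ connectionForm e A y (X j y)) x (X i x)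
    - mvfderiv I (fun y ↦ connectionForm e A y (X i y)) x (X j x)
    + (connectionForm e A x (X i x) * connectionForm e A x (X j x)
      - connectionForm e A x (X j x) * connectionForm e A x (X i x))

lemma continuousLinearMapAt_curvature [T2Space M]
    (hA : CovariantDerivative.ContMDiffCovariantDerivative A ∞) {U : Set M}
    {X : κ → ∀ x : M, TangentSpace I x} (hX : IsCommutingFrame I U X) (hx : x ∈ U)
    (hxe : x ∈ e.baseSet) (hc : DerivationsCommuteAt I F X x) (s : V x) (i j : κ) :
    e.continuousLinearMapAt ℝ x (curvature A x s (X i x) (X j x))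
      = curvatureMatrix e A X i j x (e.continuousLinearMapAt ℝ x s) := by
  obtain ⟨N, hN, hS⟩ := FiberBundle.exists_contMDiffOn_extend (k := ∞) I F s
  obtain ⟨W, hWN, hW, hxW⟩ := mem_nhds_iff.1 hN
  set S : ∀ y, V y := FiberBundle.extend F s with hSdef
  have hSx : S x = s := FiberBundle.extend_apply_self F s
  set W' := W ∩ (U ∩ e.baseSet) with hW'def
  have hW' : IsOpen W' := hW.inter (hX.isOpen.inter e.open_baseSet)
  have hxW' : x ∈ W' := ⟨hxW, hx, hxe⟩
  have hS' : CMDiff[W'] ∞ (T% S) := hS.mono (inter_subset_left.trans hWN)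
  have hSat : ∀ y ∈ W', CMDiffAt ∞ (T% S) y := fun y hy ↦ (hS' y hy).contMDiffAt (hW'.mem_nhds hy)
  set f : M → F := fun y ↦ e.continuousLinearMapAt ℝ y (S y) with hf
  have hfat : ∀ y ∈ W', CMDiffAt ∞ f y := fun y hy ↦
    (contMDiffAt_iff_continuousLinearMapAt (k := ⊤) e hy.2.2).1 (hSat y hy)
  set Θ : κ → M → F →L[ℝ] F := fun j y ↦ connectionForm e A y (X j y) with hΘ
  have hΘd : ∀ j, MDiffAt (Θ j) x := fun j ↦
    ((contMDiffOn_connectionForm e hA (hX.isOpen.inter e.open_baseSet) inter_subset_right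
      ((hX.contMDiffOn j).mono inter_subset_left)).contMDiffAt
      ((hX.isOpen.inter e.open_baseSet).mem_nhds ⟨hx, hxe⟩)).mdifferentiableAt (by simp)
  have hfd : MDiffAt f x := (hfat x hxW').mdifferentiableAt (by simp)
  have hcov : ∀ j, ∀ y ∈ W', e.continuousLinearMapAt ℝ y (A S y (X j y))
      = mvfderiv I f y (X j y) + Θ j y (f y) := fun j y hy ↦
    continuousLinearMapAt_covariantDerivative e A hy.2.2
      ((hSat y hy).mdifferentiableAt (by simp)) _
  have hASd : ∀ j, MDiffAt (T% (fun y ↦ A S y (X j y) : ∀ y, V y)) x := fun j ↦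
    (mdifferentiableCovAt_extend hA s).apply (hX.mdifferentiableAt hx j)
  have hASd' : ∀ j, MDiffAt (fun y ↦ e.continuousLinearMapAt ℝ y (A S y (X j y))) x := fun j ↦
    (mdifferentiableAt_iff_continuousLinearMapAt e hxe).1 (hASd j)
  have hDd : ∀ j, MDiffAt (fun y ↦ mvfderiv I f y (X j y)) x := fun j ↦ by
    refine ((hASd' j).sub (mdifferentiableAt_clm_apply (hΘd j) hfd)).congr_of_eventuallyEq ?_
    filter_upwards [hW'.mem_nhds hxW'] with y hy
    simp only [Pi.sub_apply, hcov j y hy, add_sub_cancel_right]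
  have key : ∀ i j, e.continuousLinearMapAt ℝ x (A (fun y ↦ A S y (X j y)) x (X i x))
      = mvfderiv I (fun y ↦ mvfderiv I f y (X j y)) x (X i x)
        + (mvfderiv I (Θ j) x (X i x) (f x) + Θ j x (mvfderiv I f x (X i x)))
        + Θ i x (mvfderiv I f x (X j x) + Θ j x (f x)) := fun i j ↦ by
    rw [continuousLinearMapAt_covariantDerivative e A hxe (hASd j), hcov j x hxW']
    congr 1
    rw [← mvfderiv_clm_apply (hΘd j) hfd]
    have h1 : (fun y ↦ e.continuousLinearMapAt ℝ y (A S y (X j y)))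
        =ᶠ[𝓝 x] (fun y ↦ mvfderiv I f y (X j y)) + fun y ↦ Θ j y (f y) := by
      filter_upwards [hW'.mem_nhds hxW'] with y hy
      exact hcov j y hy
    rw [mvfderiv_congr h1, mvfderiv_add (hDd j) (mdifferentiableAt_clm_apply (hΘd j) hfd)]
    rfl
  rw [curvature_eq hA s (hX.mdifferentiableAt hx i) (hX.mdifferentiableAt hx j),
    hX.bracket x hx i j, map_zero, sub_zero, map_sub, key, key,
    hc f W' hW' hxW' (fun y hy ↦ (hfat y hy).contMDiffWithinAt) i j]
  have hfx : f x = e.continuousLinearMapAt ℝ x s := by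
    change e.continuousLinearMapAt ℝ x (S x) = _
    rw [hSx]
  rw [← hfx]
  simp only [curvatureMatrix, _root_.add_apply, _root_.sub_apply,
    _root_.mul_apply_eq_comp, map_add]
  abel

end Curvature

end ElectricYM

/-! ### Covariant derivatives of one- and two-forms in commuting frames -/

namespace ElectricYM

open Filter Set
open scoped Topology

variable {E : Type*} [NormedAddCommGroup E] [NormedSpace ℝ E] [FiniteDimensional ℝ E]
  {H : Type*} [TopologicalSpace H] {I : ModelWithCorners ℝ E H}
  {M : Type*} [TopologicalSpace M] [ChartedSpace H M] [IsManifold I ∞ M]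
  {F : Type*} [NormedAddCommGroup F] [NormedSpace ℝ F] [FiniteDimensional ℝ F]
  {κ : Type*} [Fintype κ] [DecidableEq κ]
  {V : M → Type*} [TopologicalSpace (TotalSpace F V)]
  [∀ x, AddCommGroup (V x)] [∀ x, Module ℝ (V x)] [∀ x, TopologicalSpace (V x)]
  [∀ x, IsTopologicalAddGroup (V x)] [∀ x, ContinuousSMul ℝ (V x)]
  [FiberBundle F V] [VectorBundle ℝ F V] [ContMDiffVectorBundle ∞ F V I]
  {A : CovariantDerivative I F V} {S : ∀ y, V y} {x : M} {X Y Z : ∀ y : M, TangentSpace I y}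
  {g : Metric I M} {U : Set M} {φ : κ → M → F →L[ℝ] F} {ψ : κ → κ → M → F →L[ℝ] F}
  (e : Trivialization F (TotalSpace.proj : TotalSpace F V → M)) [MemTrivializationAtlas e]

lemma exists_curvature_eq_linearMap [T2Space M]
    (hA : CovariantDerivative.ContMDiffCovariantDerivative A ∞) (y : M) (s : V y) :
    ∃ T : TangentSpace I y →ₗ[ℝ] TangentSpace I y →ₗ[ℝ] V y, ∀ u v,
      curvature A y s u v = T u v := by
  have hAS := mdifferentiableCovAt_extend hA s
  have h0 : ∃ h : TangentSpace I y →L[ℝ] TangentSpace I y →L[ℝ] V y, ∀ u v,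
      curvature A y s u v = h u v := by
    refine ⟨TensorialAt.mkHom₂ (I := I) (F := E) (F' := E) (x := y)
      (Φ := fun X Y : ∀ y : M, TangentSpace I y ↦
        A (fun z ↦ A (FiberBundle.extend F s) z (Y z)) y (X y)
        - A (fun z ↦ A (FiberBundle.extend F s) z (X z)) y (Y y)
        - A (FiberBundle.extend F s) y (VectorField.mlieBracket I X Y y))
      (fun Y _ ↦ curvature_tensorialAt_left hAS Y)
      (fun X _ ↦ curvature_tensorialAt_right hAS X), fun u v ↦ ?_⟩
    rw [TensorialAt.mkHom₂_apply_eq_extend, FiberBundle.extend_apply_self,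
      FiberBundle.extend_apply_self]
    rfl
  obtain ⟨h, hh⟩ := h0
  exact ⟨(ContinuousLinearMap.coeLM ℝ).comp h.toLinearMap, hh⟩

lemma IsCommutingFrame.exists_eq_sum {X : κ → ∀ x : M, TangentSpace I x}
    (hX : IsCommutingFrame I U X) (hx : x ∈ U) (v : TangentSpace I x) :
    ∃ c : κ → ℝ, v = ∑ i, c i • X i x := by
  have hv : v ∈ Submodule.span ℝ (range fun i ↦ X i x) := hX.span x hx ▸ Submodule.mem_top
  obtain ⟨c, hc⟩ := (Submodule.mem_span_range_iff_exists_fun ℝ).1 hv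
  exact ⟨c, hc.symm⟩

section OneForm

variable {e' : ∀ y : M, V y → TangentSpace I y → V y}

lemma mdifferentiableAt_oneForm_apply [Nonempty (Metric I M)]
    {X : κ → ∀ x : M, TangentSpace I x} (hX : IsCommutingFrame I U X) (hx : x ∈ U)
    (hxe : x ∈ e.baseSet)
    (he' : ∀ y s, ∃ T : TangentSpace I y →ₗ[ℝ] V y, ∀ v, e' y s v = T v)
    (hφ : ∀ y ∈ U ∩ e.baseSet, ∀ s i, e.continuousLinearMapAt ℝ y (e' y s (X i y))
      = φ i y (e.continuousLinearMapAt ℝ y s))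
    (hφd : ∀ i, MDiffAt (φ i) x) (hS : MDiffAt (T% S) x) (hY : MDiffAt (T% Y) x) :
    MDiffAt (T% (fun y ↦ e' y (S y) (Y y) : ∀ y, V y)) x := by
  obtain ⟨c, hc, hYc⟩ := hX.exists_components hx hY
  rw [mdifferentiableAt_iff_continuousLinearMapAt e hxe] at hS ⊢
  have h1 := mdifferentiableAt_sum fun i ↦ (hc i).smul (mdifferentiableAt_clm_apply (hφd i) hS)
  refine h1.congr_of_eventuallyEq ?_
  filter_upwards [(hX.isOpen.inter e.open_baseSet).mem_nhds ⟨hx, hxe⟩] with y hy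
  obtain ⟨T, hT⟩ := he' y (S y)
  rw [hT, hYc y hy.1, map_sum, map_sum]
  refine Finset.sum_congr rfl fun i _ ↦ ?_
  rw [map_smul, map_smul, ← hT, hφ y hy]
  rfl

lemma covDerivOneForm_tensorialAt
    (he' : ∀ y s, ∃ T : TangentSpace I y →ₗ[ℝ] V y, ∀ v, e' y s v = T v)
    (hd : ∀ Y : ∀ y : M, TangentSpace I y, MDiffAt (T% Y) x →
      MDiffAt (T% (fun y ↦ e' y (S y) (Y y) : ∀ y, V y)) x) (u : TangentSpace I x) :
    TensorialAt I E (fun Y : ∀ y : M, TangentSpace I y ↦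
      A (fun y ↦ e' y (S y) (Y y)) x u - e' x (A S x u) (Y x)
        - e' x (S x) (leviCivita g Y x u)) x where
  smul {f Y} hf hY := by
    have h1 : (fun y ↦ e' y (S y) ((f • Y) y)) = f • fun y ↦ e' y (S y) (Y y) := by
      funext y
      obtain ⟨T, hT⟩ := he' y (S y)
      simp [hT]
    rw [h1, A.isCovariantDerivativeOnUniv.leibniz (hd Y hY) hf, leviCivita_smul hf hY]
    obtain ⟨T, hT⟩ := he' x (S x)
    obtain ⟨T', hT'⟩ := he' x (A S x u)
    simp only [hT, hT', Pi.smul_apply', map_smul, map_add, _root_.add_apply,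
      _root_.smul_apply, ContinuousLinearMap.smulRight_apply]
    module
  add {Y Y'} hY hY' := by
    have h1 : (fun y ↦ e' y (S y) ((Y + Y') y))
        = (fun y ↦ e' y (S y) (Y y)) + fun y ↦ e' y (S y) (Y' y) := by
      funext y
      obtain ⟨T, hT⟩ := he' y (S y)
      simp [hT]
    rw [h1, A.isCovariantDerivativeOnUniv.add (hd Y hY) (hd Y' hY'), leviCivita_add hY hY']
    obtain ⟨T, hT⟩ := he' x (S x)
    obtain ⟨T', hT'⟩ := he' x (A S x u)
    simp only [hT, hT', Pi.add_apply, map_add, _root_.add_apply]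
    module

variable [Nonempty (Metric I M)] {X : κ → ∀ x : M, TangentSpace I x}

lemma exists_covDerivOneForm_eq_linearMap (hX : IsCommutingFrame I U X) (hx : x ∈ U)
    (hxe : x ∈ e.baseSet)
    (he' : ∀ y s, ∃ T : TangentSpace I y →ₗ[ℝ] V y, ∀ v, e' y s v = T v)
    (hφ : ∀ y ∈ U ∩ e.baseSet, ∀ s i, e.continuousLinearMapAt ℝ y (e' y s (X i y))
      = φ i y (e.continuousLinearMapAt ℝ y s))
    (hφd : ∀ i, MDiffAt (φ i) x) (s : V x) :
    ∃ T : TangentSpace I x →ₗ[ℝ] TangentSpace I x →ₗ[ℝ] V x, ∀ u v,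
      covDerivOneForm g A e' x s u v = T u v := by
  have hS := FiberBundle.mdifferentiableAt_extend I F s
  have hd := fun Y hY ↦ mdifferentiableAt_oneForm_apply (Y := Y) e hX hx hxe he' hφ hφd hS hY
  have key : ∀ u v, covDerivOneForm g A e' x s u v
      = TensorialAt.mkHom _ x (covDerivOneForm_tensorialAt (A := A) (g := g) he' hd u) v :=
    fun u v ↦ by
      rw [TensorialAt.mkHom_apply_eq_extend, FiberBundle.extend_apply_self,
        FiberBundle.extend_apply_self]
      rfl
  have hlin : ∀ (Y : ∀ y : M, TangentSpace I y) (hY : MDiffAt (T% Y) x) u,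
      covDerivOneForm g A e' x s u (Y x)
        = A (fun y ↦ e' y (FiberBundle.extend F s y) (Y y)) x u
          - e' x (A (FiberBundle.extend F s) x u) (Y x) - e' x s (leviCivita g Y x u) :=
    fun Y hY u ↦ by
      rw [key, TensorialAt.mkHom_apply _ hY, FiberBundle.extend_apply_self]
  have hadd : ∀ v (s t : V x), e' x (s + t) v = e' x s v + e' x t v := fun v s t ↦ by
    obtain ⟨c, rfl⟩ := hX.exists_eq_sum hx v
    obtain ⟨T, hT⟩ := he' x s
    obtain ⟨T', hT'⟩ := he' x t
    obtain ⟨T'', hT''⟩ := he' x (s + t)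
    refine eq_of_continuousLinearMapAt_eq e hxe ?_
    simp only [hT, hT', hT'', map_sum, map_add, map_smul, ← Finset.sum_add_distrib, ← smul_add]
    refine Finset.sum_congr rfl fun i _ ↦ ?_
    rw [← hT, ← hT', ← hT'', hφ x ⟨hx, hxe⟩, hφ x ⟨hx, hxe⟩, hφ x ⟨hx, hxe⟩, map_add, map_add]
  have hsmul : ∀ v (c : ℝ) (s : V x), e' x (c • s) v = c • e' x s v := fun v a s ↦ by
    obtain ⟨c, rfl⟩ := hX.exists_eq_sum hx v
    obtain ⟨T, hT⟩ := he' x s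
    obtain ⟨T', hT'⟩ := he' x (a • s)
    refine eq_of_continuousLinearMapAt_eq e hxe ?_
    simp only [hT, hT', map_sum, map_smul, Finset.smul_sum]
    refine Finset.sum_congr rfl fun i _ ↦ ?_
    rw [← hT, ← hT', hφ x ⟨hx, hxe⟩, hφ x ⟨hx, hxe⟩, map_smul, map_smul, smul_comm]
  obtain ⟨T, hT⟩ := he' x s
  refine ⟨LinearMap.mk₂ ℝ (covDerivOneForm g A e' x s) ?_ ?_ ?_ ?_, fun u v ↦ rfl⟩
  · intro u u' v
    have hv := FiberBundle.mdifferentiableAt_extend I E v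
    have h1 := hlin _ hv u
    have h2 := hlin _ hv u'
    have h3 := hlin _ hv (u + u')
    rw [leviCivita_add_left (g := g) hv u u'] at h3
    rw [FiberBundle.extend_apply_self] at h1 h2 h3
    rw [h1, h2, h3, map_add, map_add, hadd, hT, hT, hT, map_add]
    module
  · intro c u v
    have hv := FiberBundle.mdifferentiableAt_extend I E v
    have h1 := hlin _ hv u
    have h3 := hlin _ hv (c • u)
    rw [leviCivita_smul_left (g := g) hv c u] at h3
    rw [FiberBundle.extend_apply_self] at h1 h3
    rw [h1, h3, map_smul, map_smul, hsmul, hT, hT, map_smul]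
    module
  · intro u v v'
    simp only [key, map_add]
  · intro c u v
    simp only [key, map_smul]

/-- The covariant derivative of a one-form in a commuting frame. -/
lemma continuousLinearMapAt_covDerivOneForm (hX : IsCommutingFrame I U X) (hx : x ∈ U)
    (hxe : x ∈ e.baseSet)
    (he' : ∀ y s, ∃ T : TangentSpace I y →ₗ[ℝ] V y, ∀ v, e' y s v = T v)
    (hφ : ∀ y ∈ U ∩ e.baseSet, ∀ s i, e.continuousLinearMapAt ℝ y (e' y s (X i y))
      = φ i y (e.continuousLinearMapAt ℝ y s))
    (hφd : ∀ i, MDiffAt (φ i) x) (s : V x) (u : TangentSpace I x) (i : κ) :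
    e.continuousLinearMapAt ℝ x (covDerivOneForm g A e' x s u (X i x))
      = (mvfderiv I (φ i) x u + (connectionForm e A x u * φ i x - φ i x * connectionForm e A x u))
          (e.continuousLinearMapAt ℝ x s)
        - e.continuousLinearMapAt ℝ x (e' x s (leviCivita g (X i) x u)) := by
  have hS := FiberBundle.mdifferentiableAt_extend I F s
  have hd := fun Y hY ↦ mdifferentiableAt_oneForm_apply (Y := Y) e hX hx hxe he' hφ hφd hS hY
  have h1 : covDerivOneForm g A e' x s u (X i x)
      = A (fun y ↦ e' y (FiberBundle.extend F s y) (X i y)) x u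
        - e' x (A (FiberBundle.extend F s) x u) (X i x) - e' x s (leviCivita g (X i) x u) := by
    have h := (covDerivOneForm_tensorialAt (A := A) (g := g) he' hd u).pointwise
      (FiberBundle.mdifferentiableAt_extend I E (X i x)) (hX.mdifferentiableAt hx i) (by simp)
    simp only [FiberBundle.extend_apply_self] at h
    exact h
  have hS' := (mdifferentiableAt_iff_continuousLinearMapAt e hxe).1 hS
  have h2 : (fun y ↦ e.continuousLinearMapAt ℝ y (e' y (FiberBundle.extend F s y) (X i y)))
      =ᶠ[𝓝 x] fun y ↦ φ i y (e.continuousLinearMapAt ℝ y (FiberBundle.extend F s y)) := by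
    filter_upwards [(hX.isOpen.inter e.open_baseSet).mem_nhds ⟨hx, hxe⟩] with y hy
    exact hφ y hy _ i
  rw [h1, map_sub, map_sub, continuousLinearMapAt_covariantDerivative e A hxe
    (hd _ (hX.mdifferentiableAt hx i)), mvfderiv_congr h2, mvfderiv_clm_apply (hφd i) hS',
    hφ x ⟨hx, hxe⟩, hφ x ⟨hx, hxe⟩, continuousLinearMapAt_covariantDerivative e A hxe hS,
    FiberBundle.extend_apply_self]
  simp only [_root_.add_apply, _root_.sub_apply, _root_.mul_apply_eq_comp, map_add]
  abel

end OneForm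

section TwoForm

variable {Φ : ∀ y : M, V y → TangentSpace I y → TangentSpace I y → V y}

lemma mdifferentiableAt_twoForm_apply [Nonempty (Metric I M)]
    {X : κ → ∀ x : M, TangentSpace I x} (hX : IsCommutingFrame I U X) (hx : x ∈ U)
    (hxe : x ∈ e.baseSet)
    (hΦ : ∀ y s, ∃ T : TangentSpace I y →ₗ[ℝ] TangentSpace I y →ₗ[ℝ] V y,
      ∀ u v, Φ y s u v = T u v)
    (hψ : ∀ y ∈ U ∩ e.baseSet, ∀ s i j, e.continuousLinearMapAt ℝ y (Φ y s (X i y) (X j y))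
      = ψ i j y (e.continuousLinearMapAt ℝ y s))
    (hψd : ∀ i j, MDiffAt (ψ i j) x) (hS : MDiffAt (T% S) x) (hY : MDiffAt (T% Y) x)
    (hZ : MDiffAt (T% Z) x) :
    MDiffAt (T% (fun y ↦ Φ y (S y) (Y y) (Z y) : ∀ y, V y)) x := by
  obtain ⟨c, hc, hYc⟩ := hX.exists_components hx hY
  obtain ⟨d, hd, hZd⟩ := hX.exists_components hx hZ
  rw [mdifferentiableAt_iff_continuousLinearMapAt e hxe] at hS ⊢
  have h1 := mdifferentiableAt_sum fun i ↦ (hc i).smul (mdifferentiableAt_sum fun j ↦ (hd j).smul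
    (mdifferentiableAt_clm_apply (hψd i j) hS))
  refine h1.congr_of_eventuallyEq ?_
  filter_upwards [(hX.isOpen.inter e.open_baseSet).mem_nhds ⟨hx, hxe⟩] with y hy
  obtain ⟨T, hT⟩ := hΦ y (S y)
  rw [hT, hYc y hy.1, hZd y hy.1, map_sum T, LinearMap.sum_apply, map_sum]
  refine Finset.sum_congr rfl fun i _ ↦ ?_
  rw [map_smul T, LinearMap.smul_apply, map_smul, map_sum, map_sum]
  refine congrArg _ (Finset.sum_congr rfl fun j _ ↦ ?_)
  rw [map_smul, map_smul, ← hT, hψ y hy]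
  rfl

lemma covDerivTwoForm_tensorialAt_left
    (hΦ : ∀ y s, ∃ T : TangentSpace I y →ₗ[ℝ] TangentSpace I y →ₗ[ℝ] V y,
      ∀ u v, Φ y s u v = T u v)
    (hd : ∀ Y : ∀ y : M, TangentSpace I y, MDiffAt (T% Y) x →
      MDiffAt (T% (fun y ↦ Φ y (S y) (Y y) (Z y) : ∀ y, V y)) x) (u : TangentSpace I x) :
    TensorialAt I E (fun Y : ∀ y : M, TangentSpace I y ↦
      A (fun y ↦ Φ y (S y) (Y y) (Z y)) x u - Φ x (A S x u) (Y x) (Z x)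
        - Φ x (S x) (leviCivita g Y x u) (Z x) - Φ x (S x) (Y x) (leviCivita g Z x u)) x where
  smul {f Y} hf hY := by
    have h1 : (fun y ↦ Φ y (S y) ((f • Y) y) (Z y)) = f • fun y ↦ Φ y (S y) (Y y) (Z y) := by
      funext y
      obtain ⟨T, hT⟩ := hΦ y (S y)
      simp [hT]
    rw [h1, A.isCovariantDerivativeOnUniv.leibniz (hd Y hY) hf, leviCivita_smul hf hY]
    obtain ⟨T, hT⟩ := hΦ x (S x)
    obtain ⟨T', hT'⟩ := hΦ x (A S x u)
    simp only [hT, hT', Pi.smul_apply', map_smul, map_add, LinearMap.add_apply, _root_.add_apply,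
      LinearMap.smul_apply, _root_.smul_apply, ContinuousLinearMap.smulRight_apply]
    module
  add {Y Y'} hY hY' := by
    have h1 : (fun y ↦ Φ y (S y) ((Y + Y') y) (Z y))
        = (fun y ↦ Φ y (S y) (Y y) (Z y)) + fun y ↦ Φ y (S y) (Y' y) (Z y) := by
      funext y
      obtain ⟨T, hT⟩ := hΦ y (S y)
      simp [hT]
    rw [h1, A.isCovariantDerivativeOnUniv.add (hd Y hY) (hd Y' hY'), leviCivita_add hY hY']
    obtain ⟨T, hT⟩ := hΦ x (S x)
    obtain ⟨T', hT'⟩ := hΦ x (A S x u)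
    simp only [hT, hT', Pi.add_apply, map_add, LinearMap.add_apply, _root_.add_apply]
    module

lemma covDerivTwoForm_tensorialAt_right
    (hΦ : ∀ y s, ∃ T : TangentSpace I y →ₗ[ℝ] TangentSpace I y →ₗ[ℝ] V y,
      ∀ u v, Φ y s u v = T u v)
    (hd : ∀ Z : ∀ y : M, TangentSpace I y, MDiffAt (T% Z) x →
      MDiffAt (T% (fun y ↦ Φ y (S y) (Y y) (Z y) : ∀ y, V y)) x) (u : TangentSpace I x) :
    TensorialAt I E (fun Z : ∀ y : M, TangentSpace I y ↦
      A (fun y ↦ Φ y (S y) (Y y) (Z y)) x u - Φ x (A S x u) (Y x) (Z x)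
        - Φ x (S x) (leviCivita g Y x u) (Z x) - Φ x (S x) (Y x) (leviCivita g Z x u)) x where
  smul {f Z} hf hZ := by
    have h1 : (fun y ↦ Φ y (S y) (Y y) ((f • Z) y)) = f • fun y ↦ Φ y (S y) (Y y) (Z y) := by
      funext y
      obtain ⟨T, hT⟩ := hΦ y (S y)
      simp [hT]
    rw [h1, A.isCovariantDerivativeOnUniv.leibniz (hd Z hZ) hf, leviCivita_smul hf hZ]
    obtain ⟨T, hT⟩ := hΦ x (S x)
    obtain ⟨T', hT'⟩ := hΦ x (A S x u)
    simp only [hT, hT', Pi.smul_apply', map_smul, map_add, _root_.add_apply,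
      _root_.smul_apply, ContinuousLinearMap.smulRight_apply]
    module
  add {Z Z'} hZ hZ' := by
    have h1 : (fun y ↦ Φ y (S y) (Y y) ((Z + Z') y))
        = (fun y ↦ Φ y (S y) (Y y) (Z y)) + fun y ↦ Φ y (S y) (Y y) (Z' y) := by
      funext y
      obtain ⟨T, hT⟩ := hΦ y (S y)
      simp [hT]
    rw [h1, A.isCovariantDerivativeOnUniv.add (hd Z hZ) (hd Z' hZ'), leviCivita_add hZ hZ']
    obtain ⟨T, hT⟩ := hΦ x (S x)
    obtain ⟨T', hT'⟩ := hΦ x (A S x u)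
    simp only [hT, hT', Pi.add_apply, map_add, _root_.add_apply]
    module

variable [Nonempty (Metric I M)] {X : κ → ∀ x : M, TangentSpace I x}

lemma covDerivTwoForm_eq (hX : IsCommutingFrame I U X) (hx : x ∈ U)
    (hxe : x ∈ e.baseSet)
    (hΦ : ∀ y s, ∃ T : TangentSpace I y →ₗ[ℝ] TangentSpace I y →ₗ[ℝ] V y,
      ∀ u v, Φ y s u v = T u v)
    (hψ : ∀ y ∈ U ∩ e.baseSet, ∀ s i j, e.continuousLinearMapAt ℝ y (Φ y s (X i y) (X j y))
      = ψ i j y (e.continuousLinearMapAt ℝ y s))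
    (hψd : ∀ i j, MDiffAt (ψ i j) x) (s : V x) (hY : MDiffAt (T% Y) x) (hZ : MDiffAt (T% Z) x)
    (u : TangentSpace I x) :
    covDerivTwoForm g A Φ x s u (Y x) (Z x)
      = A (fun y ↦ Φ y (FiberBundle.extend F s y) (Y y) (Z y)) x u
        - Φ x (A (FiberBundle.extend F s) x u) (Y x) (Z x)
        - Φ x s (leviCivita g Y x u) (Z x) - Φ x s (Y x) (leviCivita g Z x u) := by
  have hS := FiberBundle.mdifferentiableAt_extend I F s
  have hd := fun Y Z hY hZ ↦
    mdifferentiableAt_twoForm_apply (Y := Y) (Z := Z) e hX hx hxe hΦ hψ hψd hS hY hZ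
  have h := TensorialAt.pointwise₂ (I := I) (F := E) (F' := E) (x := x)
    (fun Z hZ ↦ covDerivTwoForm_tensorialAt_left (A := A) (g := g) hΦ (fun Y hY ↦ hd Y Z hY hZ) u)
    (fun Y hY ↦ covDerivTwoForm_tensorialAt_right (A := A) (g := g) hΦ (fun Z hZ ↦ hd Y Z hY hZ) u)
    (FiberBundle.mdifferentiableAt_extend I E (Y x)) hY
    (FiberBundle.mdifferentiableAt_extend I E (Z x)) hZ (by simp) (by simp)
  simp only [FiberBundle.extend_apply_self] at h
  exact h

lemma exists_covDerivTwoForm_eq_linearMap (hX : IsCommutingFrame I U X) (hx : x ∈ U)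
    (hxe : x ∈ e.baseSet)
    (hΦ : ∀ y s, ∃ T : TangentSpace I y →ₗ[ℝ] TangentSpace I y →ₗ[ℝ] V y,
      ∀ u v, Φ y s u v = T u v)
    (hψ : ∀ y ∈ U ∩ e.baseSet, ∀ s i j, e.continuousLinearMapAt ℝ y (Φ y s (X i y) (X j y))
      = ψ i j y (e.continuousLinearMapAt ℝ y s))
    (hψd : ∀ i j, MDiffAt (ψ i j) x) (s : V x) (w : TangentSpace I x) :
    ∃ T : TangentSpace I x →ₗ[ℝ] TangentSpace I x →ₗ[ℝ] V x, ∀ u v,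
      covDerivTwoForm g A Φ x s u v w = T u v := by
  have hS := FiberBundle.mdifferentiableAt_extend I F s
  have hw := FiberBundle.mdifferentiableAt_extend I E w
  have hd := fun Y hY ↦ mdifferentiableAt_twoForm_apply (Y := Y) e hX hx hxe hΦ hψ hψd hS hY hw
  have key : ∀ u v, covDerivTwoForm g A Φ x s u v w
      = TensorialAt.mkHom _ x (covDerivTwoForm_tensorialAt_left (A := A) (g := g) hΦ hd u) v :=
    fun u v ↦ by
      rw [TensorialAt.mkHom_apply_eq_extend, FiberBundle.extend_apply_self,
        FiberBundle.extend_apply_self, FiberBundle.extend_apply_self]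
      rfl
  have hadd : ∀ v (s t : V x), Φ x (s + t) v w = Φ x s v w + Φ x t v w := fun v s t ↦ by
    obtain ⟨c, rfl⟩ := hX.exists_eq_sum hx v
    obtain ⟨d, rfl⟩ := hX.exists_eq_sum hx w
    obtain ⟨T, hT⟩ := hΦ x s
    obtain ⟨T', hT'⟩ := hΦ x t
    obtain ⟨T'', hT''⟩ := hΦ x (s + t)
    refine eq_of_continuousLinearMapAt_eq e hxe ?_
    simp only [hT, hT', hT'', map_sum, LinearMap.sum_apply, map_add, map_smul, LinearMap.smul_apply,
      ← Finset.sum_add_distrib, ← smul_add]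
    refine Finset.sum_congr rfl fun i _ ↦ congrArg _ (Finset.sum_congr rfl fun j _ ↦ ?_)
    rw [← hT, ← hT', ← hT'', hψ x ⟨hx, hxe⟩, hψ x ⟨hx, hxe⟩, hψ x ⟨hx, hxe⟩, map_add, map_add]
  have hsmul : ∀ v (c : ℝ) (s : V x), Φ x (c • s) v w = c • Φ x s v w := fun v a s ↦ by
    obtain ⟨c, rfl⟩ := hX.exists_eq_sum hx v
    obtain ⟨d, rfl⟩ := hX.exists_eq_sum hx w
    obtain ⟨T, hT⟩ := hΦ x s
    obtain ⟨T', hT'⟩ := hΦ x (a • s)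
    refine eq_of_continuousLinearMapAt_eq e hxe ?_
    rw [map_smul]
    simp only [hT, hT', map_sum, LinearMap.sum_apply, map_smul, LinearMap.smul_apply, Finset.smul_sum]
    refine Finset.sum_congr rfl fun i _ ↦ Finset.sum_congr rfl fun j _ ↦ ?_
    rw [← hT, ← hT', hψ x ⟨hx, hxe⟩, hψ x ⟨hx, hxe⟩, map_smul, map_smul, smul_comm a,
      smul_comm a]
  obtain ⟨T, hT⟩ := hΦ x s
  refine ⟨LinearMap.mk₂ ℝ (fun u v ↦ covDerivTwoForm g A Φ x s u v w) ?_ ?_ ?_ ?_,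
    fun u v ↦ rfl⟩
  · intro u u' v
    have hv := FiberBundle.mdifferentiableAt_extend I E v
    have h := fun u ↦ covDerivTwoForm_eq (A := A) (g := g) e hX hx hxe hΦ hψ hψd s hv hw u
    rw [FiberBundle.extend_apply_self, FiberBundle.extend_apply_self] at h
    rw [h, h, h, leviCivita_add_left hv, leviCivita_add_left hw, map_add, map_add, hadd]
    simp only [hT, map_add, LinearMap.add_apply]
    module
  · intro c u v
    have hv := FiberBundle.mdifferentiableAt_extend I E v
    have h := fun u ↦ covDerivTwoForm_eq (A := A) (g := g) e hX hx hxe hΦ hψ hψd s hv hw u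
    rw [FiberBundle.extend_apply_self, FiberBundle.extend_apply_self] at h
    rw [h, h, leviCivita_smul_left hv, leviCivita_smul_left hw, map_smul, map_smul, hsmul]
    simp only [hT, map_smul, LinearMap.smul_apply]
    module
  · intro u v v'
    simp only [key, map_add]
  · intro c u v
    simp only [key, map_smul]

/-- The covariant derivative of a two-form in a commuting frame. -/
lemma continuousLinearMapAt_covDerivTwoForm (hX : IsCommutingFrame I U X) (hx : x ∈ U)
    (hxe : x ∈ e.baseSet)
    (hΦ : ∀ y s, ∃ T : TangentSpace I y →ₗ[ℝ] TangentSpace I y →ₗ[ℝ] V y,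
      ∀ u v, Φ y s u v = T u v)
    (hψ : ∀ y ∈ U ∩ e.baseSet, ∀ s i j, e.continuousLinearMapAt ℝ y (Φ y s (X i y) (X j y))
      = ψ i j y (e.continuousLinearMapAt ℝ y s))
    (hψd : ∀ i j, MDiffAt (ψ i j) x) (s : V x) (u : TangentSpace I x) (i j : κ) :
    e.continuousLinearMapAt ℝ x (covDerivTwoForm g A Φ x s u (X i x) (X j x))
      = (mvfderiv I (ψ i j) x u
          + (connectionForm e A x u * ψ i j x - ψ i j x * connectionForm e A x u))
          (e.continuousLinearMapAt ℝ x s)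
        - e.continuousLinearMapAt ℝ x (Φ x s (leviCivita g (X i) x u) (X j x))
        - e.continuousLinearMapAt ℝ x (Φ x s (X i x) (leviCivita g (X j) x u)) := by
  have hS := FiberBundle.mdifferentiableAt_extend I F s
  have hd := mdifferentiableAt_twoForm_apply e hX hx hxe hΦ hψ hψd hS (hX.mdifferentiableAt hx i)
    (hX.mdifferentiableAt hx j)
  have hS' := (mdifferentiableAt_iff_continuousLinearMapAt e hxe).1 hS
  have h2 : (fun y ↦ e.continuousLinearMapAt ℝ y (Φ y (FiberBundle.extend F s y) (X i y) (X j y)))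
      =ᶠ[𝓝 x] fun y ↦ ψ i j y (e.continuousLinearMapAt ℝ y (FiberBundle.extend F s y)) := by
    filter_upwards [(hX.isOpen.inter e.open_baseSet).mem_nhds ⟨hx, hxe⟩] with y hy
    exact hψ y hy _ i j
  rw [covDerivTwoForm_eq e hX hx hxe hΦ hψ hψd s (hX.mdifferentiableAt hx i)
    (hX.mdifferentiableAt hx j), map_sub, map_sub, map_sub,
    continuousLinearMapAt_covariantDerivative e A hxe hd, mvfderiv_congr h2,
    mvfderiv_clm_apply (hψd i j) hS', hψ x ⟨hx, hxe⟩, hψ x ⟨hx, hxe⟩,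
    continuousLinearMapAt_covariantDerivative e A hxe hS, FiberBundle.extend_apply_self]
  simp only [_root_.add_apply, _root_.sub_apply, _root_.mul_apply_eq_comp, map_add]
  abel

end TwoForm

end ElectricYM

/-! ### Coordinate frames -/

namespace ElectricYM

open Filter Set
open scoped Topology

variable {E : Type*} [NormedAddCommGroup E] [NormedSpace ℝ E] [FiniteDimensional ℝ E]
  {H : Type*} [TopologicalSpace H] {I : ModelWithCorners ℝ E H}
  {M : Type*} [TopologicalSpace M] [ChartedSpace H M] [IsManifold I ∞ M]
  {κ : Type*} [Fintype κ] [DecidableEq κ] (b : Module.Basis κ ℝ E)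
  {G : Type*} [NormedAddCommGroup G] [NormedSpace ℝ G]

lemma contMDiffAt_const_vectorField (v z : E) :
    ContMDiffAt 𝓘(ℝ, E) 𝓘(ℝ, E).tangent ∞ (fun x ↦ TotalSpace.mk' E
      (E := fun x : E ↦ TangentSpace 𝓘(ℝ, E) x) x v) z :=
  contMDiffAt_vectorSpace_iff_contDiffAt.2 contDiffAt_const

lemma mlieBracket_const (v w z : E) :
    VectorField.mlieBracket 𝓘(ℝ, E) (fun _ ↦ v : ∀ y : E, TangentSpace 𝓘(ℝ, E) y)
      (fun _ ↦ w : ∀ y : E, TangentSpace 𝓘(ℝ, E) y) z = 0 := by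
  have h : ∀ V W : ∀ y : E, TangentSpace 𝓘(ℝ, E) y,
      VectorField.mlieBracket 𝓘(ℝ, E) V W = VectorField.lieBracket ℝ V W := fun V W ↦ by
    rw [← VectorField.mlieBracketWithin_univ, VectorField.mlieBracketWithin_eq_lieBracketWithin]
    exact VectorField.lieBracketWithin_univ
  refine (congrFun (h _ _) z).trans ?_
  change fderiv ℝ (fun _ : E ↦ w) z v - fderiv ℝ (fun _ : E ↦ v) z w = 0
  simp

lemma minSmoothness_two_le : minSmoothness ℝ 2 ≤ ∞ := by
  rw [minSmoothness_of_isRCLikeNormedField]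
  exact WithTop.coe_le_coe.2 (le_top : (2 : ℕ∞) ≤ ⊤)

variable (I) in
/-- The coordinate vector fields of the local coordinates `ψ`. -/
def coordinateField (ψ : M → E) (i : κ) (y : M) : TangentSpace I y :=
  VectorField.mpullback I 𝓘(ℝ, E) ψ (fun _ ↦ (b i : E)) y

lemma mfderiv_coordinateField {ψ : M → E} {y : M}
    (h : (mfderiv I 𝓘(ℝ, E) ψ y).IsInvertible) (i : κ) :
    mfderiv I 𝓘(ℝ, E) ψ y (coordinateField I b ψ i y) = b i := by
  have := ContinuousLinearMap.IsInvertible.self_apply_inverse h (b i : E)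
  exact this

lemma isCommutingFrame_coordinateField {U : Set M} (hU : IsOpen U) {ψ : M → E}
    (hψ : ContMDiffOn I 𝓘(ℝ, E) ∞ ψ U)
    (hinv : ∀ y ∈ U, (mfderiv I 𝓘(ℝ, E) ψ y).IsInvertible) :
    IsCommutingFrame I U (coordinateField I b ψ) where
  isOpen := hU
  contMDiffOn i y hy := by
    exact ((contMDiffAt_const_vectorField (b i) (ψ y)).mpullback_vectorField_preimage (hψ.contMDiffAt (hU.mem_nhds hy)) (hinv y hy)
      (by simp)).contMDiffWithinAt
  linearIndependent y hy := by
    have h1 : LinearIndependent ℝ fun i ↦ mfderiv I 𝓘(ℝ, E) ψ y (coordinateField I b ψ i y) := by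
      simp only [mfderiv_coordinateField b (hinv y hy)]
      exact b.linearIndependent
    exact LinearIndependent.of_comp (mfderiv I 𝓘(ℝ, E) ψ y).toLinearMap h1
  span y hy := by
    obtain ⟨L, hL⟩ := hinv y hy
    rw [eq_top_iff]
    intro v _
    have h1 : v = ∑ i, b.repr (L v) i • coordinateField I b ψ i y := by
      apply L.injective
      have h2 : ∀ i, L (coordinateField I b ψ i y) = b i := fun i ↦ by
        rw [← mfderiv_coordinateField b (hinv y hy) i, ← hL]
        rfl
      rw [map_sum]
      simp only [map_smul, h2]
      exact (b.sum_repr (L v)).symm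
    rw [h1]
    exact Submodule.sum_mem _ fun i _ ↦ Submodule.smul_mem _ _ (Submodule.subset_span ⟨i, rfl⟩)
  bracket y hy i j := by
    have : IsManifold I (minSmoothness ℝ 2) M := IsManifold.of_le (n := ∞) minSmoothness_two_le
    have hc : ∀ i, MDifferentiableAt 𝓘(ℝ, E) 𝓘(ℝ, E).tangent (fun x ↦ TotalSpace.mk' E
        (E := fun x : E ↦ TangentSpace 𝓘(ℝ, E) x) x (b i : E)) (ψ y) := fun i ↦
      (contMDiffAt_const_vectorField (b i) (ψ y)).mdifferentiableAt (by simp)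
    have := VectorField.mpullback_mlieBracket (n := ∞) (hc i) (hc j)
      (hψ.contMDiffAt (hU.mem_nhds hy))
      minSmoothness_two_le
    have h2 : coordinateField I b ψ = fun i ↦
      VectorField.mpullback I 𝓘(ℝ, E) ψ (fun _ ↦ (b i : E)) := rfl
    rw [h2, ← this, VectorField.mpullback_apply, mlieBracket_const, map_zero]

variable (p : M)

variable (I) in
/-- The frame of coordinate vector fields of the preferred chart at `p`. -/
abbrev chartFrame (i : κ) (y : M) : TangentSpace I y := coordinateField I b (extChartAt I p) i y

lemma isCommutingFrame_chartFrame {U : Set M} (hU : IsOpen U) (hUp : U ⊆ (chartAt H p).source) :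
    IsCommutingFrame I U (chartFrame I b p) :=
  isCommutingFrame_coordinateField b hU (contMDiffOn_extChartAt.mono hUp) fun y hy ↦
    isInvertible_mfderiv_extChartAt (by simpa using hUp hy)

lemma chartFrame_eq {y : M} (hy : y ∈ (chartAt H p).source) (i : κ) :
    chartFrame I b p i y
      = mfderivWithin 𝓘(ℝ, E) I (extChartAt I p).symm (range I) (extChartAt I p y) (b i) := by
  have hy' : y ∈ (extChartAt I p).source := by simpa using hy
  have h := mfderivWithin_extChartAt_symm_comp_mfderiv_extChartAt' (I := I) hy'
  have h2 := mfderiv_coordinateField b (isInvertible_mfderiv_extChartAt (I := I) hy') i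
  rw [← h2]
  exact (DFunLike.congr_fun h (chartFrame I b p i y)).symm

lemma mvfderiv_chartFrame {y : M} (hy : y ∈ (chartAt H p).source) {f : M → G} (hf : MDiffAt f y)
    (i : κ) :
    mvfderiv I f y (chartFrame I b p i y)
      = fderivWithin ℝ (fun z ↦ f ((extChartAt I p).symm z)) (range I) (extChartAt I p y) (b i) := by
  have hy' : y ∈ (extChartAt I p).source := by simpa using hy
  have hz : extChartAt I p y ∈ (extChartAt I p).target := (extChartAt I p).map_source hy'
  have hu : UniqueMDiffWithinAt 𝓘(ℝ, E) (range I) (extChartAt I p y) :=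
    I.uniqueMDiffOn _ (extChartAt_target_subset_range p hz)
  have hsymm := mdifferentiableWithinAt_extChartAt_symm (I := I) hz
  have hf' : MDifferentiableAt I 𝓘(ℝ, G) f ((extChartAt I p).symm (extChartAt I p y)) := by
    rwa [(extChartAt I p).left_inv hy']
  have h1 := mfderiv_comp_mfderivWithin (extChartAt I p y) hf' hsymm hu
  have h2 := DFunLike.congr_fun h1 (b i : E)
  rw [mfderivWithin_eq_fderivWithin] at h2
  refine Eq.trans ?_ h2.symm
  rw [chartFrame_eq b p hy]
  change _ = mfderiv I 𝓘(ℝ, G) f ((extChartAt I p).symm (extChartAt I p y)) _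
  rw [(extChartAt I p).left_inv hy']
  rfl

section Target

variable {U : Set M} {f : M → G}

variable (I) in
/-- The open set `U` in the preferred chart at `p`. -/
def chartImage (U : Set M) : Set E := (extChartAt I p).target ∩ (extChartAt I p).symm ⁻¹' U

lemma uniqueDiffOn_chartImage (hU : IsOpen U) : UniqueDiffOn ℝ (chartImage I p U) :=
  (hU.uniqueMDiffOn (I := I)).uniqueDiffOn_target_inter p

variable {p} in
lemma extChartAt_mem_chartImage (hUp : U ⊆ (chartAt H p).source) {y : M} (hy : y ∈ U) :
    extChartAt I p y ∈ chartImage I p U := by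
  have hy' : y ∈ (extChartAt I p).source := by simpa using hUp hy
  exact ⟨(extChartAt I p).map_source hy', by rwa [mem_preimage, (extChartAt I p).left_inv hy']⟩

variable {p} in
lemma chartImage_mem_nhdsWithin (hU : IsOpen U) (hUp : U ⊆ (chartAt H p).source) {y : M}
    (hy : y ∈ U) : chartImage I p U ∈ 𝓝[range I] (extChartAt I p y) := by
  have hy' : y ∈ (extChartAt I p).source := by simpa using hUp hy
  exact inter_mem (extChartAt_target_mem_nhdsWithin' hy')
    (mem_nhdsWithin_of_mem_nhds (extChartAt_preimage_mem_nhds' hy' (hU.mem_nhds hy)))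

lemma contDiffOn_comp_extChartAt_symm (hf : CMDiff[U] ∞ f) :
    ContDiffOn ℝ ∞ (fun z ↦ f ((extChartAt I p).symm z)) (chartImage I p U) := by
  rw [← contMDiffOn_iff_contDiffOn]
  exact hf.comp ((contMDiffOn_extChartAt_symm p).mono inter_subset_left) inter_subset_right

lemma contMDiffOn_comp_extChartAt (hUp : U ⊆ (chartAt H p).source) {f : E → G}
    (hf : ContDiffOn ℝ ∞ f (chartImage I p U)) : CMDiff[U] ∞ (fun y ↦ f (extChartAt I p y)) :=
  (contMDiffOn_iff_contDiffOn.2 hf).comp (contMDiffOn_extChartAt.mono hUp)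
    fun _ hy ↦ extChartAt_mem_chartImage hUp hy

lemma fderivWithin_range_eq (hU : IsOpen U) (hUp : U ⊆ (chartAt H p).source) {f : E → G}
    (hf : ContDiffOn ℝ ∞ f (chartImage I p U)) {y : M} (hy : y ∈ U) :
    fderivWithin ℝ f (range I) (extChartAt I p y)
      = fderivWithin ℝ f (chartImage I p U) (extChartAt I p y) := by
  have h := extChartAt_mem_chartImage (I := I) hUp hy
  exact fderivWithin_of_mem_nhdsWithin (chartImage_mem_nhdsWithin hU hUp hy)
    (I.uniqueDiffOn _ (extChartAt_target_subset_range p h.1))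
    ((hf _ h).differentiableWithinAt (by simp))

lemma mvfderiv_chartFrame' (hU : IsOpen U) (hUp : U ⊆ (chartAt H p).source)
    (hf : CMDiff[U] ∞ f) {y : M} (hy : y ∈ U) (i : κ) :
    mvfderiv I f y (chartFrame I b p i y) = fderivWithin ℝ (fun z ↦ f ((extChartAt I p).symm z))
      (chartImage I p U) (extChartAt I p y) (b i) := by
  rw [mvfderiv_chartFrame b p (hUp hy) ((hf.contMDiffAt (hU.mem_nhds hy)).mdifferentiableAt
    (by simp)), fderivWithin_range_eq p hU hUp (contDiffOn_comp_extChartAt_symm p hf) hy]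

lemma contDiffOn_fderivWithin_chartImage (hU : IsOpen U) (hf : CMDiff[U] ∞ f) :
    ContDiffOn ℝ ∞ (fderivWithin ℝ (fun z ↦ f ((extChartAt I p).symm z)) (chartImage I p U))
      (chartImage I p U) :=
  (contDiffOn_comp_extChartAt_symm p hf).fderivWithin (uniqueDiffOn_chartImage p hU) (by simp)

/-- Derivatives of smooth functions along a coordinate field are smooth. -/
lemma contMDiffOn_mvfderiv_chartFrame (hU : IsOpen U)
    (hUp : U ⊆ (chartAt H p).source) (hf : CMDiff[U] ∞ f) (i : κ) :
    CMDiff[U] ∞ (fun y ↦ mvfderiv I f y (chartFrame I b p i y)) :=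
  (contMDiffOn_comp_extChartAt p hUp ((contDiffOn_fderivWithin_chartImage p hU hf).clm_apply
    (contDiffOn_const (c := b i)))).congr fun _ hy ↦ mvfderiv_chartFrame' b p hU hUp hf hy i

/-- The coordinate derivatives commute. -/
lemma derivationsCommuteAt_chartFrame {x : M} (hx : x ∈ (chartAt H p).source) :
    DerivationsCommuteAt I G (chartFrame I b p) x := by
  intro f W hW hxW hf
  set U := W ∩ (chartAt H p).source with hUdef
  have hU : IsOpen U := hW.inter (chartAt H p).open_source
  have hUp : U ⊆ (chartAt H p).source := inter_subset_right
  have hxU : x ∈ U := ⟨hxW, hx⟩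
  have hf' : CMDiff[U] ∞ f := hf.mono inter_subset_left
  set T := chartImage I p U
  set f' := fun z ↦ f ((extChartAt I p).symm z)
  have hxT : extChartAt I p x ∈ T := extChartAt_mem_chartImage hUp hxU
  have key : ∀ i j, mvfderiv I (fun y ↦ mvfderiv I f y (chartFrame I b p j y)) x
      (chartFrame I b p i x)
      = fderivWithin ℝ (fderivWithin ℝ f' T) T (extChartAt I p x) (b i) (b j) := fun i j ↦ by
    have h2 := contDiffOn_fderivWithin_chartImage p hU hf'
    rw [mvfderiv_chartFrame' b p hU hUp (contMDiffOn_mvfderiv_chartFrame b p hU hUp hf' j) hxU]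
    have h3 : fderivWithin ℝ (fun z ↦ mvfderiv I f ((extChartAt I p).symm z)
        (chartFrame I b p j ((extChartAt I p).symm z))) T (extChartAt I p x)
        = fderivWithin ℝ (fun z ↦ fderivWithin ℝ f' T z (b j)) T (extChartAt I p x) :=
      fderivWithin_congr (fun z hz ↦ by
        rw [mvfderiv_chartFrame' b p hU hUp hf' hz.2, (extChartAt I p).right_inv hz.1])
        (by
          rw [mvfderiv_chartFrame' b p hU hUp hf' hxT.2, (extChartAt I p).right_inv hxT.1])
    rw [h3, fderivWithin_clm_apply (uniqueDiffOn_chartImage p hU _ hxT)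
      ((h2 _ hxT).differentiableWithinAt (by simp)) (differentiableWithinAt_const _)]
    simp only [fderivWithin_fun_const, Pi.zero_apply, ContinuousLinearMap.comp_zero, zero_add]
    rfl
  intro i j
  rw [key, key]
  refine ContDiffWithinAt.isSymmSndFDerivWithinAt (n := ∞)
    (contDiffOn_comp_extChartAt_symm p hf' _ hxT) minSmoothness_two_le (uniqueDiffOn_chartImage p hU)
    ?_ hxT _ _
  have hx' : x ∈ (extChartAt I p).source := by simpa using hx
  have := extChartAt_mem_closure_interior (I := I) (s := U)
    (by rw [hU.interior_eq]; exact subset_closure hxU) hx'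
  rwa [inter_comm] at this

end Target

end ElectricYM

/-! ### Smooth functions on an open set and their derivatives along a frame -/

namespace ElectricYM

open Filter Set
open scoped Topology

variable {E : Type*} [NormedAddCommGroup E] [NormedSpace ℝ E] [FiniteDimensional ℝ E]
  {H : Type*} [TopologicalSpace H] {I : ModelWithCorners ℝ E H}
  {M : Type*} [TopologicalSpace M] [ChartedSpace H M] [IsManifold I ∞ M]
  {κ : Type*} [Fintype κ] [DecidableEq κ] (b : Module.Basis κ ℝ E)
  {U : Set M} {𝔸 : Type*} [NormedRing 𝔸] [NormedAlgebra ℝ 𝔸] [FiniteDimensional ℝ 𝔸]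

lemma contMDiffOn_mul {f g : M → 𝔸} (hf : ContMDiffOn I 𝓘(ℝ, 𝔸) ∞ f U) (hg : ContMDiffOn I 𝓘(ℝ, 𝔸) ∞ g U) :
    ContMDiffOn I 𝓘(ℝ, 𝔸) ∞ (fun y ↦ f y * g y) U := by
  have h : ContMDiffOn I 𝓘(ℝ, 𝔸 →L[ℝ] 𝔸) ∞ (fun y ↦ ContinuousLinearMap.mul ℝ 𝔸 (f y)) U :=
    (ContinuousLinearMap.mul ℝ 𝔸).contDiff.contMDiff.comp_contMDiffOn hf
  exact h.clm_apply hg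

variable (I U 𝔸) in
/-- The algebra of functions on `U` with values in `𝔸` which are smooth. -/
def smoothSubalgebra : Subalgebra ℝ (U → 𝔸) where
  carrier := {f | ∃ f' : M → 𝔸, ContMDiffOn I 𝓘(ℝ, 𝔸) ∞ f' U ∧ ∀ x : U, f x = f' x}
  mul_mem' := by
    rintro f g ⟨f', hf, hf'⟩ ⟨g', hg, hg'⟩
    exact ⟨fun y ↦ f' y * g' y, contMDiffOn_mul hf hg, fun x ↦ by simp [hf', hg']⟩
  add_mem' := by
    rintro f g ⟨f', hf, hf'⟩ ⟨g', hg, hg'⟩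
    exact ⟨fun y ↦ f' y + g' y, hf.add hg, fun x ↦ by simp [hf', hg']⟩
  algebraMap_mem' r := ⟨fun _ ↦ algebraMap ℝ 𝔸 r, contMDiffOn_const, fun _ ↦ rfl⟩

variable (I U 𝔸) in
/-- The type of functions on `U` with values in `𝔸` which are smooth. -/
def SmoothFun : Type _ := smoothSubalgebra I U 𝔸

namespace SmoothFun

instance : Ring (SmoothFun I U 𝔸) := inferInstanceAs (Ring (smoothSubalgebra I U 𝔸))

instance : CommRing (SmoothFun I U ℝ) := inferInstanceAs (CommRing (smoothSubalgebra I U ℝ))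

instance : Algebra ℝ (SmoothFun I U 𝔸) := inferInstanceAs (Algebra ℝ (smoothSubalgebra I U 𝔸))

/-- The restriction to `U` of a function which is smooth on `U`. -/
def mk (f : M → 𝔸) (hf : ContMDiffOn I 𝓘(ℝ, 𝔸) ∞ f U) : SmoothFun I U 𝔸 := ⟨fun x ↦ f x, f, hf, fun _ ↦ rfl⟩

/-- An extension of a smooth function on `U` to a function on `M`. -/
def rep (f : SmoothFun I U 𝔸) : M → 𝔸 := Classical.choose f.2

lemma contMDiffOn_rep (f : SmoothFun I U 𝔸) : ContMDiffOn I 𝓘(ℝ, 𝔸) ∞ (rep f) U := (Classical.choose_spec f.2).1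

lemma rep_apply (f : SmoothFun I U 𝔸) (x : U) : rep f x = f.1 x :=
  ((Classical.choose_spec f.2).2 x).symm

@[simp] lemma mk_apply (f : M → 𝔸) (hf : ContMDiffOn I 𝓘(ℝ, 𝔸) ∞ f U) (x : U) : (mk f hf).1 x = f x := rfl

instance : Module (SmoothFun I U ℝ) (SmoothFun I U 𝔸) where
  smul f a := ⟨fun x ↦ f.1 x • a.1 x, fun y ↦ rep f y • rep a y,
    (contMDiffOn_rep f).smul (contMDiffOn_rep a), fun x ↦ by
      beta_reduce
      rw [rep_apply, rep_apply]⟩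
  one_smul a := Subtype.ext (funext fun x ↦ one_smul ℝ (a.1 x))
  mul_smul f g a := Subtype.ext (funext fun x ↦ mul_smul (f.1 x) (g.1 x) (a.1 x))
  smul_zero f := Subtype.ext (funext fun x ↦ smul_zero (f.1 x))
  smul_add f a a' := Subtype.ext (funext fun x ↦ smul_add (f.1 x) (a.1 x) (a'.1 x))
  add_smul f g a := Subtype.ext (funext fun x ↦ add_smul (f.1 x) (g.1 x) (a.1 x))
  zero_smul a := Subtype.ext (funext fun x ↦ zero_smul ℝ (a.1 x))

@[simp] lemma smul_apply (f : SmoothFun I U ℝ) (a : SmoothFun I U 𝔸) (x : U) :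
    (f • a).1 x = f.1 x • a.1 x := rfl

/-- Functions with values in `𝔸` are an algebra over the scalar functions. -/
instance algebraScalar : Algebra (SmoothFun I U ℝ) (SmoothFun I U 𝔸) :=
  Algebra.ofModule (fun f a a' ↦ Subtype.ext (funext fun x ↦ smul_mul_assoc (f.1 x) (a.1 x) (a'.1 x)))
    (fun f a a' ↦ Subtype.ext (funext fun x ↦ mul_smul_comm (f.1 x) (a.1 x) (a'.1 x)))

@[simp] lemma add_apply (a a' : SmoothFun I U 𝔸) (x : U) : (a + a').1 x = a.1 x + a'.1 x := rfl
@[simp] lemma sub_apply (a a' : SmoothFun I U 𝔸) (x : U) : (a - a').1 x = a.1 x - a'.1 x := rfl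
@[simp] lemma neg_apply (a : SmoothFun I U 𝔸) (x : U) : (-a).1 x = -a.1 x := rfl
@[simp] lemma mul_apply (a a' : SmoothFun I U 𝔸) (x : U) : (a * a').1 x = a.1 x * a'.1 x := rfl
@[simp] lemma zero_apply (x : U) : (0 : SmoothFun I U 𝔸).1 x = 0 := rfl
@[simp] lemma one_apply (x : U) : (1 : SmoothFun I U 𝔸).1 x = 1 := rfl
@[simp] lemma pow_apply (a : SmoothFun I U 𝔸) (k : ℕ) (x : U) : (a ^ k).1 x = a.1 x ^ k := rfl
@[simp] lemma real_smul_apply (r : ℝ) (a : SmoothFun I U 𝔸) (x : U) :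
    (r • a).1 x = r • a.1 x := rfl
@[simp] lemma natCast_apply (k : ℕ) (x : U) : (k : SmoothFun I U 𝔸).1 x = k := by
  induction k with
  | zero => simp
  | succ k ih => simp [ih]
@[simp] lemma sum_apply {J : Type*} (t : Finset J) (a : J → SmoothFun I U 𝔸) (x : U) :
    (∑ j ∈ t, a j).1 x = ∑ j ∈ t, (a j).1 x := by
  classical
  induction t using Finset.induction_on with
  | empty => simp
  | insert i t hi ih => rw [Finset.sum_insert hi, Finset.sum_insert hi, add_apply, ih]

lemma ext_apply {a a' : SmoothFun I U 𝔸} (h : ∀ x : U, a.1 x = a'.1 x) : a = a' :=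
  Subtype.ext (funext h)

lemma mdifferentiableAt_rep (hU : IsOpen U) (f : SmoothFun I U 𝔸) {x : M} (hx : x ∈ U) :
    MDifferentiableAt I 𝓘(ℝ, 𝔸) (rep f) x :=
  ((contMDiffOn_rep f).contMDiffAt (hU.mem_nhds hx)).mdifferentiableAt (by simp)

lemma mvfderiv_rep_congr (hU : IsOpen U) {f : SmoothFun I U 𝔸} {g : M → 𝔸} {x : M} (hx : x ∈ U)
    (h : ∀ y : U, f.1 y = g y) : mvfderiv I (rep f) x = mvfderiv I g x := by
  refine mvfderiv_congr ?_
  filter_upwards [hU.mem_nhds hx] with y hy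
  rw [rep_apply f ⟨y, hy⟩, h]

variable (p : M) (hU : IsOpen U) (hUp : U ⊆ (chartAt H p).source)

/-- The derivative along a coordinate vector field. -/
def deriv (i : κ) (f : SmoothFun I U 𝔸) : SmoothFun I U 𝔸 :=
  mk (fun y ↦ mvfderiv I (rep f) y (chartFrame I b p i y))
    (contMDiffOn_mvfderiv_chartFrame b p hU hUp (contMDiffOn_rep f) i)

variable {p}

lemma deriv_apply (i : κ) {f : SmoothFun I U 𝔸} {g : M → 𝔸} (h : ∀ y : U, f.1 y = g y) (x : U) :
    (deriv b p hU hUp i f).1 x = mvfderiv I g x (chartFrame I b p i x) := by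
  change mvfderiv I (rep f) x (chartFrame I b p i x) = _
  rw [mvfderiv_rep_congr hU x.2 h]

lemma deriv_add (i : κ) (f g : SmoothFun I U 𝔸) :
    deriv b p hU hUp i (f + g) = deriv b p hU hUp i f + deriv b p hU hUp i g :=
  ext_apply fun x ↦ by
    rw [deriv_apply b hU hUp i (g := rep f + rep g) fun y ↦ by simp [rep_apply],
      mvfderiv_add (mdifferentiableAt_rep hU f x.2) (mdifferentiableAt_rep hU g x.2)]
    rfl

lemma mvfderiv_mul' {f g : M → 𝔸} {x : M} (hf : MDifferentiableAt I 𝓘(ℝ, 𝔸) f x) (hg : MDifferentiableAt I 𝓘(ℝ, 𝔸) g x)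
    (u : TangentSpace I x) :
    mvfderiv I (fun y ↦ f y * g y) x u = mvfderiv I f x u * g x + f x * mvfderiv I g x u := by
  let f' : E →L[ℝ] 𝔸 := mvfderiv I f x
  let g' : E →L[ℝ] 𝔸 := mvfderiv I g x
  have h1 : HasFDerivWithinAt (fun z ↦ f ((extChartAt I x).symm z)) f' (range I)
      (extChartAt I x x) := hf.hasMFDerivAt.2
  have h2 : HasFDerivWithinAt (fun z ↦ g ((extChartAt I x).symm z)) g' (range I)
      (extChartAt I x x) := hg.hasMFDerivAt.2
  have h3 := h1.mul' h2
  rw [(extChartAt I x).left_inv (mem_extChartAt_source x)] at h3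
  have h4 : HasMFDerivAt I 𝓘(ℝ, 𝔸) (fun y ↦ f y * g y) x _ :=
    ⟨hf.continuousAt.mul hg.continuousAt, h3⟩
  have h5 : mvfderiv I (fun y ↦ f y * g y) x u = _ := DFunLike.congr_fun h4.mfderiv u
  rw [h5]
  exact add_comm _ _

lemma mvfderiv_smul' {f : M → ℝ} {g : M → 𝔸} {x : M} (hf : MDiffAt f x) (hg : MDifferentiableAt I 𝓘(ℝ, 𝔸) g x)
    (u : TangentSpace I x) :
    mvfderiv I (fun y ↦ f y • g y) x u = mvfderiv I f x u • g x + f x • mvfderiv I g x u := by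
  have h := mvfderiv_smul hf hg
  have h2 : (fun y ↦ f y • g y) = f • g := rfl
  rw [h2, h]
  simp
  abel

end SmoothFun

variable {F : Type*} [NormedAddCommGroup F] [NormedSpace ℝ F] [FiniteDimensional ℝ F] {p : M}
  (hU : IsOpen U) (hUp : U ⊆ (chartAt H p).source)

open SmoothFun in
variable (𝔸) in
/-- The calculus of smooth functions on `U` in local coordinates. -/
def chartCalculus : Calculus κ (SmoothFun I U ℝ) (SmoothFun I U 𝔸) where
  d i :=
    { toFun := deriv b p hU hUp i
      map_add' := deriv_add b hU hUp i
      map_smul' := fun c f ↦ ext_apply fun x ↦ by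
        rw [deriv_apply b hU hUp i (g := fun y ↦ c • rep f y) fun y ↦ by simp [rep_apply],
          mvfderiv_smul' mdifferentiableAt_const (mdifferentiableAt_rep hU f x.2), mvfderiv_const,
          _root_.zero_apply, zero_smul, zero_add]
        rfl }
  D i :=
    { toFun := deriv b p hU hUp i
      map_zero' := ext_apply fun x ↦ by
        rw [deriv_apply b hU hUp i (g := fun _ ↦ 0) fun y ↦ rfl, mvfderiv_const]
        rfl
      map_add' := deriv_add b hU hUp i }
  d_mul i f g := ext_apply fun x ↦ by
    have h := mvfderiv_mul' (mdifferentiableAt_rep hU f x.2) (mdifferentiableAt_rep hU g x.2)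
      (chartFrame I b p i x)
    rw [← deriv_apply b hU hUp i (f := f * g) fun y ↦ by simp [rep_apply]] at h
    refine h.trans ?_
    rw [rep_apply, rep_apply]
    rfl
  D_mul i f g := ext_apply fun x ↦ by
    have h := mvfderiv_mul' (mdifferentiableAt_rep hU f x.2) (mdifferentiableAt_rep hU g x.2)
      (chartFrame I b p i x)
    rw [← deriv_apply b hU hUp i (f := f * g) fun y ↦ by simp [rep_apply]] at h
    refine h.trans ?_
    rw [rep_apply, rep_apply]
    rfl
  D_smul i f g := ext_apply fun x ↦ by
    have h := mvfderiv_smul' (mdifferentiableAt_rep hU f x.2) (mdifferentiableAt_rep hU g x.2)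
      (chartFrame I b p i x)
    rw [← deriv_apply b hU hUp i (f := f • g) fun y ↦ by simp [rep_apply]] at h
    refine h.trans ?_
    rw [rep_apply, rep_apply]
    rfl
  d_comm i j f := ext_apply fun x ↦
    (deriv_apply b hU hUp i (fun y ↦ rfl) x).trans <|
    (derivationsCommuteAt_chartFrame b p (hUp x.2) (rep f) U hU x.2 (contMDiffOn_rep f) i j).trans
    (deriv_apply b hU hUp j (fun y ↦ rfl) x).symm
  D_comm i j f := ext_apply fun x ↦
    (deriv_apply b hU hUp i (fun y ↦ rfl) x).trans <|
    (derivationsCommuteAt_chartFrame b p (hUp x.2) (rep f) U hU x.2 (contMDiffOn_rep f) i j).trans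
    (deriv_apply b hU hUp j (fun y ↦ rfl) x).symm

lemma chartCalculus_d_apply (i : κ) {f : SmoothFun I U ℝ} {g : M → ℝ} (h : ∀ y : U, f.1 y = g y)
    (x : U) : ((chartCalculus b 𝔸 hU hUp).d i f).1 x = mvfderiv I g x (chartFrame I b p i x) :=
  SmoothFun.deriv_apply b hU hUp i h x

lemma chartCalculus_D_apply (i : κ) {f : SmoothFun I U 𝔸} {g : M → 𝔸} (h : ∀ y : U, f.1 y = g y)
    (x : U) : ((chartCalculus b 𝔸 hU hUp).D i f).1 x = mvfderiv I g x (chartFrame I b p i x) :=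
  SmoothFun.deriv_apply b hU hUp i h x

end ElectricYM

/-! ### The current in local coordinates -/

namespace ElectricYM

open Filter Set
open scoped Topology

variable {E : Type*} [NormedAddCommGroup E] [NormedSpace ℝ E] [FiniteDimensional ℝ E]
  {H : Type*} [TopologicalSpace H] {I : ModelWithCorners ℝ E H}
  {M : Type*} [TopologicalSpace M] [ChartedSpace H M] [IsManifold I ∞ M]
  {F : Type*} [NormedAddCommGroup F] [NormedSpace ℝ F] [FiniteDimensional ℝ F]
  {κ : Type*} [Fintype κ] [DecidableEq κ] (b : Module.Basis κ ℝ E)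
  {V : M → Type*} [TopologicalSpace (TotalSpace F V)]
  [∀ x, AddCommGroup (V x)] [∀ x, Module ℝ (V x)] [∀ x, TopologicalSpace (V x)]
  [∀ x, IsTopologicalAddGroup (V x)] [∀ x, ContinuousSMul ℝ (V x)]
  [FiberBundle F V] [VectorBundle ℝ F V] [ContMDiffVectorBundle ∞ F V I]

variable (H F V) in
/-- An open set contained in the domains of the preferred chart at `p` and of a trivialization. -/
structure Patch where
  p : M
  U : Set M
  isOpen : IsOpen U
  subset_source : U ⊆ (chartAt H p).source
  e : Trivialization F (TotalSpace.proj : TotalSpace F V → M)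
  [mem : MemTrivializationAtlas e]
  subset_baseSet : U ⊆ e.baseSet

attribute [instance] Patch.mem

lemma map_smul_sub_smul {W : Type*} [AddCommGroup W] [Module ℝ W] [TopologicalSpace W]
    (L : W →L[ℝ] F) (a c : ℝ) (v w : W) : L (a • v - c • w) = a • L v - c • L w := by
  simp

lemma SmoothFun.smul_sub_natCast_smul_apply {U : Set M} (f : SmoothFun I U ℝ) (k : ℕ)
    (Φ Ψ : SmoothFun I U (F →L[ℝ] F)) (x : U) (v : F) :
    (f • Φ - (k : SmoothFun I U ℝ) • Ψ).1 x v = f.1 x • Φ.1 x v - (k : ℝ) • Ψ.1 x v := by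
  rw [SmoothFun.sub_apply, SmoothFun.smul_apply, SmoothFun.smul_apply, SmoothFun.natCast_apply]
  rfl

namespace Patch

variable (P : Patch H F V) {A : CovariantDerivative I F V}

/-- The coordinate vector fields. -/
abbrev frame (i : κ) (y : M) : TangentSpace I y := chartFrame I b P.p i y

lemma isCommutingFrame : IsCommutingFrame I P.U (P.frame b) :=
  isCommutingFrame_chartFrame b P.p P.isOpen P.subset_source

/-- The calculus of smooth functions on the patch. -/
abbrev calculus : Calculus κ (SmoothFun I P.U ℝ) (SmoothFun I P.U (F →L[ℝ] F)) :=
  chartCalculus b (F →L[ℝ] F) P.isOpen P.subset_source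

/-- The restriction of a smooth function to the patch. -/
def scalar (s : M → ℝ) (hs : CMDiff[P.U] ∞ s) : SmoothFun I P.U ℝ := SmoothFun.mk s hs

/-- The components of the metric. -/
def metric (g : Metric I M) (i j : κ) : SmoothFun I P.U ℝ :=
  SmoothFun.mk (fun y ↦ g.inner y (P.frame b i y) (P.frame b j y))
    fun _ hy ↦ ((P.isCommutingFrame b).contMDiffAt_gram hy g i j).contMDiffWithinAt

/-- The components of the inverse metric. -/
def invMetric (g : Metric I M) (i j : κ) : SmoothFun I P.U ℝ :=
  SmoothFun.mk (fun y ↦ (gram g y fun i ↦ P.frame b i y)⁻¹ i j)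
    fun _ hy ↦ ((P.isCommutingFrame b).contMDiffAt_inv_gram hy g i j).contMDiffWithinAt

/-- The components of the connection form. -/
def connection [T2Space M] (hA : CovariantDerivative.ContMDiffCovariantDerivative A ∞) (i : κ) :
    SmoothFun I P.U (F →L[ℝ] F) :=
  SmoothFun.mk (fun y ↦ connectionForm P.e A y (P.frame b i y))
    (contMDiffOn_connectionForm P.e hA P.isOpen P.subset_baseSet
      ((P.isCommutingFrame b).contMDiffOn i))

variable {b P}

lemma metric_symm (g : Metric I M) (i j : κ) : P.metric b g i j = P.metric b g j i :=
  SmoothFun.ext_apply fun x ↦ g.symm x _ _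

lemma invMetric_symm (g : Metric I M) (i j : κ) : P.invMetric b g i j = P.invMetric b g j i :=
  SmoothFun.ext_apply fun x ↦ inv_gram_symm g x ..

lemma metric_mul_invMetric (g : Metric I M) (i k : κ) :
    ∑ j, P.metric b g i j * P.invMetric b g j k = if i = k then 1 else 0 :=
  SmoothFun.ext_apply fun x ↦ by
    have := gram_mul_inv g x ((P.isCommutingFrame b).linearIndependent x x.2) i k
    rw [SmoothFun.sum_apply]
    simp only [SmoothFun.mul_apply]
    refine this.trans ?_
    split_ifs <;> simp

lemma invMetric_mul_metric (g : Metric I M) (i k : κ) :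
    ∑ j, P.invMetric b g i j * P.metric b g j k = if i = k then 1 else 0 :=
  SmoothFun.ext_apply fun x ↦ by
    have := inv_mul_gram g x ((P.isCommutingFrame b).linearIndependent x x.2) i k
    rw [SmoothFun.sum_apply]
    simp only [SmoothFun.mul_apply]
    refine this.trans ?_
    split_ifs <;> simp

lemma christoffel_apply (g : Metric I M) (u v k : κ) (x : P.U) :
    ((P.calculus b).christoffel (P.metric b g) u v k).1 x = (1 / 2 : ℝ) *
      (mvfderiv I (fun y ↦ g.inner y (P.frame b v y) (P.frame b k y)) x (P.frame b u x)
        + mvfderiv I (fun y ↦ g.inner y (P.frame b u y) (P.frame b k y)) x (P.frame b v x)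
        - mvfderiv I (fun y ↦ g.inner y (P.frame b u y) (P.frame b v y)) x (P.frame b k x)) := by
  simp only [Calculus.christoffel, SmoothFun.real_smul_apply, SmoothFun.add_apply,
    SmoothFun.sub_apply, smul_eq_mul]
  congr 2
  · congr 1
    · exact chartCalculus_d_apply b P.isOpen P.subset_source u (fun _ ↦ rfl) x
    · exact chartCalculus_d_apply b P.isOpen P.subset_source v (fun _ ↦ rfl) x
  · exact chartCalculus_d_apply b P.isOpen P.subset_source k (fun _ ↦ rfl) x

lemma leviCivita_frame (g : Metric I M) (u v : κ) (x : P.U) :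
    leviCivita g (P.frame b v) x (P.frame b u x) = ∑ k,
      (∑ m, P.invMetric b g k m * (P.calculus b).christoffel (P.metric b g) u v m).1 x
        • P.frame b k x := by
  rw [(P.isCommutingFrame b).leviCivita_eq x.2 g u v]
  refine Finset.sum_congr rfl fun k _ ↦ ?_
  rw [SmoothFun.sum_apply]
  congr 1
  refine Finset.sum_congr rfl fun m _ ↦ ?_
  rw [SmoothFun.mul_apply, christoffel_apply]
  rfl

variable [T2Space M]

lemma cov_apply
    (hA : CovariantDerivative.ContMDiffCovariantDerivative A ∞) (i : κ) {Φ : SmoothFun I P.U (F →L[ℝ] F)} {φ : M → F →L[ℝ] F}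
    (h : ∀ y : P.U, Φ.1 y = φ y) (x : P.U) :
    ((P.calculus b).cov (P.connection b hA) i Φ).1 x = mvfderiv I φ x (P.frame b i x)
      + (connectionForm P.e A x (P.frame b i x) * φ x
        - φ x * connectionForm P.e A x (P.frame b i x)) := by
  rw [Calculus.cov, SmoothFun.add_apply, SmoothFun.sub_apply, SmoothFun.mul_apply,
    SmoothFun.mul_apply, h,
    chartCalculus_D_apply b P.isOpen P.subset_source i h x]
  rfl

lemma curv_apply
    (hA : CovariantDerivative.ContMDiffCovariantDerivative A ∞) (i j : κ) (x : P.U) :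
    ((P.calculus b).curv (P.connection b hA) i j).1 x
      = curvatureMatrix P.e A (P.frame b) i j x := by
  rw [Calculus.curv, SmoothFun.add_apply, SmoothFun.sub_apply, SmoothFun.sub_apply,
    SmoothFun.mul_apply, SmoothFun.mul_apply,
    chartCalculus_D_apply b P.isOpen P.subset_source i
      (g := fun y ↦ connectionForm P.e A y (P.frame b j y)) (fun _ ↦ rfl) x,
    chartCalculus_D_apply b P.isOpen P.subset_source j
      (g := fun y ↦ connectionForm P.e A y (P.frame b i y)) (fun _ ↦ rfl) x]
  rfl

lemma continuousLinearMapAt_curvature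
    (hA : CovariantDerivative.ContMDiffCovariantDerivative A ∞) (x : P.U) (s : V x) (i j : κ) :
    P.e.continuousLinearMapAt ℝ x (curvature A x s (P.frame b i x) (P.frame b j x))
      = ((P.calculus b).curv (P.connection b hA) i j).1 x (P.e.continuousLinearMapAt ℝ x s) := by
  rw [curv_apply]
  exact ElectricYM.continuousLinearMapAt_curvature P.e hA (P.isCommutingFrame b) x.2
    (P.subset_baseSet x.2)
    (derivationsCommuteAt_chartFrame b P.p (P.subset_source x.2)) s i j

lemma mdifferentiableAt_curvatureMatrix
    (hA : CovariantDerivative.ContMDiffCovariantDerivative A ∞) (x : P.U) (i j : κ) :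
    MDiffAt (curvatureMatrix P.e A (P.frame b) i j) (x : M) := by
  refine (SmoothFun.mdifferentiableAt_rep P.isOpen
    ((P.calculus b).curv (P.connection b hA) i j) x.2).congr_of_eventuallyEq ?_
  filter_upwards [P.isOpen.mem_nhds x.2] with y hy
  rw [← curv_apply hA i j ⟨y, hy⟩, ← SmoothFun.rep_apply]

lemma continuousLinearMapAt_covDerivTwoForm [Nonempty (Metric I M)]
    (hA : CovariantDerivative.ContMDiffCovariantDerivative A ∞) (g : Metric I M) (x : P.U)
    (s : V x) (u v w : κ) :
    P.e.continuousLinearMapAt ℝ x (covDerivTwoForm g A (curvature A) x s (P.frame b u x)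
        (P.frame b v x) (P.frame b w x))
      = ((P.calculus b).covTwoForm (P.connection b hA) (P.metric b g) (P.invMetric b g)
          ((P.calculus b).curv (P.connection b hA)) u v w).1 x
          (P.e.continuousLinearMapAt ℝ x s) := by
  obtain ⟨T, hT⟩ := exists_curvature_eq_linearMap hA (x : M) s
  have hcu : ∀ i j, P.e.continuousLinearMapAt ℝ x (T (P.frame b i x) (P.frame b j x))
      = ((P.calculus b).curv (P.connection b hA) i j).1 x (P.e.continuousLinearMapAt ℝ x s) :=
    fun i j ↦ by rw [← hT, continuousLinearMapAt_curvature]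
  rw [ElectricYM.continuousLinearMapAt_covDerivTwoForm P.e (P.isCommutingFrame b) x.2
    (P.subset_baseSet x.2) (exists_curvature_eq_linearMap hA)
    (ψ := curvatureMatrix P.e A (P.frame b))
    (fun y hy s i j ↦ by
      rw [continuousLinearMapAt_curvature hA ⟨y, hy.1⟩ s i j, curv_apply])
    (mdifferentiableAt_curvatureMatrix hA x)]
  rw [hT, hT, leviCivita_frame, leviCivita_frame, Calculus.covTwoForm, SmoothFun.sub_apply,
    SmoothFun.sub_apply, SmoothFun.sum_apply, SmoothFun.sum_apply,
    cov_apply hA u (curv_apply hA v w) x]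
  simp only [map_sum, map_smul, LinearMap.sum_apply, LinearMap.smul_apply, hcu,
    SmoothFun.smul_apply, _root_.sub_apply, _root_.sum_apply, _root_.smul_apply]

lemma sharp_frame (g : Metric I M) {s : M → ℝ} (hs : CMDiff[P.U] ∞ s) (x : P.U) :
    sharp g x (mvfderiv I s x) = ∑ j, ((P.calculus b).grad (P.invMetric b g) (P.scalar s hs) j).1 x
      • P.frame b j x := by
  have h := (P.isCommutingFrame b).sharp_eq x.2 g (mvfderiv I s x).toLinearMap
  refine h.trans (Finset.sum_congr rfl fun j _ ↦ ?_)
  congr 1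
  rw [Calculus.grad, SmoothFun.sum_apply]
  refine Finset.sum_congr rfl fun i _ ↦ ?_
  rw [SmoothFun.mul_apply, chartCalculus_d_apply b P.isOpen P.subset_source i (g := s) (fun _ ↦ rfl)]
  rfl

lemma continuousLinearMapAt_metricTrace_covDerivTwoForm [Nonempty (Metric I M)]
    (hA : CovariantDerivative.ContMDiffCovariantDerivative A ∞) (g : Metric I M) (x : P.U)
    (s : V x) (w : κ) :
    P.e.continuousLinearMapAt ℝ x (metricTrace g x (fun u v ↦ covDerivTwoForm g A (curvature A) x s
        u v (P.frame b w x)))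
      = (∑ u, ∑ v, P.invMetric b g u v • (P.calculus b).covTwoForm (P.connection b hA)
          (P.metric b g) (P.invMetric b g) ((P.calculus b).curv (P.connection b hA)) u v w).1 x
          (P.e.continuousLinearMapAt ℝ x s) := by
  obtain ⟨T', hT'⟩ := exists_covDerivTwoForm_eq_linearMap (A := A) (g := g) P.e
    (P.isCommutingFrame b) x.2 (P.subset_baseSet x.2) (exists_curvature_eq_linearMap hA)
    (ψ := curvatureMatrix P.e A (P.frame b))
    (fun y hy s i j ↦ by
      rw [continuousLinearMapAt_curvature hA ⟨y, hy.1⟩ s i j, curv_apply])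
    (mdifferentiableAt_curvatureMatrix hA x) s (P.frame b w x)
  simp only [hT']
  rw [metricTrace_eq_sum g x ((P.isCommutingFrame b).linearIndependent x x.2)
    ((P.isCommutingFrame b).span x x.2), map_sum, SmoothFun.sum_apply, _root_.sum_apply]
  refine Finset.sum_congr rfl fun u _ ↦ ?_
  rw [map_sum, SmoothFun.sum_apply, _root_.sum_apply]
  refine Finset.sum_congr rfl fun v _ ↦ ?_
  rw [map_smul, ← hT', continuousLinearMapAt_covDerivTwoForm hA]
  rfl

lemma continuousLinearMapAt_curvature_sharp
    (hA : CovariantDerivative.ContMDiffCovariantDerivative A ∞) (g : Metric I M) {f : M → ℝ}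
    (hf : CMDiff[P.U] ∞ f) (x : P.U) (s : V x) (w : κ) :
    P.e.continuousLinearMapAt ℝ x
        (curvature A x s (sharp g x (mvfderiv I f x)) (P.frame b w x))
      = (∑ u, ∑ v, (P.invMetric b g u v * (P.calculus b).d u (P.scalar f hf)) •
          (P.calculus b).curv (P.connection b hA) v w).1 x (P.e.continuousLinearMapAt ℝ x s) := by
  obtain ⟨T, hT⟩ := exists_curvature_eq_linearMap hA (x : M) s
  rw [sharp_frame (b := b) g hf, hT, map_sum T, LinearMap.sum_apply, map_sum, Finset.sum_comm,
    SmoothFun.sum_apply, _root_.sum_apply]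
  refine Finset.sum_congr rfl fun v _ ↦ ?_
  rw [map_smul T, LinearMap.smul_apply, map_smul, ← hT, continuousLinearMapAt_curvature hA,
    ← Finset.sum_smul, SmoothFun.smul_apply, _root_.smul_apply, Calculus.grad]
  congr 2
  exact congrArg (fun z : SmoothFun I P.U ℝ ↦ z.1 x)
    (Finset.sum_congr rfl fun u _ ↦ by rw [invMetric_symm g u v])

/-- The current in local coordinates. -/
theorem continuousLinearMapAt_current
    (hA : CovariantDerivative.ContMDiffCovariantDerivative A ∞) {c : Set (Metric I M)} (σ : Density c 1) (g : c) {m : ℕ}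
    (hm : Module.finrank ℝ E = m + 4) (x : P.U) (s : V x) (w : κ) :
    P.e.continuousLinearMapAt ℝ x (current σ A g x s (P.frame b w x))
      = (∑ k, P.metric b g.1 w k • (P.calculus b).current (P.connection b hA)
          ((P.calculus b).logVol (P.metric b g.1) (P.invMetric b g.1))
          (P.scalar (σ.rep g) (σ.contMDiff g).contMDiffOn) m
          (Calculus.up (P.invMetric b g.1) ((P.calculus b).curv (P.connection b hA))) k).1 x
          (P.e.continuousLinearMapAt ℝ x s) := by
  have : Nonempty (Metric I M) := ⟨g.1⟩
  rw [← Calculus.sum_current _ (invMetric_symm g.1) (metric_symm g.1) (metric_mul_invMetric g.1)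
    (invMetric_mul_metric g.1)]
  have h2 : ((Module.finrank ℝ E : ℝ) - 4) = m := by rw [hm]; push_cast; ring
  have e1 := continuousLinearMapAt_metricTrace_covDerivTwoForm (b := b) hA g.1 x s w
  have e2 := continuousLinearMapAt_curvature_sharp (b := b) hA g.1
    (σ.contMDiff g).contMDiffOn x s w
  rw [current, h2]
  refine (map_smul_sub_smul (P.e.continuousLinearMapAt ℝ (x : M)) _ _ _ _).trans ?_
  refine (congrArg₂ (fun v w ↦ σ.rep g x • v - (m : ℝ) • w) e1 e2).trans ?_
  rw [SmoothFun.smul_sub_natCast_smul_apply]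
  rfl

end Patch

end ElectricYM

/-! ### Endomorphism-valued one-forms -/

namespace ElectricYM

open Filter Set
open scoped Topology

variable {E : Type*} [NormedAddCommGroup E] [NormedSpace ℝ E] [FiniteDimensional ℝ E]
  {H : Type*} [TopologicalSpace H] {I : ModelWithCorners ℝ E H}
  {M : Type*} [TopologicalSpace M] [ChartedSpace H M] [IsManifold I ∞ M]
  {F : Type*} [NormedAddCommGroup F] [NormedSpace ℝ F] [FiniteDimensional ℝ F]
  {F₁ : Type*} [NormedAddCommGroup F₁] [NormedSpace ℝ F₁] [FiniteDimensional ℝ F₁]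
  {κ : Type*} [Fintype κ] [DecidableEq κ] (b : Module.Basis κ ℝ E)
  {V : M → Type*} [TopologicalSpace (TotalSpace F V)]
  [∀ x, AddCommGroup (V x)] [∀ x, Module ℝ (V x)] [∀ x, TopologicalSpace (V x)]
  [∀ x, IsTopologicalAddGroup (V x)] [∀ x, ContinuousSMul ℝ (V x)]
  [FiberBundle F V] [VectorBundle ℝ F V] [ContMDiffVectorBundle ∞ F V I]
  {V₁ : M → Type*} [TopologicalSpace (TotalSpace F₁ V₁)]
  [∀ x, AddCommGroup (V₁ x)] [∀ x, Module ℝ (V₁ x)] [∀ x, TopologicalSpace (V₁ x)]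
  [∀ x, IsTopologicalAddGroup (V₁ x)] [∀ x, ContinuousSMul ℝ (V₁ x)]
  [FiberBundle F₁ V₁] [VectorBundle ℝ F₁ V₁] [ContMDiffVectorBundle ∞ F₁ V₁ I]

/-- A family of linear maps between the fibres of vector bundles is smooth if it maps the local
sections which are constant in a trivialization to smooth sections. -/
lemma contMDiffAt_clm_bundle_of_apply {φ : ∀ x, V₁ x →L[ℝ] V x} {x : M}
    (h : ∀ v : F₁, CMDiffAt ∞
      (T% (fun y ↦ φ y ((trivializationAt F₁ V₁ x).symmL ℝ y v) : ∀ y, V y)) x) :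
    ContMDiffAt I (I.prod 𝓘(ℝ, F₁ →L[ℝ] F)) ∞ (fun y ↦ TotalSpace.mk' (F₁ →L[ℝ] F)
      (E := fun y : M ↦ V₁ y →L[ℝ] V y) y (φ y)) x := by
  rw [contMDiffAt_hom_bundle]
  refine ⟨contMDiffAt_id, contMDiffAt_clm_of_apply (k := ⊤) fun v ↦ ?_⟩
  exact (contMDiffAt_iff_continuousLinearMapAt (k := ⊤) (trivializationAt F V x)
    (FiberBundle.mem_baseSet_trivializationAt F V x)).1 (h v)

/-- Smoothness on `U` of a one-form with values in `End V`. -/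
def IsSmoothOneFormOn (U : Set M) (a : ∀ x : M, V x →L[ℝ] TangentSpace I x →L[ℝ] V x) : Prop :=
  ContMDiffOn I (I.prod 𝓘(ℝ, F →L[ℝ] E →L[ℝ] F)) ∞
    (fun x ↦ TotalSpace.mk' (F →L[ℝ] E →L[ℝ] F)
      (E := fun x : M ↦ V x →L[ℝ] TangentSpace I x →L[ℝ] V x) x (a x)) U

variable {U : Set M} {a : ∀ x : M, V x →L[ℝ] TangentSpace I x →L[ℝ] V x}

lemma IsSmoothOneFormOn.apply (hU : IsOpen U) (ha : IsSmoothOneFormOn (F := F) U a) {x : M} (hx : x ∈ U)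
    {S : ∀ y, V y} {Y : ∀ y : M, TangentSpace I y} (hS : CMDiffAt ∞ (T% S) x)
    (hY : CMDiffAt ∞ (T% Y) x) : CMDiffAt ∞ (T% (fun y ↦ a y (S y) (Y y) : ∀ y, V y)) x := by
  apply ContMDiffAt.clm_bundle_apply₂ (F₁ := F) (F₂ := E) (ha.contMDiffAt (hU.mem_nhds hx)) hS hY

lemma isSmoothOneFormOn_of_apply
    (h : ∀ x ∈ U, ∀ (S : ∀ y, V y) (Y : ∀ y : M, TangentSpace I y), CMDiffAt ∞ (T% S) x →
      CMDiffAt ∞ (T% Y) x → CMDiffAt ∞ (T% (fun y ↦ a y (S y) (Y y) : ∀ y, V y)) x) :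
    IsSmoothOneFormOn (F := F) U a := fun x hx ↦ by
  refine ContMDiffAt.contMDiffWithinAt (contMDiffAt_clm_bundle_of_apply (V₁ := V)
    (V := fun x : M ↦ TangentSpace I x →L[ℝ] V x) (φ := a) fun v ↦ ?_)
  refine contMDiffAt_clm_bundle_of_apply (V₁ := fun x : M ↦ TangentSpace I x) (V := V)
    (φ := fun y ↦ a y ((trivializationAt F V x).symmL ℝ y v)) fun w ↦ ?_
  exact h x hx _ _ ((contMDiffOn_symmL_apply (I := I) _ v).contMDiffAt
    ((trivializationAt F V x).open_baseSet.mem_nhds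
      (FiberBundle.mem_baseSet_trivializationAt F V x)))
    ((contMDiffOn_symmL_apply (I := I) (trivializationAt E (TangentSpace I) x) w).contMDiffAt
    ((trivializationAt E (TangentSpace I) x).open_baseSet.mem_nhds
      (FiberBundle.mem_baseSet_trivializationAt E (TangentSpace I) x)))

variable (I F) in
/-- The continuous bilinear map defined by an algebraic one. -/
def continuousBilinear {x : M} (T : V x →ₗ[ℝ] TangentSpace I x →ₗ[ℝ] V x) :
    V x →L[ℝ] TangentSpace I x →L[ℝ] V x :=
  have : T2Space (V x) := FiberBundle.t2Space F V x
  have : FiniteDimensional ℝ (V x) := VectorBundle.finiteDimensional ℝ F V x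
  have : T2Space (TangentSpace I x) := inferInstanceAs (T2Space E)
  have : FiniteDimensional ℝ (TangentSpace I x) := inferInstanceAs (FiniteDimensional ℝ E)
  LinearMap.toContinuousLinearMap
    ((LinearMap.toContinuousLinearMap (𝕜 := ℝ) (E := TangentSpace I x) (F' := V x)).toLinearMap ∘ₗ T)

lemma continuousBilinear_apply {x : M} (T : V x →ₗ[ℝ] TangentSpace I x →ₗ[ℝ] V x) (s : V x)
    (u : TangentSpace I x) : continuousBilinear I F T s u = T s u := rfl

lemma contMDiffCovariantDerivative_addOneForm {A : CovariantDerivative I F V}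
    (hA : CovariantDerivative.ContMDiffCovariantDerivative A ∞)
    (ha : IsSmoothOneFormOn (F := F) univ a) :
    CovariantDerivative.ContMDiffCovariantDerivative (A.addOneForm a) ∞ where
  contMDiff := by
    refine ⟨fun {S} hS x hx ↦ ?_⟩
    have h1 := (hA.contMDiff.contMDiff hS).contMDiffAt (univ_mem (f := 𝓝 x))
    refine ContMDiffAt.contMDiffWithinAt (contMDiffAt_clm_bundle_of_apply
      (V₁ := fun x : M ↦ TangentSpace I x) (V := V) (φ := fun y ↦ A S y + a y (S y)) fun v ↦ ?_)
    have hv := (contMDiffOn_symmL_apply (I := I) (trivializationAt E (TangentSpace I) x) v).contMDiffAt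
      ((trivializationAt E (TangentSpace I) x).open_baseSet.mem_nhds
        (FiberBundle.mem_baseSet_trivializationAt E (TangentSpace I) x))
    have hS' : CMDiffAt ∞ (T% S) x :=
      (hS.contMDiffAt (univ_mem (f := 𝓝 x))).of_le (by simp)
    exact (ContMDiffAt.clm_bundle_apply (F₁ := E) (F₂ := F) h1 hv).add_section
      (ha.apply isOpen_univ (mem_univ x) hS' hv)

namespace Patch

variable {b} {P : Patch H F V} {A : CovariantDerivative I F V}

/-- The components of a one-form as functions. -/
def component (P : Patch H F V) (b : Module.Basis κ ℝ E)
    (a : ∀ x : M, V x →L[ℝ] TangentSpace I x →L[ℝ] V x) (i : κ) (y : M) : F →L[ℝ] F :=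
  LinearMap.toContinuousLinearMap
    { toFun := fun v ↦ P.e.continuousLinearMapAt ℝ y (a y (P.e.symmL ℝ y v) (P.frame b i y))
      map_add' := fun v w ↦ by simp
      map_smul' := fun c v ↦ by simp }

lemma component_apply (i : κ) (y : M) (v : F) : P.component b a i y v
    = P.e.continuousLinearMapAt ℝ y (a y (P.e.symmL ℝ y v) (P.frame b i y)) := rfl

lemma continuousLinearMapAt_oneForm {y : M} (hy : y ∈ P.U) (s : V y) (i : κ) :
    P.e.continuousLinearMapAt ℝ y (a y s (P.frame b i y))
      = P.component b a i y (P.e.continuousLinearMapAt ℝ y s) := by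
  rw [component_apply, P.e.symmL_continuousLinearMapAt (P.subset_baseSet hy)]

lemma contMDiffOn_component (ha : IsSmoothOneFormOn (F := F) P.U a) (i : κ) :
    CMDiff[P.U] ∞ (P.component b a i) := fun y hy ↦ by
  refine ContMDiffAt.contMDiffWithinAt (contMDiffAt_clm_of_apply (k := ⊤) fun v ↦ ?_)
  refine (contMDiffAt_iff_continuousLinearMapAt (k := ⊤) P.e (P.subset_baseSet hy)).1 ?_
  exact ha.apply P.isOpen hy ((contMDiffOn_symmL_apply (I := I) P.e v).contMDiffAt
    (P.e.open_baseSet.mem_nhds (P.subset_baseSet hy))) ((P.isCommutingFrame b).contMDiffAt hy i)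

/-- The components of a one-form. -/
def oneForm (P : Patch H F V) (b : Module.Basis κ ℝ E)
    (ha : IsSmoothOneFormOn (F := F) P.U a) (i : κ) : SmoothFun I P.U (F →L[ℝ] F) :=
  SmoothFun.mk (P.component b a i) (contMDiffOn_component ha i)

/-- A one-form is determined by its components. -/
lemma oneForm_ext {x : M} (hx : x ∈ P.U) {β β' : V x →L[ℝ] TangentSpace I x →L[ℝ] V x}
    (h : ∀ s i, P.e.continuousLinearMapAt ℝ x (β s (P.frame b i x))
      = P.e.continuousLinearMapAt ℝ x (β' s (P.frame b i x))) : β = β' := by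
  ext s u
  obtain ⟨c, rfl⟩ := (P.isCommutingFrame b).exists_eq_sum hx u
  rw [map_sum, map_sum]
  refine Finset.sum_congr rfl fun i _ ↦ ?_
  rw [map_smul, map_smul, eq_of_continuousLinearMapAt_eq P.e (P.subset_baseSet hx) (h s i)]

/-- There is a one-form with given components. -/
lemma exists_oneForm [Nonempty (Metric I M)] (K : κ → SmoothFun I P.U (F →L[ℝ] F)) :
    ∃ a : ∀ x : M, V x →L[ℝ] TangentSpace I x →L[ℝ] V x, IsSmoothOneFormOn (F := F) P.U a ∧
      ∀ (x : P.U) (s : V x) (i : κ), P.e.continuousLinearMapAt ℝ x (a x s (P.frame b i x))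
        = (K i).1 x (P.e.continuousLinearMapAt ℝ x s) := by
  obtain ⟨g⟩ := ‹Nonempty (Metric I M)›
  let θ : ∀ x : M, κ → TangentSpace I x →ₗ[ℝ] ℝ := fun x i ↦
    ∑ j, (gram g x fun i ↦ P.frame b i x)⁻¹ i j • (g.inner x (P.frame b j x)).toLinearMap
  have hθ : ∀ x i u, θ x i u = ∑ j, (gram g x fun i ↦ P.frame b i x)⁻¹ i j
      * g.inner x (P.frame b j x) u := fun x i u ↦ by
    simp [θ]
  let T : ∀ x : M, V x →ₗ[ℝ] TangentSpace I x →ₗ[ℝ] V x := fun x ↦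
    LinearMap.mk₂ ℝ (fun s u ↦ ∑ i, θ x i u • P.e.symmL ℝ x
        ((K i).rep x (P.e.continuousLinearMapAt ℝ x s)))
      (by intros; simp only [map_add, smul_add, Finset.sum_add_distrib])
      (by
        intros
        simp only [map_smul, Finset.smul_sum]
        exact Finset.sum_congr rfl fun i _ ↦ smul_comm ..)
      (by intros; simp only [map_add, add_smul, Finset.sum_add_distrib])
      (by intros; simp only [map_smul, Finset.smul_sum, smul_assoc])
  have hT : ∀ x ∈ P.U, ∀ s u, P.e.continuousLinearMapAt ℝ x (T x s u)
      = ∑ i, θ x i u • (K i).rep x (P.e.continuousLinearMapAt ℝ x s) := fun x hx s u ↦ by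
    simp only [T, LinearMap.mk₂_apply, map_sum, map_smul,
      P.e.continuousLinearMapAt_symmL (P.subset_baseSet hx)]
  refine ⟨fun x ↦ continuousBilinear I F (T x), isSmoothOneFormOn_of_apply ?_, ?_⟩
  · intro x hx S Y hS hY
    simp only [continuousBilinear_apply]
    rw [contMDiffAt_iff_continuousLinearMapAt (k := ⊤) P.e (P.subset_baseSet hx)] at hS ⊢
    have h0 : ∀ i, CMDiffAt ∞ (fun y ↦ ∑ j, (gram g y fun i ↦ P.frame b i y)⁻¹ i j
        * g.inner y (P.frame b j y) (Y y)) x := fun i ↦ by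
      refine ContMDiffAt.sum fun j _ ↦ ?_
      exact ((P.isCommutingFrame b).contMDiffAt_inv_gram hx g i j).mul
        (contMDiffAt_inner (k := ⊤) g ((P.isCommutingFrame b).contMDiffAt hx j) hY)
    have h1 : CMDiffAt ∞ (fun y ↦ ∑ i, (∑ j, (gram g y fun i ↦ P.frame b i y)⁻¹ i j
        * g.inner y (P.frame b j y) (Y y)) •
          (K i).rep y (P.e.continuousLinearMapAt ℝ y (S y))) x := by
      refine ContMDiffAt.sum fun i _ ↦ (h0 i).smul ?_
      exact ((SmoothFun.contMDiffOn_rep (K i)).contMDiffAt (P.isOpen.mem_nhds hx)).clm_apply hS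
    refine h1.congr_of_eventuallyEq ?_
    filter_upwards [P.isOpen.mem_nhds hx] with y hy
    rw [hT y hy]
    simp only [hθ]
  · intro x s i
    rw [continuousBilinear_apply, hT x x.2, Finset.sum_eq_single i]
    · rw [hθ, inv_mul_gram g x ((P.isCommutingFrame b).linearIndependent x x.2), if_pos rfl,
        one_smul, SmoothFun.rep_apply]
    · intro j _ hj
      rw [hθ, inv_mul_gram g x ((P.isCommutingFrame b).linearIndependent x x.2), if_neg hj,
        zero_smul]
    · simp

end Patch

end ElectricYM

/-! ### One step of the recursion, in local coordinates -/

namespace ElectricYM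

namespace Calculus

variable {ι R 𝓐 : Type*} [Fintype ι] [DecidableEq ι] [CommRing R] [Algebra ℝ R] [Ring 𝓐]
  [Algebra R 𝓐] (C : Calculus ι R 𝓐) {g h : ι → ι → R}

/-- The current as a one-form. -/
def lowerCurrent (A : ι → 𝓐) (g h : ι → ι → R) (s : R) (m : ℕ) (w : ι) : 𝓐 :=
  ∑ i, g w i • C.current A (C.logVol g h) s m (up h (C.curv A)) i

lemma current_eq_sum_lowerCurrent (hhg : ∀ i k, ∑ j, h i j * g j k = if i = k then 1 else 0)
    (A : ι → 𝓐) (s : R) (m : ℕ) (i : ι) :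
    C.current A (C.logVol g h) s m (up h (C.curv A)) i
      = ∑ w, h i w • C.lowerCurrent A g h s m w := by
  simp only [lowerCurrent, Finset.smul_sum, smul_smul]
  rw [Finset.sum_comm]
  simp only [← Finset.sum_smul, hhg]
  simp

lemma gradSq_eq (s : R) : C.gradSq h s = ∑ u, ∑ v, h u v * (C.d u s * C.d v s) := by
  simp only [gradSq, grad, Finset.mul_sum]
  exact Finset.sum_congr rfl fun _ _ ↦ Finset.sum_congr rfl fun _ _ ↦ by ring

lemma sum_d_smul_sum (hs : ∀ i j, h i j = h j i) (s : R) (k : ι → 𝓐) :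
    ∑ b, C.d b s • ∑ c, h b c • k c = ∑ c, C.grad h s c • k c := by
  simp only [grad, Finset.smul_sum, Finset.sum_smul, smul_smul]
  rw [Finset.sum_comm]
  exact Finset.sum_congr rfl fun _ _ ↦ Finset.sum_congr rfl fun _ _ ↦ by rw [hs, mul_comm]

lemma exists_lowerCurrent_add_connection (hs : ∀ i j, h i j = h j i)
    (hgh : ∀ i k, ∑ j, g i j * h j k = if i = k then 1 else 0) (A : ι → 𝓐) (s : R) (m k : ℕ)
    (b : ι → 𝓐) : ∃ r : ι → 𝓐, ∀ w,
      C.lowerCurrent (fun j ↦ A j + s ^ (k + 1) • b j) g h s m w = C.lowerCurrent A g h s m w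
        + (((k + 1 : ℕ) : R) * ((k : R) - m) * s ^ k) •
          (C.gradSq h s • b w - C.d w s • ∑ v, C.grad h s v • b v)
        + s ^ (k + 1) • r w := by
  obtain ⟨r, hr⟩ := C.exists_current_add_connection A (C.logVol g h) h s m k b
  refine ⟨fun w ↦ ∑ i, g w i • r i, fun w ↦ ?_⟩
  have h1 : ∑ u, ∑ v, (h u v * C.d u s) • b v = ∑ v, C.grad h s v • b v := by
    rw [Finset.sum_comm]
    simp only [grad, Finset.sum_smul]
    exact Finset.sum_congr rfl fun _ _ ↦ Finset.sum_congr rfl fun _ _ ↦ by rw [hs]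
  rw [gradSq_eq, ← h1, ← C.sum_d_up s b hgh w]
  simp only [lowerCurrent, hr, smul_add, Finset.sum_add_distrib, Finset.smul_sum]
  congr 1
  · congr 1
    exact Finset.sum_congr rfl fun _ _ ↦ Finset.sum_congr rfl fun _ _ ↦ by
      rw [smul_comm (g w _)]
  · exact Finset.sum_congr rfl fun _ _ ↦ by rw [smul_comm (g w _)]

/-- If the current is `s ^ N k`, then a correction of order `s ^ (N + 1)` of the connection makes
it divisible by `s ^ (N + 1)`, provided that the normal component of `k` is divisible by `s`. -/
lemma exists_lowerCurrent_step (hs : ∀ i j, h i j = h j i)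
    (hgh : ∀ i k, ∑ j, g i j * h j k = if i = k then 1 else 0) (A : ι → 𝓐) (s : R) (m N : ℕ)
    {k : ι → 𝓐} (hk : ∀ w, C.lowerCurrent A g h s m w = s ^ N • k w) {q : 𝓐}
    (hq : ∑ v, C.grad h s v • k v = s • q) {ρ : R} (hρ : ρ * C.gradSq h s = 1 - s ^ 2 * ρ)
    {c : R} (hc : c * (((N + 1 : ℕ) : R) * ((N : R) - m)) = -1) : ∃ k' : ι → 𝓐, ∀ w,
      C.lowerCurrent (fun j ↦ A j + s ^ (N + 1) • (c * ρ) • k j) g h s m w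
        = s ^ (N + 1) • k' w := by
  obtain ⟨r, hr⟩ := C.exists_lowerCurrent_add_connection hs hgh A s m N fun j ↦ (c * ρ) • k j
  refine ⟨fun w ↦ (s * ρ) • k w + (ρ * C.d w s) • q + r w, fun w ↦ ?_⟩
  have h1 : ∑ v, C.grad h s v • (c * ρ) • k v = (c * ρ * s) • q := by
    simp only [smul_comm _ (c * ρ)]
    rw [← Finset.smul_sum, hq, smul_smul]
  rw [hr, hk, h1]
  generalize (((N + 1 : ℕ) : R) * ((N : R) - m)) = κ at hc
  match_scalars
  · linear_combination (-s ^ N) * hρ + C.gradSq h s * ρ * s ^ N * hc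
  · linear_combination (-(s ^ (N + 1) * C.d w s * ρ)) * hc
  · ring

/-- The normal component of the leading term of the current is divisible by `s`. -/
lemma pow_smul_normal_component (hs : ∀ i j, h i j = h j i)
    (hgh : ∀ i k, ∑ j, g i j * h j k = if i = k then 1 else 0)
    (hhg : ∀ i k, ∑ j, h i j * g j k = if i = k then 1 else 0) (A : ι → 𝓐) (s : R) (m N : ℕ)
    {k : ι → 𝓐} (hk : ∀ w, C.lowerCurrent A g h s m w = s ^ N • k w) :
    s ^ N • (s • C.div A (C.logVol g h) (fun b ↦ ∑ c, h b c • k c)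
      + ((N : R) - ((m + 1 : ℕ) : R)) • ∑ c, C.grad h s c • k c) = 0 := by
  rw [← C.sum_d_smul_sum hs]
  refine C.pow_smul_conservation A (C.logVol g h) s m N _ _
    (C.smul_div_current A _ (C.logVol_closed hs hgh hhg) h hs s m) fun b ↦ ?_
  rw [C.current_eq_sum_lowerCurrent hhg, Finset.smul_sum]
  exact Finset.sum_congr rfl fun c _ ↦ by rw [hk, smul_comm]

end Calculus

end ElectricYM

/-! ### One step of the recursion -/

namespace ElectricYM

open Filter Set
open scoped Topology

variable {E : Type*} [NormedAddCommGroup E] [NormedSpace ℝ E] [FiniteDimensional ℝ E]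
  {H : Type*} [TopologicalSpace H] {I : ModelWithCorners ℝ E H}
  {M : Type*} [TopologicalSpace M] [ChartedSpace H M] [IsManifold I ∞ M]
  {F : Type*} [NormedAddCommGroup F] [NormedSpace ℝ F] [FiniteDimensional ℝ F]
  {κ : Type*} [Fintype κ] [DecidableEq κ] {b : Module.Basis κ ℝ E}
  {V : M → Type*} [TopologicalSpace (TotalSpace F V)]
  [∀ x, AddCommGroup (V x)] [∀ x, Module ℝ (V x)] [∀ x, TopologicalSpace (V x)]
  [∀ x, IsTopologicalAddGroup (V x)] [∀ x, ContinuousSMul ℝ (V x)]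
  [FiberBundle F V] [VectorBundle ℝ F V] [ContMDiffVectorBundle ∞ F V I]
  {c : Set (Metric I M)}

section Conorm

variable (g : Metric I M) (x : M) (α : TangentSpace I x →ₗ[ℝ] ℝ)

lemma conormSq_eq_apply_sharp : conormSq g x α = α (sharp g x α) := by
  simp only [conormSq, sharp, metricTrace, map_sum, map_smul, smul_eq_mul]
  exact Finset.sum_congr rfl fun i _ ↦ Finset.sum_congr rfl fun j _ ↦
    congrArg _ (α.map_smul _ _).symm

lemma conormSq_eq_inner : conormSq g x α = g.inner x (sharp g x α) (sharp g x α) := by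
  rw [inner_sharp, conormSq_eq_apply_sharp]

lemma conormSq_nonneg : 0 ≤ conormSq g x α := by
  rw [conormSq_eq_inner]
  by_cases h : sharp g x α = 0
  · simp [h]
  · exact (g.pos x _ h).le

lemma conormSq_pos (hα : α ≠ 0) : 0 < conormSq g x α := by
  rw [conormSq_eq_inner]
  refine g.pos x _ fun h ↦ hα (LinearMap.ext fun w ↦ ?_)
  rw [← inner_sharp g x α, h]
  simp

end Conorm

namespace SmoothFun

variable {𝔸 : Type*} [NormedRing 𝔸] [NormedAlgebra ℝ 𝔸] [FiniteDimensional ℝ 𝔸]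

lemma eq_zero_of_pow_smul {U : Set M} (hU : IsOpen U) {s : M → ℝ}
    (hs : ∀ x ∈ U, s x = 0 → mvfderiv I s x ≠ 0) {f : SmoothFun I U 𝔸} (N : ℕ)
    (h : ∀ x : U, s x ^ N • f.1 x = 0) : f = 0 := by
  refine ext_apply fun x ↦ ?_
  by_contra hx
  have hc : ContinuousAt (rep f) (x : M) :=
    ((contMDiffOn_rep f).contMDiffAt (hU.mem_nhds x.2)).continuousAt
  have h0 : rep f x ≠ 0 := by rwa [rep_apply]
  have h1 : s =ᶠ[𝓝 (x : M)] fun _ ↦ 0 := by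
    filter_upwards [hc.eventually_ne h0, hU.mem_nhds x.2] with y hy hyU
    have h2 := h ⟨y, hyU⟩
    rw [← rep_apply f ⟨y, hyU⟩] at h2
    exact eq_zero_of_pow_eq_zero ((smul_eq_zero.1 h2).resolve_right hy)
  refine hs x x.2 h1.self_of_nhds ?_
  rw [mvfderiv_congr h1]
  ext u
  simp [mvfderiv]

end SmoothFun

lemma IsSmoothOneFormOn.smul {U : Set M} (hU : IsOpen U) {f : M → ℝ} (hf : CMDiff[U] ∞ f)
    {a : ∀ x : M, V x →L[ℝ] TangentSpace I x →L[ℝ] V x} (ha : IsSmoothOneFormOn (F := F) U a) :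
    IsSmoothOneFormOn (F := F) U fun x ↦ f x • a x := by
  refine isSmoothOneFormOn_of_apply fun x hx S Y hS hY ↦ ?_
  exact (hf.contMDiffAt (hU.mem_nhds hx)).smul_section (ha.apply hU hx hS hY)

lemma IsSmoothOneFormOn.add {U : Set M} (hU : IsOpen U)
    {a a' : ∀ x : M, V x →L[ℝ] TangentSpace I x →L[ℝ] V x} (ha : IsSmoothOneFormOn (F := F) U a)
    (ha' : IsSmoothOneFormOn (F := F) U a') :
    IsSmoothOneFormOn (F := F) U fun x ↦ a x + a' x := by
  refine isSmoothOneFormOn_of_apply fun x hx S Y hS hY ↦ ?_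
  exact (ha.apply hU hx hS hY).add_section (ha'.apply hU hx hS hY)

namespace Patch

variable {P : Patch H F V} {A : CovariantDerivative I F V}
  {a : ∀ x : M, V x →L[ℝ] TangentSpace I x →L[ℝ] V x}

lemma connection_addOneForm [T2Space M]
    (hA : CovariantDerivative.ContMDiffCovariantDerivative A ∞) {f : M → ℝ}
    (hf : CMDiff[P.U] ∞ f) (ha : IsSmoothOneFormOn (F := F) P.U a)
    {A' : CovariantDerivative I F V} (hA' : CovariantDerivative.ContMDiffCovariantDerivative A' ∞)
    (h : A' = A.addOneForm fun x ↦ f x • a x) :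
    P.connection b hA' = fun i ↦ P.connection b hA i + P.scalar f hf • P.oneForm b ha i := by
  subst h
  funext i
  refine SmoothFun.ext_apply fun x ↦ ContinuousLinearMap.ext fun v ↦ ?_
  have h1 : P.e.continuousLinearMapAt ℝ (x : M) ((f x • a x) (P.e.symmL ℝ (x : M) v)
      (P.frame b i x)) = f x • P.component b a i x v := by
    rw [component_apply, _root_.smul_apply, _root_.smul_apply, map_smul]
  refine (map_add (P.e.continuousLinearMapAt ℝ (x : M)) _ _).trans ?_
  exact congrArg₂ (· + ·) rfl h1

variable [T2Space M] (P b)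

/-- The current in local coordinates, as a one-form. -/
def lowerCurrent (hA : CovariantDerivative.ContMDiffCovariantDerivative A ∞) (σ : Density c 1)
    (g : c) (m : ℕ) (w : κ) : SmoothFun I P.U (F →L[ℝ] F) :=
  (P.calculus b).lowerCurrent (P.connection b hA) (P.metric b g.1) (P.invMetric b g.1)
    (P.scalar (σ.rep g) (σ.contMDiff g).contMDiffOn) m w

variable {P b}

lemma lowerCurrent_apply (hA : CovariantDerivative.ContMDiffCovariantDerivative A ∞)
    (σ : Density c 1) (g : c) {m : ℕ} (hm : Module.finrank ℝ E = m + 4) (x : P.U) (s : V x)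
    (w : κ) : P.e.continuousLinearMapAt ℝ x (current σ A g x s (P.frame b w x))
      = (P.lowerCurrent b hA σ g m w).1 x (P.e.continuousLinearMapAt ℝ x s) :=
  continuousLinearMapAt_current hA σ g hm x s w

lemma lowerCurrent_eq_pow_smul (hA : CovariantDerivative.ContMDiffCovariantDerivative A ∞)
    (σ : Density c 1) (g : c) {m : ℕ} (hm : Module.finrank ℝ E = m + 4) (N : ℕ)
    (ha : IsSmoothOneFormOn (F := F) P.U a)
    (h : ∀ x ∈ P.U, ∀ s w, current σ A g x s w = σ.rep g x ^ N • a x s w) (w : κ) :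
    P.lowerCurrent b hA σ g m w
      = P.scalar (σ.rep g) (σ.contMDiff g).contMDiffOn ^ N • P.oneForm b ha w := by
  refine SmoothFun.ext_apply fun x ↦ ContinuousLinearMap.ext fun v ↦ ?_
  have h1 := lowerCurrent_apply (b := b) hA σ g hm x (P.e.symmL ℝ (x : M) v) w
  rw [P.e.continuousLinearMapAt_symmL (P.subset_baseSet x.2)] at h1
  refine h1.symm.trans ?_
  refine (congrArg _ (h x x.2 _ _)).trans ?_
  exact map_smul (P.e.continuousLinearMapAt ℝ (x : M)) _ _

lemma exists_current_eq_linearMap (hA : CovariantDerivative.ContMDiffCovariantDerivative A ∞)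
    (σ : Density c 1) (g : c) (x : P.U) (s : V x) :
    ∃ T : TangentSpace I (x : M) →ₗ[ℝ] V x, ∀ w, current σ A g x s w = T w := by
  have : Nonempty (Metric I M) := ⟨g.1⟩
  have hΦ := exists_curvature_eq_linearMap hA
  obtain ⟨T₁, hT₁⟩ := hΦ x s
  let b := Module.finBasis ℝ E
  have hd : ∀ u v : TangentSpace I (x : M), ∃ T : TangentSpace I (x : M) →ₗ[ℝ] V x,
      ∀ w, covDerivTwoForm g.1 A (curvature A) x s u v w = T w := fun u v ↦ by
    have hS := FiberBundle.mdifferentiableAt_extend I F s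
    have hv := FiberBundle.mdifferentiableAt_extend I E v
    have hd := fun Z hZ ↦ mdifferentiableAt_twoForm_apply (Z := Z) P.e (P.isCommutingFrame b) x.2
      (P.subset_baseSet x.2) hΦ (ψ := curvatureMatrix P.e A (P.frame b))
      (fun y hy s i j ↦ by rw [continuousLinearMapAt_curvature hA ⟨y, hy.1⟩ s i j, curv_apply])
      (mdifferentiableAt_curvatureMatrix hA x) hS hv hZ
    refine ⟨TensorialAt.mkHom _ (x : M)
      (covDerivTwoForm_tensorialAt_right (A := A) (g := g.1) hΦ hd u), fun w ↦ ?_⟩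
    have h1 := TensorialAt.mkHom_apply_eq_extend
      (covDerivTwoForm_tensorialAt_right (A := A) (g := g.1) hΦ hd u) w
    refine Eq.trans ?_ h1.symm
    rw [FiberBundle.extend_apply_self, FiberBundle.extend_apply_self,
      FiberBundle.extend_apply_self]
    rfl
  choose T hT using hd
  refine ⟨σ.rep g x • ∑ i, ∑ j, inverseGram g.1 (x : M) i j • T (Module.finBasis ℝ E i : E)
    (Module.finBasis ℝ E j : E) - ((Module.finrank ℝ E : ℝ) - 4) •
      T₁ (sharp g.1 x (mvfderiv I (σ.rep g) x)), fun w ↦ ?_⟩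
  rw [LinearMap.sub_apply, LinearMap.smul_apply, LinearMap.smul_apply, ← hT₁,
    LinearMap.sum_apply, current, metricTrace]
  congr 2
  refine Finset.sum_congr rfl fun i _ ↦ ?_
  rw [LinearMap.sum_apply]
  exact Finset.sum_congr rfl fun j _ ↦ congrArg _ (hT _ _ _)

lemma exists_pow_smul_of_lowerCurrent (hA : CovariantDerivative.ContMDiffCovariantDerivative A ∞)
    (σ : Density c 1) (g : c) {m : ℕ} (hm : Module.finrank ℝ E = m + 4) (N : ℕ)
    {k : κ → SmoothFun I P.U (F →L[ℝ] F)}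
    (h : ∀ w, P.lowerCurrent b hA σ g m w
      = P.scalar (σ.rep g) (σ.contMDiff g).contMDiffOn ^ N • k w) :
    ∃ a : ∀ x : M, V x →L[ℝ] TangentSpace I x →L[ℝ] V x, IsSmoothOneFormOn (F := F) P.U a ∧
      ∀ x ∈ P.U, ∀ s w, current σ A g x s w = σ.rep g x ^ N • a x s w := by
  have : Nonempty (Metric I M) := ⟨g.1⟩
  obtain ⟨a, ha, hak⟩ := exists_oneForm (b := b) k
  refine ⟨a, ha, fun x hx s w ↦ ?_⟩
  obtain ⟨T, hT⟩ := exists_current_eq_linearMap hA σ g ⟨x, hx⟩ s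
  obtain ⟨d, rfl⟩ := (P.isCommutingFrame b).exists_eq_sum hx w
  rw [hT, map_sum T, map_sum, Finset.smul_sum]
  refine Finset.sum_congr rfl fun i _ ↦ ?_
  rw [map_smul T, map_smul, smul_comm, ← hT]
  congr 1
  refine eq_of_continuousLinearMapAt_eq P.e (P.subset_baseSet hx) ?_
  refine (lowerCurrent_apply hA σ g hm ⟨x, hx⟩ s i).trans ?_
  rw [h, map_smul, hak ⟨x, hx⟩]
  rfl

end Patch

end ElectricYM

/-! ### One step of the recursion, on a patch and globally -/

namespace ElectricYM

open Filter Set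
open scoped Topology

variable {E : Type*} [NormedAddCommGroup E] [NormedSpace ℝ E] [FiniteDimensional ℝ E]
  {H : Type*} [TopologicalSpace H] {I : ModelWithCorners ℝ E H}
  {M : Type*} [TopologicalSpace M] [ChartedSpace H M] [IsManifold I ∞ M]
  {F : Type*} [NormedAddCommGroup F] [NormedSpace ℝ F] [FiniteDimensional ℝ F]
  {κ : Type*} [Fintype κ] [DecidableEq κ] {b : Module.Basis κ ℝ E}
  {V : M → Type*} [TopologicalSpace (TotalSpace F V)]
  [∀ x, AddCommGroup (V x)] [∀ x, Module ℝ (V x)] [∀ x, TopologicalSpace (V x)]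
  [∀ x, IsTopologicalAddGroup (V x)] [∀ x, ContinuousSMul ℝ (V x)]
  [FiberBundle F V] [VectorBundle ℝ F V] [ContMDiffVectorBundle ∞ F V I]
  {c : Set (Metric I M)}

namespace Patch

variable [T2Space M] {P : Patch H F V} {A : CovariantDerivative I F V}
  {k : ∀ x : M, V x →L[ℝ] TangentSpace I x →L[ℝ] V x}

lemma gradSq_apply (g : Metric I M) {s : M → ℝ} (hs : CMDiff[P.U] ∞ s) (x : P.U) :
    ((P.calculus b).gradSq (P.invMetric b g) (P.scalar s hs)).1 x
      = conormSq g x (mvfderiv I s x) := by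
  refine Eq.symm ((conormSq_eq_apply_sharp g (x : M) (mvfderiv I s x).toLinearMap).trans ?_)
  refine (congrArg (mvfderiv I s (x : M)) (sharp_frame (b := b) g hs x)).trans ?_
  rw [map_sum, Calculus.gradSq, SmoothFun.sum_apply]
  refine Finset.sum_congr rfl fun j _ ↦ ?_
  rw [map_smul, SmoothFun.mul_apply,
    chartCalculus_d_apply b P.isOpen P.subset_source j (g := s) (fun _ ↦ rfl), smul_eq_mul, mul_comm]

lemma sum_grad_smul_oneForm_apply (g : Metric I M) {s : M → ℝ} (hs : CMDiff[P.U] ∞ s)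
    (hk : IsSmoothOneFormOn (F := F) P.U k) (x : P.U) (t : V x) :
    (∑ v, (P.calculus b).grad (P.invMetric b g) (P.scalar s hs) v • P.oneForm b hk v).1 x
        (P.e.continuousLinearMapAt ℝ x t)
      = P.e.continuousLinearMapAt ℝ x (k x t (sharp g x (mvfderiv I s x))) := by
  rw [sharp_frame (b := b) g hs x, map_sum, map_sum, SmoothFun.sum_apply, _root_.sum_apply]
  refine Finset.sum_congr rfl fun j _ ↦ ?_
  rw [map_smul, map_smul, continuousLinearMapAt_oneForm x.2]
  rfl

lemma sum_grad_smul_oneForm_eq_smul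
    (hA : CovariantDerivative.ContMDiffCovariantDerivative A ∞) (σ : Density c 1) (g : c)
    (hσ : ∀ x, σ.rep g x = 0 → mvfderiv I (σ.rep g) x ≠ 0)
    {m : ℕ} (hm : Module.finrank ℝ E = m + 4) {N : ℕ} (hN : m + 1 < N)
    (hk : IsSmoothOneFormOn (F := F) P.U k)
    (h : ∀ x ∈ P.U, ∀ s w, current σ A g x s w = σ.rep g x ^ N • k x s w) :
    ∃ q : SmoothFun I P.U (F →L[ℝ] F), ∑ v, (P.calculus b).grad (P.invMetric b g.1)
      (P.scalar (σ.rep g) (σ.contMDiff g).contMDiffOn) v • P.oneForm b hk v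
        = P.scalar (σ.rep g) (σ.contMDiff g).contMDiffOn • q := by
  set s := P.scalar (σ.rep g) (σ.contMDiff g).contMDiffOn with hs
  have h1 := (P.calculus b).pow_smul_normal_component (invMetric_symm g.1)
    (metric_mul_invMetric g.1) (invMetric_mul_metric g.1) (P.connection b hA) s m N
    (lowerCurrent_eq_pow_smul hA σ g hm N hk h)
  set Q := ∑ v, (P.calculus b).grad (P.invMetric b g.1) s v • P.oneForm b hk v
  set D := (P.calculus b).div (P.connection b hA)
    ((P.calculus b).logVol (P.metric b g.1) (P.invMetric b g.1))
    (fun i ↦ ∑ j, P.invMetric b g.1 i j • P.oneForm b hk j)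
  have h2 : s • D + ((N : SmoothFun I P.U ℝ) - ((m + 1 : ℕ) : SmoothFun I P.U ℝ)) • Q = 0 :=
    SmoothFun.eq_zero_of_pow_smul P.isOpen (fun x _ ↦ hσ x) N fun x ↦
      congrArg (fun z : SmoothFun I P.U (F →L[ℝ] F) ↦ z.1 x) h1
  have h3 : (N : ℝ) - ((m + 1 : ℕ) : ℝ) ≠ 0 := by
    rw [sub_ne_zero]; exact_mod_cast hN.ne'
  refine ⟨(-((N : ℝ) - ((m + 1 : ℕ) : ℝ))⁻¹) • D, SmoothFun.ext_apply fun x ↦ ?_⟩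
  have h4 := congrArg (fun z : SmoothFun I P.U (F →L[ℝ] F) ↦ z.1 x) h2
  simp only [SmoothFun.add_apply, SmoothFun.smul_apply, SmoothFun.sub_apply,
    SmoothFun.natCast_apply, SmoothFun.zero_apply] at h4
  rw [SmoothFun.smul_apply, SmoothFun.real_smul_apply, neg_smul, smul_neg, eq_neg_iff_add_eq_zero,
    smul_comm]
  have h5 := congrArg (((N : ℝ) - ((m + 1 : ℕ) : ℝ))⁻¹ • ·) h4
  simp only [smul_add, smul_smul, inv_mul_cancel₀ h3, one_smul, smul_zero] at h5
  rw [add_comm, smul_smul]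
  exact h5

lemma exists_current_step
    (hA : CovariantDerivative.ContMDiffCovariantDerivative A ∞) (σ : Density c 1) (g : c)
    {m : ℕ} (hm : Module.finrank ℝ E = m + 4) {N : ℕ}
    (hk : IsSmoothOneFormOn (F := F) P.U k)
    (h : ∀ x ∈ P.U, ∀ s w, current σ A g x s w = σ.rep g x ^ N • k x s w)
    {q : SmoothFun I P.U (F →L[ℝ] F)}
    (hq : ∑ v, (P.calculus b).grad (P.invMetric b g.1)
      (P.scalar (σ.rep g) (σ.contMDiff g).contMDiffOn) v • P.oneForm b hk v
        = P.scalar (σ.rep g) (σ.contMDiff g).contMDiffOn • q)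
    {ρ : M → ℝ} (hρ : CMDiff[P.U] ∞ ρ)
    (hρ' : ∀ x, ρ x * conormSq g.1 x (mvfderiv I (σ.rep g) x) = 1 - σ.rep g x ^ 2 * ρ x)
    {r : ℝ} (hr : r * (((N + 1 : ℕ) : ℝ) * ((N : ℝ) - m)) = -1)
    {A' : CovariantDerivative I F V} (hA' : CovariantDerivative.ContMDiffCovariantDerivative A' ∞)
    (hAA' : A' = A.addOneForm fun x ↦ σ.rep g x ^ (N + 1) • (r * ρ x) • k x) :
    ∃ k' : ∀ x : M, V x →L[ℝ] TangentSpace I x →L[ℝ] V x, IsSmoothOneFormOn (F := F) P.U k' ∧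
      ∀ x ∈ P.U, ∀ s w, current σ A' g x s w = σ.rep g x ^ (N + 1) • k' x s w := by
  set s := P.scalar (σ.rep g) (σ.contMDiff g).contMDiffOn with hs
  have hr' : CMDiff[P.U] ∞ fun x ↦ r * ρ x := contMDiffOn_const.mul hρ
  obtain ⟨k', hk'⟩ := (P.calculus b).exists_lowerCurrent_step (invMetric_symm g.1)
    (metric_mul_invMetric g.1) (P.connection b hA) s m N
    (lowerCurrent_eq_pow_smul hA σ g hm N hk h) hq (ρ := P.scalar ρ hρ)
    (SmoothFun.ext_apply fun x ↦ by
      rw [SmoothFun.mul_apply, gradSq_apply]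
      exact hρ' x)
    (c := SmoothFun.mk (fun _ ↦ r) contMDiffOn_const)
    (SmoothFun.ext_apply fun x ↦ hr)
  refine exists_pow_smul_of_lowerCurrent (b := b) (k := k') hA' σ g hm (N + 1) fun w ↦ ?_
  rw [← hk', lowerCurrent, connection_addOneForm hA ((σ.contMDiff g).contMDiffOn.pow (N + 1))
    (hk.smul P.isOpen hr') hA' hAA']
  congr 1
  funext j
  congr 1
  refine SmoothFun.ext_apply fun x ↦ ContinuousLinearMap.ext fun v ↦ ?_
  have h1 : P.e.continuousLinearMapAt ℝ (x : M) (((r * ρ x) • k x) (P.e.symmL ℝ (x : M) v)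
      (P.frame b j x)) = (r * ρ x) • P.component b k j x v := by
    rw [component_apply, _root_.smul_apply, _root_.smul_apply, map_smul]
  exact congrArg (σ.rep g x ^ (N + 1) • ·) h1

lemma exists_pow_smul_of_lowerCurrent_add
    (hA : CovariantDerivative.ContMDiffCovariantDerivative A ∞)
    {A' : CovariantDerivative I F V} (hA' : CovariantDerivative.ContMDiffCovariantDerivative A' ∞)
    (σ : Density c 1) (g : c) {m : ℕ} (hm : Module.finrank ℝ E = m + 4) (N : ℕ)
    {k : κ → SmoothFun I P.U (F →L[ℝ] F)}
    (h : ∀ w, P.lowerCurrent b hA' σ g m w = P.lowerCurrent b hA σ g m w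
      + P.scalar (σ.rep g) (σ.contMDiff g).contMDiffOn ^ N • k w) :
    ∃ a : ∀ x : M, V x →L[ℝ] TangentSpace I x →L[ℝ] V x, IsSmoothOneFormOn (F := F) P.U a ∧
      ∀ x ∈ P.U, ∀ s w, current σ A' g x s w = current σ A g x s w + σ.rep g x ^ N • a x s w := by
  have : Nonempty (Metric I M) := ⟨g.1⟩
  obtain ⟨a, ha, hak⟩ := exists_oneForm (b := b) k
  refine ⟨a, ha, fun x hx s w ↦ ?_⟩
  obtain ⟨T, hT⟩ := exists_current_eq_linearMap hA σ g ⟨x, hx⟩ s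
  obtain ⟨T', hT'⟩ := exists_current_eq_linearMap hA' σ g ⟨x, hx⟩ s
  obtain ⟨d, rfl⟩ := (P.isCommutingFrame b).exists_eq_sum hx w
  rw [hT, hT', map_sum T, map_sum T', map_sum, Finset.smul_sum, ← Finset.sum_add_distrib]
  refine Finset.sum_congr rfl fun i _ ↦ ?_
  rw [map_smul T, map_smul T', map_smul, smul_comm, ← smul_add, ← hT, ← hT']
  congr 1
  refine eq_of_continuousLinearMapAt_eq P.e (P.subset_baseSet hx) ?_
  refine (lowerCurrent_apply hA' σ g hm ⟨x, hx⟩ s i).trans ?_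
  rw [h, map_add, map_smul, hak ⟨x, hx⟩]
  exact congrArg₂ (· + ·) (lowerCurrent_apply hA σ g hm ⟨x, hx⟩ s i).symm rfl

lemma exists_current_add (hA : CovariantDerivative.ContMDiffCovariantDerivative A ∞)
    (σ : Density c 1) (g : c) {m : ℕ} (hm : Module.finrank ℝ E = m + 4) {N : ℕ}
    (hk : IsSmoothOneFormOn (F := F) P.U k)
    {A' : CovariantDerivative I F V} (hA' : CovariantDerivative.ContMDiffCovariantDerivative A' ∞)
    (hAA' : A' = A.addOneForm fun x ↦ σ.rep g x ^ (N + 1) • k x) :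
    ∃ r : ∀ x : M, V x →L[ℝ] TangentSpace I x →L[ℝ] V x, IsSmoothOneFormOn (F := F) P.U r ∧
      ∀ x ∈ P.U, ∀ s w, current σ A' g x s w = current σ A g x s w + σ.rep g x ^ N • r x s w := by
  let b := Module.finBasis ℝ E
  obtain ⟨r, hr⟩ := (P.calculus b).exists_lowerCurrent_add_connection (invMetric_symm g.1)
    (metric_mul_invMetric g.1) (P.connection b hA)
    (P.scalar (σ.rep g) (σ.contMDiff g).contMDiffOn) m N (P.oneForm b hk)
  set f := P.scalar (σ.rep g) (σ.contMDiff g).contMDiffOn with hf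
  refine exists_pow_smul_of_lowerCurrent_add (b := b) hA hA' σ g hm N
    (k := fun w ↦ (((N + 1 : ℕ) : SmoothFun I P.U ℝ) * ((N : SmoothFun I P.U ℝ) - m)) •
      ((P.calculus b).gradSq (P.invMetric b g.1) f • P.oneForm b hk w
        - (P.calculus b).d w f • ∑ v, (P.calculus b).grad (P.invMetric b g.1) f v •
          P.oneForm b hk v) + f • r w) fun w ↦ ?_
  rw [lowerCurrent, connection_addOneForm hA ((σ.contMDiff g).contMDiffOn.pow (N + 1)) hk hA' hAA']
  refine (hr w).trans ?_
  rw [mul_comm _ (f ^ N), mul_smul (f ^ N), pow_succ, mul_smul (f ^ N), add_assoc, ← smul_add]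
  rfl

end Patch

lemma exists_patch (x : M) {W : Set M} (hW : W ∈ 𝓝 x) :
    ∃ P : Patch H F V, x ∈ P.U ∧ P.p = x ∧ P.e = trivializationAt F V x ∧ P.U ⊆ W := by
  refine ⟨{ p := x, U := interior W ∩ (chartAt H x).source ∩ (trivializationAt F V x).baseSet
            isOpen := (isOpen_interior.inter (chartAt H x).open_source).inter
              (trivializationAt F V x).open_baseSet
            subset_source := fun y hy ↦ hy.1.2
            e := trivializationAt F V x
            subset_baseSet := fun y hy ↦ hy.2 }, ⟨⟨mem_interior_iff_mem_nhds.2 hW,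
    mem_chart_source H x⟩, FiberBundle.mem_baseSet_trivializationAt F V x⟩, rfl, rfl,
    fun y hy ↦ interior_subset hy.1.1⟩

/-- One-forms that satisfy linear equations can be glued. -/
lemma exists_oneForm_of_local [T2Space M] [SigmaCompactSpace M] {N : ℕ} {f : M → ℝ}
    {J : ∀ x : M, V x → TangentSpace I x → V x}
    (h : ∀ x : M, ∃ U ∈ 𝓝 x, ∃ k : ∀ x : M, V x →L[ℝ] TangentSpace I x →L[ℝ] V x,
      IsSmoothOneFormOn (F := F) U k ∧ ∀ x ∈ U, ∀ s w, J x s w = f x ^ N • k x s w) :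
    ∃ k : ∀ x : M, V x →L[ℝ] TangentSpace I x →L[ℝ] V x,
      IsSmoothOneFormOn (F := F) univ k ∧ ∀ x s w, J x s w = f x ^ N • k x s w := by
  obtain ⟨k, hk⟩ := exists_contMDiffSection_forall_mem_convex_of_local I (n := ⊤)
    (F_fiber := F →L[ℝ] E →L[ℝ] F) (fun x : M ↦ V x →L[ℝ] TangentSpace I x →L[ℝ] V x)
    (fun x ↦ {k | ∀ s w, J x s w = f x ^ N • k s w})
    (fun x k hk k' hk' a a' _ _ haa' s w ↦ by
      rw [_root_.add_apply, _root_.smul_apply, _root_.smul_apply, _root_.add_apply,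
        _root_.smul_apply, _root_.smul_apply, smul_add, smul_comm _ a, smul_comm _ a', ← hk, ← hk',
        ← add_smul, haa', one_smul])
    (fun x ↦ by
      obtain ⟨U, hU, k, hk, hk'⟩ := h x
      exact ⟨U, hU, k, hk, hk'⟩)
  exact ⟨k, k.contMDiff.contMDiffOn, hk⟩

end ElectricYM

/-! ### Balls in charts -/

namespace ElectricYM

open Filter Set
open scoped Topology

section ChartBall

variable {E : Type*} [NormedAddCommGroup E] [NormedSpace ℝ E] [FiniteDimensional ℝ E]
  {H : Type*} [TopologicalSpace H] (I : ModelWithCorners ℝ E H)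
  {M : Type*} [TopologicalSpace M] [ChartedSpace H M] [IsManifold I ∞ M]
  {W : Type*} [NormedAddCommGroup W] [NormedSpace ℝ W]

/-- A closed ball in the preferred chart at `p`. -/
def chartBall (p : M) (r : ℝ) : Set E := range I ∩ Metric.closedBall (extChartAt I p p) r

variable {I}

lemma convex_chartBall (p : M) (r : ℝ) : Convex ℝ (chartBall I p r) :=
  I.convex_range.inter (convex_closedBall _ _)

lemma isCompact_chartBall (p : M) (r : ℝ) : IsCompact (chartBall I p r) :=
  (isCompact_closedBall _ _).inter_left I.isClosed_range

lemma uniqueDiffOn_chartBall (p : M) {r : ℝ} (hr : 0 < r) : UniqueDiffOn ℝ (chartBall I p r) := by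
  refine uniqueDiffOn_convex (convex_chartBall p r) ?_
  have h1 : extChartAt I p p ∈ closure (interior (range I)) :=
    I.range_subset_closure_interior (mem_range_self _)
  obtain ⟨z, hz, hz'⟩ := mem_closure_iff.1 h1 _ Metric.isOpen_ball (Metric.mem_ball_self hr)
  refine ⟨z, mem_interior_iff_mem_nhds.2 (inter_mem (mem_interior_iff_mem_nhds.1 hz') ?_)⟩
  exact mem_of_superset (Metric.isOpen_ball.mem_nhds hz) Metric.ball_subset_closedBall

lemma exists_chartBall_subset {p : M} {U : Set M} (hU : IsOpen U)
    (hUp : U ⊆ (chartAt H p).source) (hp : p ∈ U) : ∃ r > 0, chartBall I p r ⊆ chartImage I p U := by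
  obtain ⟨ε, hε, h⟩ := Metric.mem_nhdsWithin_iff.1 (chartImage_mem_nhdsWithin (I := I) hU hUp hp)
  exact ⟨ε / 2, half_pos hε, fun z hz ↦
    h ⟨Metric.closedBall_subset_ball (half_lt_self hε) hz.2, hz.1⟩⟩

lemma exists_nhds_chartBall (p : M) {r : ℝ} (hr : 0 < r) : ∃ U : Set M, IsOpen U ∧ p ∈ U ∧
    U ⊆ (chartAt H p).source ∧ MapsTo (extChartAt I p) U (chartBall I p r) := by
  refine ⟨(chartAt H p).source ∩ extChartAt I p ⁻¹' Metric.ball (extChartAt I p p) r,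
    isOpen_extChartAt_preimage p Metric.isOpen_ball, ⟨mem_chart_source H p,
    Metric.mem_ball_self hr⟩, inter_subset_left, fun y hy ↦ ⟨?_, Metric.ball_subset_closedBall hy.2⟩⟩
  exact extChartAt_target_subset_range p ((extChartAt I p).map_source (by simpa using hy.1))

lemma contMDiffOn_comp_extChartAt_of_mapsTo {p : M} {U : Set M} {s : Set E}
    (hUp : U ⊆ (chartAt H p).source) (h : MapsTo (extChartAt I p) U s) {f : E → W}
    (hf : ContDiffOn ℝ ∞ f s) : CMDiff[U] ∞ (fun y ↦ f (extChartAt I p y)) :=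
  (contMDiffOn_iff_contDiffOn.2 hf).comp (contMDiffOn_extChartAt.mono hUp) h

end ChartBall

section HalfSpace

variable {n : ℕ} {M : Type*} [TopologicalSpace M] [ChartedSpace (EuclideanHalfSpace (n + 1)) M]
  [IsManifold (𝓡∂ (n + 1)) ∞ M] {W : Type*} [NormedAddCommGroup W] [NormedSpace ℝ W]

lemma mem_boundary_iff {p y : M} (hy : y ∈ (chartAt (EuclideanHalfSpace (n + 1)) p).source) :
    y ∈ (𝓡∂ (n + 1)).boundary M ↔ extChartAt (𝓡∂ (n + 1)) p y 0 = 0 := by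
  have h := ModelWithCorners.isInteriorPoint_iff_of_mem_atlas (I := 𝓡∂ (n + 1)) (n := ∞)
    (by simp) (chart_mem_atlas _ p) hy
  have hy' : y ∈ (extChartAt (𝓡∂ (n + 1)) p).source := by simpa using hy
  have h2 : extChartAt (𝓡∂ (n + 1)) p y ∈ interior (extChartAt (𝓡∂ (n + 1)) p).target
      ↔ extChartAt (𝓡∂ (n + 1)) p y ∈ interior (range (𝓡∂ (n + 1))) := by
    rw [mem_interior_iff_mem_nhds, mem_interior_iff_mem_nhds]
    refine ⟨fun h ↦ mem_of_superset h (extChartAt_target_subset_range p), fun h ↦ ?_⟩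
    have := extChartAt_target_mem_nhdsWithin' hy'
    rwa [nhdsWithin_eq_nhds.2 h] at this
  rw [interior_range_modelWithCornersEuclideanHalfSpace] at h2
  have h0 : 0 ≤ extChartAt (𝓡∂ (n + 1)) p y 0 := by
    have := extChartAt_target_subset_range (I := 𝓡∂ (n + 1)) p
      ((extChartAt (𝓡∂ (n + 1)) p).map_source (by simpa using hy))
    rwa [range_modelWithCornersEuclideanHalfSpace] at this
  have h1 : y ∈ (𝓡∂ (n + 1)).boundary M ↔ ¬ (𝓡∂ (n + 1)).IsInteriorPoint y :=
    ModelWithCorners.isBoundaryPoint_iff_not_isInteriorPoint y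
  refine (h1.trans (not_congr (h.trans h2))).trans ?_
  exact not_lt.trans ⟨fun h ↦ le_antisymm h h0, fun h ↦ h.le⟩

variable (n) in
/-- `σ` is a smooth defining function of the boundary. -/
structure IsDefiningFunction (σ : M → ℝ) : Prop where
  contMDiff : ContMDiff (𝓡∂ (n + 1)) 𝓘(ℝ, ℝ) ∞ σ
  nonneg (x : M) : 0 ≤ σ x
  zero_iff (x : M) : σ x = 0 ↔ x ∈ (𝓡∂ (n + 1)).boundary M
  deriv_ne_zero (x : M) (hx : x ∈ (𝓡∂ (n + 1)).boundary M) : mvfderiv (𝓡∂ (n + 1)) σ x ≠ 0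

namespace IsDefiningFunction

variable {σ : M → ℝ}

lemma fderivWithin_eq_zero (hσ : IsDefiningFunction n σ) {p y : M}
    (hy : y ∈ (chartAt (EuclideanHalfSpace (n + 1)) p).source)
    (hy' : y ∈ (𝓡∂ (n + 1)).boundary M) {v : EuclideanSpace ℝ (Fin (n + 1))} (hv : v 0 = 0) :
    fderivWithin ℝ (fun z ↦ σ ((extChartAt (𝓡∂ (n + 1)) p).symm z)) (range (𝓡∂ (n + 1)))
      (extChartAt (𝓡∂ (n + 1)) p y) v = 0 := by
  have hy0 := (mem_boundary_iff hy).1 hy'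
  have hl : (extChartAt (𝓡∂ (n + 1)) p).symm (extChartAt (𝓡∂ (n + 1)) p y) = y :=
    (extChartAt (𝓡∂ (n + 1)) p).left_inv (by simpa using hy)
  have hseg : ∀ v : EuclideanSpace ℝ (Fin (n + 1)), v 0 = 0 →
      v ∈ posTangentConeAt (range (𝓡∂ (n + 1))) (extChartAt (𝓡∂ (n + 1)) p y) := fun v hv ↦ by
    refine mem_posTangentConeAt_of_segment_subset ((𝓡∂ (n + 1)).convex_range.segment_subset ?_ ?_)
    · exact extChartAt_target_subset_range p
        ((extChartAt (𝓡∂ (n + 1)) p).map_source (by simpa using hy))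
    · rw [range_modelWithCornersEuclideanHalfSpace, mem_ofPred_eq, PiLp.add_apply, hy0, hv, add_zero]
  refine IsLocalMinOn.fderivWithin_eq_zero (IsMinOn.localize fun z _ ↦ ?_) (hseg v hv)
    (hseg _ (by simp [hv]))
  rw [mem_ofPred_eq, hl, (hσ.zero_iff y).2 hy']
  exact hσ.nonneg _

lemma mvfderiv_chartFrame_eq_zero (hσ : IsDefiningFunction n σ) {κ : Type*} [Fintype κ]
    [DecidableEq κ] (b : Module.Basis κ ℝ (EuclideanSpace ℝ (Fin (n + 1)))) {p y : M}
    (hy : y ∈ (chartAt (EuclideanHalfSpace (n + 1)) p).source)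
    (hy' : y ∈ (𝓡∂ (n + 1)).boundary M) {i : κ} (hi : b i 0 = 0) :
    mvfderiv (𝓡∂ (n + 1)) σ y (chartFrame (𝓡∂ (n + 1)) b p i y) = 0 := by
  rw [mvfderiv_chartFrame b p hy ((hσ.contMDiff y).mdifferentiableAt (by simp))]
  exact hσ.fderivWithin_eq_zero hy hy' hi

lemma fderivWithin_single_ne_zero (hσ : IsDefiningFunction n σ) {p y : M}
    (hy : y ∈ (chartAt (EuclideanHalfSpace (n + 1)) p).source)
    (hy' : y ∈ (𝓡∂ (n + 1)).boundary M) :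
    fderivWithin ℝ (fun z ↦ σ ((extChartAt (𝓡∂ (n + 1)) p).symm z)) (range (𝓡∂ (n + 1)))
      (extChartAt (𝓡∂ (n + 1)) p y) (EuclideanSpace.single 0 1) ≠ 0 := by
  intro h0
  set b := (EuclideanSpace.basisFun (Fin (n + 1)) ℝ).toBasis with hb
  refine hσ.deriv_ne_zero y hy' (ContinuousLinearMap.ext fun u ↦ ?_)
  obtain ⟨c, rfl⟩ := (isCommutingFrame_chartFrame (I := 𝓡∂ (n + 1)) b p
    (chartAt (EuclideanHalfSpace (n + 1)) p).open_source subset_rfl).exists_eq_sum hy u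
  rw [map_sum, _root_.zero_apply]
  refine Finset.sum_eq_zero fun i _ ↦ ?_
  rw [map_smul]
  by_cases hi : i = 0
  · rw [mvfderiv_chartFrame b p hy ((hσ.contMDiff y).mdifferentiableAt (by simp)), hi]
    have : b 0 = EuclideanSpace.single 0 1 := by simp [hb]
    rw [this, h0, smul_zero]
  · rw [hσ.mvfderiv_chartFrame_eq_zero b hy hy' (by simp [hb, Ne.symm hi]), smul_zero]

/-- A smooth function that vanishes on the boundary is locally divisible by `σ`. -/
lemma exists_eq_smul [CompleteSpace W] (hσ : IsDefiningFunction n σ) {p : M} {U : Set M}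
    (hU : IsOpen U) (hp : p ∈ U) {f : M → W} (hf : ContMDiffOn (𝓡∂ (n + 1)) 𝓘(ℝ, W) ∞ f U)
    (h0 : ∀ x ∈ U, x ∈ (𝓡∂ (n + 1)).boundary M → f x = 0) :
    ∃ U' ⊆ U, IsOpen U' ∧ p ∈ U' ∧ ∃ q : M → W,
      ContMDiffOn (𝓡∂ (n + 1)) 𝓘(ℝ, W) ∞ q U' ∧ ∀ x ∈ U', f x = σ x • q x := by
  by_cases hpb : σ p = 0
  · set U₁ := U ∩ (chartAt (EuclideanHalfSpace (n + 1)) p).source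
    have hU₁ : IsOpen U₁ := hU.inter (chartAt _ p).open_source
    have hpU₁ : p ∈ U₁ := ⟨hp, mem_chart_source _ p⟩
    obtain ⟨r, hr, hT⟩ := exists_chartBall_subset (I := 𝓡∂ (n + 1)) hU₁ inter_subset_right hpU₁
    obtain ⟨U', hU', hpU', hU'p, hmaps⟩ := exists_nhds_chartBall (I := 𝓡∂ (n + 1)) p hr
    have hp0 := (mem_boundary_iff (mem_chart_source _ p)).1 ((hσ.zero_iff p).1 hpb)
    have hmem : ∀ z ∈ chartBall (𝓡∂ (n + 1)) p r,
        (extChartAt (𝓡∂ (n + 1)) p).symm z ∈ U₁ ∧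
          extChartAt (𝓡∂ (n + 1)) p ((extChartAt (𝓡∂ (n + 1)) p).symm z) = z := fun z hz ↦
      ⟨(hT hz).2, (extChartAt (𝓡∂ (n + 1)) p).right_inv (hT hz).1⟩
    have hσs := contDiffOn_comp_extChartAt_symm p (hσ.contMDiff.contMDiffOn (s := U₁))
    have hzero : ∀ z ∈ chartBall (𝓡∂ (n + 1)) p r,
        σ ((extChartAt (𝓡∂ (n + 1)) p).symm z) = 0 ↔ z 0 = 0 := fun z hz ↦ by
      rw [hσ.zero_iff, mem_boundary_iff (hmem z hz).1.2, (hmem z hz).2]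
    have hsc : ∀ z ∈ chartBall (𝓡∂ (n + 1)) p r,
        scaling (EuclideanSpace.proj 0 : EuclideanSpace ℝ (Fin (n + 1)) →L[ℝ] ℝ)
          (EuclideanSpace.single 0 1) 0 z ∈ chartBall (𝓡∂ (n + 1)) p r := by
      intro z hz
      have hz1 := hz.1
      rw [range_modelWithCornersEuclideanHalfSpace] at hz1
      refine ⟨?_, ?_⟩
      · rw [range_modelWithCornersEuclideanHalfSpace]
        simp [scaling_apply]
      · refine le_trans ?_ (Metric.mem_closedBall.1 hz.2)
        rw [EuclideanSpace.dist_eq, EuclideanSpace.dist_eq]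
        refine Real.sqrt_le_sqrt (Finset.sum_le_sum fun i _ ↦ ?_)
        by_cases hi : i = 0
        · subst hi
          rw [hp0]
          simp [scaling_apply, sq_nonneg]
        · simp [scaling_apply, hi]
    have hdσ : ∀ z ∈ chartBall (𝓡∂ (n + 1)) p r,
        (EuclideanSpace.proj 0 : EuclideanSpace ℝ (Fin (n + 1)) →L[ℝ] ℝ) z = 0 →
        fderivWithin ℝ (fun z ↦ σ ((extChartAt (𝓡∂ (n + 1)) p).symm z))
          (chartBall (𝓡∂ (n + 1)) p r) z (EuclideanSpace.single 0 1) ≠ 0 := by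
      intro z hz hz0
      have hz0' : z 0 = 0 := hz0
      have h1 := hσ.fderivWithin_single_ne_zero (p := p) (hmem z hz).1.2
        ((hσ.zero_iff _).1 ((hzero z hz).2 hz0'))
      rw [fderivWithin_range_eq p hU₁ inter_subset_right hσs (hmem z hz).1, (hmem z hz).2] at h1
      rwa [fderivWithin_subset hT (uniqueDiffOn_chartBall p hr z hz)
        ((hσs z (hT hz)).differentiableWithinAt (by simp))]
    obtain ⟨q, hq, hq'⟩ := exists_eq_smul_of_vanishing (convex_chartBall (I := 𝓡∂ (n + 1)) p r)
      (isCompact_chartBall p r) (uniqueDiffOn_chartBall p hr)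
      (l := (EuclideanSpace.proj 0 : EuclideanSpace ℝ (Fin (n + 1)) →L[ℝ] ℝ))
      (e := EuclideanSpace.single 0 1) (by simp) hsc (hσs.mono hT) hzero hdσ
      ((contDiffOn_comp_extChartAt_symm p (hf.mono inter_subset_left)).mono hT)
      (fun z hz hz0 ↦ h0 _ (hmem z hz).1.1 ((hσ.zero_iff _).1 hz0))
    refine ⟨U' ∩ U, inter_subset_right, hU'.inter hU, ⟨hpU', hp⟩, fun y ↦ q (extChartAt (𝓡∂ (n + 1)) p y),
      (contMDiffOn_comp_extChartAt_of_mapsTo hU'p hmaps hq).mono inter_subset_left,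
      fun y hy ↦ ?_⟩
    have h1 := hq' _ (hmaps hy.1)
    rwa [(extChartAt (𝓡∂ (n + 1)) p).left_inv (by simpa using hU'p hy.1)] at h1
  · have hc := hσ.contMDiff.continuous
    refine ⟨U ∩ {x | σ x ≠ 0}, inter_subset_left, hU.inter (isOpen_ne.preimage hc), ⟨hp, hpb⟩,
      fun x ↦ (σ x)⁻¹ • f x, ?_, fun x hx ↦ ?_⟩
    · exact (hσ.contMDiff.contMDiffOn.inv₀ fun x hx ↦ hx.2).smul (hf.mono inter_subset_left)
    · rw [smul_smul, mul_inv_cancel₀ hx.2, one_smul]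

end IsDefiningFunction

end HalfSpace

end ElectricYM

/-! ### The formal solution -/

namespace ElectricYM

open Filter Set
open scoped Topology

section General

variable {E : Type*} [NormedAddCommGroup E] [NormedSpace ℝ E] [FiniteDimensional ℝ E]
  {H : Type*} [TopologicalSpace H] {I : ModelWithCorners ℝ E H}
  {M : Type*} [TopologicalSpace M] [ChartedSpace H M] [IsManifold I ∞ M]
  {F : Type*} [NormedAddCommGroup F] [NormedSpace ℝ F] [FiniteDimensional ℝ F]
  {V : M → Type*} [TopologicalSpace (TotalSpace F V)]
  [∀ x, AddCommGroup (V x)] [∀ x, Module ℝ (V x)] [∀ x, TopologicalSpace (V x)]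
  [∀ x, IsTopologicalAddGroup (V x)] [∀ x, ContinuousSMul ℝ (V x)]
  [FiberBundle F V] [VectorBundle ℝ F V] [ContMDiffVectorBundle ∞ F V I]

lemma covariantDerivative_ext {A A' : CovariantDerivative I F V}
    (h : ∀ S x u, A S x u = A' S x u) : A = A' := by
  cases A
  cases A'
  congr
  funext S x
  exact ContinuousLinearMap.ext fun u ↦ h S x u

lemma addOneForm_apply (A : CovariantDerivative I F V)
    (a : ∀ x : M, V x →L[ℝ] TangentSpace I x →L[ℝ] V x) (S : ∀ x, V x) (x : M)
    (u : TangentSpace I x) : A.addOneForm a S x u = A S x u + a x (S x) u := rfl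

lemma isSmoothOneFormOn_zero {U : Set M} : IsSmoothOneFormOn (F := F) U
    (fun x : M ↦ (0 : V x →L[ℝ] TangentSpace I x →L[ℝ] V x)) :=
  isSmoothOneFormOn_of_apply fun x _ S _ hS _ ↦ by
    have := (contMDiffAt_const (c := (0 : ℝ)) (I := I) (n := ∞) (x := x)).smul_section hS
    simpa using this

lemma isSmoothOneFormOn_sum {U : Set M} (hU : IsOpen U) {ι : Type*} (t : Finset ι)
    {a : ι → ∀ x : M, V x →L[ℝ] TangentSpace I x →L[ℝ] V x}
    (ha : ∀ i ∈ t, IsSmoothOneFormOn (F := F) U (a i)) :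
    IsSmoothOneFormOn (F := F) U fun x ↦ ∑ i ∈ t, a i x := by
  classical
  induction t using Finset.induction_on with
  | empty => simpa using isSmoothOneFormOn_zero
  | insert i t hi ih =>
    simp only [Finset.sum_insert hi]
    exact (ha i (Finset.mem_insert_self i t)).add hU
      (ih fun j hj ↦ ha j (Finset.mem_insert_of_mem hj))

lemma contMDiff_conormSq [T2Space M] (g : Metric I M) {s : M → ℝ} (hs : CMDiff ∞ s) :
    CMDiff ∞ fun x ↦ conormSq g x (mvfderiv I s x) := by
  intro x
  obtain ⟨P, hx, -⟩ := exists_patch (H := H) (F := ℝ) (V := Bundle.Trivial M ℝ) x univ_mem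
  have h := SmoothFun.contMDiffOn_rep ((P.calculus (Module.finBasis ℝ E)).gradSq
    (P.invMetric (Module.finBasis ℝ E) g) (P.scalar s hs.contMDiffOn))
  refine (h.contMDiffAt (P.isOpen.mem_nhds hx)).congr_of_eventuallyEq ?_
  filter_upwards [P.isOpen.mem_nhds hx] with y hy
  have h1 := Patch.gradSq_apply (b := Module.finBasis ℝ E) g hs.contMDiffOn ⟨y, hy⟩
  exact h1.symm.trans (SmoothFun.rep_apply _ (⟨y, hy⟩ : P.U)).symm

/-- The restriction of a patch. -/
def Patch.restrict (P : Patch H F V) (U : Set M) (hU : IsOpen U) (h : U ⊆ P.U) : Patch H F V where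
  p := P.p
  U := U
  isOpen := hU
  subset_source := h.trans P.subset_source
  e := P.e
  subset_baseSet := h.trans P.subset_baseSet

end General

section HalfSpace

variable {n : ℕ} {M : Type*} [TopologicalSpace M] [T2Space M]
  [ChartedSpace (EuclideanHalfSpace (n + 1)) M] [IsManifold (𝓡∂ (n + 1)) ∞ M]
  {F : Type*} [NormedAddCommGroup F] [NormedSpace ℝ F] [FiniteDimensional ℝ F]
  {V : M → Type*} [TopologicalSpace (TotalSpace F V)]
  [∀ x, AddCommGroup (V x)] [∀ x, Module ℝ (V x)] [∀ x, TopologicalSpace (V x)]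
  [∀ x, IsTopologicalAddGroup (V x)] [∀ x, ContinuousSMul ℝ (V x)]
  [FiberBundle F V] [VectorBundle ℝ F V] [ContMDiffVectorBundle ∞ F V (𝓡∂ (n + 1))]
  {c : Set (Metric (𝓡∂ (n + 1)) M)} {σ : Density c 1}
  {A : CovariantDerivative (𝓡∂ (n + 1)) F V}

lemma IsDefiningDensity.isDefiningFunction (hσ : IsDefiningDensity σ) (g : c) :
    IsDefiningFunction n (σ.rep g) :=
  ⟨σ.contMDiff g, hσ.nonneg g, hσ.zero_iff g, hσ.deriv_ne_zero g⟩

lemma exists_weight (hσ : IsDefiningDensity σ) (g : c) : ∃ ρ : M → ℝ,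
    ContMDiff (𝓡∂ (n + 1)) 𝓘(ℝ, ℝ) ∞ ρ ∧ ∀ x, ρ x * conormSq g.1 x
      (mvfderiv (𝓡∂ (n + 1)) (σ.rep g) x) = 1 - σ.rep g x ^ 2 * ρ x := by
  have hpos : ∀ x, conormSq g.1 x (mvfderiv (𝓡∂ (n + 1)) (σ.rep g) x) + σ.rep g x ^ 2 ≠ 0 := by
    intro x
    by_cases hx : σ.rep g x = 0
    · have h := conormSq_pos g.1 x (mvfderiv (𝓡∂ (n + 1)) (σ.rep g) x).toLinearMap fun h ↦
        hσ.deriv_ne_zero g x ((hσ.zero_iff g x).1 hx)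
          (ContinuousLinearMap.ext fun u ↦ LinearMap.congr_fun h u)
      exact (add_pos_of_pos_of_nonneg h (sq_nonneg _)).ne'
    · have h := conormSq_nonneg g.1 x (mvfderiv (𝓡∂ (n + 1)) (σ.rep g) x).toLinearMap
      exact (add_pos_of_nonneg_of_pos h (by positivity)).ne'
  refine ⟨fun x ↦ (conormSq g.1 x (mvfderiv (𝓡∂ (n + 1)) (σ.rep g) x) + σ.rep g x ^ 2)⁻¹,
    ((contMDiff_conormSq g.1 (σ.contMDiff g)).add ((σ.contMDiff g).pow 2)).inv₀ hpos, fun x ↦ ?_⟩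
  have := inv_mul_cancel₀ (hpos x)
  linear_combination this

/-- The current of `A` in the scale `g` is `σ ^ N k`, where `k` is smooth. -/
def CurrentDivisible (σ : Density c 1) (g : c) (A : CovariantDerivative (𝓡∂ (n + 1)) F V) (N : ℕ)
    (k : ∀ x : M, V x →L[ℝ] TangentSpace (𝓡∂ (n + 1)) x →L[ℝ] V x) : Prop :=
  IsSmoothOneFormOn (F := F) univ k ∧
    ∀ x s w, current σ A g x s w = σ.rep g x ^ N • k x s w

lemma exists_current_step [SigmaCompactSpace M]
    (hA : CovariantDerivative.ContMDiffCovariantDerivative A ∞)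
    (hσ : IsDefiningDensity σ) (g : c) {m : ℕ} (hm : n + 1 = m + 4) {N : ℕ} (hN : m < N)
    {k : ∀ x : M, V x →L[ℝ] TangentSpace (𝓡∂ (n + 1)) x →L[ℝ] V x}
    (hk : CurrentDivisible σ g A N k)
    (hnk : N = m + 1 → ∀ x ∈ (𝓡∂ (n + 1)).boundary M, ∀ s,
      k x s (sharp g.1 x (mvfderiv (𝓡∂ (n + 1)) (σ.rep g) x)) = 0) :
    ∃ b : ∀ x : M, V x →L[ℝ] TangentSpace (𝓡∂ (n + 1)) x →L[ℝ] V x,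
      IsSmoothOneFormOn (F := F) univ b ∧
      ∃ k', CurrentDivisible σ g (A.addOneForm fun x ↦ σ.rep g x ^ (N + 1) • b x) (N + 1) k' := by
  obtain ⟨ρ, hρ, hρ'⟩ := exists_weight hσ g
  have hNm : ((N + 1 : ℕ) : ℝ) * ((N : ℝ) - m) ≠ 0 :=
    mul_ne_zero (by positivity) (sub_ne_zero.2 (by exact_mod_cast hN.ne'))
  set r : ℝ := -(((N + 1 : ℕ) : ℝ) * ((N : ℝ) - m))⁻¹
  have hr : r * (((N + 1 : ℕ) : ℝ) * ((N : ℝ) - m)) = -1 := by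
    rw [neg_mul, inv_mul_cancel₀ hNm]
  have hm' : Module.finrank ℝ (EuclideanSpace ℝ (Fin (n + 1))) = m + 4 := by simp [hm]
  have hd : ∀ x, σ.rep g x = 0 → mvfderiv (𝓡∂ (n + 1)) (σ.rep g) x ≠ 0 := fun x hx ↦
    hσ.deriv_ne_zero g x ((hσ.zero_iff g x).1 hx)
  have hb : IsSmoothOneFormOn (F := F) univ fun x ↦ (r * ρ x) • k x :=
    hk.1.smul isOpen_univ (contMDiffOn_const.mul hρ.contMDiffOn)
  refine ⟨_, hb, exists_oneForm_of_local fun x ↦ ?_⟩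
  have hA' := contMDiffCovariantDerivative_addOneForm hA
    (hb.smul isOpen_univ ((σ.contMDiff g).pow (N + 1)).contMDiffOn)
  let b := Module.finBasis ℝ (EuclideanSpace ℝ (Fin (n + 1)))
  obtain ⟨P, hxP, hPq⟩ : ∃ P : Patch (EuclideanHalfSpace (n + 1)) F V, x ∈ P.U ∧
      ∃ q : SmoothFun (𝓡∂ (n + 1)) P.U (F →L[ℝ] F), ∑ v, (P.calculus b).grad (P.invMetric b g.1)
      (P.scalar (σ.rep g) (σ.contMDiff g).contMDiffOn) v • P.oneForm b (hk.1.mono (subset_univ _)) v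
        = P.scalar (σ.rep g) (σ.contMDiff g).contMDiffOn • q := by
    obtain ⟨P, hxP, -, -, -⟩ := exists_patch (H := EuclideanHalfSpace (n + 1)) (F := F) (V := V) x
      univ_mem
    by_cases hN' : N = m + 1
    · have hf := fun P : Patch (EuclideanHalfSpace (n + 1)) F V ↦
        Patch.sum_grad_smul_oneForm_apply (P := P) (b := b) g.1 (σ.contMDiff g).contMDiffOn
          (hk.1.mono (subset_univ _))
      set Q := ∑ v, (P.calculus b).grad (P.invMetric b g.1)
        (P.scalar (σ.rep g) (σ.contMDiff g).contMDiffOn) v •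
          P.oneForm b (hk.1.mono (subset_univ _)) v with hQ
      obtain ⟨U, hUP, hU, hxU, q, hq, hqQ⟩ := (hσ.isDefiningFunction g).exists_eq_smul P.isOpen hxP
        (SmoothFun.contMDiffOn_rep Q) fun y hy hyb ↦ by
          refine (SmoothFun.rep_apply Q ⟨y, hy⟩).trans (ContinuousLinearMap.ext fun v ↦ ?_)
          have h1 := hf P ⟨y, hy⟩ (P.e.symmL ℝ y v)
          rw [P.e.continuousLinearMapAt_symmL (P.subset_baseSet hy), hnk hN' y hyb, map_zero] at h1
          exact h1
      refine ⟨P.restrict U hU hUP, hxU, SmoothFun.mk q hq, SmoothFun.ext_apply fun y ↦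
        ContinuousLinearMap.ext fun v ↦ ?_⟩
      have h1 := hf P ⟨y, hUP y.2⟩ (P.e.symmL ℝ (y : M) v)
      have h2 := hf (P.restrict U hU hUP) y (P.e.symmL ℝ (y : M) v)
      have h3 := P.e.continuousLinearMapAt_symmL (R := ℝ) (P.subset_baseSet (hUP y.2)) v
      have h4 := (h2.trans h1.symm)
      rw [h3] at h4
      refine Eq.trans ?_ (h4.trans ?_)
      · exact congrArg _ h3.symm
      · exact congrArg (fun T : F →L[ℝ] F ↦ T v)
          ((SmoothFun.rep_apply Q ⟨y, hUP y.2⟩).symm.trans (hqQ y y.2))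
    · exact ⟨P, hxP, Patch.sum_grad_smul_oneForm_eq_smul hA σ g hd hm' (by omega) _
        fun x _ ↦ hk.2 x⟩
  obtain ⟨q, hq⟩ := hPq
  obtain ⟨k', hk', hk''⟩ := Patch.exists_current_step hA σ g hm' (hk.1.mono (subset_univ _))
    (fun x _ ↦ hk.2 x) hq hρ.contMDiffOn hρ' hr hA' rfl
  exact ⟨P.U, P.isOpen.mem_nhds hxP, k', hk', hk''⟩

end HalfSpace

end ElectricYM

/-! ### Summation of the formal solution -/

namespace ElectricYM

open Filter Set
open scoped Topology

section General

variable {E : Type*} [NormedAddCommGroup E] [NormedSpace ℝ E] [FiniteDimensional ℝ E]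
  {H : Type*} [TopologicalSpace H] {I : ModelWithCorners ℝ E H}
  {M : Type*} [TopologicalSpace M] [ChartedSpace H M] [IsManifold I ∞ M]
  {F : Type*} [NormedAddCommGroup F] [NormedSpace ℝ F] [FiniteDimensional ℝ F]
  {V : M → Type*} [TopologicalSpace (TotalSpace F V)]
  [∀ x, AddCommGroup (V x)] [∀ x, Module ℝ (V x)] [∀ x, TopologicalSpace (V x)]
  [∀ x, IsTopologicalAddGroup (V x)] [∀ x, ContinuousSMul ℝ (V x)]
  [FiberBundle F V] [VectorBundle ℝ F V] [ContMDiffVectorBundle ∞ F V I]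

/-- A one-form with smooth components is smooth. -/
lemma Patch.isSmoothOneFormOn_of_component [Nonempty (Metric I M)] {κ : Type*} [Fintype κ]
    [DecidableEq κ] (b : Module.Basis κ ℝ E) (P : Patch H F V)
    {a : ∀ x : M, V x →L[ℝ] TangentSpace I x →L[ℝ] V x}
    (h : ∀ i, CMDiff[P.U] ∞ (P.component b a i)) : IsSmoothOneFormOn (F := F) P.U a := by
  obtain ⟨a', ha', h'⟩ := Patch.exists_oneForm (b := b) fun i ↦ SmoothFun.mk _ (h i)
  refine ha'.congr fun x hx ↦ ?_
  have h1 : a x = a' x := Patch.oneForm_ext (b := b) hx fun s i ↦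
    (Patch.continuousLinearMapAt_oneForm hx s i).trans (h' ⟨x, hx⟩ s i).symm
  rw [h1]

/-- A cut-off power series in `σ`. -/
def borelSum (σ : M → ℝ) (a : ℕ → ∀ x : M, V x →L[ℝ] TangentSpace I x →L[ℝ] V x) (ε : ℕ → ℝ)
    (N : ℕ) (x : M) : V x →L[ℝ] TangentSpace I x →L[ℝ] V x :=
  ∑ᶠ k, (cutoff (σ x / ε (k + N)) * σ x ^ k) • a (k + N) x

section Finite

variable {σ : M → ℝ} {ε : ℕ → ℝ}

lemma finite_support_borel {W : Type*} [AddCommGroup W] [Module ℝ W] {t : ℝ} (ht : 0 ≤ t)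
    (hε : ∀ k, 0 < ε k) (hε' : ∀ k, ε k ≤ 1 / ((k : ℝ) + 1)) (N : ℕ) (w : ℕ → W) :
    (Function.support fun k ↦ (cutoff (t / ε (k + N)) * t ^ k) • w k).Finite := by
  rcases ht.eq_or_lt with rfl | ht
  · refine (finite_singleton 0).subset fun k hk ↦ ?_
    by_contra hk0
    exact hk (by simp [zero_pow (show k ≠ 0 from hk0)])
  · obtain ⟨K, hK⟩ := exists_nat_gt (2 / t)
    refine (Finset.range K).finite_toSet.subset fun k hk ↦ ?_
    simp only [Finset.coe_range, mem_Iio]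
    by_contra! hkK
    refine hk ?_
    have h1 : cutoff (t / ε (k + N)) = 0 := by
      refine cutoff.zero_of_le_dist ?_
      have h2 : ε (k + N) * 2 ≤ t := by
        have h3 : ((k + N : ℕ) : ℝ) + 1 ≥ 2 / t := by
          have : (K : ℝ) ≤ k := by exact_mod_cast hkK
          push_cast
          have : (0 : ℝ) ≤ N := N.cast_nonneg
          linarith
        have h4 := hε' (k + N)
        have h5 : 1 / (((k + N : ℕ) : ℝ) + 1) ≤ t / 2 := by
          rw [div_le_div_iff₀ (by positivity) two_pos]
          rw [ge_iff_le, div_le_iff₀ ht] at h3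
          linarith
        linarith
      rw [dist_zero_right, Real.norm_of_nonneg (div_nonneg ht.le (hε _).le), le_div_iff₀ (hε _)]
      have : cutoff.rOut = 2 := rfl
      rw [this]
      linarith
    simp [h1]

end Finite

lemma exists_pos_forall_le {ι : Type*} (t : Finset ι) {δ : ι → ℝ} (hδ : ∀ i, 0 < δ i) :
    ∃ ε > 0, ∀ i ∈ t, ε ≤ δ i := by
  induction t using Finset.cons_induction with
  | empty => exact ⟨1, one_pos, by simp⟩
  | cons i t hi ih =>
    obtain ⟨ε, hε, h⟩ := ih
    refine ⟨min (δ i) ε, lt_min (hδ i) hε, fun j hj ↦ ?_⟩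
    rcases Finset.mem_cons.1 hj with rfl | hj
    · exact min_le_left _ _
    · exact (min_le_right _ _).trans (h j hj)

lemma exists_finset_borel {σ : M → ℝ} (hσ0 : ∀ x, 0 ≤ σ x) {ε : ℕ → ℝ} (hε : ∀ k, 0 < ε k)
    (hε' : ∀ k, ε k ≤ 1 / ((k : ℝ) + 1)) (N : ℕ) (x : M) :
    ∃ t : Finset ℕ, ∀ k ∉ t, cutoff (σ x / ε (k + N)) * σ x ^ k = 0 := by
  refine ⟨(finite_support_borel (hσ0 x) hε hε' N fun _ ↦ (1 : ℝ)).toFinset, fun k hk ↦ ?_⟩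
  rw [Set.Finite.mem_toFinset, Function.notMem_support, smul_eq_mul, mul_one] at hk
  exact hk

lemma borelSum_eq_sum {σ : M → ℝ} {a : ℕ → ∀ x : M, V x →L[ℝ] TangentSpace I x →L[ℝ] V x}
    {ε : ℕ → ℝ} {N : ℕ} {x : M} {t : Finset ℕ}
    (ht : ∀ k ∉ t, cutoff (σ x / ε (k + N)) * σ x ^ k = 0) :
    borelSum σ a ε N x = ∑ k ∈ t, (cutoff (σ x / ε (k + N)) * σ x ^ k) • a (k + N) x := by
  refine finsum_eq_sum_of_support_subset _ fun k hk ↦ ?_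
  by_contra hkt
  exact hk (by simp only [ht k hkt, zero_smul])

lemma component_borelSum {κ : Type*} [Fintype κ] [DecidableEq κ] (b : Module.Basis κ ℝ E)
    (P : Patch H F V) {σ : M → ℝ} (hσ0 : ∀ x, 0 ≤ σ x)
    (a : ℕ → ∀ x : M, V x →L[ℝ] TangentSpace I x →L[ℝ] V x) {ε : ℕ → ℝ} (hε : ∀ k, 0 < ε k)
    (hε' : ∀ k, ε k ≤ 1 / ((k : ℝ) + 1)) (N : ℕ) (i : κ) (y : M) :
    P.component b (borelSum σ a ε N) i y
      = ∑' k, (cutoff (σ y / ε (k + N)) * σ y ^ k) • P.component b (a (k + N)) i y := by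
  obtain ⟨t, ht⟩ := exists_finset_borel hσ0 hε hε' N y
  rw [tsum_eq_sum fun k hk ↦ by rw [ht k hk, zero_smul]]
  ext v
  rw [Patch.component_apply, borelSum_eq_sum ht, _root_.sum_apply, _root_.sum_apply,
    _root_.sum_apply, map_sum]
  refine Finset.sum_congr rfl fun k _ ↦ ?_
  rw [_root_.smul_apply, _root_.smul_apply, map_smul, _root_.smul_apply, Patch.component_apply]

lemma borelSum_zero_eq {σ : M → ℝ} (hσ0 : ∀ x, 0 ≤ σ x)
    (a : ℕ → ∀ x : M, V x →L[ℝ] TangentSpace I x →L[ℝ] V x) {ε : ℕ → ℝ} (hε : ∀ k, 0 < ε k)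
    (hε' : ∀ k, ε k ≤ 1 / ((k : ℝ) + 1)) (N : ℕ) (x : M) :
    borelSum σ a ε 0 x = ∑ k ∈ Finset.range N, (cutoff (σ x / ε k) * σ x ^ k) • a k x
      + σ x ^ N • borelSum σ a ε N x := by
  obtain ⟨t, ht⟩ := exists_finset_borel hσ0 hε hε' N x
  obtain ⟨K, hK⟩ := t.exists_nat_subset_range
  have ht' : ∀ k ∉ Finset.range K, cutoff (σ x / ε (k + N)) * σ x ^ k = 0 :=
    fun k hk ↦ ht k fun h ↦ hk (hK h)
  have h0 : ∀ k ∉ Finset.range (N + K), cutoff (σ x / ε (k + 0)) * σ x ^ k = 0 := by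
    intro k hk
    obtain ⟨j, rfl⟩ := Nat.exists_eq_add_of_le (show N ≤ k by
      simp only [Finset.mem_range] at hk; omega)
    have := ht' j (by simp only [Finset.mem_range] at hk ⊢; omega)
    rw [add_zero, add_comm N j, pow_add, ← mul_assoc, this, zero_mul]
  rw [borelSum_eq_sum h0, borelSum_eq_sum ht', Finset.sum_range_add, Finset.smul_sum]
  congr 1
  refine Finset.sum_congr rfl fun k _ ↦ ?_
  rw [smul_smul, add_zero, add_comm N k]
  congr 1
  ring

variable [T2Space M]

lemma exists_nhds_isSmoothOneFormOn_borelSum [Nonempty (Metric I M)] {σ : M → ℝ}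
    (hσ : CMDiff ∞ σ) (hσ0 : ∀ x, 0 ≤ σ x)
    {a : ℕ → ∀ x : M, V x →L[ℝ] TangentSpace I x →L[ℝ] V x}
    (ha : ∀ k, IsSmoothOneFormOn (F := F) univ (a k)) (p : M) :
    ∃ U : Set M, IsOpen U ∧ p ∈ U ∧ ∃ δ : ℕ → ℝ, (∀ k, 0 < δ k) ∧ ∀ ε : ℕ → ℝ, (∀ k, 0 < ε k) →
      (∀ k, ε k ≤ δ k) → (∀ k, ε k ≤ 1 / ((k : ℝ) + 1)) → ∀ N,
        IsSmoothOneFormOn (F := F) U (borelSum σ a ε N) := by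
  let b := Module.finBasis ℝ E
  obtain ⟨P, hpP, rfl, -⟩ := exists_patch (H := H) (F := F) (V := V) p univ_mem
  obtain ⟨r, hr, hT⟩ := exists_chartBall_subset (I := I) P.isOpen P.subset_source hpP
  obtain ⟨U, hU, hpU, hUp, hmaps⟩ := exists_nhds_chartBall (I := I) P.p hr
  have hinv : ∀ y ∈ U, (extChartAt I P.p).symm (extChartAt I P.p y) = y := fun y hy ↦
    (extChartAt I P.p).left_inv (by simpa using hUp hy)
  have hUP : U ⊆ P.U := fun y hy ↦ by
    have := (hT (hmaps hy)).2
    rwa [mem_preimage, hinv y hy] at this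
  have hs := (contDiffOn_comp_extChartAt_symm P.p (hσ.contMDiffOn (s := P.U))).mono hT
  have hc := fun k i ↦ (contDiffOn_comp_extChartAt_symm P.p (Patch.contMDiffOn_component (P := P)
    (b := b) ((ha k).mono (subset_univ _)) i)).mono hT
  choose δ hδ hδ' using fun k i ↦ exists_isBorelScale (isCompact_chartBall P.p r)
    (uniqueDiffOn_chartBall P.p hr) hs (hc k i) k
  choose δ' hδ0 hδ1 using fun k ↦ exists_pos_forall_le Finset.univ (hδ k)
  refine ⟨U, hU, hpU, δ', hδ0, fun ε hε hεδ hε' N ↦ ?_⟩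
  refine Patch.isSmoothOneFormOn_of_component b (P.restrict U hU hUP) fun i ↦ ?_
  have h1 := contDiffOn_borel (convex_chartBall P.p r) (isCompact_chartBall P.p r)
    (uniqueDiffOn_chartBall P.p hr) hs (fun k ↦ hc k i)
    (fun k ↦ hδ' k i _ (hε k) ((hεδ k).trans (hδ1 k i (Finset.mem_univ i)))) N
  refine (contMDiffOn_comp_extChartAt_of_mapsTo hUp hmaps h1).congr fun y hy ↦ ?_
  rw [component_borelSum b _ hσ0 a hε hε']
  simp only [hinv y hy]
  rfl

/-- Every formal power series in `σ` is the expansion of a smooth one-form. -/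
lemma exists_oneForm_of_series [Nonempty (Metric I M)] [CompactSpace M] {σ : M → ℝ}
    (hσ : CMDiff ∞ σ) (hσ0 : ∀ x, 0 ≤ σ x)
    {a : ℕ → ∀ x : M, V x →L[ℝ] TangentSpace I x →L[ℝ] V x}
    (ha : ∀ k, IsSmoothOneFormOn (F := F) univ (a k)) :
    ∃ s : ∀ x : M, V x →L[ℝ] TangentSpace I x →L[ℝ] V x, IsSmoothOneFormOn (F := F) univ s ∧
      ∀ N, ∃ r : ∀ x : M, V x →L[ℝ] TangentSpace I x →L[ℝ] V x,
        IsSmoothOneFormOn (F := F) univ r ∧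
          ∀ x, s x = ∑ k ∈ Finset.range N, σ x ^ k • a k x + σ x ^ N • r x := by
  choose U hU hpU δ hδ h using fun p ↦ exists_nhds_isSmoothOneFormOn_borelSum hσ hσ0 ha p
  obtain ⟨t, ht⟩ := isCompact_univ.elim_finite_subcover U hU fun p _ ↦ mem_iUnion.2 ⟨p, hpU p⟩
  choose ε₁ hε₁ hε₁' using fun k ↦ exists_pos_forall_le t fun p ↦ hδ p k
  set ε : ℕ → ℝ := fun k ↦ min (ε₁ k) (1 / ((k : ℝ) + 1)) with hεdef
  have hε : ∀ k, 0 < ε k := fun k ↦ lt_min (hε₁ k) (by positivity)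
  have hε' : ∀ k, ε k ≤ 1 / ((k : ℝ) + 1) := fun k ↦ min_le_right _ _
  have hsm : ∀ N, IsSmoothOneFormOn (F := F) univ (borelSum σ a ε N) := fun N x _ ↦ by
    obtain ⟨p, hp, hx⟩ := mem_iUnion₂.1 (ht (mem_univ x))
    exact ((h p ε hε (fun k ↦ (min_le_left _ _).trans (hε₁' k p hp)) hε' N).contMDiffAt
      ((hU p).mem_nhds hx)).contMDiffWithinAt
  have hsum : ∀ N, IsSmoothOneFormOn (F := F) univ
      fun x ↦ ∑ k ∈ Finset.range N, σ x ^ k • a k x := fun N ↦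
    isSmoothOneFormOn_sum isOpen_univ _ fun k _ ↦ (ha k).smul isOpen_univ (hσ.pow k).contMDiffOn
  refine ⟨borelSum σ a ε 0, hsm 0, fun N ↦ ?_⟩
  obtain ⟨r, hr, hr'⟩ := exists_oneForm_of_local (F := F) (N := N) (f := σ)
    (J := fun x v w ↦ (borelSum σ a ε 0 x - ∑ k ∈ Finset.range N, σ x ^ k • a k x) v w)
    fun x ↦ by
      by_cases hx : σ x = 0
      · obtain ⟨η, hη, hη'⟩ := exists_pos_forall_le (Finset.range N) hε
        refine ⟨{y | σ y < η}, (isOpen_lt hσ.continuous continuous_const).mem_nhds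
          (show σ x < η by rwa [hx]), borelSum σ a ε N, (hsm N).mono (subset_univ _),
          fun y hy v w ↦ ?_⟩
        have h1 : ∀ k ∈ Finset.range N, cutoff (σ y / ε k) = 1 := fun k hk ↦ by
          refine cutoff.one_of_mem_closedBall ?_
          have h2 : cutoff.rIn = 1 := rfl
          rw [h2, mem_closedBall_zero_iff, Real.norm_of_nonneg (div_nonneg (hσ0 y) (hε k).le),
            div_le_one (hε k)]
          exact (le_of_lt hy).trans (hη' k hk)
        have h2 := borelSum_zero_eq hσ0 a hε hε' N y
        rw [Finset.sum_congr rfl fun k hk ↦ by rw [h1 k hk, one_mul]] at h2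
        rw [h2, add_sub_cancel_left]
        rfl
      · have hU : IsOpen {y | σ y ≠ 0} := isOpen_ne.preimage hσ.continuous
        refine ⟨{y | σ y ≠ 0}, hU.mem_nhds hx, fun y ↦ (σ y ^ N)⁻¹ • (borelSum σ a ε 0 y
          + (-1 : ℝ) • ∑ k ∈ Finset.range N, σ y ^ k • a k y), ?_, fun y hy v w ↦ ?_⟩
        · refine IsSmoothOneFormOn.smul hU ((hσ.pow N).contMDiffOn.inv₀ fun y hy ↦ pow_ne_zero _ hy)
            (IsSmoothOneFormOn.add hU ((hsm 0).mono (subset_univ _)) (IsSmoothOneFormOn.smul hU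
              contMDiffOn_const ((hsum N).mono (subset_univ _))))
        · rw [_root_.smul_apply, _root_.smul_apply, smul_smul, mul_inv_cancel₀ (pow_ne_zero _ hy),
            one_smul, neg_one_smul, sub_eq_add_neg]
  refine ⟨r, hr, fun x ↦ ?_⟩
  rw [← sub_eq_iff_eq_add']
  ext v w
  exact hr' x v w

end General

end ElectricYM

/-! ### The solution in a fixed scale -/

namespace ElectricYM

open Filter Set
open scoped Topology

variable {n : ℕ} {M : Type*} [TopologicalSpace M] [T2Space M]
  [ChartedSpace (EuclideanHalfSpace (n + 1)) M] [IsManifold (𝓡∂ (n + 1)) ∞ M]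
  {F : Type*} [NormedAddCommGroup F] [NormedSpace ℝ F] [FiniteDimensional ℝ F]
  {V : M → Type*} [TopologicalSpace (TotalSpace F V)]
  [∀ x, AddCommGroup (V x)] [∀ x, Module ℝ (V x)] [∀ x, TopologicalSpace (V x)]
  [∀ x, IsTopologicalAddGroup (V x)] [∀ x, ContinuousSMul ℝ (V x)]
  [FiberBundle F V] [VectorBundle ℝ F V] [ContMDiffVectorBundle ∞ F V (𝓡∂ (n + 1))]
  {c : Set (Metric (𝓡∂ (n + 1)) M)} {σ : Density c 1}
  {A : CovariantDerivative (𝓡∂ (n + 1)) F V}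

/-- The connection `A + σ ^ N a`. -/
abbrev perturb (σ : Density c 1) (g : c) (A : CovariantDerivative (𝓡∂ (n + 1)) F V) (N : ℕ)
    (a : ∀ x : M, V x →L[ℝ] TangentSpace (𝓡∂ (n + 1)) x →L[ℝ] V x) :
    CovariantDerivative (𝓡∂ (n + 1)) F V :=
  A.addOneForm fun x ↦ σ.rep g x ^ N • a x

lemma perturb_add_pow_smul (g : c) (N k : ℕ)
    (a b : ∀ x : M, V x →L[ℝ] TangentSpace (𝓡∂ (n + 1)) x →L[ℝ] V x) :
    perturb σ g A N (fun x ↦ a x + σ.rep g x ^ k • b x)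
      = perturb σ g (perturb σ g A N a) (N + k) b := by
  refine covariantDerivative_ext fun S x u ↦ ?_
  simp only [perturb, addOneForm_apply, smul_add, smul_smul, pow_add, _root_.add_apply, add_assoc]

lemma contMDiffCovariantDerivative_perturb
    (hA : CovariantDerivative.ContMDiffCovariantDerivative A ∞) (g : c) (N : ℕ)
    {a : ∀ x : M, V x →L[ℝ] TangentSpace (𝓡∂ (n + 1)) x →L[ℝ] V x}
    (ha : IsSmoothOneFormOn (F := F) univ a) :
    CovariantDerivative.ContMDiffCovariantDerivative (perturb σ g A N a) ∞ :=
  contMDiffCovariantDerivative_addOneForm hA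
    (ha.smul isOpen_univ ((σ.contMDiff g).pow N).contMDiffOn)

lemma exists_formal_solution [SigmaCompactSpace M]
    (hA : CovariantDerivative.ContMDiffCovariantDerivative A ∞)
    (hσ : IsDefiningDensity σ) (g : c) {m : ℕ} (hm : n + 1 = m + 4)
    {k : ∀ x : M, V x →L[ℝ] TangentSpace (𝓡∂ (n + 1)) x →L[ℝ] V x}
    (hk : CurrentDivisible σ g A (m + 1) k)
    (hnk : ∀ x ∈ (𝓡∂ (n + 1)).boundary M, ∀ s,
      k x s (sharp g.1 x (mvfderiv (𝓡∂ (n + 1)) (σ.rep g) x)) = 0) :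
    ∃ b : ℕ → ∀ x : M, V x →L[ℝ] TangentSpace (𝓡∂ (n + 1)) x →L[ℝ] V x,
      (∀ N, IsSmoothOneFormOn (F := F) univ (b N)) ∧ ∀ N, ∃ k',
        CurrentDivisible σ g (perturb σ g A (m + 2)
          fun x ↦ ∑ i ∈ Finset.range N, σ.rep g x ^ i • b i x) (m + 1 + N) k' := by
  set Q : ℕ → (∀ x : M, V x →L[ℝ] TangentSpace (𝓡∂ (n + 1)) x →L[ℝ] V x) → Prop := fun N a ↦
    IsSmoothOneFormOn (F := F) univ a ∧ ∃ k',
      CurrentDivisible σ g (perturb σ g A (m + 2) a) (m + 1 + N) k' ∧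
      (N = 0 → ∀ x ∈ (𝓡∂ (n + 1)).boundary M, ∀ s,
        k' x s (sharp g.1 x (mvfderiv (𝓡∂ (n + 1)) (σ.rep g) x)) = 0)
  have step : ∀ N a, ∃ b, Q N a → IsSmoothOneFormOn (F := F) univ b ∧
      Q (N + 1) fun x ↦ a x + σ.rep g x ^ N • b x := by
    intro N a
    by_cases hQ : Q N a
    · obtain ⟨ha, k', hk', hn⟩ := hQ
      obtain ⟨b, hb, k'', hk''⟩ := exists_current_step
        (contMDiffCovariantDerivative_perturb hA g (m + 2) ha) hσ g hm (by omega) hk'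
        fun h ↦ hn (by omega)
      refine ⟨b, fun _ ↦ ⟨hb, ha.add isOpen_univ
        (hb.smul isOpen_univ ((σ.contMDiff g).pow N).contMDiffOn), k'', ?_, by omega⟩⟩
      rw [perturb_add_pow_smul, show m + 2 + N = m + 1 + N + 1 by omega]
      exact hk''
    · exact ⟨0, fun h ↦ absurd h hQ⟩
  choose f hf using step
  set a : ℕ → ∀ x : M, V x →L[ℝ] TangentSpace (𝓡∂ (n + 1)) x →L[ℝ] V x := fun N ↦
    Nat.rec (fun _ ↦ 0) (fun N a x ↦ a x + σ.rep g x ^ N • f N a x) N with ha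
  have hQ : ∀ N, Q N (a N) := by
    intro N
    induction N with
    | zero =>
      refine ⟨isSmoothOneFormOn_zero, k, ?_, fun _ ↦ hnk⟩
      have : perturb σ g A (m + 2) (a 0) = A := covariantDerivative_ext fun S x u ↦ by
        simp [addOneForm_apply, ha]
      rwa [this]
    | succ N ih => exact (hf N (a N) ih).2
  refine ⟨fun N ↦ f N (a N), fun N ↦ (hf N (a N) (hQ N)).1, fun N ↦ ?_⟩
  have hsum : a N = fun x ↦ ∑ i ∈ Finset.range N, σ.rep g x ^ i • f i (a i) x := by
    induction N with
    | zero => simp [ha]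
    | succ N ih =>
      funext x
      rw [Finset.sum_range_succ, ← congrFun ih x]
  obtain ⟨-, k', hk', -⟩ := hQ N
  exact ⟨k', hsum ▸ hk'⟩

/-- The solution to infinite order, in a fixed scale. -/
theorem exists_solution [CompactSpace M]
    (hA : CovariantDerivative.ContMDiffCovariantDerivative A ∞)
    (hσ : IsDefiningDensity σ) (g : c) {m : ℕ} (hm : n + 1 = m + 4)
    {k : ∀ x : M, V x →L[ℝ] TangentSpace (𝓡∂ (n + 1)) x →L[ℝ] V x}
    (hk : CurrentDivisible σ g A (m + 1) k)
    (hnk : ∀ x ∈ (𝓡∂ (n + 1)).boundary M, ∀ s,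
      k x s (sharp g.1 x (mvfderiv (𝓡∂ (n + 1)) (σ.rep g) x)) = 0) :
    ∃ a : ∀ x : M, V x →L[ℝ] TangentSpace (𝓡∂ (n + 1)) x →L[ℝ] V x,
      IsSmoothOneFormOn (F := F) univ a ∧
      ∀ l, ∃ k', CurrentDivisible σ g (perturb σ g A (m + 2) a) l k' := by
  have : Nonempty (Metric (𝓡∂ (n + 1)) M) := ⟨g.1⟩
  have hm' : Module.finrank ℝ (EuclideanSpace ℝ (Fin (n + 1))) = m + 4 := by simp [hm]
  obtain ⟨b, hb, hb'⟩ := exists_formal_solution hA hσ g hm hk hnk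
  obtain ⟨a, ha, hab⟩ := exists_oneForm_of_series (σ.contMDiff g) (hσ.nonneg g) hb
  refine ⟨a, ha, fun l ↦ ?_⟩
  obtain ⟨k', hk'⟩ := hb' l
  obtain ⟨r, hr, har⟩ := hab l
  have hS : IsSmoothOneFormOn (F := F) univ
      fun x ↦ ∑ i ∈ Finset.range l, σ.rep g x ^ i • b i x :=
    isSmoothOneFormOn_sum isOpen_univ _ fun i _ ↦
      (hb i).smul isOpen_univ ((σ.contMDiff g).pow i).contMDiffOn
  have hA' := contMDiffCovariantDerivative_perturb (σ := σ) hA g (m + 2) hS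
  obtain ⟨k'', hk'', hc⟩ := exists_oneForm_of_local (F := F) (N := m + 1 + l) (f := σ.rep g)
    (J := current σ (perturb σ g A (m + 2) a) g) fun x ↦ by
      obtain ⟨P, hxP, -⟩ := exists_patch (H := EuclideanHalfSpace (n + 1)) (F := F) (V := V) x
        univ_mem
      obtain ⟨q, hq, hq'⟩ := Patch.exists_current_add (N := m + 1 + l) hA' σ g hm'
        (hr.mono (subset_univ P.U)) (contMDiffCovariantDerivative_perturb hA g (m + 2) ha) <| by
          rw [show a = fun x ↦ ∑ k ∈ Finset.range l, σ.rep g x ^ k • b k x + σ.rep g x ^ l • r x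
            from funext har, perturb_add_pow_smul, show m + 2 + l = m + 1 + l + 1 by omega]
      refine ⟨P.U, P.isOpen.mem_nhds hxP, fun y ↦ k' y + q y,
        IsSmoothOneFormOn.add P.isOpen (hk'.1.mono (subset_univ _)) hq, fun y hy s w ↦ ?_⟩
      rw [hq' y hy, hk'.2, _root_.add_apply, _root_.add_apply, smul_add]
  refine ⟨fun x ↦ σ.rep g x ^ (m + 1) • k'' x,
    hk''.smul isOpen_univ ((σ.contMDiff g).pow _).contMDiffOn, fun x s w ↦ ?_⟩
  rw [hc, _root_.smul_apply, _root_.smul_apply, smul_smul, pow_add, mul_comm]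

end ElectricYM

/-! ### The current of a connection whose curvature is divisible -/

namespace ElectricYM

open Filter Set
open scoped Topology

variable {E : Type*} [NormedAddCommGroup E] [NormedSpace ℝ E] [FiniteDimensional ℝ E]
  {H : Type*} [TopologicalSpace H] {I : ModelWithCorners ℝ E H}
  {M : Type*} [TopologicalSpace M] [ChartedSpace H M] [IsManifold I ∞ M]
  {F : Type*} [NormedAddCommGroup F] [NormedSpace ℝ F] [FiniteDimensional ℝ F]
  {κ : Type*} [Fintype κ] [DecidableEq κ] {b : Module.Basis κ ℝ E}
  {V : M → Type*} [TopologicalSpace (TotalSpace F V)]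
  [∀ x, AddCommGroup (V x)] [∀ x, Module ℝ (V x)] [∀ x, TopologicalSpace (V x)]
  [∀ x, IsTopologicalAddGroup (V x)] [∀ x, ContinuousSMul ℝ (V x)]
  [FiberBundle F V] [VectorBundle ℝ F V] [ContMDiffVectorBundle ∞ F V I]
  {c : Set (Metric I M)} {σ : Density c 1} {g : c} {A : CovariantDerivative I F V} {w₀ : ℤ}
  {G : EndTwoForm F V c w₀}

namespace Patch

variable {P : Patch H F V}

/-- The components of a two-form as functions. -/
def twoFormComponent (P : Patch H F V) (b : Module.Basis κ ℝ E) (G : EndTwoForm F V c w₀) (g : c)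
    (i j : κ) (y : M) : F →L[ℝ] F :=
  LinearMap.toContinuousLinearMap
    { toFun := fun v ↦ P.e.continuousLinearMapAt ℝ y
        (G.rep g y (P.e.symmL ℝ y v) (P.frame b i y) (P.frame b j y))
      map_add' := fun v w ↦ by simp
      map_smul' := fun c v ↦ by simp }

lemma twoFormComponent_apply (i j : κ) (y : M) (v : F) : P.twoFormComponent b G g i j y v
    = P.e.continuousLinearMapAt ℝ y
      (G.rep g y (P.e.symmL ℝ y v) (P.frame b i y) (P.frame b j y)) := rfl

lemma contMDiffOn_twoFormComponent (i j : κ) : CMDiff[P.U] ∞ (P.twoFormComponent b G g i j) :=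
    fun y hy ↦ by
  refine ContMDiffAt.contMDiffWithinAt (contMDiffAt_clm_of_apply (k := ⊤) fun v ↦ ?_)
  refine (contMDiffAt_iff_continuousLinearMapAt (k := ⊤) P.e (P.subset_baseSet hy)).1 ?_
  have hs := (contMDiffOn_symmL_apply (I := I) P.e v).contMDiffAt
    (P.e.open_baseSet.mem_nhds (P.subset_baseSet hy))
  have hi := fun i ↦ (isCommutingFrame (I := I) (P := P) b).contMDiffAt hy i
  have h1 : ContMDiffAt I (I.prod 𝓘(ℝ, E →L[ℝ] F)) ∞ (fun y ↦ TotalSpace.mk' (E →L[ℝ] F)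
      (E := fun x : M ↦ TangentSpace I x →L[ℝ] V x) y
        (G.rep g y (P.e.symmL ℝ y v) (P.frame b i y))) y :=
    ContMDiffAt.clm_bundle_apply₂ (F₁ := F) (F₂ := E) (F₃ := E →L[ℝ] F)
      (E₃ := fun x : M ↦ TangentSpace I x →L[ℝ] V x) (G.contMDiff g y) hs (hi i)
  exact ContMDiffAt.clm_bundle_apply (F₁ := E) (F₂ := F) h1 (hi j)

/-- The components of a two-form. -/
def twoForm (P : Patch H F V) (b : Module.Basis κ ℝ E) (G : EndTwoForm F V c w₀) (g : c)
    (i j : κ) : SmoothFun I P.U (F →L[ℝ] F) :=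
  SmoothFun.mk (P.twoFormComponent b G g i j) (contMDiffOn_twoFormComponent i j)

lemma twoForm_antisymm (i j : κ) : P.twoForm b G g i j = -P.twoForm b G g j i :=
  SmoothFun.ext_apply fun x ↦ ContinuousLinearMap.ext fun v ↦ by
    refine (congrArg _ (G.antisymm g x _ _ _)).trans ?_
    exact map_neg (P.e.continuousLinearMapAt ℝ (x : M)) _

variable [T2Space M]

lemma curv_eq_pow_smul_twoForm (hA : CovariantDerivative.ContMDiffCovariantDerivative A ∞)
    {m : ℕ} (hG : HasCurvature σ A m G) (i j : κ) :
    (P.calculus b).curv (P.connection b hA) i j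
      = P.scalar (σ.rep g) (σ.contMDiff g).contMDiffOn ^ m • P.twoForm b G g i j := by
  refine SmoothFun.ext_apply fun x ↦ ContinuousLinearMap.ext fun v ↦ ?_
  have h1 := continuousLinearMapAt_curvature (P := P) (b := b) hA x (P.e.symmL ℝ (x : M) v) i j
  rw [P.e.continuousLinearMapAt_symmL (P.subset_baseSet x.2), hG g] at h1
  refine h1.symm.trans ?_
  exact map_smul (P.e.continuousLinearMapAt ℝ (x : M)) _ _

/-- The divergence of a two-form, as a one-form. -/
def divTwoForm (P : Patch H F V) (b : Module.Basis κ ℝ E)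
    (hA : CovariantDerivative.ContMDiffCovariantDerivative A ∞) (G : EndTwoForm F V c w₀) (g : c)
    (w : κ) : SmoothFun I P.U (F →L[ℝ] F) :=
  ∑ i, P.metric b g.1 w i • (P.calculus b).div (P.connection b hA)
    ((P.calculus b).logVol (P.metric b g.1) (P.invMetric b g.1))
    fun a ↦ Calculus.up (P.invMetric b g.1) (P.twoForm b G g) a i

lemma lowerCurrent_eq_pow_smul_divTwoForm
    (hA : CovariantDerivative.ContMDiffCovariantDerivative A ∞) {m : ℕ}
    (hG : HasCurvature σ A m G) (w : κ) :
    P.lowerCurrent b hA σ g m w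
      = P.scalar (σ.rep g) (σ.contMDiff g).contMDiffOn ^ (m + 1) • P.divTwoForm b hA G g w := by
  have h1 : (P.calculus b).curv (P.connection b hA)
      = fun i j ↦ P.scalar (σ.rep g) (σ.contMDiff g).contMDiffOn ^ m • P.twoForm b G g i j :=
    funext fun i ↦ funext fun j ↦ curv_eq_pow_smul_twoForm hA hG i j
  rw [lowerCurrent, Calculus.lowerCurrent, divTwoForm, Finset.smul_sum]
  refine Finset.sum_congr rfl fun i _ ↦ ?_
  rw [smul_comm _ (P.metric b g.1 w i)]
  congr 1
  refine Eq.trans ?_ (Calculus.current_smul_pow _ _ _ _ m _ i)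
  congr 1
  rw [h1]
  funext a b
  exact Calculus.up_smul _ _ a b

lemma exists_current_eq_pow_smul (hA : CovariantDerivative.ContMDiffCovariantDerivative A ∞)
    {m : ℕ} (hm : Module.finrank ℝ E = m + 4) (hG : HasCurvature σ A m G) (g : c) :
    ∃ a : ∀ x : M, V x →L[ℝ] TangentSpace I x →L[ℝ] V x, IsSmoothOneFormOn (F := F) P.U a ∧
      ∀ x ∈ P.U, ∀ s w, current σ A g x s w = σ.rep g x ^ (m + 1) • a x s w :=
  exists_pow_smul_of_lowerCurrent (b := Module.finBasis ℝ E) hA σ g hm (m + 1)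
    (lowerCurrent_eq_pow_smul_divTwoForm hA hG)

/-- The normal component of the leading term of the current. -/
lemma sum_grad_smul_oneForm_eq_sum_covOneForm
    (hA : CovariantDerivative.ContMDiffCovariantDerivative A ∞)
    (hσ : ∀ x, σ.rep g x = 0 → mvfderiv I (σ.rep g) x ≠ 0)
    {m : ℕ} (hm : Module.finrank ℝ E = m + 4) (hG : HasCurvature σ A m G)
    {k : ∀ x : M, V x →L[ℝ] TangentSpace I x →L[ℝ] V x}
    (hk : IsSmoothOneFormOn (F := F) P.U k)
    (h : ∀ x ∈ P.U, ∀ s w, current σ A g x s w = σ.rep g x ^ (m + 1) • k x s w) :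
    ∑ v, (P.calculus b).grad (P.invMetric b g.1)
      (P.scalar (σ.rep g) (σ.contMDiff g).contMDiffOn) v • P.oneForm b hk v
    = ∑ u, ∑ v, P.invMetric b g.1 u v • (P.calculus b).covOneForm (P.connection b hA)
        (P.metric b g.1) (P.invMetric b g.1) ((P.calculus b).contractGrad (P.invMetric b g.1)
          (P.scalar (σ.rep g) (σ.contMDiff g).contMDiffOn) (P.twoForm b G g)) u v := by
  set s := P.scalar (σ.rep g) (σ.contMDiff g).contMDiffOn
  have h1 : ∀ w, P.oneForm b hk w = P.divTwoForm b hA G g w := fun w ↦ by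
    rw [← sub_eq_zero]
    refine SmoothFun.eq_zero_of_pow_smul P.isOpen (fun x _ ↦ hσ x) (m + 1) fun x ↦ ?_
    have h2 := (lowerCurrent_eq_pow_smul (b := b) hA σ g hm (m + 1) hk h w).symm.trans
      (lowerCurrent_eq_pow_smul_divTwoForm (b := b) hA hG w)
    rw [← sub_eq_zero, ← smul_sub] at h2
    exact congrArg (fun z : SmoothFun I P.U (F →L[ℝ] F) ↦ z.1 x) h2
  rw [← Calculus.sum_d_smul_div_up _ (invMetric_symm g.1) (metric_mul_invMetric g.1)
    (invMetric_mul_metric g.1) _ _ _ twoForm_antisymm]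
  simp only [h1, divTwoForm]
  rw [← (P.calculus b).sum_d_smul_sum (invMetric_symm g.1)]
  refine Finset.sum_congr rfl fun i _ ↦ ?_
  congr 1
  simp only [Finset.smul_sum, smul_smul]
  rw [Finset.sum_comm]
  simp only [← Finset.sum_smul, invMetric_mul_metric g.1]
  simp

end Patch

lemma exists_currentDivisible [T2Space M] [SigmaCompactSpace M]
    (hA : CovariantDerivative.ContMDiffCovariantDerivative A ∞)
    {m : ℕ} (hm : Module.finrank ℝ E = m + 4) (hG : HasCurvature σ A m G) (g : c) :
    ∃ k : ∀ x : M, V x →L[ℝ] TangentSpace I x →L[ℝ] V x, IsSmoothOneFormOn (F := F) univ k ∧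
      ∀ x s w, current σ A g x s w = σ.rep g x ^ (m + 1) • k x s w :=
  exists_oneForm_of_local fun x ↦ by
    obtain ⟨P, hxP, -⟩ := exists_patch (H := H) (F := F) (V := V) x univ_mem
    obtain ⟨k, hk, hk'⟩ := P.exists_current_eq_pow_smul hA hm hG g
    exact ⟨P.U, P.isOpen.mem_nhds hxP, k, hk, hk'⟩

end ElectricYM

/-! ### Coordinates and the induced metric on the boundary -/

namespace ElectricYM

open Filter Set
open scoped Topology

section InducedMetric

variable {E : Type*} [NormedAddCommGroup E] [NormedSpace ℝ E] [FiniteDimensional ℝ E]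
  {H : Type*} [TopologicalSpace H] {I : ModelWithCorners ℝ E H}
  {M : Type*} [TopologicalSpace M] [ChartedSpace H M] [IsManifold I ∞ M]
  {E' : Type*} [NormedAddCommGroup E'] [NormedSpace ℝ E'] [FiniteDimensional ℝ E']
  {H' : Type*} [TopologicalSpace H'] {J : ModelWithCorners ℝ E' H'}
  {S : Type*} [TopologicalSpace S] [ChartedSpace H' S] [IsManifold J ∞ S]
  {ι : C^∞⟮J, S; I, M⟯}

/-- The pullback of a bilinear form on a tangent space. -/
def pullbackInner (ι : C^∞⟮J, S; I, M⟯) (g : Metric I M) (y : S) :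
    TangentSpace J y →L[ℝ] TangentSpace J y →L[ℝ] ℝ :=
  ContinuousLinearMap.bilinearComp (E := E) (F := E) (E' := E') (F' := E') (g.inner (ι y))
    (mfderiv J I ι y) (mfderiv J I ι y)

lemma pullbackInner_apply (g : Metric I M) (y : S) (u v : TangentSpace J y) :
    pullbackInner ι g y u v = g.inner (ι y) (mfderiv J I ι y u) (mfderiv J I ι y v) := rfl

/-- The pullback of a metric by an immersion. -/
def inducedMetric (hι : ∀ x, Function.Injective (mfderiv J I ι x)) (g : Metric I M) :
    Metric J S where
  inner := pullbackInner ι g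
  symm y u v := g.symm (ι y) _ _
  pos y v hv := g.pos (ι y) _ fun h ↦ hv (hι y (h.trans (map_zero _).symm))
  isVonNBounded y := by
    set T : E' →L[ℝ] E := mfderiv J I ι y with hT
    obtain ⟨L, hL⟩ := LinearMap.exists_leftInverse_of_injective T.toLinearMap
      (LinearMap.ker_eq_bot.2 (hι y))
    have h : Bornology.IsVonNBounded ℝ {v : E | g.inner (ι y) v v < 1} := g.isVonNBounded (ι y)
    have h' := h.image (LinearMap.toContinuousLinearMap L)
    refine Bornology.IsVonNBounded.subset (E := E') ?_ h'
    exact fun v hv ↦ ⟨T v, hv, DFunLike.congr_fun hL v⟩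
  contMDiff := by
    intro x
    have hv := fun v ↦ (contMDiffOn_symmL_apply (I := J) (trivializationAt E' (TangentSpace J) x)
      v).contMDiffAt ((trivializationAt E' (TangentSpace J) x).open_baseSet.mem_nhds
        (FiberBundle.mem_baseSet_trivializationAt E' (TangentSpace J) x))
    refine contMDiffAt_clm_bundle_of_apply (V₁ := fun x : S ↦ TangentSpace J x)
      (V := fun x : S ↦ TangentSpace J x →L[ℝ] Bundle.Trivial S ℝ x)
      (φ := pullbackInner ι g) fun v ↦ ?_
    refine contMDiffAt_clm_bundle_of_apply (V₁ := fun x : S ↦ TangentSpace J x)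
      (V := Bundle.Trivial S ℝ) (F := ℝ) (φ := fun y ↦ pullbackInner ι g y
        ((trivializationAt E' (TangentSpace J) x).symmL ℝ y v)) fun w ↦ ?_
    have h1 := fun v ↦ ((ι.contMDiff.contMDiff_tangentMap (m := ∞) (by simp)) _).comp x (hv v)
    have h2 := (g.contMDiff (ι x)).comp x (ι.contMDiff x)
    have h3 : ContMDiffAt J (I.prod 𝓘(ℝ)) ∞ (fun y ↦ TotalSpace.mk' ℝ (E := Bundle.Trivial M ℝ)
        (ι y) (pullbackInner ι g y ((trivializationAt E' (TangentSpace J) x).symmL ℝ y v)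
          ((trivializationAt E' (TangentSpace J) x).symmL ℝ y w))) x :=
      ContMDiffAt.clm_bundle_apply₂ (F₁ := E) (F₂ := E) (F₃ := ℝ) (b := ι) h2 (h1 v) (h1 w)
    rw [contMDiffAt_totalSpace] at h3
    rw [contMDiffAt_section]
    exact h3.2

lemma inducedMetric_inner (hι : ∀ x, Function.Injective (mfderiv J I ι x)) (g : Metric I M) (y : S)
    (u v : TangentSpace J y) : (inducedMetric hι g).inner y u v
      = g.inner (ι y) (mfderiv J I ι y u) (mfderiv J I ι y v) := rfl

lemma isInducedMetric_inducedMetric (hι : ∀ x, Function.Injective (mfderiv J I ι x))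
    (g : Metric I M) : IsInducedMetric ι (fun _ ↦ 1) g (inducedMetric hι g) := fun x u v ↦ by
  rw [inducedMetric_inner, one_pow, one_mul]

lemma inducedMetric_mem (hι : ∀ x, Function.Injective (mfderiv J I ι x))
    {c : Set (Metric I M)} {g : Metric I M} (hg : g ∈ c) :
    inducedMetric hι g ∈ inducedClass ι c :=
  ⟨g, hg, fun _ ↦ 1, contMDiff_const, fun _ ↦ one_pos, isInducedMetric_inducedMetric hι g⟩

end InducedMetric

section Coordinates

variable {n : ℕ} {M : Type*} [TopologicalSpace M] [ChartedSpace (EuclideanHalfSpace (n + 1)) M]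
  [IsManifold (𝓡∂ (n + 1)) ∞ M]
  {S : Type*} [TopologicalSpace S] [ChartedSpace (EuclideanSpace ℝ (Fin n)) S]
  [IsManifold (𝓡 n) ∞ S] {ι : C^∞⟮𝓡 n, S; 𝓡∂ (n + 1), M⟯}

variable (n) in
/-- The projection of a half-space to its boundary. -/
def tailCLM : EuclideanSpace ℝ (Fin (n + 1)) →L[ℝ] EuclideanSpace ℝ (Fin n) :=
  LinearMap.toContinuousLinearMap
    { toFun := fun v ↦ WithLp.toLp 2 fun i ↦ v i.succ
      map_add' := fun _ _ ↦ rfl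
      map_smul' := fun _ _ ↦ rfl }

lemma tailCLM_apply (v : EuclideanSpace ℝ (Fin (n + 1))) (i : Fin n) :
    tailCLM n v i = v i.succ := rfl

lemma eq_of_tailCLM_eq {v w : EuclideanSpace ℝ (Fin (n + 1))} (h0 : v 0 = w 0)
    (h : tailCLM n v = tailCLM n w) : v = w := by
  ext i
  refine Fin.cases h0 (fun i ↦ ?_) i
  rw [← tailCLM_apply, h, tailCLM_apply]

/-- The standard basis. -/
abbrev stdBasis (n : ℕ) : Module.Basis (Fin n) ℝ (EuclideanSpace ℝ (Fin n)) :=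
  (EuclideanSpace.basisFun (Fin n) ℝ).toBasis

/-- The coordinates on the boundary which are induced by the preferred chart at `p`. -/
def boundaryCoord (ι : C^∞⟮𝓡 n, S; 𝓡∂ (n + 1), M⟯) (p : M) (y : S) : EuclideanSpace ℝ (Fin n) :=
  tailCLM n (extChartAt (𝓡∂ (n + 1)) p (ι y))

variable {p : M} {y : S}

lemma contMDiffAt_extChartAt_comp (hy : ι y ∈ (chartAt (EuclideanHalfSpace (n + 1)) p).source) :
    ContMDiffAt (𝓡 n) 𝓘(ℝ, EuclideanSpace ℝ (Fin (n + 1))) ∞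
      (fun y ↦ extChartAt (𝓡∂ (n + 1)) p (ι y)) y :=
  ContMDiffAt.comp y (contMDiffAt_extChartAt' hy) ι.contMDiff.contMDiffAt

lemma contMDiffAt_boundaryCoord (hy : ι y ∈ (chartAt (EuclideanHalfSpace (n + 1)) p).source) :
    ContMDiffAt (𝓡 n) 𝓘(ℝ, EuclideanSpace ℝ (Fin n)) ∞ (boundaryCoord ι p) y :=
  (tailCLM n).contMDiff.contMDiffAt.comp y (contMDiffAt_extChartAt_comp hy)

lemma mfderiv_clm_extChartAt_comp {W : Type*} [NormedAddCommGroup W] [NormedSpace ℝ W]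
    (L : EuclideanSpace ℝ (Fin (n + 1)) →L[ℝ] W)
    (hy : ι y ∈ (chartAt (EuclideanHalfSpace (n + 1)) p).source) (v : TangentSpace (𝓡 n) y) :
    mfderiv (𝓡 n) 𝓘(ℝ, W) (fun y ↦ L (extChartAt (𝓡∂ (n + 1)) p (ι y))) y v
      = L (mfderiv (𝓡∂ (n + 1)) 𝓘(ℝ, EuclideanSpace ℝ (Fin (n + 1))) (extChartAt (𝓡∂ (n + 1)) p)
        (ι y) (mfderiv (𝓡 n) (𝓡∂ (n + 1)) ι y v)) := by
  have h1 : MDifferentiableAt (𝓡∂ (n + 1)) 𝓘(ℝ, EuclideanSpace ℝ (Fin (n + 1)))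
      (extChartAt (𝓡∂ (n + 1)) p) (ι y) :=
    (contMDiffAt_extChartAt' (n := ∞) hy).mdifferentiableAt (by simp)
  have h2 : HasMFDerivAt (𝓡 n) (𝓡∂ (n + 1)) ι y _ :=
    (ι.contMDiff.contMDiffAt.mdifferentiableAt (by simp)).hasMFDerivAt
  have h3 := (L.hasMFDerivAt (x := extChartAt (𝓡∂ (n + 1)) p (ι y))).comp y
    (h1.hasMFDerivAt.comp y h2)
  exact DFunLike.congr_fun h3.mfderiv v

lemma mfderiv_boundaryCoord (hy : ι y ∈ (chartAt (EuclideanHalfSpace (n + 1)) p).source)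
    (v : TangentSpace (𝓡 n) y) :
    mfderiv (𝓡 n) 𝓘(ℝ, EuclideanSpace ℝ (Fin n)) (boundaryCoord ι p) y v
      = tailCLM n (mfderiv (𝓡∂ (n + 1)) 𝓘(ℝ, EuclideanSpace ℝ (Fin (n + 1)))
        (extChartAt (𝓡∂ (n + 1)) p) (ι y) (mfderiv (𝓡 n) (𝓡∂ (n + 1)) ι y v)) :=
  mfderiv_clm_extChartAt_comp (tailCLM n) hy v

lemma proj_mfderiv_extChartAt (hι : IsBoundaryInclusion ι)
    (hy : ι y ∈ (chartAt (EuclideanHalfSpace (n + 1)) p).source)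
    (v : TangentSpace (𝓡 n) y) :
    (EuclideanSpace.proj 0 : EuclideanSpace ℝ (Fin (n + 1)) →L[ℝ] ℝ)
      (mfderiv (𝓡∂ (n + 1)) 𝓘(ℝ, EuclideanSpace ℝ (Fin (n + 1)))
      (extChartAt (𝓡∂ (n + 1)) p) (ι y) (mfderiv (𝓡 n) (𝓡∂ (n + 1)) ι y v)) = 0 := by
  rw [← mfderiv_clm_extChartAt_comp _ hy]
  have h0 : (fun y ↦ (EuclideanSpace.proj 0 : EuclideanSpace ℝ (Fin (n + 1)) →L[ℝ] ℝ)
      (extChartAt (𝓡∂ (n + 1)) p (ι y))) =ᶠ[𝓝 y] fun _ ↦ (0 : ℝ) := by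
    filter_upwards [((chartAt (EuclideanHalfSpace (n + 1)) p).open_source.preimage
      ι.contMDiff.continuous).mem_nhds hy] with z hz
    exact (mem_boundary_iff hz).1 (hι.range_eq ▸ mem_range_self z)
  rw [h0.mfderiv_eq, mfderiv_const]
  rfl

lemma isInvertible_mfderiv_boundaryCoord (hι : IsBoundaryInclusion ι)
    (hy : ι y ∈ (chartAt (EuclideanHalfSpace (n + 1)) p).source) :
    (mfderiv (𝓡 n) 𝓘(ℝ, EuclideanSpace ℝ (Fin n)) (boundaryCoord ι p) y).IsInvertible := by
  set L : EuclideanSpace ℝ (Fin n) →L[ℝ] EuclideanSpace ℝ (Fin n) :=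
    mfderiv (𝓡 n) 𝓘(ℝ, EuclideanSpace ℝ (Fin n)) (boundaryCoord ι p) y with hL
  have hinj : Function.Injective L := by
    rw [injective_iff_map_eq_zero]
    intro v hv
    have h1 := (mfderiv_boundaryCoord hy v).symm.trans hv
    have h2 := eq_of_tailCLM_eq (w := 0) (proj_mfderiv_extChartAt hι hy v) (h1.trans (map_zero _).symm)
    obtain ⟨K, hK⟩ := isInvertible_mfderiv_extChartAt (I := 𝓡∂ (n + 1)) (x := p) (y := ι y)
      (by simpa using hy)
    rw [← hK] at h2
    exact hι.injective_mfderiv y ((K.map_eq_zero_iff.1 h2).trans (map_zero _).symm)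
  exact ⟨(LinearEquiv.ofInjectiveEndo L.toLinearMap hinj).toContinuousLinearEquiv,
    ContinuousLinearMap.ext fun v ↦ rfl⟩

/-- The coordinate fields of the boundary. -/
abbrev boundaryFrame (ι : C^∞⟮𝓡 n, S; 𝓡∂ (n + 1), M⟯) (p : M) (i : Fin n) (y : S) :
    TangentSpace (𝓡 n) y :=
  coordinateField (𝓡 n) (stdBasis n) (boundaryCoord ι p) i y

lemma isCommutingFrame_boundaryFrame (hι : IsBoundaryInclusion ι) {U : Set M} (hU : IsOpen U)
    (hUp : U ⊆ (chartAt (EuclideanHalfSpace (n + 1)) p).source) :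
    IsCommutingFrame (𝓡 n) (ι ⁻¹' U) (boundaryFrame ι p) :=
  isCommutingFrame_coordinateField _ (hU.preimage ι.contMDiff.continuous)
    (fun _ hy ↦ (contMDiffAt_boundaryCoord (hUp hy)).contMDiffWithinAt)
    fun _ hy ↦ isInvertible_mfderiv_boundaryCoord hι (hUp hy)

lemma mfderiv_boundaryFrame (hι : IsBoundaryInclusion ι)
    (hy : ι y ∈ (chartAt (EuclideanHalfSpace (n + 1)) p).source) (i : Fin n) :
    mfderiv (𝓡 n) (𝓡∂ (n + 1)) ι y (boundaryFrame ι p i y)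
      = chartFrame (𝓡∂ (n + 1)) (stdBasis (n + 1)) p i.succ (ι y) := by
  have hinv := isInvertible_mfderiv_extChartAt (I := 𝓡∂ (n + 1)) (x := p) (y := ι y)
      (by simpa using hy)
  have h1 := mfderiv_coordinateField (stdBasis (n + 1)) hinv i.succ
  have h2 := mfderiv_coordinateField (stdBasis n) (isInvertible_mfderiv_boundaryCoord hι hy) i
  rw [mfderiv_boundaryCoord hy] at h2
  have h3 := proj_mfderiv_extChartAt hι hy (boundaryFrame ι p i y)
  obtain ⟨K, hK⟩ := hinv
  refine K.injective ?_
  rw [← hK] at h1 h2 h3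
  refine Eq.trans ?_ h1.symm
  refine eq_of_tailCLM_eq (h3.trans ?_) (h2.trans ?_)
  · simp
  · refine PiLp.ext fun j ↦ ?_
    rw [tailCLM_apply]
    simp [Fin.ext_iff]

/-- The chain rule for the restriction of a function to the boundary. -/
lemma mvfderiv_comp_boundaryFrame (hι : IsBoundaryInclusion ι) {W : Type*} [NormedAddCommGroup W]
    [NormedSpace ℝ W]
    (hy : ι y ∈ (chartAt (EuclideanHalfSpace (n + 1)) p).source) {f : M → W}
    (hf : MDifferentiableAt (𝓡∂ (n + 1)) 𝓘(ℝ, W) f (ι y)) (i : Fin n) :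
    mvfderiv (𝓡 n) (fun y ↦ f (ι y)) y (boundaryFrame ι p i y)
      = mvfderiv (𝓡∂ (n + 1)) f (ι y) (chartFrame (𝓡∂ (n + 1)) (stdBasis (n + 1)) p i.succ (ι y)) := by
  rw [← mfderiv_boundaryFrame hι hy]
  exact DFunLike.congr_fun (mfderiv_comp y hf (ι.contMDiff.contMDiffAt.mdifferentiableAt
    (by simp))) _

end Coordinates

end ElectricYM

/-! ### The restriction of a connection to the boundary -/

namespace ElectricYM

open Filter Set
open scoped Topology

variable {E : Type*} [NormedAddCommGroup E] [NormedSpace ℝ E] [FiniteDimensional ℝ E]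
  {H : Type*} [TopologicalSpace H] {I : ModelWithCorners ℝ E H}
  {M : Type*} [TopologicalSpace M] [ChartedSpace H M] [IsManifold I ∞ M]
  {E' : Type*} [NormedAddCommGroup E'] [NormedSpace ℝ E'] [FiniteDimensional ℝ E']
  {H' : Type*} [TopologicalSpace H'] {J : ModelWithCorners ℝ E' H'}
  {S : Type*} [TopologicalSpace S] [ChartedSpace H' S] [IsManifold J ∞ S]
  {F : Type*} [NormedAddCommGroup F] [NormedSpace ℝ F] [FiniteDimensional ℝ F]
  {V : M → Type*} [TopologicalSpace (TotalSpace F V)]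
  [∀ x, AddCommGroup (V x)] [∀ x, Module ℝ (V x)] [∀ x, TopologicalSpace (V x)]
  [∀ x, IsTopologicalAddGroup (V x)] [∀ x, ContinuousSMul ℝ (V x)]
  [FiberBundle F V] [VectorBundle ℝ F V] [ContMDiffVectorBundle ∞ F V I]
  {ι : C^∞⟮J, S; I, M⟯} (e : Trivialization F (TotalSpace.proj : TotalSpace F V → M))
  [MemTrivializationAtlas e]

lemma exists_section_eventuallyEq_symmL [T2Space M] {x : M} (hx : x ∈ e.baseSet) (v : F) :
    ∃ T : ∀ y, V y, ContMDiff I (I.prod 𝓘(ℝ, F)) ∞ (fun y ↦ TotalSpace.mk' F y (T y)) ∧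
      ∀ᶠ y in 𝓝 x, T y = e.symmL ℝ y v := by
  obtain ⟨χ, -, hχU⟩ := (SmoothBumpFunction.nhds_basis_tsupport (I := I) x).mem_iff.1
    (e.open_baseSet.mem_nhds hx)
  refine ⟨(χ : M → ℝ) • fun y ↦ e.symmL ℝ y v, ?_, ?_⟩
  · exact ContMDiffOn.smul_section_of_tsupport χ.contMDiff.contMDiffOn e.open_baseSet hχU
      (contMDiffOn_symmL_apply e v)
  · filter_upwards [χ.eventuallyEq_one] with z hz
    simp [hz]

instance memTrivializationAtlas_pullback : MemTrivializationAtlas (e.pullback ι) :=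
  ⟨⟨e, inferInstance, rfl⟩⟩

lemma continuousLinearMapAt_pullback {y : S} (hy : ι y ∈ e.baseSet) (s : V (ι y)) :
    (e.pullback ι).continuousLinearMapAt ℝ y (s : (ι *ᵖ V) y) = e.continuousLinearMapAt ℝ (ι y) s := by
  have hy' : y ∈ (e.pullback ι).baseSet := hy
  rw [Trivialization.continuousLinearMapAt_apply, Trivialization.continuousLinearMapAt_apply,
    Trivialization.coe_linearMapAt_of_mem _ hy, Trivialization.coe_linearMapAt_of_mem _ hy']
  rfl

lemma symmL_pullback {y : S} (hy : ι y ∈ e.baseSet) (v : F) :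
    ((e.pullback ι).symmL ℝ y v : (ι *ᵖ V) y) = e.symmL ℝ (ι y) v := by
  have hy' : y ∈ (e.pullback ι).baseSet := hy
  have h1 := continuousLinearMapAt_pullback e hy ((e.pullback ι).symmL ℝ y v)
  rw [(e.pullback ι).continuousLinearMapAt_symmL hy'] at h1
  refine (e.symmL_continuousLinearMapAt (R := ℝ) hy _).symm.trans ?_
  rw [← h1]

/-- The connection forms of the induced connection on the boundary. -/
lemma connectionForm_pullback [T2Space M] {A : CovariantDerivative I F V}
    {B : CovariantDerivative J F (ι *ᵖ V)} (h : InducesOnBoundary ι A B) {y : S}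
    (hy : ι y ∈ e.baseSet) (u : TangentSpace J y) :
    connectionForm (e.pullback ι) B y u = connectionForm e A (ι y) (mfderiv J I ι y u) := by
  ext v
  have hy' : y ∈ (e.pullback ι).baseSet := hy
  obtain ⟨T, hT, hT'⟩ := exists_section_eventuallyEq_symmL (I := I) e hy v
  have h1 := h T hT y u
  have h2 : A T (ι y) = A (fun z ↦ e.symmL ℝ z v) (ι y) :=
    A.isCovariantDerivativeOnUniv.congr_of_eventuallyEq ((hT (ι y)).mdifferentiableAt (by simp))
      (mdifferentiableAt_symmL_apply e hy v) univ_mem hT'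
  set Tι : ∀ z, (ι *ᵖ V) z := fun z ↦ T (ι z)
  have h4 : ∀ᶠ z in 𝓝 y, (e.pullback ι).symmL ℝ z v = Tι z := by
    filter_upwards [ι.contMDiff.continuous.continuousAt.eventually hT',
      ι.contMDiff.continuous.continuousAt.eventually (e.open_baseSet.mem_nhds hy)] with z hz hz'
    exact (symmL_pullback e hz' v).trans hz.symm
  have h5 := mdifferentiableAt_symmL_apply (I := J) (e.pullback ι) hy' v
  have h6 : MDifferentiableAt J (J.prod 𝓘(ℝ, F)) (fun z ↦ TotalSpace.mk' F
      z (Tι z)) y := h5.congr_of_eventuallyEq (by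
    filter_upwards [h4] with z hz
    exact congrArg (TotalSpace.mk' F z) hz.symm)
  have h3 : B (fun z ↦ ((e.pullback ι).symmL ℝ z v : (ι *ᵖ V) z)) y
      = B Tι y :=
    B.isCovariantDerivativeOnUniv.congr_of_eventuallyEq h5 h6 univ_mem h4
  rw [connectionForm_apply, connectionForm_apply, h3, ← h1, h2]
  exact continuousLinearMapAt_pullback e hy _

end ElectricYM

/-! ### The Gauss law and the normal component of the current -/

namespace ElectricYM

open Filter Set
open scoped Topology

section Schur

variable {n : ℕ} {W : Type*} [AddCommGroup W] [Module ℝ W] {h : Fin (n + 1) → Fin (n + 1) → ℝ}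

/-- The Schur complement of the entry `h 0 0`. -/
def schur (h : Fin (n + 1) → Fin (n + 1) → ℝ) (i j : Fin n) : ℝ :=
  h i.succ j.succ - h 0 i.succ * h 0 j.succ / h 0 0

lemma sum_smul_eq_sum_schur_smul (hs : ∀ i j, h i j = h j i) (h0 : h 0 0 ≠ 0)
    {ε : Fin (n + 1) → W} (hε : ∑ c, h 0 c • ε c = 0) (l : Fin n) :
    ∑ c, h l.succ c • ε c = ∑ m, schur h l m • ε m.succ := by
  have h1 : ∑ c, h l.succ c • ε c
      = ∑ c, h l.succ c • ε c - (h 0 l.succ / h 0 0) • ∑ c, h 0 c • ε c := by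
    rw [hε, smul_zero, sub_zero]
  rw [h1, Finset.smul_sum, ← Finset.sum_sub_distrib, Fin.sum_univ_succ, smul_smul,
    div_mul_cancel₀ _ h0, hs l.succ 0, sub_self, zero_add]
  refine Finset.sum_congr rfl fun m _ ↦ ?_
  rw [schur, smul_smul, ← sub_smul]
  congr 1
  ring

lemma sum_schur_mul {g : Fin (n + 1) → Fin (n + 1) → ℝ} (hs : ∀ i j, h i j = h j i)
    (h0 : h 0 0 ≠ 0) (hhg : ∀ i k, ∑ j, h i j * g j k = if i = k then 1 else 0) (i k : Fin n) :
    ∑ j, schur h i j * g j.succ k.succ = if i = k then 1 else 0 := by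
  have h1 := sum_smul_eq_sum_schur_smul hs h0 (ε := fun c ↦ g c k.succ)
    ((hhg 0 k.succ).trans (if_neg (Fin.succ_ne_zero k).symm)) i
  simp only [smul_eq_mul] at h1
  rw [← h1, hhg]
  simp [Fin.succ_inj]

lemma smul_sum_eq_schur_add (hs : ∀ i j, h i j = h j i) (h0 : h 0 0 ≠ 0) (a : ℝ)
    (T : Fin (n + 1) → Fin (n + 1) → W) :
    (h 0 0 * a ^ 2) • ∑ u, ∑ v, h u v • T u v
      = (h 0 0 * a ^ 2) • ∑ i, ∑ j, schur h i j • T i.succ j.succ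
        + ∑ u, ∑ v, ((h u 0 * a) * (h v 0 * a)) • T u v := by
  rw [← sub_eq_iff_eq_add]
  simp only [Finset.smul_sum, smul_smul, ← Finset.sum_sub_distrib, ← sub_smul]
  have h1 : ∀ v, h 0 0 * a ^ 2 * h 0 v - h 0 0 * a * (h v 0 * a) = 0 := fun v ↦ by
    rw [hs v 0]; ring
  have h2 : ∀ u, h 0 0 * a ^ 2 * h u 0 - h u 0 * a * (h 0 0 * a) = 0 := fun v ↦ by ring
  simp only [Fin.sum_univ_succ, h1, h2, zero_smul, Finset.sum_const_zero, zero_add]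
  refine Finset.sum_congr rfl fun i _ ↦ Finset.sum_congr rfl fun j _ ↦ ?_
  congr 1
  rw [schur, hs i.succ 0, hs j.succ 0]
  field_simp

end Schur

section Divergence

variable {E : Type*} [NormedAddCommGroup E] [NormedSpace ℝ E] [FiniteDimensional ℝ E]
  {H : Type*} [TopologicalSpace H] {I : ModelWithCorners ℝ E H}
  {M : Type*} [TopologicalSpace M] [ChartedSpace H M] [IsManifold I ∞ M]
  {F : Type*} [NormedAddCommGroup F] [NormedSpace ℝ F] [FiniteDimensional ℝ F]
  {κ : Type*} [Fintype κ] [DecidableEq κ]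
  {V : M → Type*} [TopologicalSpace (TotalSpace F V)]
  [∀ x, AddCommGroup (V x)] [∀ x, Module ℝ (V x)] [∀ x, TopologicalSpace (V x)]
  [∀ x, IsTopologicalAddGroup (V x)] [∀ x, ContinuousSMul ℝ (V x)]
  [FiberBundle F V] [VectorBundle ℝ F V] [ContMDiffVectorBundle ∞ F V I]
  (e : Trivialization F (TotalSpace.proj : TotalSpace F V → M)) [MemTrivializationAtlas e]

/-- The Christoffel symbols of the first kind in a commuting frame. -/
def frameChristoffel (g : Metric I M) (X : κ → ∀ x : M, TangentSpace I x) (i j m : κ) (x : M) : ℝ :=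
  (1 / 2 : ℝ) *
    (mvfderiv I (fun y ↦ g.inner y (X j y) (X m y)) x (X i x)
      + mvfderiv I (fun y ↦ g.inner y (X i y) (X m y)) x (X j x)
      - mvfderiv I (fun y ↦ g.inner y (X i y) (X j y)) x (X m x))

/-- The divergence of a one-form in a commuting frame. -/
lemma continuousLinearMapAt_divOneForm {g : Metric I M} {A : CovariantDerivative I F V}
    {U : Set M} {x : M} {X : κ → ∀ x : M, TangentSpace I x}
    {e' : ∀ x : M, V x → TangentSpace I x → V x} {φ : κ → M → F →L[ℝ] F}
    (hX : IsCommutingFrame I U X) (hx : x ∈ U) (hxe : x ∈ e.baseSet)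
    (he' : ∀ y s, ∃ T : TangentSpace I y →ₗ[ℝ] V y, ∀ v, e' y s v = T v)
    (hφ : ∀ y ∈ U ∩ e.baseSet, ∀ s i, e.continuousLinearMapAt ℝ y (e' y s (X i y))
      = φ i y (e.continuousLinearMapAt ℝ y s))
    (hφd : ∀ i, MDiffAt (φ i) x) (s : V x) :
    e.continuousLinearMapAt ℝ x (divOneForm g A e' x s)
      = (∑ i, ∑ j, (gram g x fun i ↦ X i x)⁻¹ i j • (mvfderiv I (φ j) x (X i x)
          + (connectionForm e A x (X i x) * φ j x - φ j x * connectionForm e A x (X i x))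
          - ∑ k, (∑ m, (gram g x fun i ↦ X i x)⁻¹ k m * frameChristoffel g X i j m x) • φ k x))
        (e.continuousLinearMapAt ℝ x s) := by
  have : Nonempty (Metric I M) := ⟨g⟩
  obtain ⟨T, hT⟩ := exists_covDerivOneForm_eq_linearMap (g := g) (A := A) e hX hx hxe he' hφ hφd s
  have h1 : divOneForm g A e' x s = ∑ i, ∑ j, (gram g x fun i ↦ X i x)⁻¹ i j • T (X i x) (X j x) := by
    rw [← metricTrace_eq_sum g x (hX.linearIndependent x hx) (hX.span x hx) T]
    simp only [← hT]
    rfl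
  rw [h1, map_sum, _root_.sum_apply]
  refine Finset.sum_congr rfl fun i _ ↦ ?_
  rw [map_sum, _root_.sum_apply]
  refine Finset.sum_congr rfl fun j _ ↦ ?_
  rw [map_smul, _root_.smul_apply, ← hT,
    continuousLinearMapAt_covDerivOneForm e hX hx hxe he' hφ hφd, _root_.sub_apply,
    hX.leviCivita_eq hx]
  congr 2
  obtain ⟨T', hT'⟩ := he' x s
  rw [hT', map_sum, map_sum, _root_.sum_apply]
  refine Finset.sum_congr rfl fun k _ ↦ ?_
  rw [map_smul, map_smul, ← hT', hφ x ⟨hx, hxe⟩]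
  rfl

namespace Patch

variable {b : Module.Basis κ ℝ E} {P : Patch H F V} {c : Set (Metric I M)} {w₀ : ℤ}
  {G : EndTwoForm F V c w₀} [T2Space M]

lemma contractGrad_apply {g : c} {s : M → ℝ} (hs : CMDiff[P.U] ∞ s) (i : κ) (x : P.U) (t : V x) :
    ((P.calculus b).contractGrad (P.invMetric b g.1) (P.scalar s hs) (P.twoForm b G g) i).1 x
        (P.e.continuousLinearMapAt ℝ x t)
      = P.e.continuousLinearMapAt ℝ x (G.rep g x t (P.frame b i x) (sharp g.1 x (mvfderiv I s x))) := by
  rw [sharp_frame (b := b) g.1 hs x, map_sum, map_sum, Calculus.contractGrad, SmoothFun.sum_apply,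
    _root_.sum_apply]
  refine Finset.sum_congr rfl fun j _ ↦ ?_
  rw [map_smul, map_smul, SmoothFun.smul_apply, _root_.smul_apply]
  congr 1
  refine (twoFormComponent_apply i j (x : M) _).trans ?_
  rw [P.e.symmL_continuousLinearMapAt (P.subset_baseSet x.2)]

end Patch

end Divergence

end ElectricYM

/-! ### The electric field on the boundary -/

namespace ElectricYM

open Filter Set
open scoped Topology

section ElectricField

variable {E : Type*} [NormedAddCommGroup E] [NormedSpace ℝ E] [FiniteDimensional ℝ E]
  {H : Type*} [TopologicalSpace H] {I : ModelWithCorners ℝ E H}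
  {M : Type*} [TopologicalSpace M] [ChartedSpace H M] [IsManifold I ∞ M]
  {E' : Type*} [NormedAddCommGroup E'] [NormedSpace ℝ E'] [FiniteDimensional ℝ E']
  {H' : Type*} [TopologicalSpace H'] {J : ModelWithCorners ℝ E' H'}
  {S : Type*} [TopologicalSpace S] [ChartedSpace H' S] [IsManifold J ∞ S]
  {F : Type*} [NormedAddCommGroup F] [NormedSpace ℝ F] [FiniteDimensional ℝ F]
  {V : M → Type*} [TopologicalSpace (TotalSpace F V)]
  [∀ x, AddCommGroup (V x)] [∀ x, Module ℝ (V x)] [∀ x, TopologicalSpace (V x)]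
  [∀ x, IsTopologicalAddGroup (V x)] [∀ x, ContinuousSMul ℝ (V x)]
  [FiberBundle F V] [VectorBundle ℝ F V] [ContMDiffVectorBundle ∞ F V I]
  {ι : C^∞⟮J, S; I, M⟯} {c : Set (Metric I M)} {σ : Density c 1} {w w' : ℤ}
  {G : EndTwoForm F V c w} {e : EndOneForm F (ι *ᵖ V) (inducedClass ι c) w'} {g : c}

lemma sharp_div (g : Metric I M) (x : M) (α : TangentSpace I x → ℝ) (r : ℝ) :
    sharp g x (fun u ↦ α u / r) = r⁻¹ • sharp g x α := by
  simp only [sharp, metricTrace, Finset.smul_sum]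
  have h : ∀ (a β : ℝ) (v : E), a • (β / r) • v = r⁻¹ • a • β • v := fun a β v ↦ by
    simp only [smul_smul]
    congr 1
    ring
  exact Finset.sum_congr rfl fun i _ ↦ Finset.sum_congr rfl fun j _ ↦ h _ _ _

lemma tangential_sharp {x : M} (h : mvfderiv I (σ.rep g) x ≠ 0) :
    tangential σ g x (sharp g.1 x (mvfderiv I (σ.rep g) x)) = 0 := by
  have h1 : conormSq g.1 x (mvfderiv I (σ.rep g) x)
      = mvfderiv I (σ.rep g) x (sharp g.1 x (mvfderiv I (σ.rep g) x)) :=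
    conormSq_eq_apply_sharp g.1 x (mvfderiv I (σ.rep g) x).toLinearMap
  have h2 : 0 < conormSq g.1 x (mvfderiv I (σ.rep g) x) :=
    conormSq_pos g.1 x (α := (mvfderiv I (σ.rep g) x).toLinearMap)
      fun h' ↦ h (ContinuousLinearMap.coe_injective h')
  have h3 : sharp g.1 x (unitConormal σ g x) = _ :=
    sharp_div g.1 x (mvfderiv I (σ.rep g) x) (√(conormSq g.1 x (mvfderiv I (σ.rep g) x)))
  rw [tangential, h3, unitConormal, smul_smul, sub_eq_zero]
  conv_lhs => rw [← one_smul ℝ (sharp _ _ _)]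
  congr 1
  rw [← h1, ← div_eq_mul_inv, div_div, Real.mul_self_sqrt h2.le, div_self h2.ne']

/-- The electric field is the contraction of `G` with the normal. -/
lemma HasElectricField.apply_sharp (hG : HasElectricField σ ι G e) {h : inducedClass ι c}
    (hh : IsInducedMetric ι (fun _ ↦ 1) g.1 h.1) {y : S}
    (hy : mvfderiv I (σ.rep g) (ι y) ≠ 0) (s : V (ι y)) {u : TangentSpace I (ι y)}
    {u' : TangentSpace J y} (hu : mfderiv J I ι y u' = u) (hu0 : mvfderiv I (σ.rep g) (ι y) u = 0) :
    G.rep g (ι y) s u (sharp g.1 (ι y) (mvfderiv I (σ.rep g) (ι y)))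
      = (-√(conormSq g.1 (ι y) (mvfderiv I (σ.rep g) (ι y)))) • (e.rep h y s u' : V (ι y)) := by
  have h1 : unitConormal σ g (ι y) u = 0 := by rw [unitConormal, hu0, zero_div]
  have h2 : tangential σ g (ι y) u = u := by rw [tangential, h1, zero_smul, sub_zero]
  have h3 := hG g h hh y s u (sharp g.1 (ι y) (mvfderiv I (σ.rep g) (ι y))) u' 0
    (hu.trans h2.symm) ((map_zero _).trans (tangential_sharp hy).symm)
  rw [h3, h1, zero_smul, zero_sub, neg_smul]
  congr 2
  have h4 : conormSq g.1 (ι y) (mvfderiv I (σ.rep g) (ι y)) = mvfderiv I (σ.rep g) (ι y) _ :=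
    conormSq_eq_apply_sharp g.1 (ι y) (mvfderiv I (σ.rep g) (ι y)).toLinearMap
  have h5 : conormSq g.1 (ι y) (mvfderiv I (σ.rep g) (ι y)) / _ = _ := Real.div_sqrt
  rw [unitConormal]
  refine Eq.trans ?_ h5
  congr 1
  exact h4.symm

end ElectricField

section Boundary

variable {n : ℕ} {M : Type*} [TopologicalSpace M] [T2Space M]
  [ChartedSpace (EuclideanHalfSpace (n + 1)) M] [IsManifold (𝓡∂ (n + 1)) ∞ M]
  {S : Type*} [TopologicalSpace S] [ChartedSpace (EuclideanSpace ℝ (Fin n)) S]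
  [IsManifold (𝓡 n) ∞ S] {ι : C^∞⟮𝓡 n, S; 𝓡∂ (n + 1), M⟯}
  {F : Type*} [NormedAddCommGroup F] [NormedSpace ℝ F] [FiniteDimensional ℝ F]
  {V : M → Type*} [TopologicalSpace (TotalSpace F V)]
  [∀ x, AddCommGroup (V x)] [∀ x, Module ℝ (V x)] [∀ x, TopologicalSpace (V x)]
  [∀ x, IsTopologicalAddGroup (V x)] [∀ x, ContinuousSMul ℝ (V x)]
  [FiberBundle F V] [VectorBundle ℝ F V] [ContMDiffVectorBundle ∞ F V (𝓡∂ (n + 1))]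

namespace Patch

variable {P : Patch (EuclideanHalfSpace (n + 1)) F V} {y : S}

lemma inducedMetric_boundaryFrame (hι : IsBoundaryInclusion ι) (g : Metric (𝓡∂ (n + 1)) M)
    (hy : ι y ∈ P.U) (i j : Fin n) :
    (inducedMetric hι.injective_mfderiv g).inner y (boundaryFrame ι P.p i y)
      (boundaryFrame ι P.p j y)
    = g.inner (ι y) (P.frame (stdBasis (n + 1)) i.succ (ι y))
      (P.frame (stdBasis (n + 1)) j.succ (ι y)) := by
  rw [inducedMetric_inner, mfderiv_boundaryFrame hι (P.subset_source hy),
    mfderiv_boundaryFrame hι (P.subset_source hy)]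

lemma mvfderiv_inducedMetric (hι : IsBoundaryInclusion ι) (g : Metric (𝓡∂ (n + 1)) M)
    (hy : ι y ∈ P.U) (i j k : Fin n) :
    mvfderiv (𝓡 n) (fun y ↦ (inducedMetric hι.injective_mfderiv g).inner y
      (boundaryFrame ι P.p i y) (boundaryFrame ι P.p j y)) y (boundaryFrame ι P.p k y)
    = mvfderiv (𝓡∂ (n + 1)) (fun y ↦ g.inner y (P.frame (stdBasis (n + 1)) i.succ y)
      (P.frame (stdBasis (n + 1)) j.succ y)) (ι y) (P.frame (stdBasis (n + 1)) k.succ (ι y)) := by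
  have h := (P.isCommutingFrame (stdBasis (n + 1))).contMDiffAt_gram hy g i.succ j.succ
  refine Eq.trans ?_ (mvfderiv_comp_boundaryFrame hι (P.subset_source hy)
    (h.mdifferentiableAt (by simp)) k)
  refine DFunLike.congr_fun (mvfderiv_congr ?_) _
  filter_upwards [(P.isOpen.preimage ι.contMDiff.continuous).mem_nhds hy] with z hz
  exact inducedMetric_boundaryFrame hι g hz i j

lemma frameChristoffel_inducedMetric (hι : IsBoundaryInclusion ι) (g : Metric (𝓡∂ (n + 1)) M)
    (hy : ι y ∈ P.U) (i j k : Fin n) :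
    frameChristoffel (inducedMetric hι.injective_mfderiv g) (boundaryFrame ι P.p) i j k y
      = ((P.calculus (stdBasis (n + 1))).christoffel (P.metric (stdBasis (n + 1)) g)
        i.succ j.succ k.succ).1 ⟨ι y, hy⟩ := by
  rw [christoffel_apply, frameChristoffel, mvfderiv_inducedMetric hι g hy,
    mvfderiv_inducedMetric hι g hy, mvfderiv_inducedMetric hι g hy]

lemma inv_gram_inducedMetric (hι : IsBoundaryInclusion ι) (g : Metric (𝓡∂ (n + 1)) M)
    (hy : ι y ∈ P.U)
    (h0 : (P.invMetric (stdBasis (n + 1)) g 0 0).1 ⟨ι y, hy⟩ ≠ 0) (i j : Fin n) :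
    (gram (inducedMetric hι.injective_mfderiv g) y fun i ↦ boundaryFrame ι P.p i y)⁻¹ i j
      = schur (fun i j ↦ (P.invMetric (stdBasis (n + 1)) g i j).1 ⟨ι y, hy⟩) i j := by
  set h := fun i j ↦ (P.invMetric (stdBasis (n + 1)) g i j).1 ⟨ι y, hy⟩
  have h1 : Matrix.of (schur h) * gram (inducedMetric hι.injective_mfderiv g) y
      (fun i ↦ boundaryFrame ι P.p i y) = 1 := by
    ext i k
    rw [Matrix.mul_apply, Matrix.one_apply, ← sum_schur_mul (h := h)
      (g := fun i j ↦ (P.metric (stdBasis (n + 1)) g i j).1 ⟨ι y, hy⟩)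
      (fun i j ↦ congrArg (fun f : SmoothFun (𝓡∂ (n + 1)) P.U ℝ ↦ f.1 ⟨ι y, hy⟩)
        (invMetric_symm g i j)) h0 (fun i k ↦ ?_)]
    · refine Finset.sum_congr rfl fun j _ ↦ ?_
      rw [gram_apply, inducedMetric_boundaryFrame hι g hy]
      rfl
    · have h2 := congrArg (fun f : SmoothFun (𝓡∂ (n + 1)) P.U ℝ ↦ f.1 ⟨ι y, hy⟩)
        (invMetric_mul_metric (b := stdBasis (n + 1)) (P := P) g i k)
      rw [SmoothFun.sum_apply] at h2
      refine h2.trans ?_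
      split_ifs <;> simp
  rw [Matrix.inv_eq_left_inv h1]
  rfl

end Patch

end Boundary

end ElectricYM

/-! ### The normal component of the current vanishes on the boundary -/

namespace ElectricYM

open Filter Set
open scoped Topology

section Algebra

variable {n : ℕ} {W : Type*} [AddCommGroup W] [Module ℝ W] {h : Fin (n + 1) → Fin (n + 1) → ℝ}

/-- The algebraic form of the Gauss law: the trace of `T` vanishes if its normal part is determined
by the differential `δ` of the length `r` of the normal, and its tangential part is the derivative
of `-r • φ` with divergence free `φ`. -/
lemma sum_smul_eq_zero_of_gauss (hs : ∀ i j, h i j = h j i) {a r : ℝ} (hr : r ≠ 0)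
    (hra : h 0 0 * a ^ 2 = r ^ 2) {T : Fin (n + 1) → Fin (n + 1) → W} {ε : Fin (n + 1) → W}
    {φ : Fin n → W} {D : Fin n → Fin n → W} {δ : Fin n → ℝ} {δ' : Fin (n + 1) → ℝ}
    (hδ : ∀ k, δ' k.succ = 2 * r * δ k)
    (hε0 : ∑ c, h 0 c • ε c = 0) (hεφ : ∀ i, ε i.succ = (-r) • φ i)
    (hT : ∀ i j, T i.succ j.succ = (-δ i) • φ j - r • D i j)
    (hD : ∑ i, ∑ j, schur h i j • D i j = 0)
    (hN : ∑ u, ∑ v, ((h u 0 * a) * (h v 0 * a)) • T u v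
      = ∑ k, (-((1 / 2 : ℝ) * δ' k)) • ∑ c, h k c • ε c) :
    ∑ u, ∑ v, h u v • T u v = 0 := by
  have h0 : h 0 0 ≠ 0 := fun h0 ↦ hr (by rw [h0, zero_mul] at hra; exact pow_eq_zero_iff two_ne_zero |>.1 hra.symm)
  have h1 := smul_sum_eq_schur_add hs h0 a T
  rw [Fin.sum_univ_succ fun k ↦ (-((1 / 2 : ℝ) * δ' k)) • ∑ c, h k c • ε c, hε0, smul_zero,
    zero_add] at hN
  rw [hN] at h1
  simp only [sum_smul_eq_sum_schur_smul hs h0 hε0, hεφ, hT, hδ] at h1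
  have h2 : ∑ i, ∑ j, schur h i j • ((-δ i) • φ j - r • D i j)
      = -∑ i, ∑ j, (δ i * schur h i j) • φ j := by
    have : ∑ i, ∑ j, schur h i j • ((-δ i) • φ j - r • D i j)
        = -∑ i, ∑ j, (δ i * schur h i j) • φ j - r • ∑ i, ∑ j, schur h i j • D i j := by
      simp only [Finset.smul_sum, ← Finset.sum_neg_distrib, ← Finset.sum_sub_distrib]
      refine Finset.sum_congr rfl fun i _ ↦ Finset.sum_congr rfl fun j _ ↦ ?_
      module
    rw [this, hD, smul_zero, sub_zero]
  have h3 : ∑ k, (-((1 / 2 : ℝ) * (2 * r * δ k))) • ∑ m, schur h k m • (-r) • φ m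
      = r ^ 2 • ∑ i, ∑ j, (δ i * schur h i j) • φ j := by
    simp only [Finset.smul_sum]
    refine Finset.sum_congr rfl fun i _ ↦ Finset.sum_congr rfl fun j _ ↦ ?_
    module
  rw [h2, h3, hra, smul_neg, neg_add_cancel] at h1
  exact (smul_eq_zero.1 h1).resolve_left (pow_ne_zero 2 hr)

lemma sum_christoffel_smul_eq (hs : ∀ i j, h i j = h j i) (h0 : h 0 0 ≠ 0)
    {ε : Fin (n + 1) → W} (hε : ∑ c, h 0 c • ε c = 0) (Γ : Fin (n + 1) → ℝ) :
    ∑ k, (∑ m, h k m * Γ m) • ε k = ∑ k : Fin n, (∑ m : Fin n, schur h k m * Γ m.succ) • ε k.succ := by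
  have h1 : ∑ k, (∑ m, h k m * Γ m) • ε k = ∑ m, Γ m • ∑ k, h m k • ε k := by
    simp only [Finset.sum_smul, Finset.smul_sum, smul_smul]
    rw [Finset.sum_comm]
    exact Finset.sum_congr rfl fun m _ ↦ Finset.sum_congr rfl fun k _ ↦ by rw [hs k m, mul_comm]
  rw [h1, Fin.sum_univ_succ, hε, smul_zero, zero_add]
  simp only [sum_smul_eq_sum_schur_smul hs h0 hε, Finset.sum_smul, Finset.smul_sum, smul_smul]
  rw [Finset.sum_comm]
  refine Finset.sum_congr rfl fun m _ ↦ Finset.sum_congr rfl fun k _ ↦ ?_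
  rw [schur, schur, hs m.succ k.succ]
  congr 1
  ring

end Algebra

section Boundary

variable {n : ℕ} {M : Type*} [TopologicalSpace M] [T2Space M]
  [ChartedSpace (EuclideanHalfSpace (n + 1)) M] [IsManifold (𝓡∂ (n + 1)) ∞ M]
  {S : Type*} [TopologicalSpace S] [ChartedSpace (EuclideanSpace ℝ (Fin n)) S]
  [IsManifold (𝓡 n) ∞ S] {ι : C^∞⟮𝓡 n, S; 𝓡∂ (n + 1), M⟯}
  {F : Type*} [NormedAddCommGroup F] [NormedSpace ℝ F] [FiniteDimensional ℝ F]
  {V : M → Type*} [TopologicalSpace (TotalSpace F V)]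
  [∀ x, AddCommGroup (V x)] [∀ x, Module ℝ (V x)] [∀ x, TopologicalSpace (V x)]
  [∀ x, IsTopologicalAddGroup (V x)] [∀ x, ContinuousSMul ℝ (V x)]
  [FiberBundle F V] [VectorBundle ℝ F V] [ContMDiffVectorBundle ∞ F V (𝓡∂ (n + 1))]
  {c : Set (Metric (𝓡∂ (n + 1)) M)} {σ : Density c 1} {w w' : ℤ} {G : EndTwoForm F V c w}
  {e : EndOneForm F (ι *ᵖ V) (inducedClass ι c) w'} {A : CovariantDerivative (𝓡∂ (n + 1)) F V}
  {B : CovariantDerivative (𝓡 n) F (ι *ᵖ V)}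

namespace Patch

variable {P : Patch (EuclideanHalfSpace (n + 1)) F V} {y : S}

lemma mvfderiv_sqrt {E : Type*} [NormedAddCommGroup E] [NormedSpace ℝ E]
    {H : Type*} [TopologicalSpace H] {I : ModelWithCorners ℝ E H}
    {M : Type*} [TopologicalSpace M] [ChartedSpace H M] {f : M → ℝ} {x : M}
    (hf : MDifferentiableAt I 𝓘(ℝ, ℝ) f x) (hx : 0 < f x) :
    MDifferentiableAt I 𝓘(ℝ, ℝ) (fun y ↦ √(f y)) x ∧ ∀ u,
      mvfderiv I f x u = 2 * √(f x) * mvfderiv I (fun y ↦ √(f y)) x u := by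
  have h1 : HasDerivAt Real.sqrt (1 / (2 * √(f x))) (f x) := Real.hasDerivAt_sqrt hx.ne'
  have h2 := h1.hasFDerivAt.hasMFDerivAt.comp x hf.hasMFDerivAt
  refine ⟨h2.mdifferentiableAt, fun u ↦ ?_⟩
  have h3 : mvfderiv I (fun y ↦ √(f y)) x u = mvfderiv I f x u * (1 / (2 * √(f x))) :=
    DFunLike.congr_fun h2.mfderiv u
  rw [h3]
  have := (Real.sqrt_pos.2 hx).ne'
  field_simp

theorem sum_covOneForm_contractGrad_eq_zero (hι : IsBoundaryInclusion ι)
    (hσ : IsDefiningDensity σ) (he : GaussLaw B e)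
    (hA : CovariantDerivative.ContMDiffCovariantDerivative A ∞) (hAB : InducesOnBoundary ι A B)
    (hG : HasElectricField σ ι G e) (g : c) (hy : ι y ∈ P.U) :
    (∑ u, ∑ v, P.invMetric (stdBasis (n + 1)) g.1 u v •
      (P.calculus (stdBasis (n + 1))).covOneForm (P.connection (stdBasis (n + 1)) hA)
        (P.metric (stdBasis (n + 1)) g.1) (P.invMetric (stdBasis (n + 1)) g.1)
        ((P.calculus (stdBasis (n + 1))).contractGrad (P.invMetric (stdBasis (n + 1)) g.1)
          (P.scalar (σ.rep g) (σ.contMDiff g).contMDiffOn) (P.twoForm (stdBasis (n + 1)) G g))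
        u v).1 ⟨ι y, hy⟩ = 0 := by
  set b := stdBasis (n + 1) with hb
  set C := P.calculus (I := 𝓡∂ (n + 1)) b with hC
  set s := P.scalar (σ.rep g) (σ.contMDiff g).contMDiffOn with hs
  set ε := C.contractGrad (P.invMetric b g.1) s (P.twoForm b G g) with hε
  set x : P.U := ⟨ι y, hy⟩ with hx
  set h : Fin (n + 1) → Fin (n + 1) → ℝ := fun i j ↦ (P.invMetric b g.1 i j).1 x with hh
  set f : M → ℝ := fun z ↦ conormSq g.1 z (mvfderiv (𝓡∂ (n + 1)) (σ.rep g) z) with hf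
  set r : S → ℝ := fun z ↦ √(f (ι z)) with hr
  set εt : Fin n → M → F →L[ℝ] F := fun i ↦ SmoothFun.rep (ε i.succ) with hεt
  set φ : Fin n → S → F →L[ℝ] F := fun i z ↦ (-(r z)⁻¹) • εt i (ι z) with hφ
  have hbd : ∀ z, ι z ∈ (𝓡∂ (n + 1)).boundary M := fun z ↦ hι.range_eq ▸ mem_range_self z
  have hsymm : ∀ i j, h i j = h j i := fun i j ↦
    congrArg (fun f : SmoothFun (𝓡∂ (n + 1)) P.U ℝ ↦ f.1 x) (invMetric_symm (b := b) g.1 i j)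
  have hds : ∀ z, ι z ∈ P.U → ∀ i : Fin n,
      mvfderiv (𝓡∂ (n + 1)) (σ.rep g) (ι z) (P.frame b i.succ (ι z)) = 0 := fun z hz i ↦
    (hσ.isDefiningFunction g).mvfderiv_chartFrame_eq_zero b (P.subset_source hz) (hbd z)
      (by simp [hb])
  have hfpos : ∀ z, 0 < f (ι z) := fun z ↦
    conormSq_pos g.1 (ι z) (α := (mvfderiv (𝓡∂ (n + 1)) (σ.rep g) (ι z)).toLinearMap)
      fun h' ↦ hσ.deriv_ne_zero g _ (hbd z) (ContinuousLinearMap.coe_injective h')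
  have hrpos : ∀ z, 0 < r z := fun z ↦ Real.sqrt_pos.2 (hfpos z)
  set a := mvfderiv (𝓡∂ (n + 1)) (σ.rep g) (ι y) (P.frame b 0 (ι y)) with ha
  have hd : ∀ i, (C.d i s).1 x = mvfderiv (𝓡∂ (n + 1)) (σ.rep g) (ι y) (P.frame b i (ι y)) :=
    fun i ↦ chartCalculus_d_apply b P.isOpen P.subset_source i (fun _ ↦ rfl) x
  have hgrad : ∀ u, (C.grad (P.invMetric b g.1) s u).1 x = h u 0 * a := fun u ↦ by
    rw [Calculus.grad, SmoothFun.sum_apply, Fin.sum_univ_succ, SmoothFun.mul_apply, hd]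
    refine (congrArg (_ + ·) (Finset.sum_eq_zero fun i _ ↦ ?_)).trans (add_zero _)
    rw [SmoothFun.mul_apply, hd, hds y hy, mul_zero]
  have hfa : h 0 0 * a ^ 2 = r y ^ 2 := by
    rw [hr, Real.sq_sqrt (hfpos y).le, hf]
    refine Eq.trans ?_ (gradSq_apply (b := b) g.1 (σ.contMDiff g).contMDiffOn x)
    rw [Calculus.gradSq, SmoothFun.sum_apply, Fin.sum_univ_succ, SmoothFun.mul_apply, hd, hgrad]
    refine Eq.symm ((congrArg (_ + ·) (Finset.sum_eq_zero fun i _ ↦ ?_)).trans ?_)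
    · rw [SmoothFun.mul_apply, hd, hds y hy, zero_mul]
    · rw [add_zero]; ring
  have h00 : h 0 0 ≠ 0 := fun h0 ↦ (hrpos y).ne' (by
    rw [h0, zero_mul] at hfa; exact (pow_eq_zero_iff two_ne_zero).1 hfa.symm)
  have ha0 : a ≠ 0 := fun h0 ↦ (hrpos y).ne' (by
    rw [h0, zero_pow two_ne_zero, mul_zero] at hfa
    exact (pow_eq_zero_iff two_ne_zero).1 hfa.symm)
  have hgε := C.sum_grad_contractGrad (h := P.invMetric b g.1) s (P.twoForm b G g) twoForm_antisymm
  have hε0 : ∑ c, h 0 c • (ε c).1 x = 0 := by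
    have h1 := congrArg (fun z : SmoothFun (𝓡∂ (n + 1)) P.U (F →L[ℝ] F) ↦ z.1 x) hgε
    simp only [SmoothFun.sum_apply, SmoothFun.smul_apply, SmoothFun.zero_apply, hgrad] at h1
    have h2 : a • ∑ c, h 0 c • (ε c).1 x = 0 := by
      rw [← h1, Finset.smul_sum]
      exact Finset.sum_congr rfl fun c _ ↦ by rw [smul_smul, hsymm 0 c, mul_comm]
    exact (smul_eq_zero.1 h2).resolve_left ha0
  have hεφ : ∀ z (hz : ι z ∈ P.U) i, (ε (Fin.succ i)).1 ⟨ι z, hz⟩ = (-r z) • φ i z := by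
    intro z hz i
    rw [hφ, smul_smul, neg_mul_neg, mul_inv_cancel₀ (hrpos z).ne', one_smul]
    exact (SmoothFun.rep_apply (ε i.succ) ⟨ι z, hz⟩).symm
  set e' := P.e.pullback ι with he'
  set h₀ : inducedClass ι c := ⟨inducedMetric hι.injective_mfderiv g.1,
    inducedMetric_mem hι.injective_mfderiv g.2⟩ with hh₀
  set Y := boundaryFrame ι P.p with hY
  have hφe : ∀ z ∈ (ι ⁻¹' P.U) ∩ e'.baseSet, ∀ t i,
      e'.continuousLinearMapAt ℝ z (e.rep h₀ z t (Y i z))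
        = φ i z (e'.continuousLinearMapAt ℝ z t) := fun z hz t i ↦ by
    have hz' : ι z ∈ P.U := hz.1
    have h1 := hG.apply_sharp (g := g) (h := h₀) (isInducedMetric_inducedMetric hι.injective_mfderiv g.1)
      (hσ.deriv_ne_zero g _ (hbd z)) t (mfderiv_boundaryFrame hι (P.subset_source hz') i)
      (hds z hz' i)
    have h2 := contractGrad_apply (b := b) (G := G) (g := g) (σ.contMDiff g).contMDiffOn i.succ ⟨ι z, hz'⟩ t
    have h3 := (congrArg (fun L : F →L[ℝ] F ↦ L (P.e.continuousLinearMapAt ℝ (ι z) t))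
      (hεφ z hz' i)).symm.trans (h2.trans ((congrArg (P.e.continuousLinearMapAt ℝ (ι z)) h1).trans
        (map_smul (P.e.continuousLinearMapAt ℝ (ι z)) (-r z) (e.rep h₀ z t (Y i z) : V (ι z)))))
    have h4 : (-r z) ≠ 0 := neg_ne_zero.2 (hrpos z).ne'
    have h5 := smul_right_injective F h4 h3
    have h6 := fun u : V (ι z) ↦ continuousLinearMapAt_pullback (ι := ι) P.e hz.2 u
    exact (h6 _).trans (h5.symm.trans (congrArg (φ i z) (h6 t).symm))
  have hfd : MDifferentiableAt (𝓡 n) 𝓘(ℝ, ℝ) (fun z ↦ f (ι z)) y :=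
    ((contMDiff_conormSq g.1 (σ.contMDiff g)).comp ι.contMDiff y).mdifferentiableAt (by simp)
  obtain ⟨hrd, hrf⟩ := mvfderiv_sqrt hfd (hfpos y)
  have hεd : ∀ i, MDifferentiableAt (𝓡∂ (n + 1)) 𝓘(ℝ, F →L[ℝ] F) (εt i) (ι y) := fun i ↦
    SmoothFun.mdifferentiableAt_rep P.isOpen (ε i.succ) hy
  have hφd : ∀ i, MDifferentiableAt (𝓡 n) 𝓘(ℝ, F →L[ℝ] F) (φ i) y := fun i ↦ by
    have h1 : MDifferentiableAt (𝓡 n) 𝓘(ℝ, ℝ) (fun z ↦ -(r z)⁻¹) y :=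
      MDifferentiableAt.comp (g := fun t : ℝ ↦ -t⁻¹) y
        (differentiableAt_inv (hrpos y).ne').fun_neg.mdifferentiableAt hrd
    exact h1.smul (MDifferentiableAt.comp y (hεd i) (ι.contMDiff.mdifferentiableAt (by simp)))
  set D : Fin n → Fin n → F →L[ℝ] F := fun i j ↦ mvfderiv (𝓡 n) (φ j) y (Y i y)
    + (connectionForm e' B y (Y i y) * φ j y - φ j y * connectionForm e' B y (Y i y))
    - ∑ k, (∑ m, (gram h₀.1 y fun i ↦ Y i y)⁻¹ k m * frameChristoffel h₀.1 Y i j m y) • φ k y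
    with hD
  have hgram : ∀ i j, (gram h₀.1 y fun i ↦ Y i y)⁻¹ i j = schur h i j :=
    inv_gram_inducedMetric hι g.1 hy h00
  have hye : y ∈ e'.baseSet := P.subset_baseSet hy
  have hDsum : ∑ i, ∑ j, schur h i j • D i j = 0 := by
    have h0 : ∑ i, ∑ j, schur h i j • D i j
        = ∑ i, ∑ j, (gram h₀.1 y fun i ↦ Y i y)⁻¹ i j • D i j :=
      Finset.sum_congr rfl fun i _ ↦ Finset.sum_congr rfl fun j _ ↦ by rw [hgram]
    rw [h0]
    ext v
    have h1 := continuousLinearMapAt_divOneForm (g := h₀.1) (A := B) e'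
      (isCommutingFrame_boundaryFrame hι P.isOpen P.subset_source) hy hye
      (e' := fun z t v ↦ e.rep h₀ z t v) (φ := φ)
      (fun z t ↦ ⟨(e.rep h₀ z t).toLinearMap, fun v ↦ rfl⟩) hφe hφd (e'.symmL ℝ y v)
    rw [he h₀ y, map_zero, e'.continuousLinearMapAt_symmL hye] at h1
    exact h1.symm
  have hεt' : ∀ j z, εt j (ι z) = -(r z • φ j z) := fun j z ↦ by
    rw [hφ, smul_smul, mul_neg, mul_inv_cancel₀ (hrpos z).ne', neg_smul, one_smul, neg_neg]
  set T : Fin (n + 1) → Fin (n + 1) → F →L[ℝ] F := fun u v ↦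
    (C.covOneForm (P.connection b hA) (P.metric b g.1) (P.invMetric b g.1) ε u v).1 x with hT
  have hTD : ∀ i j, T i.succ j.succ
      = (-mvfderiv (𝓡 n) r y (Y i y)) • φ j y - r y • D i j := fun i j ↦ by
    have h1 : (C.cov (P.connection b hA) i.succ (ε j.succ)).1 x = _ :=
      cov_apply (b := b) hA i.succ (φ := εt j) (fun z ↦ (SmoothFun.rep_apply _ z).symm) x
    have h2 := mvfderiv_comp_boundaryFrame hι (P.subset_source hy) (hεd j) i
    have h3 : (fun z ↦ εt j (ι z)) = fun z ↦ -(r z • φ j z) := funext (hεt' j)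
    rw [h3, mvfderiv_fun_neg, _root_.neg_apply, SmoothFun.mvfderiv_smul' hrd (hφd j)] at h2
    have h4 : connectionForm P.e A (ι y) (P.frame b i.succ (ι y)) = connectionForm e' B y (Y i y) := by
      rw [connectionForm_pullback P.e hAB (P.subset_baseSet hy),
        mfderiv_boundaryFrame hι (P.subset_source hy)]
    have h5 := sum_christoffel_smul_eq hsymm h00 hε0
      fun m ↦ (C.christoffel (P.metric b g.1) i.succ j.succ m).1 x
    have h6 : ∑ k : Fin n, (∑ m : Fin n, schur h k m
        * (C.christoffel (P.metric b g.1) i.succ j.succ m.succ).1 x) • (ε k.succ).1 x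
        = -(r y • ∑ k, (∑ m, (gram h₀.1 y fun i ↦ Y i y)⁻¹ k m * frameChristoffel h₀.1 Y i j m y)
          • φ k y) := by
      rw [Finset.smul_sum, ← Finset.sum_neg_distrib]
      refine Finset.sum_congr rfl fun k _ ↦ ?_
      rw [hεφ y hy k, smul_comm, neg_smul]
      congr 3
      refine Finset.sum_congr rfl fun m _ ↦ ?_
      rw [hgram, frameChristoffel_inducedMetric hι g.1 hy]
    have h7 : T i.succ j.succ = (C.cov (P.connection b hA) i.succ (ε j.succ)).1 x
        - ∑ k, (∑ m, h k m * (C.christoffel (P.metric b g.1) i.succ j.succ m).1 x) • (ε k).1 x := by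
      simp only [hT, Calculus.covOneForm, SmoothFun.sub_apply, SmoothFun.sum_apply,
        SmoothFun.smul_apply, SmoothFun.mul_apply, hh]
    have h8 : εt j x = -(r y • φ j y) := hεt' j y
    rw [h7, h1, h5, h6, h8]
    have h9 : mvfderiv (𝓡∂ (n + 1)) (εt j) (x : M) (P.frame b i.succ (x : M)) = _ := h2.symm
    have h10 : connectionForm P.e A (x : M) (P.frame b i.succ (x : M)) = _ := h4
    rw [h9, h10, hD]
    simp only [mul_neg, neg_mul, mul_smul_comm, smul_mul_assoc]
    module
  have hfin : (∑ u, ∑ v, P.invMetric b g.1 u v • C.covOneForm (P.connection b hA)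
      (P.metric b g.1) (P.invMetric b g.1) ε u v).1 x = ∑ u, ∑ v, h u v • T u v := by
    simp only [SmoothFun.sum_apply, SmoothFun.smul_apply, hT, hh]
  rw [hfin]
  refine sum_smul_eq_zero_of_gauss hsymm (hrpos y).ne' hfa (ε := fun k ↦ (ε k).1 x)
    (φ := fun i ↦ φ i y) (δ := fun i ↦ mvfderiv (𝓡 n) r y (Y i y))
    (δ' := fun k ↦ (C.d k (C.gradSq (P.invMetric b g.1) s)).1 x) (fun k ↦ ?_) hε0 (hεφ y hy) hTD
    hDsum ?_
  · have h1 : (C.d k.succ (C.gradSq (P.invMetric b g.1) s)).1 x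
        = mvfderiv (𝓡∂ (n + 1)) f (ι y) (P.frame b k.succ (ι y)) :=
      chartCalculus_d_apply b P.isOpen P.subset_source k.succ
        (gradSq_apply (b := b) g.1 (σ.contMDiff g).contMDiffOn) x
    have h2 := mvfderiv_comp_boundaryFrame hι (P.subset_source hy) (f := f)
      ((contMDiff_conormSq g.1 (σ.contMDiff g) (ι y)).mdifferentiableAt (by simp)) k
    rw [h1, ← hrf, ← h2]
  · have h1 := congrArg (fun z : SmoothFun (𝓡∂ (n + 1)) P.U (F →L[ℝ] F) ↦ z.1 x)
      (C.sum_grad_grad_covOneForm (invMetric_symm g.1) (metric_symm g.1)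
        (metric_mul_invMetric g.1) (P.connection b hA) s ε hgε)
    simp only [SmoothFun.sum_apply, SmoothFun.smul_apply, SmoothFun.mul_apply, hgrad,
      SmoothFun.neg_apply, SmoothFun.real_smul_apply, smul_eq_mul] at h1
    exact h1

end Patch

end Boundary

end ElectricYM

/-! ### Conformal covariance -/

namespace ElectricYM

open Filter Set
open scoped Topology

namespace Calculus

variable {ι R 𝓐 : Type*} [Fintype ι] [DecidableEq ι] [CommRing R] [Algebra ℝ R] [Ring 𝓐]
  [Algebra R 𝓐] (C : Calculus ι R 𝓐) {g h : ι → ι → R}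

lemma logVol_conformal (gs : ∀ i j, g i j = g j i)
    (hhg : ∀ i k, ∑ j, h i j * g j k = if i = k then 1 else 0) {w v : R} (hv : w * v = 1) (a : ι) :
    C.logVol (fun i j ↦ w ^ 2 * g i j) (fun i j ↦ v ^ 2 * h i j) a
      = C.logVol g h a + (Fintype.card ι : R) * v * C.d a w := by
  have h1 : ∑ e, ∑ f, h e f * g e f = (Fintype.card ι : R) := by
    have : ∀ e, ∑ f, h e f * g e f = 1 := fun e ↦ by
      rw [← (hhg e e).trans (if_pos rfl)]
      exact Finset.sum_congr rfl fun f _ ↦ by rw [gs e f]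
    simp [this]
  have h2 : ∀ e f, v ^ 2 * h e f * C.d a (w ^ 2 * g e f)
      = h e f * C.d a (g e f) + (2 : ℝ) • (v * C.d a w * (h e f * g e f)) := fun e f ↦ by
    rw [C.d_mul, pow_two w, C.d_mul, two_smul]
    linear_combination (h e f * C.d a (g e f) * (w * v + 1)
      + 2 * v * C.d a w * h e f * g e f) * hv
  simp only [logVol, h2, Finset.sum_add_distrib, ← Finset.smul_sum, ← Finset.mul_sum, h1]
  rw [smul_add, smul_smul]
  norm_num
  ring

lemma lowerCurrent_conformal (gs : ∀ i j, g i j = g j i)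
    (hhg : ∀ i k, ∑ j, h i j * g j k = if i = k then 1 else 0) {w v : R} (hv : w * v = 1)
    (A : ι → 𝓐) (s : R) {m : ℕ} (hm : Fintype.card ι = m + 4) (a : ι) :
    C.lowerCurrent A (fun i j ↦ w ^ 2 * g i j) (fun i j ↦ v ^ 2 * h i j) (w * s) m a
      = v • C.lowerCurrent A g h s m a := by
  have h1 : up (fun i j ↦ v ^ 2 * h i j) (C.curv A) = fun i j ↦ v ^ 4 • up h (C.curv A) i j := by
    funext i j
    simp only [up, Finset.smul_sum, smul_smul]
    refine Finset.sum_congr rfl fun e _ ↦ Finset.sum_congr rfl fun f _ ↦ ?_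
    congr 1
    ring
  rw [lowerCurrent, lowerCurrent, h1, Finset.smul_sum]
  refine Finset.sum_congr rfl fun i _ ↦ ?_
  rw [C.current_conformal A (C.logVol g h) w v hv m _
    (fun a ↦ hm ▸ C.logVol_conformal gs hhg hv a), smul_smul, smul_smul]
  congr 1
  linear_combination g a i * v * (w * v + 1) * hv

end Calculus

variable {E : Type*} [NormedAddCommGroup E] [NormedSpace ℝ E] [FiniteDimensional ℝ E]
  {H : Type*} [TopologicalSpace H] {I : ModelWithCorners ℝ E H}
  {M : Type*} [TopologicalSpace M] [ChartedSpace H M] [IsManifold I ∞ M]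
  {F : Type*} [NormedAddCommGroup F] [NormedSpace ℝ F] [FiniteDimensional ℝ F]
  {κ : Type*} [Fintype κ] [DecidableEq κ] {b : Module.Basis κ ℝ E}
  {V : M → Type*} [TopologicalSpace (TotalSpace F V)]
  [∀ x, AddCommGroup (V x)] [∀ x, Module ℝ (V x)] [∀ x, TopologicalSpace (V x)]
  [∀ x, IsTopologicalAddGroup (V x)] [∀ x, ContinuousSMul ℝ (V x)]
  [FiberBundle F V] [VectorBundle ℝ F V] [ContMDiffVectorBundle ∞ F V I]
  {c : Set (Metric I M)} {σ : Density c 1} {g g' : c} {A : CovariantDerivative I F V}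
  {Ω : M → ℝ}

namespace Patch

variable {P : Patch H F V}

lemma metric_rescale (hΩ : CMDiff[P.U] ∞ Ω) (h : IsRescaling Ω g.1 g'.1) :
    P.metric b g'.1 = fun i j ↦ P.scalar Ω hΩ ^ 2 * P.metric b g.1 i j :=
  funext fun _ ↦ funext fun _ ↦ SmoothFun.ext_apply fun x ↦ h x _ _

lemma invMetric_rescale (hΩ' : CMDiff[P.U] ∞ fun x ↦ (Ω x)⁻¹)
    (hpos : ∀ x, 0 < Ω x) (h : IsRescaling Ω g.1 g'.1) :
    P.invMetric b g'.1 = fun i j ↦ P.scalar _ hΩ' ^ 2 * P.invMetric b g.1 i j := by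
  funext i j
  refine SmoothFun.ext_apply fun x ↦ ?_
  have h1 : gram g'.1 (x : M) (fun i ↦ P.frame b i x)
      = Ω x ^ 2 • gram g.1 (x : M) fun i ↦ P.frame b i x := Matrix.ext fun i j ↦ h x _ _
  have h2 : (gram g'.1 (x : M) (fun i ↦ P.frame b i x))⁻¹
      = (Ω x)⁻¹ ^ 2 • (gram g.1 (x : M) fun i ↦ P.frame b i x)⁻¹ := by
    refine Matrix.inv_eq_left_inv ?_
    rw [h1, Matrix.smul_mul, Matrix.mul_smul, Matrix.nonsing_inv_mul _ (isUnit_gram_det g.1 (x : M)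
      ((P.isCommutingFrame b).linearIndependent x x.2)), smul_smul, ← mul_pow,
      inv_mul_cancel₀ (hpos x).ne', one_pow, one_smul]
  exact congrFun (congrFun h2 i) j

lemma scalar_rescale (hΩ : CMDiff[P.U] ∞ Ω) (hpos : ∀ x, 0 < Ω x) (h : IsRescaling Ω g.1 g'.1) :
    P.scalar (σ.rep g') (σ.contMDiff g').contMDiffOn
      = P.scalar Ω hΩ * P.scalar (σ.rep g) (σ.contMDiff g).contMDiffOn :=
  SmoothFun.ext_apply fun x ↦ by
    have := σ.rescale g g' Ω hpos h x
    rwa [zpow_one] at this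

end Patch

/-- The current is a density of weight `-1`. -/
theorem current_rescale [T2Space M] (hA : CovariantDerivative.ContMDiffCovariantDerivative A ∞)
    {m : ℕ} (hm : Module.finrank ℝ E = m + 4) (hΩ : CMDiff ∞ Ω) (hpos : ∀ x, 0 < Ω x)
    (h : IsRescaling Ω g.1 g'.1) (x : M) (s : V x) (w : TangentSpace I x) :
    current σ A g' x s w = (Ω x)⁻¹ • current σ A g x s w := by
  obtain ⟨P, hx, -⟩ := exists_patch (H := H) (F := F) (V := V) x univ_mem
  set b := Module.finBasis ℝ E
  have hΩ' : CMDiff[P.U] ∞ fun x ↦ (Ω x)⁻¹ := hΩ.contMDiffOn.inv₀ fun x _ ↦ (hpos x).ne'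
  obtain ⟨T, hT⟩ := P.exists_current_eq_linearMap hA σ g ⟨x, hx⟩ s
  obtain ⟨T', hT'⟩ := P.exists_current_eq_linearMap hA σ g' ⟨x, hx⟩ s
  obtain ⟨a, rfl⟩ := (P.isCommutingFrame b).exists_eq_sum hx w
  rw [hT, hT', map_sum, map_sum, Finset.smul_sum]
  refine Finset.sum_congr rfl fun i _ ↦ ?_
  rw [map_smul, map_smul, smul_comm, ← hT, ← hT']
  congr 1
  refine eq_of_continuousLinearMapAt_eq P.e (P.subset_baseSet hx) ?_
  have h1 : P.lowerCurrent b hA σ g' m i = P.scalar _ hΩ' • P.lowerCurrent b hA σ g m i := by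
    rw [Patch.lowerCurrent, Patch.metric_rescale hΩ.contMDiffOn h,
      Patch.invMetric_rescale hΩ' hpos h,
      Patch.scalar_rescale hΩ.contMDiffOn hpos h]
    exact Calculus.lowerCurrent_conformal _ (Patch.metric_symm g.1)
      (Patch.invMetric_mul_metric g.1) (w := P.scalar Ω hΩ.contMDiffOn) (v := P.scalar _ hΩ')
      (SmoothFun.ext_apply fun x ↦ mul_inv_cancel₀ (hpos x).ne') _ _ (by simpa using hm) i
  refine (Patch.lowerCurrent_apply (b := b) hA σ g' hm ⟨x, hx⟩ s i).trans ?_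
  rw [h1]
  have h2 := Patch.lowerCurrent_apply (b := b) hA σ g hm ⟨x, hx⟩ s i
  refine (congrArg ((Ω x)⁻¹ • ·) h2.symm).trans ?_
  exact (map_smul (P.e.continuousLinearMapAt ℝ x) _ _).symm

end ElectricYM

/-! ### Sections with a conformal weight -/

namespace ElectricYM

open Filter Set
open scoped Topology

section Rescaling

variable {E : Type*} [NormedAddCommGroup E] [NormedSpace ℝ E]
  {H : Type*} [TopologicalSpace H] {I : ModelWithCorners ℝ E H}
  {M : Type*} [TopologicalSpace M] [ChartedSpace H M] [IsManifold I ∞ M]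
  {c : Set (Metric I M)}

lemma IsConformalClass.nonempty (hc : IsConformalClass c) : c.Nonempty := by
  obtain ⟨g, rfl⟩ := hc
  exact ⟨g, fun _ ↦ 1, contMDiff_const, fun _ ↦ one_pos, fun x u v ↦ by simp⟩

lemma IsConformalClass.exists_isRescaling (hc : IsConformalClass c) {g g' : Metric I M}
    (hg : g ∈ c) (hg' : g' ∈ c) :
    ∃ Ω : M → ℝ, CMDiff ∞ Ω ∧ (∀ x, 0 < Ω x) ∧ IsRescaling Ω g g' := by
  obtain ⟨g₀, rfl⟩ := hc
  obtain ⟨Ω, hΩ, hpos, h⟩ := hg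
  obtain ⟨Ω', hΩ', hpos', h'⟩ := hg'
  refine ⟨fun x ↦ Ω' x * (Ω x)⁻¹, hΩ'.mul (hΩ.inv₀ fun x ↦ (hpos x).ne'),
    fun x ↦ mul_pos (hpos' x) (inv_pos.2 (hpos x)), fun x u v ↦ ?_⟩
  rw [h', h]
  have := (hpos x).ne'
  field_simp

lemma IsRescaling.eq [Nontrivial E] {g g' : Metric I M} {Ω Ω' : M → ℝ} (h : IsRescaling Ω g g')
    (h' : IsRescaling Ω' g g') (hpos : ∀ x, 0 < Ω x) (hpos' : ∀ x, 0 < Ω' x) : Ω = Ω' := by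
  funext x
  obtain ⟨v, hv⟩ := exists_ne (0 : E)
  have h1 : Ω x ^ 2 * g.inner x (v : TangentSpace I x) v = Ω' x ^ 2 * g.inner x v v :=
    (h x v v).symm.trans (h' x v v)
  exact (sq_eq_sq₀ (hpos x).le (hpos' x).le).1 (mul_right_cancel₀ (g.pos x v hv).ne' h1)

lemma IsRescaling.trans {g g' g'' : Metric I M} {Ω Ω' : M → ℝ} (h : IsRescaling Ω g g')
    (h' : IsRescaling Ω' g' g'') : IsRescaling (fun x ↦ Ω' x * Ω x) g g'' := fun x u v ↦ by
  rw [h', h, mul_pow, mul_assoc]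

lemma contMDiff_zpow {Ω : M → ℝ} (hΩ : CMDiff ∞ Ω) (hpos : ∀ x, 0 < Ω x) (w : ℤ) :
    CMDiff ∞ fun x ↦ Ω x ^ w := by
  cases w with
  | ofNat k => simpa using hΩ.pow k
  | negSucc k =>
    simp only [zpow_negSucc]
    exact (hΩ.pow (k + 1)).inv₀ fun x ↦ pow_ne_zero _ (hpos x).ne'

variable [FiniteDimensional ℝ E]
  {F : Type*} [NormedAddCommGroup F] [NormedSpace ℝ F] [FiniteDimensional ℝ F]
  {V : M → Type*} [TopologicalSpace (TotalSpace F V)]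
  [∀ x, AddCommGroup (V x)] [∀ x, Module ℝ (V x)] [∀ x, TopologicalSpace (V x)]
  [∀ x, IsTopologicalAddGroup (V x)] [∀ x, ContinuousSMul ℝ (V x)]
  [FiberBundle F V] [VectorBundle ℝ F V] [ContMDiffVectorBundle ∞ F V I]

/-- A one-form in one scale defines a section of every weight. -/
lemma IsConformalClass.exists_endOneForm [Nontrivial E] (hc : IsConformalClass c) (g₀ : c) (w : ℤ)
    {a : ∀ x : M, V x →L[ℝ] TangentSpace I x →L[ℝ] V x}
    (ha : IsSmoothOneFormOn (F := F) univ a) :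
    ∃ a' : EndOneForm F V c w, ∀ (g : c) (Ω : M → ℝ), (∀ x, 0 < Ω x) →
      IsRescaling Ω g₀.1 g.1 → ∀ x, a'.rep g x = Ω x ^ w • a x := by
  choose Ω hΩ hpos h using fun g : c ↦ hc.exists_isRescaling g₀.2 g.2
  refine ⟨⟨fun g x ↦ Ω g x ^ w • a x, fun g ↦ contMDiffOn_univ.1
    (ha.smul isOpen_univ (contMDiff_zpow (hΩ g) (hpos g) w).contMDiffOn),
    fun g g' Ω' hpos' h' x ↦ ?_⟩, fun g Ω' hpos' h' x ↦ ?_⟩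
  · have h1 := IsRescaling.eq (h g') ((h g).trans h') (hpos g')
      fun x ↦ mul_pos (hpos' x) (hpos g x)
    rw [h1, mul_zpow, smul_smul]
  · exact congrArg (fun r : M → ℝ ↦ r x ^ w • a x) ((h g).eq h' (hpos g) hpos')

end Rescaling

section Boundary

variable {n : ℕ} {M : Type*} [TopologicalSpace M] [T2Space M] [CompactSpace M]
  [ChartedSpace (EuclideanHalfSpace (n + 1)) M] [IsManifold (𝓡∂ (n + 1)) ∞ M]
  {S : Type*} [TopologicalSpace S] [ChartedSpace (EuclideanSpace ℝ (Fin n)) S]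
  [IsManifold (𝓡 n) ∞ S] {ι : C^∞⟮𝓡 n, S; 𝓡∂ (n + 1), M⟯}
  {F : Type*} [NormedAddCommGroup F] [NormedSpace ℝ F] [FiniteDimensional ℝ F]
  {V : M → Type*} [TopologicalSpace (TotalSpace F V)]
  [∀ x, AddCommGroup (V x)] [∀ x, Module ℝ (V x)] [∀ x, TopologicalSpace (V x)]
  [∀ x, IsTopologicalAddGroup (V x)] [∀ x, ContinuousSMul ℝ (V x)]
  [FiberBundle F V] [VectorBundle ℝ F V] [ContMDiffVectorBundle ∞ F V (𝓡∂ (n + 1))]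
  {c : Set (Metric (𝓡∂ (n + 1)) M)} {σ : Density c 1} {w w' : ℤ} {G : EndTwoForm F V c w}
  {e : EndOneForm F (ι *ᵖ V) (inducedClass ι c) w'} {A : CovariantDerivative (𝓡∂ (n + 1)) F V}
  {B : CovariantDerivative (𝓡 n) F (ι *ᵖ V)}

/-- By the Gauss law, the normal component of the leading term of the current vanishes. -/
theorem apply_sharp_eq_zero (hι : IsBoundaryInclusion ι)
    (hσ : IsDefiningDensity σ) (he : GaussLaw B e)
    (hA : CovariantDerivative.ContMDiffCovariantDerivative A ∞) (hAB : InducesOnBoundary ι A B)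
    {m : ℕ} (hm : n + 1 = m + 4) (hG : HasCurvature σ A m G) (hGe : HasElectricField σ ι G e) (g : c)
    {k : ∀ x : M, V x →L[ℝ] TangentSpace (𝓡∂ (n + 1)) x →L[ℝ] V x}
    (hk : CurrentDivisible σ g A (m + 1) k) {x : M} (hx : x ∈ (𝓡∂ (n + 1)).boundary M) (s : V x) :
    k x s (sharp g.1 x (mvfderiv (𝓡∂ (n + 1)) (σ.rep g) x)) = 0 := by
  have hm' : Module.finrank ℝ (EuclideanSpace ℝ (Fin (n + 1))) = m + 4 := by simp [hm]
  rw [← hι.range_eq] at hx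
  obtain ⟨y, rfl⟩ := hx
  obtain ⟨P, hy, -⟩ := exists_patch (H := EuclideanHalfSpace (n + 1)) (F := F) (V := V) (ι y)
    univ_mem
  refine eq_of_continuousLinearMapAt_eq P.e (P.subset_baseSet hy) ?_
  have hkP : IsSmoothOneFormOn (F := F) P.U k := hk.1.mono (subset_univ P.U)
  refine (P.sum_grad_smul_oneForm_apply (b := stdBasis (n + 1)) g.1 (σ.contMDiff g).contMDiffOn
    hkP ⟨ι y, hy⟩ s).symm.trans ?_
  rw [P.sum_grad_smul_oneForm_eq_sum_covOneForm (b := stdBasis (n + 1)) hA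
    (fun x hx ↦ hσ.deriv_ne_zero g x ((hσ.zero_iff g x).1 hx)) hm' hG hkP fun x _ ↦ hk.2 x,
    Patch.sum_covOneForm_contractGrad_eq_zero hι hσ he hA hAB hGe g hy, map_zero]
  rfl

end Boundary

end ElectricYM

end

theorem theorem1p3 (n : ℕ) (hn : 5 ≤ n + 1)
    {M : Type*} [TopologicalSpace M] [T2Space M] [CompactSpace M]
    [ChartedSpace (EuclideanHalfSpace (n + 1)) M] [IsManifold (𝓡∂ (n + 1)) ∞ M]
    {S : Type*} [TopologicalSpace S] [ChartedSpace (EuclideanSpace ℝ (Fin n)) S]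
    [IsManifold (𝓡 n) ∞ S]
    (ι : C^∞⟮𝓡 n, S; 𝓡∂ (n + 1), M⟯) (hι : ElectricYM.IsBoundaryInclusion ι)
    {F : Type*} [NormedAddCommGroup F] [NormedSpace ℝ F] [FiniteDimensional ℝ F]
    {V : M → Type*} [TopologicalSpace (TotalSpace F V)]
    [∀ x, AddCommGroup (V x)] [∀ x, Module ℝ (V x)] [∀ x, TopologicalSpace (V x)]
    [∀ x, IsTopologicalAddGroup (V x)] [∀ x, ContinuousSMul ℝ (V x)]
    [FiberBundle F V] [VectorBundle ℝ F V] [ContMDiffVectorBundle ∞ F V (𝓡∂ (n + 1))]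
    (c : Set (ElectricYM.Metric (𝓡∂ (n + 1)) M)) (hc : ElectricYM.IsConformalClass c)
    (σ : ElectricYM.Density c 1) (hσ : ElectricYM.IsDefiningDensity σ)
    (B : CovariantDerivative (𝓡 n) F (ι *ᵖ V))
    (hB : CovariantDerivative.ContMDiffCovariantDerivative B ∞)
    (e : ElectricYM.EndOneForm F (ι *ᵖ V) (ElectricYM.inducedClass ι c) (3 - (n + 1)))
    (he : ElectricYM.GaussLaw B e)
    (A₀ : CovariantDerivative (𝓡∂ (n + 1)) F V)
    (hA₀ : CovariantDerivative.ContMDiffCovariantDerivative A₀ ∞)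
    (hA₀B : ElectricYM.InducesOnBoundary ι A₀ B)
    (G : ElectricYM.EndTwoForm F V c (4 - (n + 1)))
    (hG : ElectricYM.HasCurvature σ A₀ (n + 1 - 4) G)
    (hGe : ElectricYM.HasElectricField σ ι G e) :
    ∃ (a : ElectricYM.EndOneForm F V c (2 - (n + 1))) (A : CovariantDerivative (𝓡∂ (n + 1)) F V),
      (∀ g : c, A = A₀.addOneForm fun x ↦ σ.rep g x ^ (n + 1 - 2) • a.rep g x) ∧
      ∀ l : ℕ, ElectricYM.CurrentVanishesToOrder σ A l := by
  obtain ⟨m, hm⟩ : ∃ m, n + 1 = m + 4 := ⟨n + 1 - 4, by omega⟩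
  have hm' : Module.finrank ℝ (EuclideanSpace ℝ (Fin (n + 1))) = m + 4 := by simp [hm]
  have hm2 : n + 1 - 2 = m + 2 := by omega
  rw [show n + 1 - 4 = m by omega] at hG
  obtain ⟨g₀, hg₀⟩ := hc.nonempty
  set g : c := ⟨g₀, hg₀⟩
  obtain ⟨k, hk⟩ := ElectricYM.exists_currentDivisible hA₀ hm' hG g
  obtain ⟨a, ha, hak⟩ := ElectricYM.exists_solution hA₀ hσ g hm hk fun x hx s ↦
    ElectricYM.apply_sharp_eq_zero hι hσ he hA₀ hA₀B hm hG hGe g hk hx s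
  have hA := ElectricYM.contMDiffCovariantDerivative_perturb (σ := σ) hA₀ g (m + 2) ha
  obtain ⟨a', ha'⟩ := hc.exists_endOneForm g (2 - (n + 1)) ha
  refine ⟨a', ElectricYM.perturb σ g A₀ (m + 2) a, fun g' ↦ ?_, fun l ↦ ?_⟩
  · obtain ⟨Ω, -, hpos, h⟩ := hc.exists_isRescaling hg₀ g'.2
    refine congrArg A₀.addOneForm (funext fun x ↦ ?_)
    rw [ha' g' Ω hpos h, σ.rescale g g' Ω hpos h, hm2, smul_smul, zpow_one, mul_pow,
      mul_right_comm, ← zpow_natCast (Ω x), ← zpow_add₀ (hpos x).ne',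
      show ((m + 2 : ℕ) : ℤ) + (2 - (n + 1)) = 0 by push_cast; omega, zpow_zero, one_mul]
  · obtain ⟨k', hk', hkA⟩ := hak l
    obtain ⟨k'', hk''⟩ := hc.exists_endOneForm g (-1 - l) hk'
    refine ⟨k'', fun g' x s w ↦ ?_⟩
    obtain ⟨Ω, hΩ, hpos, h⟩ := hc.exists_isRescaling hg₀ g'.2
    rw [ElectricYM.current_rescale (g := g) (g' := g') hA hm' hΩ hpos h, hkA,
      hk'' g' Ω hpos h, σ.rescale g g' Ω hpos h, _root_.smul_apply, _root_.smul_apply, smul_smul,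
      smul_smul, zpow_one, mul_pow, mul_right_comm, ← zpow_natCast (Ω x),
      ← zpow_add₀ (hpos x).ne', add_sub_cancel, zpow_neg_one]
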